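/- Let $K,g:(0,\infty)\to\mathbb{R}$ be smooth with $K>0$, and consider the one-dimensional Euler–Korteweg system for $V=(\rho,v)$, $$\partial_tV=J\partial_x\,\delta H[V],\qquad J=\begin{pmatrix}0&-1\\-1&0\end{pmatrix},\qquad \delta H[V]=\begin{pmatrix}-K(\rho)\partial_x^2\rho-\tfrac12K'(\rho)(\partial_x\rho)^2+g(\rho)+\tfrac12v^2\\ \rho v\end{pmatrix}.$$ For $U=(r,u)$ put $\|U\|_{\mathcal H^m}^2=\|r\|_{H^{m+1}(\mathbb{R})}^2+\|u\|_{H^m(\mathbb{R})}^2$. Let $V_{\rm ref}$ be a reference state: a smooth function of $(t,x)\in\mathbb{R}^+\times\mathbb{R}$, bounded together with all its derivatives on $\mathbb{R}^+\times\mathbb{R}$, such that for each $t$ it has finite limits as $x\to\pm\infty$ and its derivatives $\partial_x^k\partial_t^jV_{\rm ref}$, $k+j\ge1$, decay rapidly as $x\to\pm\infty$. Let $n\ge1$. There is a continuous, nondecreasing function $C:\mathbb{R}^+\to(0,\infty)$, depending only on $K,g,n,V_{\rm ref}$, with the following property. Let $I\subset\mathbb{R}^+$ be an interval with more than one point. Let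 $V=(\rho,v)=V_{\rm ref}+U$ be a solution on $I$ with $U\in C(I,\mathcal H^{2n})$, and let $V^a=(\rho^a,v^a)=V_{\rm ref}+U^a$ be an approximate solution with the same reference state, $$\partial_tV^a=J\partial_x\,\delta H[V^a]+f^a\quad\text{on } I,\qquad U^a\in C(I,\mathcal H^{2n+2}),\quad f^a\in C(I,\mathcal H^{2n}),$$ where the equations hold in the sense of distributions in $x$ at each time of $I$, and where at each time of $I$ both $\rho$ and $\rho^a$ are bounded below by a positive constant. Set $$z=v+i\sqrt{K(\rho)/\rho}\;\partial_x\rho,\qquad z^a=v^a+i\sqrt{K(\rho^a)/\rho^a}\;\partial_x\rho^a,\qquad \Delta\rho=\rho-\rho^a,\qquad \Delta z=z-z^a,$$ $$\varphi_n(\rho)=a(\rho)^n\sqrt\rho,\qquad a(\rho)=\sqrt{\rho K(\rho)},$$ and define the gauged modified norm of $\Delta V=V-V^a$ by $$N(t)=\|\Delta\rho\|_{L^2}+\|\sqrt\rho\,\Delta z\|_{L^2}+\|\varphi_n(\rho)\,\partial_x^{2n}\Delta z\|_{L^2}.$$ Then $\Delta z(t)\in H^{2n}$ for every $t\in I$,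 the function $N$ is locally Lipschitz on $I$ (hence differentiable almost everywhere on $I$), and at every $t\in I$ at which $N$ is differentiable (one-sidedly if $t$ is an endpoint of $I$) $$\Big|\frac12\frac{d}{dt}N(t)\Big|\le C\Big(\|U(t)\|_{\mathcal H^{2n}}+\|U^a(t)\|_{\mathcal H^{2n+2}}+\big\|1/\rho(t)+1/\rho^a(t)\big\|_{L^\infty}\Big)\Big(N(t)+\|f^a(t)\|_{\mathcal H^{2n}}\Big).$$ -/

import Mathlib

open Set Filter Topology MeasureTheory
open scoped ContDiff

namespace EulerKorteweg

noncomputable section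

/-! ### Weak derivatives and Sobolev spaces on the line -/

section Sobolev

variable {E : Type*} [NormedAddCommGroup E] [NormedSpace ℝ E]

/-- `w` is a `k`-th weak derivative of `u` on `ℝ`. -/
def HasWeakDeriv (k : ℕ) (u w : ℝ → E) : Prop :=
  LocallyIntegrable u ∧ LocallyIntegrable w ∧
    ∀ φ : ℝ → ℝ, ContDiff ℝ ∞ φ → HasCompactSupport φ →
      ∫ x, iteratedDeriv k φ x • u x = (-1 : ℝ) ^ k • ∫ x, φ x • w x

open Classical in
/-- A representative of the weak derivative `∂ₓᵏ u`, which is unique almost everywhere; it is zero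
by convention if `u` has no `k`-th weak derivative. -/
def weakDeriv (k : ℕ) (u : ℝ → E) : ℝ → E :=
  if h : ∃ w, HasWeakDeriv k u w then h.choose else 0

/-- `u ∈ Hⁿ(ℝ)`: the weak derivatives of order `0, …, n` exist and are square integrable. -/
def MemH (n : ℕ) (u : ℝ → E) : Prop :=
  ∀ k ≤ n, ∃ w, HasWeakDeriv k u w ∧ MemLp w 2 volume

/-- `‖u‖_{Hⁿ} = (∑_{k ≤ n} ‖∂ₓᵏ u‖²_{L²})^{1/2}`. -/
def normH (n : ℕ) (u : ℝ → E) : ℝ :=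
  √(∑ k ∈ Finset.range (n + 1), lpNorm (weakDeriv k u) 2 volume ^ 2)

end Sobolev

/-- `U = (r, u) ∈ 𝓗ⁿ`, that is, `r ∈ Hⁿ⁺¹` and `u ∈ Hⁿ`. -/
def MemHH (n : ℕ) (U : ℝ → ℝ × ℝ) : Prop :=
  MemH (n + 1) (fun x => (U x).1) ∧ MemH n (fun x => (U x).2)

/-- `‖(r, u)‖_{𝓗ⁿ} = (‖r‖²_{Hⁿ⁺¹} + ‖u‖²_{Hⁿ})^{1/2}`. -/
def normHH (n : ℕ) (U : ℝ → ℝ × ℝ) : ℝ :=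
  √(normH (n + 1) (fun x => (U x).1) ^ 2 + normH n (fun x => (U x).2) ^ 2)

/-- `U ∈ C(I, 𝓗ⁿ)`; the first argument of `U` is time, the second one is space. -/
def ContInHH (n : ℕ) (I : Set ℝ) (U : ℝ → ℝ → ℝ × ℝ) : Prop :=
  (∀ t ∈ I, MemHH n (U t)) ∧
    ∀ t₀ ∈ I, Tendsto (fun t => normHH n (U t - U t₀)) (𝓝[I] t₀) (𝓝 0)

/-! ### Reference states -/

/-- `∂ₓᵏ ∂ₜʲ V (t, x)` on `ℝ⁺ × ℝ` (one-sided in time at `t = 0`). -/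
def mixedDeriv (k j : ℕ) (V : ℝ → ℝ → ℝ × ℝ) (t x : ℝ) : ℝ × ℝ :=
  iteratedDerivWithin j (fun s => iteratedDeriv k (V s) x) (Ici 0) t

/-- A reference state: a smooth function on `ℝ⁺ × ℝ`, bounded together with all its derivatives,
with finite limits as `x → ±∞`, and whose derivatives of order at least one decay rapidly as
`x → ±∞` (at each time). -/
structure IsReferenceState (V : ℝ → ℝ → ℝ × ℝ) : Prop where
  smooth : ContDiffOn ℝ ∞ (fun p : ℝ × ℝ => V p.1 p.2) (Ici 0 ×ˢ univ)
  bounded : ∀ k j : ℕ, ∃ M : ℝ, ∀ t ≥ 0, ∀ x, ‖mixedDeriv k j V t x‖ ≤ M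
  limit_top : ∀ t ≥ 0, ∃ l, Tendsto (V t) atTop (𝓝 l)
  limit_bot : ∀ t ≥ 0, ∃ l, Tendsto (V t) atBot (𝓝 l)
  decay : ∀ k j : ℕ, 1 ≤ k + j → ∀ m : ℕ, ∀ t ≥ 0, ∃ M : ℝ, ∀ x,
    |x| ^ m * ‖mixedDeriv k j V t x‖ ≤ M

/-! ### The Euler–Korteweg system -/

/-- The variational derivative of the energy,
`δH[V] = (-K(ρ) ∂ₓ²ρ - K'(ρ) (∂ₓρ)² / 2 + g(ρ) + v² / 2, ρ v)` for `V = (ρ, v)`. -/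
def deltaH (K g : ℝ → ℝ) (V : ℝ → ℝ × ℝ) (x : ℝ) : ℝ × ℝ :=
  let ρ : ℝ → ℝ := fun y => (V y).1
  let v : ℝ → ℝ := fun y => (V y).2
  (-K (ρ x) * weakDeriv 2 ρ x - 1 / 2 * deriv K (ρ x) * weakDeriv 1 ρ x ^ 2 + g (ρ x) + v x ^ 2 / 2,
    ρ x * v x)

/-- The matrix `J = (0, -1; -1, 0)`. -/
def J (p : ℝ × ℝ) : ℝ × ℝ := (-p.2, -p.1)

/-- `∂ₜ V = J ∂ₓ δH[V] + f` on `I × ℝ`, in the sense of distributions in `x` at each time of `I`. -/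
def IsSolution (K g : ℝ → ℝ) (f : ℝ → ℝ → ℝ × ℝ) (I : Set ℝ) (V : ℝ → ℝ → ℝ × ℝ) : Prop :=
  ∀ φ : ℝ → ℝ, ContDiff ℝ ∞ φ → HasCompactSupport φ → ∀ t ∈ I,
    HasDerivWithinAt (fun s => ∫ x, φ x • V s x)
      (-(∫ x, deriv φ x • J (deltaH K g (V t) x)) + ∫ x, φ x • f t x) I t

/-- At each time of `I` the density is bounded below by a positive constant. -/
def NoVacuum (I : Set ℝ) (V : ℝ → ℝ → ℝ × ℝ) : Prop :=
  ∀ t ∈ I, ∃ m > 0, ∀ᵐ x, m ≤ (V t x).1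

/-! ### The gauged modified norm -/

/-- `z = v + i w` with `w = √(K(ρ)/ρ) ∂ₓρ`, for `V = (ρ, v)`. -/
def zVar (K : ℝ → ℝ) (V : ℝ → ℝ × ℝ) (x : ℝ) : ℂ :=
  ⟨(V x).2, √(K (V x).1 / (V x).1) * weakDeriv 1 (fun y => (V y).1) x⟩

/-- `Δz = z - zᵃ`. -/
def deltaZ (K : ℝ → ℝ) (V Va : ℝ → ℝ × ℝ) (x : ℝ) : ℂ :=
  zVar K V x - zVar K Va x

/-- The gauge `φₙ(ρ) = a(ρ)ⁿ √ρ` with `a(ρ) = √(ρ K(ρ))`. -/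
def gauge (K : ℝ → ℝ) (n : ℕ) (s : ℝ) : ℝ :=
  √(s * K s) ^ n * √s

/-- `‖Δρ‖_{L²} + ‖√ρ Δz‖_{L²} + ‖φₙ(ρ) ∂ₓ²ⁿ Δz‖_{L²}`, where `V = (ρ, v)`. -/
def modNorm (K : ℝ → ℝ) (n : ℕ) (V Va : ℝ → ℝ × ℝ) : ℝ :=
  lpNorm (fun x => (V x).1 - (Va x).1) 2 volume
    + lpNorm (fun x => √(V x).1 • deltaZ K V Va x) 2 volume
    + lpNorm (fun x => gauge K n (V x).1 • weakDeriv (2 * n) (deltaZ K V Va) x) 2 volume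

end

end EulerKorteweg

/-! The complex variable z = v + iw, with w = √(K(ρ)/ρ) ∂ₓρ, turns the system into a quasilinear
Schrödinger equation ∂ₜz = ∂ₓ(-i a(ρ) ∂ₓz - z²/2 - g(ρ)), see `IsFlow.hasWeakTimeDeriv_zRep`. The
difference of two states obeys ∂ₜΔz = -i a ∂ₓ²Δz - (z + i ∂ₓa) ∂ₓΔz + q, where a and z belong to the
exact solution and q ∈ H²ⁿ is bounded linearly by the difference and the source (`exists_dzRhs`).
Here derivatives fall on zᵃ, which explains the two extra derivatives asked of Uᵃ.

Put m = 2n - 2, Q = ∂ₓᵐΔz and Y = Q''. The commutators with ∂ₓᵐ give ∂ₜQ = -i a Q'' + c Q' + q with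
c = -(z + i(m+1) ∂ₓa). In an energy for Y the imaginary part of c costs one derivative. The weight μ
= φₙ² = a²ⁿρ satisfies a ∂ₓμ - μ ∂ₓa = (w + (m+1) ∂ₓa) μ along ρ, and this cancels the loss
(`gaugeSq_identity`, `transportCoef_mul_gaugeSq`). What survives is transport by the real velocity
v, which loses nothing after an integration by parts.

At this regularity ∂ₜQ is only in L², so ∂ₜY cannot be paired with Y and the formal computation
needs a regularization. For ε > 0 consider the maximum over k of ∫ 2 Re(μ Y k̄) - μ|k|² - ε a μ
|k'|². It is attained at the resolvent h solving μh - ε(aμh')' = μY. The functional at a later or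
earlier time, evaluated at the present maximizer, bounds the later or earlier maximum from below;
therefore h is never differentiated in time (`energyDensity_sub_ge`). Since h has two derivatives,
∂ₜQ may be tested against (μh̄)''. The special form of the resolvent makes the dominant term purely
imaginary and lets the gauge identity act on the rest, with bounds independent of ε
(`IsResolvent.abs_re_energy_le`). Letting ε → 0 shows that ‖φₙ Y‖² is Lipschitz in time
(`EnergyFlow.abs_sub_le`). Its Lipschitz constant contains one factor ‖φₙ Y‖, and comparison at a
maximum point removes the square (`abs_sub_le_of_sq_lipschitz`).

The two lower order parts of N are Lipschitz by duality, because the time derivatives of Δρ and Δz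
are in L². Interpolation between orders 0 and 2n, together with the recovery of ∂ₓΔρ from Im Δz,
shows that N dominates all Sobolev norms of the difference that occur (`exists_regPair`).

All constants depend on one number L, which bounds the states and keeps the densities in [1/L, L].
Near a time t₀ it can be taken in terms of the size of the data at t₀ (`exists_local_flow`).
Rounding this size to an integer gives a sequence of constants, and the sequence is dominated by a
continuous nondecreasing function (`exists_continuous_monotone_ge`). -/

set_option linter.unusedSectionVars false

namespace EulerKorteweg

/-! ### Primitives of locally integrable functions -/

section Primitive

variable {E : Type*} [NormedAddCommGroup E] [NormedSpace ℝ E]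
variable {G : Type*} [NormedAddCommGroup G] [NormedSpace ℝ G]

/-- `u` is a primitive of the locally integrable function `u'`. -/
def IsPrim (u u' : ℝ → E) : Prop :=
  LocallyIntegrable u' ∧ ∀ x y, u y - u x = ∫ t in x..y, u' t

theorem _root_.MeasureTheory.LocallyIntegrable.intervalIntegrable' {E : Type*}
    [NormedAddCommGroup E] {u : ℝ → E}
    (h : LocallyIntegrable u) (a b : ℝ) : IntervalIntegrable u volume a b :=
  intervalIntegrable_iff.mpr <|
    (h.integrableOn_isCompact isCompact_uIcc).mono_set uIoc_subset_uIcc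

theorem IsPrim.eq_add {u u' : ℝ → E} (h : IsPrim u u') (a x : ℝ) :
    u x = u a + ∫ t in a..x, u' t := by
  rw [← h.2 a x]; abel

/-- Absolute continuity is a statement about sums of distances over disjoint intervals, and the
pointwise comparison passes to such sums. It serves for primitives, compared with the integral of
the norm of the integrand, and for the chain rule. -/
theorem _root_.AbsolutelyContinuousOnInterval.of_dist_le {X Y : Type*} [PseudoMetricSpace X]
    [PseudoMetricSpace Y] {f : ℝ → X} {g : ℝ → Y} {a b C : ℝ} (hg : AbsolutelyContinuousOnInterval g a b)
    (h : ∀ x ∈ uIcc a b, ∀ y ∈ uIcc a b, dist (f x) (f y) ≤ C * dist (g x) (g y)) :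
    AbsolutelyContinuousOnInterval f a b := by
  unfold AbsolutelyContinuousOnInterval at hg ⊢
  refine squeeze_zero' (Eventually.of_forall fun _ => Finset.sum_nonneg fun i _ => dist_nonneg) ?_
    (by simpa using hg.const_mul C)
  rw [eventually_inf_principal]
  filter_upwards with D hD
  rw [Finset.mul_sum]
  exact Finset.sum_le_sum fun i hi => h _ (hD.1 i hi).1 _ (hD.1 i hi).2

theorem IsPrim.absolutelyContinuous {u u' : ℝ → E} (h : IsPrim u u') (a b : ℝ) :
    AbsolutelyContinuousOnInterval u a b := by
  have hn : LocallyIntegrable (fun x => ‖u' x‖) := fun x => (h.1 x).norm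
  refine ((hn.intervalIntegrable' a b).absolutelyContinuousOnInterval_intervalIntegral
    (c := a) (by simp)).of_dist_le (C := 1) fun x _ y _ => ?_
  rw [dist_comm, dist_eq_norm, h.2, one_mul, dist_comm, Real.dist_eq,
    intervalIntegral.integral_interval_sub_left (hn.intervalIntegrable' _ _)
      (hn.intervalIntegrable' _ _)]
  exact intervalIntegral.norm_integral_le_abs_integral_norm

theorem IsPrim.continuous {u u' : ℝ → E} (h : IsPrim u u') : Continuous u := by
  refine continuous_iff_continuousAt.2 fun x => ?_
  exact (h.absolutelyContinuous (x - 1) (x + 1)).continuousOn.continuousAt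
    (by rw [uIcc_of_le (by linarith)]; exact Icc_mem_nhds (by linarith) (by linarith))

theorem IsPrim.locallyIntegrable {u u' : ℝ → E} (h : IsPrim u u') : LocallyIntegrable u :=
  h.continuous.locallyIntegrable

theorem IsPrim.ae_hasDerivAt [CompleteSpace E] {u u' : ℝ → E} (h : IsPrim u u') :
    ∀ᵐ x, HasDerivAt u (u' x) x := by
  filter_upwards [LocallyIntegrable.ae_hasDerivAt_integral h.1] with x hx
  have : u = fun y => u 0 + ∫ t in (0 : ℝ)..y, u' t := funext fun y => h.eq_add 0 y
  rw [this]
  exact (hx 0).const_add _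

theorem IsPrim.deriv_ae [CompleteSpace E] {u u' : ℝ → E} (h : IsPrim u u') : deriv u =ᵐ[volume] u' :=
  h.ae_hasDerivAt.mono fun _ hx => hx.deriv

theorem IsPrim.congr {u u' w : ℝ → E} (h : IsPrim u u') (hw : u' =ᵐ[volume] w) : IsPrim u w := by
  refine ⟨fun x => (h.1 x).congr hw, fun x y => ?_⟩
  · rw [h.2, intervalIntegral.integral_congr_ae (hw.mono fun _ hx _ => hx)]

theorem IsPrim.deriv [CompleteSpace E] {u u' : ℝ → E} (h : IsPrim u u') : IsPrim u (deriv u) :=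
  h.congr h.deriv_ae.symm

theorem IsPrim.hasDerivAt [CompleteSpace E] {u u' : ℝ → E} (h : IsPrim u u') (hc : Continuous u')
    (x : ℝ) : HasDerivAt u (u' x) x := by
  have : u = fun y => u 0 + ∫ t in (0 : ℝ)..y, u' t := funext fun y => h.eq_add 0 y
  rw [this]
  exact (hc.integral_hasStrictDerivAt 0 x).hasDerivAt.const_add _

/-- The difference with an actual primitive of `u'` is absolutely continuous with zero derivative
almost everywhere, hence constant. Product and chain rules thereby reduce to pointwise
differentiation at almost every point. -/
theorem isPrim_of_ae_hasDerivAt [CompleteSpace E] {u u' : ℝ → E}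
    (hac : ∀ a b, AbsolutelyContinuousOnInterval u a b) (hi : LocallyIntegrable u')
    (hd : ∀ᵐ x, HasDerivAt u (u' x) x) : IsPrim u u' := by
  refine ⟨hi, fun a b => ?_⟩
  set p : ℝ → E := fun x => ∫ t in a..x, u' t with hp
  have hpp : IsPrim p u' := ⟨hi, fun x y => by
    simp only [hp]
    rw [intervalIntegral.integral_interval_sub_left (hi.intervalIntegrable' _ _)
      (hi.intervalIntegrable' _ _)]⟩
  have h1 : AbsolutelyContinuousOnInterval (u - p) a b :=
    (hac a b).sub (hpp.absolutelyContinuous a b)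
  have h2 : ∀ᵐ x, x ∈ uIcc a b → HasDerivAt (u - p) 0 x := by
    filter_upwards [hd, hpp.ae_hasDerivAt] with x h1 h2 _
    simpa using h1.sub h2
  obtain ⟨C, hC⟩ := h1.const_of_ae_hasDerivAt_zero h2
  have ha := hC a (by simp)
  have hb := hC b (by simp)
  simp only [Pi.sub_apply, hp, intervalIntegral.integral_same, sub_zero] at ha hb
  rw [ha, ← hb]; abel

theorem isPrim_of_hasDerivAt [CompleteSpace E] {u u' : ℝ → E} (h : ∀ x, HasDerivAt u (u' x) x)
    (hc : Continuous u') : IsPrim u u' :=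
  ⟨hc.locallyIntegrable, fun x y => by
    rw [intervalIntegral.integral_eq_sub_of_hasDerivAt (fun t _ => h t) (hc.intervalIntegrable _ _)]⟩

theorem IsPrim.add {u u' w w' : ℝ → E} (h : IsPrim u u') (k : IsPrim w w') :
    IsPrim (fun x => u x + w x) (fun x => u' x + w' x) :=
  ⟨h.1.add k.1, fun x y => by
    rw [intervalIntegral.integral_add (h.1.intervalIntegrable' _ _) (k.1.intervalIntegrable' _ _),
      ← h.2, ← k.2, add_sub_add_comm]⟩

theorem IsPrim.clm [CompleteSpace E] [CompleteSpace G] {u u' : ℝ → E} (h : IsPrim u u')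
    (L : E →L[ℝ] G) : IsPrim (fun x => L (u x)) (fun x => L (u' x)) := by
  refine ⟨?_, fun x y => ?_⟩
  · intro x
    obtain ⟨s, hs, hi⟩ := h.1 x
    exact ⟨s, hs, L.integrable_comp hi⟩
  · rw [ContinuousLinearMap.intervalIntegral_comp_comm L (h.1.intervalIntegrable' _ _), ← h.2,
      map_sub]

theorem IsPrim.neg {u u' : ℝ → E} (h : IsPrim u u') :
    IsPrim (fun x => -u x) (fun x => -u' x) :=
  ⟨h.1.neg, fun x y => by rw [intervalIntegral.integral_neg, ← h.2, neg_sub_neg, neg_sub]⟩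

theorem IsPrim.sub {u u' w w' : ℝ → E} (h : IsPrim u u') (k : IsPrim w w') :
    IsPrim (fun x => u x - w x) (fun x => u' x - w' x) := by
  simpa only [sub_eq_add_neg] using h.add k.neg

theorem IsPrim.smul [CompleteSpace E] {𝕜 : Type*} [NormedField 𝕜] [NormedAlgebra ℝ 𝕜]
    [CompleteSpace 𝕜] [NormedSpace 𝕜 E] [IsScalarTower ℝ 𝕜 E] {f f' : ℝ → 𝕜} {u u' : ℝ → E}
    (hf : IsPrim f f') (hu : IsPrim u u') :
    IsPrim (fun x => f x • u x) (fun x => f x • u' x + f' x • u x) := by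
  refine isPrim_of_ae_hasDerivAt
    (fun a b => (hf.absolutelyContinuous a b).fun_smul (hu.absolutelyContinuous a b)) ?_ ?_
  · exact (hu.1.continuous_smul hf.continuous).add
      (hf.1.smul_continuous hu.continuous)
  · filter_upwards [hf.ae_hasDerivAt, hu.ae_hasDerivAt] with x h1 h2
    exact h1.smul h2

theorem IsPrim.mul {𝕜 : Type*} [NormedField 𝕜] [NormedAlgebra ℝ 𝕜] [CompleteSpace 𝕜]
    {f f' g g' : ℝ → 𝕜} (hf : IsPrim f f') (hg : IsPrim g g') :
    IsPrim (fun x => f x * g x) (fun x => f' x * g x + f x * g' x) := by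
  have := hf.smul hg
  simp only [smul_eq_mul] at this
  simpa only [add_comm] using this

/-- Chain rule for a primitive with positive values. -/
theorem IsPrim.comp {f : ℝ → ℝ} (hf : ContDiffOn ℝ 1 f (Ioi 0)) {ρ ρ' : ℝ → ℝ} (h : IsPrim ρ ρ')
    (hpos : ∀ x, 0 < ρ x) :
    IsPrim (fun x => f (ρ x)) (fun x => _root_.deriv f (ρ x) * ρ' x) := by
  have hd : ∀ s > 0, HasDerivAt f (_root_.deriv f s) s := fun s hs =>
    ((hf.differentiableOn (by norm_num)).differentiableAt (Ioi_mem_nhds hs)).hasDerivAt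
  have hdc : ContinuousOn (_root_.deriv f) (Ioi 0) :=
    hf.continuousOn_deriv_of_isOpen isOpen_Ioi le_rfl
  refine isPrim_of_ae_hasDerivAt (fun a b => ?_) ?_ ?_
  · obtain ⟨z, hz, hzm⟩ := (isCompact_uIcc (a := a) (b := b)).exists_isMinOn nonempty_uIcc
      h.continuous.continuousOn
    obtain ⟨w, hw, hwm⟩ := (isCompact_uIcc (a := a) (b := b)).exists_isMaxOn nonempty_uIcc
      h.continuous.continuousOn
    have hsub : Icc (ρ z) (ρ w) ⊆ Ioi 0 := fun s hs => lt_of_lt_of_le (hpos z) hs.1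
    obtain ⟨C, hC⟩ := isCompact_Icc.exists_bound_of_continuousOn (hdc.mono hsub)
    refine (h.absolutelyContinuous a b).of_dist_le (C := C) fun x hx y hy => ?_
    rw [dist_comm, dist_comm (ρ x), dist_eq_norm, dist_eq_norm]
    exact (convex_Icc (ρ z) (ρ w)).norm_image_sub_le_of_norm_hasDerivWithin_le
      (fun s hs => (hd s (hsub hs)).hasDerivWithinAt) hC ⟨hzm hx, hwm hx⟩ ⟨hzm hy, hwm hy⟩
  · exact h.1.continuous_smul (hdc.comp_continuous h.continuous hpos)
  · filter_upwards [h.ae_hasDerivAt] with x hx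
    exact (hd _ (hpos x)).comp x hx

/-- Integrability of `u'` gives limits of `u` at both ends, and integrability of `u` forces these
limits to vanish. The integrations by parts on the whole line rest on this. -/
theorem IsPrim.integral_eq_zero {u u' : ℝ → E} (h : IsPrim u u') (hu : Integrable u)
    (hu' : Integrable u') : ∫ x, u' x = 0 := by
  rcases subsingleton_or_nontrivial E with hE | hE
  · exact Subsingleton.elim _ _
  -- Without completeness the Bochner integral is zero by convention.
  by_cases hcpl : CompleteSpace E
  swap
  · simp [integral, hcpl]
  have h1 : Tendsto (fun n : ℕ => ∫ t in (-(n : ℝ))..n, u' t) atTop (𝓝 (∫ x, u' x)) :=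
    intervalIntegral_tendsto_integral hu' (tendsto_neg_atTop_atBot.comp tendsto_natCast_atTop_atTop)
      tendsto_natCast_atTop_atTop
  -- A nonzero limit would keep the norm of `u` above a positive level on a half-line, a set of
  -- infinite measure.
  have key : ∀ l : Filter ℝ, (l = atTop ∨ l = atBot) → ∀ L, Tendsto u l (𝓝 L) → L = 0 := by
    intro l hl L hL
    have hn : Integrable (fun x => ‖u x‖) := hu.norm
    by_contra hne
    have hpos : 0 < ‖L‖ := norm_pos_iff.2 hne
    have hev : ∀ᶠ x in l, ‖L‖ / 2 < ‖u x‖ := hL.norm.eventually_const_lt (by linarith)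
    have hfin : volume {x | ‖L‖ / 2 ≤ ‖u x‖} < ⊤ := hu.measure_norm_ge_lt_top (by positivity)
    rcases hl with rfl | rfl
    · obtain ⟨a, ha⟩ := eventually_atTop.1 hev
      have : volume (Ici a) ≤ volume {x | ‖L‖ / 2 ≤ ‖u x‖} := measure_mono fun x hx => (ha x hx).le
      simp at this; exact absurd this (by simpa using hfin.ne)
    · obtain ⟨a, ha⟩ := eventually_atBot.1 hev
      have : volume (Iic a) ≤ volume {x | ‖L‖ / 2 ≤ ‖u x‖} := measure_mono fun x hx => (ha x hx).le
      simp at this; exact absurd this (by simpa using hfin.ne)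
  have ht : Tendsto u atTop (𝓝 (u 0 + ∫ t in Ioi (0 : ℝ), u' t)) := by
    have := (intervalIntegral_tendsto_integral_Ioi 0 hu'.integrableOn tendsto_id).const_add (u 0)
    exact this.congr fun y => (h.eq_add 0 y).symm
  have hb : Tendsto u atBot (𝓝 (u 0 - ∫ t in Iic (0 : ℝ), u' t)) := by
    have := (intervalIntegral_tendsto_integral_Iic 0 hu'.integrableOn tendsto_id).const_sub (u 0)
    refine this.congr fun y => ?_
    rw [← h.2]; simp
  have e1 := key _ (Or.inl rfl) _ ht
  have e2 := key _ (Or.inr rfl) _ hb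
  have e3 := intervalIntegral.integral_Iic_add_Ioi (b := (0 : ℝ)) hu'.integrableOn hu'.integrableOn
  rw [← e3]
  have e4 : ∫ t in Iic (0 : ℝ), u' t = u 0 := (sub_eq_zero.1 e2).symm
  rw [e4, e1]

end Primitive

/-! ### Weak derivatives -/

section WeakDerivative

variable {E : Type*} [NormedAddCommGroup E] [NormedSpace ℝ E]
variable {G : Type*} [NormedAddCommGroup G] [NormedSpace ℝ G]

theorem _root_.ContDiff.iteratedDeriv_infty {φ : ℝ → E} (h : ContDiff ℝ ∞ φ) (k : ℕ) :
    ContDiff ℝ ∞ (iteratedDeriv k φ) := by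
  induction k with
  | zero => simpa using h
  | succ k ih => rw [iteratedDeriv_succ]; exact (contDiff_infty_iff_deriv.1 ih).2

theorem _root_.HasCompactSupport.iteratedDeriv {φ : ℝ → E} (h : HasCompactSupport φ) (k : ℕ) :
    HasCompactSupport (iteratedDeriv k φ) := by
  induction k with
  | zero => simpa using h
  | succ k ih => rw [iteratedDeriv_succ]; exact ih.deriv

theorem iteratedDeriv_iteratedDeriv (k j : ℕ) (φ : ℝ → E) :
    iteratedDeriv k (iteratedDeriv j φ) = iteratedDeriv (k + j) φ := by
  simp only [iteratedDeriv_eq_iterate, Function.iterate_add_apply]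

theorem _root_.MeasureTheory.LocallyIntegrable.integrable_test {u : ℝ → E} (hu : LocallyIntegrable u)
    {φ : ℝ → ℝ} (hφ : ContDiff ℝ ∞ φ) (hc : HasCompactSupport φ) :
    Integrable (fun x => φ x • u x) :=
  hu.integrable_smul_left_of_hasCompactSupport hφ.continuous hc

theorem HasWeakDeriv.congr {k : ℕ} {u w u₂ w₂ : ℝ → E} (h : HasWeakDeriv k u w)
    (hu : u =ᵐ[volume] u₂) (hw : w =ᵐ[volume] w₂) : HasWeakDeriv k u₂ w₂ := by
  refine ⟨h.1.congr hu, h.2.1.congr hw, fun φ h1 h2 => ?_⟩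
  rw [integral_congr_ae (hu.symm.mono fun x hx => congrArg (iteratedDeriv k φ x • ·) hx),
    h.2.2 φ h1 h2, integral_congr_ae (hw.mono fun x hx => congrArg (φ x • ·) hx)]

theorem HasWeakDeriv.zero {u : ℝ → E} (h : LocallyIntegrable u) : HasWeakDeriv 0 u u :=
  ⟨h, h, fun φ _ _ => by simp⟩

theorem HasWeakDeriv.comp {k j : ℕ} {u w z : ℝ → E} (h : HasWeakDeriv k u w)
    (h' : HasWeakDeriv j w z) : HasWeakDeriv (k + j) u z := by
  refine ⟨h.1, h'.2.1, fun φ h1 h2 => ?_⟩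
  rw [← iteratedDeriv_iteratedDeriv, h.2.2 _ (h1.iteratedDeriv_infty j) (h2.iteratedDeriv j),
    h'.2.2 φ h1 h2, smul_smul, pow_add]

/-- Reads higher derivatives of `u` as derivatives of its weak derivative. This drives the induction
on the order in `exists_sob_of_memH`. -/
theorem HasWeakDeriv.of_comp {k j : ℕ} {u w z : ℝ → E} (h : HasWeakDeriv k u w)
    (h' : HasWeakDeriv (k + j) u z) : HasWeakDeriv j w z := by
  refine ⟨h.2.1, h'.2.1, fun φ h1 h2 => ?_⟩
  have e1 := h.2.2 _ (h1.iteratedDeriv_infty j) (h2.iteratedDeriv j)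
  rw [iteratedDeriv_iteratedDeriv, h'.2.2 φ h1 h2] at e1
  have e2 : ((-1 : ℝ) ^ k) • ((-1 : ℝ) ^ k • ∫ x, iteratedDeriv j φ x • w x)
      = ∫ x, iteratedDeriv j φ x • w x := by
    rw [smul_smul, ← mul_pow]; simp
  rw [← e2, ← e1, smul_smul, ← pow_add, ← add_assoc, pow_add, Even.neg_one_pow ⟨k, rfl⟩, one_mul]

theorem HasWeakDeriv.unique [CompleteSpace E] {k : ℕ} {u w w' : ℝ → E} (h : HasWeakDeriv k u w)
    (h' : HasWeakDeriv k u w') : w =ᵐ[volume] w' := by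
  refine ae_eq_of_integral_contDiff_smul_eq h.2.1 h'.2.1 fun φ h1 h2 => ?_
  have e := (h.2.2 φ h1 h2).symm.trans (h'.2.2 φ h1 h2)
  have hne : ((-1 : ℝ) ^ k) ≠ 0 := by positivity
  exact smul_right_injective _ hne e

theorem weakDeriv_ae [CompleteSpace E] {k : ℕ} {u w : ℝ → E} (h : HasWeakDeriv k u w) :
    weakDeriv k u =ᵐ[volume] w := by
  have hex : ∃ w, HasWeakDeriv k u w := ⟨w, h⟩
  rw [weakDeriv, dif_pos hex]
  exact hex.choose_spec.unique h

theorem HasWeakDeriv.clm [CompleteSpace E] [CompleteSpace G] {k : ℕ} {u w : ℝ → E}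
    (h : HasWeakDeriv k u w) (L : E →L[ℝ] G) :
    HasWeakDeriv k (fun x => L (u x)) (fun x => L (w x)) := by
  have hL : ∀ {v : ℝ → E}, LocallyIntegrable v → LocallyIntegrable fun x => L (v x) := by
    intro v hv x
    obtain ⟨s, hs, hi⟩ := hv x
    exact ⟨s, hs, L.integrable_comp hi⟩
  refine ⟨hL h.1, hL h.2.1, fun φ h1 h2 => ?_⟩
  have e1 := L.integral_comp_comm (h.1.integrable_test (h1.iteratedDeriv_infty k)
    (h2.iteratedDeriv k))
  have e2 := L.integral_comp_comm (h.2.1.integrable_test h1 h2)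
  simp only [map_smul] at e1 e2
  rw [e1, e2, h.2.2 φ h1 h2, map_smul]

theorem isPrim_of_contDiff [CompleteSpace E] {φ : ℝ → E} (h : ContDiff ℝ ∞ φ) :
    IsPrim φ (deriv φ) :=
  isPrim_of_hasDerivAt (fun x => (h.differentiable (by simp) x).hasDerivAt)
    (contDiff_infty_iff_deriv.1 h).2.continuous

theorem IsPrim.hasWeakDeriv [CompleteSpace E] {u u' : ℝ → E} (h : IsPrim u u') :
    HasWeakDeriv 1 u u' := by
  refine ⟨h.locallyIntegrable, h.1, fun φ h1 h2 => ?_⟩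
  have i1 := h.1.integrable_test h1 h2
  have i2 := h.locallyIntegrable.integrable_test (contDiff_infty_iff_deriv.1 h1).2 h2.deriv
  have := ((isPrim_of_contDiff h1).smul h).integral_eq_zero
    (h.locallyIntegrable.integrable_test h1 h2) (i1.add i2)
  rw [integral_add i1 i2] at this
  simp only [iteratedDeriv_one, pow_one, neg_smul, one_smul]
  rw [eq_neg_iff_add_eq_zero, add_comm]; exact this

theorem exists_contDiff_integral_one :
    ∃ ψ : ℝ → ℝ, ContDiff ℝ ∞ ψ ∧ HasCompactSupport ψ ∧ ∫ x, ψ x = 1 := by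
  let b : ContDiffBump (0 : ℝ) := default
  exact ⟨b.normed volume, b.contDiff_normed, b.hasCompactSupport_normed, b.integral_normed⟩

/-- A test function with vanishing integral is the derivative of a test function. -/
theorem exists_test_deriv_eq {φ : ℝ → ℝ} (h1 : ContDiff ℝ ∞ φ) (h2 : HasCompactSupport φ)
    (h0 : ∫ x, φ x = 0) :
    ∃ χ : ℝ → ℝ, ContDiff ℝ ∞ χ ∧ HasCompactSupport χ ∧ deriv χ = φ := by
  obtain ⟨R, hR⟩ := h2.isCompact.isBounded.subset_closedBall (0 : ℝ)
  have hz : ∀ x, R < |x| → φ x = 0 := fun x hx => by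
    by_contra hne
    have := hR (subset_tsupport _ hne)
    rw [mem_closedBall_zero_iff, Real.norm_eq_abs] at this
    linarith
  -- The base point lies to the left of the support, so the primitive vanishes there; to the right
  -- of the support it equals the full integral, which is zero. The absolute value is needed because
  -- `R` may be negative.
  have hd : ∀ x, HasDerivAt (fun x => ∫ t in (-(|R| + 1))..x, φ t) (φ x) x := fun x =>
    (h1.continuous.integral_hasStrictDerivAt _ x).hasDerivAt
  have hde : deriv (fun x => ∫ t in (-(|R| + 1))..x, φ t) = φ := funext fun x => (hd x).deriv
  have hi : Integrable φ := h1.continuous.integrable_of_hasCompactSupport h2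
  refine ⟨fun x => ∫ t in (-(|R| + 1))..x, φ t, ?_, ?_, hde⟩
  · rw [contDiff_infty_iff_deriv, hde]
    exact ⟨fun x => (hd x).differentiableAt, h1⟩
  · refine HasCompactSupport.intro (K := Icc (-(|R| + 1)) (|R| + 1)) isCompact_Icc fun x hx => ?_
    have hR0 := le_abs_self R
    rcases lt_or_ge x (-(|R| + 1)) with hlt | hge
    · rw [intervalIntegral.integral_symm, intervalIntegral.integral_of_le hlt.le,
        setIntegral_eq_zero_of_forall_eq_zero, neg_zero]
      intro t ht
      refine hz t ?_
      rw [abs_of_nonpos (by linarith [ht.2, abs_nonneg R])]; linarith [ht.2]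
    · have hgt : |R| + 1 < x := by
        by_contra hcon; exact hx ⟨hge, not_lt.1 hcon⟩
      rw [intervalIntegral.integral_of_le hge, setIntegral_eq_integral_of_forall_compl_eq_zero, h0]
      intro t ht
      refine hz t ?_
      rcases lt_or_ge (-(|R| + 1)) t with h3 | h3
      · have : x < t := by by_contra hcon; exact ht ⟨h3, not_lt.1 hcon⟩
        rw [abs_of_nonneg (by linarith [abs_nonneg R])]; linarith
      · rw [abs_of_nonpos (by linarith [abs_nonneg R])]; linarith

/-- A function with locally integrable weak derivative agrees almost everywhere with a
primitive of it. -/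
theorem HasWeakDeriv.exists_isPrim [CompleteSpace E] {u w : ℝ → E} (h : HasWeakDeriv 1 u w) :
    ∃ v, v =ᵐ[volume] u ∧ IsPrim v w := by
  set p : ℝ → E := fun x => ∫ t in (0 : ℝ)..x, w t with hp
  have hpp : IsPrim p w := ⟨h.2.1, fun x y => by
    simp only [hp]
    rw [intervalIntegral.integral_interval_sub_left (h.2.1.intervalIntegrable' _ _)
      (h.2.1.intervalIntegrable' _ _)]⟩
  have hpw := hpp.hasWeakDeriv
  obtain ⟨ψ, hψ1, hψ2, hψ⟩ := exists_contDiff_integral_one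
  set c : E := ∫ x, ψ x • (u x - p x) with hc
  have hup : LocallyIntegrable fun x => u x - p x := h.1.sub hpp.locallyIntegrable
  -- A test function minus its mean times `ψ` is the derivative of a test function, and `u - p` has
  -- weak derivative zero. Hence `u - p` pairs with every test function as the constant `c` does.
  have key : ∀ᵐ x, u x - p x = c := by
    refine ae_eq_of_integral_contDiff_smul_eq hup (locallyIntegrable_const c) fun φ h1 h2 => ?_
    generalize hm : ∫ y, φ y = m
    have hcs : HasCompactSupport fun x => φ x - m * ψ x := by
      have h3 : HasCompactSupport fun x => m * ψ x := hψ2.mul_left (f := fun _ => m)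
      exact HasCompactSupport.sub h2 h3
    have hcd : ContDiff ℝ ∞ fun x => φ x - m * ψ x := h1.sub (contDiff_const.mul hψ1)
    have iφ := h1.continuous.integrable_of_hasCompactSupport (μ := volume) h2
    have iψ := hψ1.continuous.integrable_of_hasCompactSupport (μ := volume) hψ2
    obtain ⟨χ, hχ1, hχ2, hχ⟩ := exists_test_deriv_eq hcd hcs (by
      rw [integral_sub iφ (iψ.const_mul _), integral_const_mul, hψ, hm]; ring)
    have e1 := h.2.2 χ hχ1 hχ2
    have e2 := hpw.2.2 χ hχ1 hχ2
    rw [iteratedDeriv_one, hχ] at e1 e2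
    have e3 : ∫ x, (φ x - m * ψ x) • (u x - p x) = 0 := by
      simp only [smul_sub (_ - _)]
      rw [integral_sub (h.1.integrable_test hcd hcs) (hpp.locallyIntegrable.integrable_test hcd hcs),
        e1, e2, sub_self]
    simp only [sub_smul, mul_smul] at e3
    have i3 : Integrable fun x => m • ψ x • (u x - p x) := (hup.integrable_test hψ1 hψ2).smul m
    rw [integral_sub (hup.integrable_test h1 h2) i3, integral_smul, sub_eq_zero] at e3
    rw [e3, integral_smul_const, hm]
  refine ⟨fun x => p x + c, key.mono fun x hx => by simp [← hx], h.2.1, fun x y => ?_⟩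
  rw [← hpp.2, add_sub_add_right_eq_sub]

end WeakDerivative

/-! ### Quantitative Sobolev and coefficient classes -/

section Classes

variable {E : Type*} [NormedAddCommGroup E] [NormedSpace ℝ E]
variable {G : Type*} [NormedAddCommGroup G] [NormedSpace ℝ G]

/-- `u ∈ L²` with norm at most `M`. -/
def L2Bound (M : ℝ) (u : ℝ → E) : Prop := MemLp u 2 volume ∧ lpNorm u 2 volume ≤ M

theorem L2Bound.nonneg {M : ℝ} {u : ℝ → E} (h : L2Bound M u) : 0 ≤ M := lpNorm_nonneg.trans h.2

theorem L2Bound.mono {M M' : ℝ} {u : ℝ → E} (h : L2Bound M u) (hM : M ≤ M') : L2Bound M' u :=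
  ⟨h.1, h.2.trans hM⟩

theorem lpNorm_congr_ae' {u w : ℝ → E} {p : ENNReal} (h : u =ᵐ[volume] w) :
    lpNorm u p volume = lpNorm w p volume := by
  by_cases hu : AEStronglyMeasurable u volume
  · rw [← toReal_eLpNorm hu, ← toReal_eLpNorm (hu.congr h), eLpNorm_congr_ae h]
  · rw [lpNorm_of_not_aestronglyMeasurable hu,
      lpNorm_of_not_aestronglyMeasurable fun hw => hu (hw.congr h.symm)]

theorem L2Bound.congr {M : ℝ} {u w : ℝ → E} (h : L2Bound M u) (hw : u =ᵐ[volume] w) :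
    L2Bound M w :=
  ⟨(memLp_congr_ae hw).1 h.1, (lpNorm_congr_ae' hw) ▸ h.2⟩

theorem L2Bound.add {M M' : ℝ} {u w : ℝ → E} (h : L2Bound M u) (k : L2Bound M' w) :
    L2Bound (M + M') (fun x => u x + w x) :=
  ⟨h.1.add k.1, (lpNorm_add_le h.1 (by norm_num)).trans (add_le_add h.2 k.2)⟩

theorem L2Bound.of_le {M c : ℝ} {u : ℝ → E} {w : ℝ → G} (h : L2Bound M u) (hc : 0 ≤ c)
    (hm : AEStronglyMeasurable w volume) (hle : ∀ᵐ x, ‖w x‖ ≤ c * ‖u x‖) : L2Bound (c * M) w := by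
  have hw : MemLp w 2 volume := h.1.of_le_mul hm hle
  refine ⟨hw, ?_⟩
  have h1 : eLpNorm w 2 volume ≤ ENNReal.ofReal c * eLpNorm u 2 volume :=
    eLpNorm_le_mul_eLpNorm_of_ae_le_mul hle 2
  have h2 : lpNorm w 2 volume ≤ c * lpNorm u 2 volume := by
    rw [← toReal_eLpNorm hw.1, ← toReal_eLpNorm h.1.1]
    calc _ ≤ (ENNReal.ofReal c * eLpNorm u 2 volume).toReal :=
          ENNReal.toReal_mono (ENNReal.mul_ne_top (by simp) h.1.2.ne) h1
      _ = _ := by rw [ENNReal.toReal_mul, ENNReal.toReal_ofReal hc]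
  exact h2.trans (mul_le_mul_of_nonneg_left h.2 hc)

theorem L2Bound.clm {M c : ℝ} {u : ℝ → E} (h : L2Bound M u) (L : E →L[ℝ] G) (hc : 0 ≤ c)
    (hL : ∀ x, ‖L x‖ ≤ c * ‖x‖) : L2Bound (c * M) (fun x => L (u x)) :=
  h.of_le hc (L.continuous.comp_aestronglyMeasurable h.1.1) (Eventually.of_forall fun _ => hL _)

/-- `u ∈ Hᵐ`, with all derivatives of order at most `m` bounded by `M` in `L²`. -/
def Sob : ℕ → ℝ → (ℝ → E) → Prop
  | 0, M, u => L2Bound M u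
  | m + 1, M, u => L2Bound M u ∧ IsPrim u (deriv u) ∧ Sob m M (deriv u)

/-- `c` has bounded derivatives of order less than `m`, and a derivative of order `m` in
`L² + L^∞`, all of them with bound `M`. -/
def Coef : ℕ → ℝ → (ℝ → E) → Prop
  | 0, M, c => ∃ c₁ c₂ : ℝ → E, c =ᵐ[volume] (fun x => c₁ x + c₂ x) ∧ L2Bound M c₁ ∧
      AEStronglyMeasurable c₂ volume ∧ ∀ᵐ x, ‖c₂ x‖ ≤ M
  | m + 1, M, c => (∀ x, ‖c x‖ ≤ M) ∧ IsPrim c (deriv c) ∧ Coef m M (deriv c)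

theorem Sob.l2 {m : ℕ} {M : ℝ} {u : ℝ → E} (h : Sob m M u) : L2Bound M u := by
  cases m with
  | zero => exact h
  | succ m => exact h.1

theorem Sob.nonneg {m : ℕ} {M : ℝ} {u : ℝ → E} (h : Sob m M u) : 0 ≤ M := h.l2.nonneg

theorem Coef.nonneg {m : ℕ} {M : ℝ} {u : ℝ → E} (h : Coef m M u) : 0 ≤ M := by
  cases m with
  | zero => obtain ⟨_, _, _, h, _⟩ := h; exact h.nonneg
  | succ m => exact (norm_nonneg _).trans (h.1 0)

theorem Sob.mono {m : ℕ} {M M' : ℝ} {u : ℝ → E} (h : Sob m M u) (hM : M ≤ M') : Sob m M' u := by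
  induction m generalizing u with
  | zero => exact L2Bound.mono h hM
  | succ m ih => exact ⟨h.1.mono hM, h.2.1, ih h.2.2⟩

theorem Coef.mono {m : ℕ} {M M' : ℝ} {u : ℝ → E} (h : Coef m M u) (hM : M ≤ M') :
    Coef m M' u := by
  induction m generalizing u with
  | zero =>
    obtain ⟨c₁, c₂, h1, h2, h3, h4⟩ := h
    exact ⟨c₁, c₂, h1, h2.mono hM, h3, h4.mono fun x hx => hx.trans hM⟩
  | succ m ih => exact ⟨fun x => (h.1 x).trans hM, h.2.1, ih h.2.2⟩

theorem Sob.congr_zero {M : ℝ} {u w : ℝ → E} (h : Sob 0 M u) (hw : u =ᵐ[volume] w) : Sob 0 M w :=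
  L2Bound.congr h hw

theorem Coef.congr_zero {M : ℝ} {u w : ℝ → E} (h : Coef 0 M u) (hw : u =ᵐ[volume] w) :
    Coef 0 M w := by
  obtain ⟨c₁, c₂, h1, h2⟩ := h
  exact ⟨c₁, c₂, hw.symm.trans h1, h2⟩

theorem Sob.congr {m : ℕ} {M : ℝ} {u w : ℝ → E} (h : Sob m M u) (hw : ∀ x, u x = w x) :
    Sob m M w := (funext hw : u = w) ▸ h

theorem Coef.congr {m : ℕ} {M : ℝ} {u w : ℝ → E} (h : Coef m M u) (hw : ∀ x, u x = w x) :
    Coef m M w := (funext hw : u = w) ▸ h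

variable [CompleteSpace E] [CompleteSpace G]

/-- `Sob` refers to the pointwise derivative, while computations produce explicit derivatives. The
two agree almost everywhere, which is enough at order zero; at higher order the explicit one is
continuous and they agree everywhere. -/
theorem Sob.of_isPrim {m : ℕ} {M : ℝ} {u u' : ℝ → E} (h : L2Bound M u) (hp : IsPrim u u')
    (h' : Sob m M u') : Sob (m + 1) M u := by
  refine ⟨h, hp.deriv, ?_⟩
  cases m with
  | zero => exact h'.congr_zero hp.deriv_ae.symm
  | succ m => rwa [show deriv u = u' from
      funext fun x => (hp.hasDerivAt h'.2.1.continuous x).deriv]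

theorem Coef.of_isPrim {m : ℕ} {M : ℝ} {u u' : ℝ → E} (h : ∀ x, ‖u x‖ ≤ M) (hp : IsPrim u u')
    (h' : Coef m M u') : Coef (m + 1) M u := by
  refine ⟨h, hp.deriv, ?_⟩
  cases m with
  | zero => exact h'.congr_zero hp.deriv_ae.symm
  | succ m => rwa [show deriv u = u' from
      funext fun x => (hp.hasDerivAt h'.2.1.continuous x).deriv]

theorem Sob.pred {m : ℕ} {M : ℝ} {u : ℝ → E} (h : Sob (m + 1) M u) : Sob m M u := by
  induction m generalizing u with
  | zero => exact h.1
  | succ m ih => exact ⟨h.1, h.2.1, ih h.2.2⟩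

theorem Sob.le {m k : ℕ} {M : ℝ} {u : ℝ → E} (h : Sob m M u) (hk : k ≤ m) : Sob k M u := by
  induction m, hk using Nat.le_induction with
  | base => exact h
  | succ m _ ih => exact ih h.pred

theorem Coef.zero_of_bound {M : ℝ} {c : ℝ → E} (hM : ∀ᵐ x, ‖c x‖ ≤ M)
    (hc : AEStronglyMeasurable c volume) (h0 : 0 ≤ M) : Coef 0 M c := by
  have h1 : L2Bound M (0 : ℝ → E) := ⟨MemLp.zero, by rw [lpNorm_zero]; exact h0⟩
  exact ⟨0, c, by simp, h1, hc, hM⟩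

theorem Coef.pred {m : ℕ} {M : ℝ} {u : ℝ → E} (h : Coef (m + 1) M u) : Coef m M u := by
  induction m generalizing u with
  | zero =>
    exact Coef.zero_of_bound (Eventually.of_forall h.1) h.2.1.continuous.aestronglyMeasurable
      h.nonneg
  | succ m ih => exact ⟨h.1, h.2.1, ih h.2.2⟩

theorem Coef.le {m k : ℕ} {M : ℝ} {u : ℝ → E} (h : Coef m M u) (hk : k ≤ m) : Coef k M u := by
  induction m, hk using Nat.le_induction with
  | base => exact h
  | succ m _ ih => exact ih h.pred

theorem Sob.add {m : ℕ} {M M' : ℝ} {u w : ℝ → E} (h : Sob m M u) (k : Sob m M' w) :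
    Sob m (M + M') (fun x => u x + w x) := by
  induction m generalizing u w with
  | zero => exact L2Bound.add h k
  | succ m ih => exact Sob.of_isPrim (h.1.add k.1) (h.2.1.add k.2.1) (ih h.2.2 k.2.2)

theorem Coef.add {m : ℕ} {M M' : ℝ} {u w : ℝ → E} (h : Coef m M u) (k : Coef m M' w) :
    Coef m (M + M') (fun x => u x + w x) := by
  induction m generalizing u w with
  | zero =>
    obtain ⟨c₁, c₂, h1, h2, h3, h4⟩ := h
    obtain ⟨d₁, d₂, k1, k2, k3, k4⟩ := k
    refine ⟨_, _, ?_, h2.add k2, h3.add k3, ?_⟩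
    · filter_upwards [h1, k1] with x h k
      simp only [h, k, Pi.add_apply]; abel
    · filter_upwards [h4, k4] with x h k
      exact (norm_add_le _ _).trans (add_le_add h k)
  | succ m ih =>
    exact Coef.of_isPrim (fun x => (norm_add_le _ _).trans (add_le_add (h.1 x) (k.1 x)))
      (h.2.1.add k.2.1) (ih h.2.2 k.2.2)

theorem Sob.clm {m : ℕ} {M c : ℝ} {u : ℝ → E} (h : Sob m M u) (L : E →L[ℝ] G) (hc : 0 ≤ c)
    (hL : ∀ x, ‖L x‖ ≤ c * ‖x‖) : Sob m (c * M) (fun x => L (u x)) := by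
  induction m generalizing u with
  | zero => exact L2Bound.clm h L hc hL
  | succ m ih => exact Sob.of_isPrim (h.1.clm L hc hL) (h.2.1.clm L) (ih h.2.2)

theorem Coef.clm {m : ℕ} {M c : ℝ} {u : ℝ → E} (h : Coef m M u) (L : E →L[ℝ] G) (hc : 0 ≤ c)
    (hL : ∀ x, ‖L x‖ ≤ c * ‖x‖) : Coef m (c * M) (fun x => L (u x)) := by
  induction m generalizing u with
  | zero =>
    obtain ⟨c₁, c₂, h1, h2, h3, h4⟩ := h
    refine ⟨_, _, ?_, h2.clm L hc hL, L.continuous.comp_aestronglyMeasurable h3, ?_⟩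
    · filter_upwards [h1] with x h
      simp only [h, map_add]
    · filter_upwards [h4] with x h
      exact (hL _).trans (mul_le_mul_of_nonneg_left h hc)
  | succ m ih =>
    exact Coef.of_isPrim (fun x => (hL _).trans (mul_le_mul_of_nonneg_left (h.1 x) hc))
      (h.2.1.clm L) (ih h.2.2)

theorem Sob.neg {m : ℕ} {M : ℝ} {u : ℝ → E} (h : Sob m M u) : Sob m M (fun x => -u x) := by
  simpa using h.clm (-ContinuousLinearMap.id ℝ E) zero_le_one (by simp)

theorem Coef.neg {m : ℕ} {M : ℝ} {u : ℝ → E} (h : Coef m M u) : Coef m M (fun x => -u x) := by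
  simpa using h.clm (-ContinuousLinearMap.id ℝ E) zero_le_one (by simp)

theorem Sob.sub {m : ℕ} {M M' : ℝ} {u w : ℝ → E} (h : Sob m M u) (k : Sob m M' w) :
    Sob m (M + M') (fun x => u x - w x) := by
  simpa only [sub_eq_add_neg] using h.add k.neg

theorem Coef.sub {m : ℕ} {M M' : ℝ} {u w : ℝ → E} (h : Coef m M u) (k : Coef m M' w) :
    Coef m (M + M') (fun x => u x - w x) := by
  simpa only [sub_eq_add_neg] using h.add k.neg

/-- An interval of length one is a probability space, so the L¹ norm on it is at most the L² norm.
-/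
theorem integral_norm_Ioc_le {M : ℝ} {u : ℝ → E} (h : L2Bound M u) (x : ℝ) :
    ∫ y in Ioc x (x + 1), ‖u y‖ ≤ M := by
  have hp : IsProbabilityMeasure (volume.restrict (Ioc x (x + 1))) := ⟨by simp⟩
  have h2 : MemLp u 2 (volume.restrict (Ioc x (x + 1))) := h.1.restrict _
  rw [← lpNorm_one_eq_integral_norm h2.1, ← toReal_eLpNorm h2.1]
  refine le_trans (ENNReal.toReal_mono h.1.2.ne ?_) ((toReal_eLpNorm h.1.1).trans_le h.2)
  exact (eLpNorm_le_eLpNorm_of_exponent_le (by norm_num) h2.1).trans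
    (eLpNorm_mono_measure _ Measure.restrict_le_self)

/-- Average ‖u(x)‖ ≤ ‖u(y)‖ + ∫‖u'‖ over y in (x, x+1]. Each of the two terms contributes one `M`.
-/
theorem Sob.norm_le {m : ℕ} {M : ℝ} {u : ℝ → E} (h : Sob (m + 1) M u) (x : ℝ) :
    ‖u x‖ ≤ 2 * M := by
  have hp := h.2.1
  have h1 : ∀ y ∈ Ioc x (x + 1), ‖u x‖ ≤ ‖u y‖ + M := by
    intro y hy
    have h3 : ‖u y - u x‖ ≤ M := by
      rw [hp.2, intervalIntegral.integral_of_le hy.1.le]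
      refine (norm_integral_le_integral_norm _).trans
        (le_trans ?_ (integral_norm_Ioc_le h.2.2.l2 x))
      refine setIntegral_mono_set ?_ (Eventually.of_forall fun _ => norm_nonneg _)
        (Ioc_subset_Ioc_right hy.2).eventuallyLE
      exact ((hp.1.integrableOn_isCompact isCompact_Icc).mono_set Ioc_subset_Icc_self).norm
    calc ‖u x‖ = ‖u y - (u y - u x)‖ := by rw [sub_sub_cancel]
      _ ≤ _ := (norm_sub_le _ _).trans (by gcongr)
  have hi : IntegrableOn (fun y => ‖u y‖ + M) (Ioc x (x + 1)) := by
    refine IntegrableOn.mono_set ?_ Ioc_subset_Icc_self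
    exact (Continuous.add hp.continuous.norm continuous_const).continuousOn.integrableOn_compact
      isCompact_Icc
  have h2 : ∫ y in Ioc x (x + 1), ‖u x‖ ≤ ∫ y in Ioc x (x + 1), (‖u y‖ + M) :=
    setIntegral_mono_on (by simp) hi measurableSet_Ioc h1
  have hi' : IntegrableOn (fun y => ‖u y‖) (Ioc x (x + 1)) :=
    (hp.continuous.norm.continuousOn.integrableOn_compact isCompact_Icc).mono_set
      Ioc_subset_Icc_self
  rw [integral_add hi' (by simp)] at h2
  simp at h2
  linarith [integral_norm_Ioc_le h.l2 x]

theorem Sob.coef {m : ℕ} {M : ℝ} {u : ℝ → E} (h : Sob m M u) : Coef m (2 * M) u := by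
  have hM := h.nonneg
  induction m generalizing u with
  | zero =>
    exact ⟨u, 0, by simp, h.l2.mono (by linarith), aestronglyMeasurable_const, by simp [hM]⟩
  | succ m ih => exact ⟨h.norm_le, h.2.1, ih h.2.2⟩

end Classes

/-! ### Products, compositions and integration by parts -/

section Products

variable {𝕜 : Type*} [RCLike 𝕜]

theorem L2Bound.mul_of_bound {M N : ℝ} {u c : ℝ → 𝕜} (h : L2Bound M u)
    (hc : AEStronglyMeasurable c volume) (hN : 0 ≤ N) (hb : ∀ᵐ x, ‖c x‖ ≤ N) :
    L2Bound (N * M) (fun x => u x * c x) :=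
  h.of_le hN (h.1.1.mul hc) (hb.mono fun x hx => by
    rw [norm_mul, mul_comm]; exact mul_le_mul_of_nonneg_right hx (norm_nonneg _))

theorem L2Bound.mul_coef_zero {η M : ℝ} {u c : ℝ → 𝕜} (hu : L2Bound η u)
    (hm : AEStronglyMeasurable u volume) (hb : ∀ x, ‖u x‖ ≤ 2 * η) (hc : Coef 0 M c) :
    L2Bound (3 * (M * η)) (fun x => u x * c x) := by
  have hM := hc.nonneg
  obtain ⟨c₁, c₂, h1, h2, h3, h4⟩ := hc
  have h0 := hu.nonneg
  have e1 := h2.mul_of_bound hm (by positivity) (Eventually.of_forall hb)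
  have e2 := hu.mul_of_bound h3 hM h4
  refine ((e1.add e2).congr ?_).mono (by nlinarith)
  filter_upwards [h1] with x hx
  rw [hx]; ring

/-- Leibniz rule by induction. The hypothesis `hpos` ensures that at least one factor is bounded, so
that two factors of which only L² information is available never meet. The 3 arises when the rough
factor is `c`: its L² part meets the bound 2η of `u`, its bounded part meets the L² norm η. Each
derivative doubles the number of terms. -/
theorem Sob.mul_coef {j m k : ℕ} {η M : ℝ} {u c : ℝ → 𝕜} (hu : Sob j η u) (hc : Coef m M c)
    (hj : k ≤ j) (hm : k ≤ m) (hpos : 1 ≤ j ∨ 1 ≤ m) :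
    Sob k (3 * 2 ^ k * (M * η)) (fun x => u x * c x) := by
  have base : ∀ {j m : ℕ} {u c : ℝ → 𝕜}, Sob j η u → Coef m M c → (1 ≤ j ∨ 1 ≤ m) →
      L2Bound (3 * (M * η)) (fun x => u x * c x) := by
    intro j m u c hu hc hpos
    have hM := hc.nonneg
    have hη := hu.nonneg
    rcases hpos with h | h
    · have h1 := hu.le h
      exact hu.l2.mul_coef_zero hu.l2.1.1 h1.norm_le (hc.le (Nat.zero_le _))
    · have h1 := hc.le h
      refine (hu.l2.mul_of_bound h1.2.1.continuous.aestronglyMeasurable hM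
        (Eventually.of_forall h1.1)).mono ?_
      nlinarith [mul_nonneg hM hη]
  have hM := hc.nonneg
  have hη := hu.nonneg
  induction k generalizing u c j m with
  | zero => exact (base hu hc hpos).mono (by simp)
  | succ k ih =>
    obtain ⟨j, rfl⟩ := Nat.exists_eq_add_of_le' hj
    obtain ⟨m, rfl⟩ := Nat.exists_eq_add_of_le' hm
    have e1 := ih (j := j + k) (m := m + (k + 1)) hu.2.2 hc (by omega) (by omega) (Or.inr (by omega))
    have e2 := ih (j := j + (k + 1)) (m := m + k) hu hc.2.2 (by omega) (by omega) (Or.inl (by omega))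
    refine Sob.of_isPrim ((base hu hc hpos).mono ?_) (hu.2.1.mul hc.2.1)
      ((e1.add e2).mono (le_of_eq (by ring)))
    have : (1 : ℝ) ≤ 2 ^ (k + 1) := one_le_pow₀ (by norm_num)
    nlinarith [mul_nonneg hM hη]

theorem Coef.mul_zero_of_bound {M N : ℝ} {c d : ℝ → 𝕜} (hc : Coef 0 M c)
    (hd : AEStronglyMeasurable d volume) (hN : 0 ≤ N) (hb : ∀ᵐ x, ‖d x‖ ≤ N) :
    Coef 0 (N * M) (fun x => c x * d x) := by
  have hM := hc.nonneg
  obtain ⟨c₁, c₂, h1, h2, h3, h4⟩ := hc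
  refine ⟨_, _, ?_, h2.mul_of_bound hd hN hb, h3.mul hd, ?_⟩
  · filter_upwards [h1] with x hx
    simp only [hx, Pi.mul_apply]; ring
  · filter_upwards [h4, hb] with x h4 hb
    rw [Pi.mul_apply, norm_mul, mul_comm]
    exact mul_le_mul hb h4 (norm_nonneg _) hN

/-- The same mechanism as for `Sob.mul_coef`: a factor with one derivative is bounded, and L² + L^∞
is stable under multiplication by a bounded function. -/
theorem Coef.mul {j m k : ℕ} {η M : ℝ} {u c : ℝ → 𝕜} (hu : Coef j η u) (hc : Coef m M c)
    (hj : k ≤ j) (hm : k ≤ m) (hpos : 1 ≤ j ∨ 1 ≤ m) :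
    Coef k (2 ^ k * (M * η)) (fun x => u x * c x) := by
  have hM := hc.nonneg
  have hη := hu.nonneg
  induction k generalizing u c j m with
  | zero =>
    rcases hpos with h | h
    · have h1 := hu.le h
      have := (hc.le (Nat.zero_le _)).mul_zero_of_bound h1.2.1.continuous.aestronglyMeasurable hη
        (Eventually.of_forall h1.1)
      simpa [mul_comm] using this
    · have h1 := hc.le h
      have := (hu.le (Nat.zero_le _)).mul_zero_of_bound h1.2.1.continuous.aestronglyMeasurable hM
        (Eventually.of_forall h1.1)
      simpa using this
  | succ k ih =>
    obtain ⟨j, rfl⟩ := Nat.exists_eq_add_of_le' hj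
    obtain ⟨m, rfl⟩ := Nat.exists_eq_add_of_le' hm
    have e1 := ih (j := j + k) (m := m + (k + 1)) hu.2.2 hc (by omega) (by omega) (Or.inr (by omega))
    have e2 := ih (j := j + (k + 1)) (m := m + k) hu hc.2.2 (by omega) (by omega) (Or.inl (by omega))
    refine Coef.of_isPrim (fun x => ?_) (hu.2.1.mul hc.2.1)
      ((e1.add e2).mono (le_of_eq (by ring)))
    have h1 : (1 : ℝ) ≤ 2 ^ (k + 1) := one_le_pow₀ (by norm_num)
    have h2 : ‖u x * c x‖ ≤ M * η := by
      rw [norm_mul, mul_comm]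
      exact mul_le_mul (hc.1 x) (hu.1 x) (norm_nonneg _) hM
    nlinarith [mul_nonneg hM hη]

/-- Cauchy-Schwarz. -/
theorem L2Bound.integrable_mul {M N : ℝ} {u w : ℝ → 𝕜} (hu : L2Bound M u) (hw : L2Bound N w) :
    Integrable (fun x => u x * w x) := hu.1.integrable_mul hw.1

theorem L2Bound.norm_integral_mul_le {M N : ℝ} {u w : ℝ → 𝕜} (hu : L2Bound M u)
    (hw : L2Bound N w) : ‖∫ x, u x * w x‖ ≤ M * N := by
  have hm : AEStronglyMeasurable (fun x => u x * w x) volume := hu.1.1.mul hw.1.1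
  have h1 : eLpNorm (fun x => u x * w x) 1 volume ≤ eLpNorm u 2 volume * eLpNorm w 2 volume := by
    have h0 : eLpNorm (u • w) 1 volume ≤ eLpNorm u 2 volume * eLpNorm w 2 volume :=
      eLpNorm_smul_le_mul_eLpNorm hw.1.1 hu.1.1
    rwa [show u • w = fun x => u x * w x from rfl] at h0
  refine (norm_integral_le_integral_norm _).trans ?_
  rw [← lpNorm_one_eq_integral_norm hm, ← toReal_eLpNorm hm]
  refine (ENNReal.toReal_mono (ENNReal.mul_ne_top hu.1.2.ne hw.1.2.ne) h1).trans ?_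
  rw [ENNReal.toReal_mul, toReal_eLpNorm hu.1.1, toReal_eLpNorm hw.1.1]
  exact mul_le_mul hu.2 hw.2 lpNorm_nonneg hu.nonneg

theorem lpNorm_two_sq {E : Type*} [NormedAddCommGroup E] {u : ℝ → E} (h : MemLp u 2 volume) :
    lpNorm u 2 volume ^ 2 = ∫ x, ‖u x‖ ^ 2 := by
  rw [lpNorm_eq_integral_norm_rpow_toReal (by norm_num) (by norm_num) h.1]
  have h0 : 0 ≤ ∫ x, ‖u x‖ ^ (ENNReal.toReal 2) := integral_nonneg fun x => by positivity
  rw [← Real.rpow_natCast, ← Real.rpow_mul h0]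
  simp

/-- Integration by parts on the line. -/
theorem Sob.integral_mul_deriv {M N : ℝ} {u w : ℝ → 𝕜} (hu : Sob 1 M u) (hw : Sob 1 N w) :
    ∫ x, u x * deriv w x = -∫ x, deriv u x * w x := by
  have i1 : Integrable fun x => deriv u x * w x := L2Bound.integrable_mul hu.2.2 hw.1
  have i2 : Integrable fun x => u x * deriv w x := L2Bound.integrable_mul hu.1 hw.2.2
  have := (hu.2.1.mul hw.2.1).integral_eq_zero (L2Bound.integrable_mul hu.1 hw.1) (i1.add i2)
  rw [integral_add i1 i2] at this
  rw [eq_neg_iff_add_eq_zero, add_comm]; exact this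

/-- The conjugate function. -/
theorem Sob.conj {m : ℕ} {M : ℝ} {u : ℝ → ℂ} (h : Sob m M u) :
    Sob m M (fun x => (starRingEnd ℂ) (u x)) := by
  simpa using h.clm (Complex.conjCLE : ℂ →L[ℝ] ℂ) zero_le_one (by simp)

theorem deriv_conj_comp {u u' : ℝ → ℂ} (h : IsPrim u u') :
    IsPrim (fun x => (starRingEnd ℂ) (u x)) (fun x => (starRingEnd ℂ) (u' x)) := by
  simpa using h.clm (Complex.conjCLE : ℂ →L[ℝ] ℂ)

/-- Integrate |u'|² by parts to obtain -∫ ū u'', then apply Cauchy-Schwarz. This makes the norms of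
successive derivatives a log-convex sequence. -/
theorem Sob.lpNorm_deriv_sq_le {M : ℝ} {u : ℝ → ℂ} (h : Sob 2 M u) :
    lpNorm (deriv u) 2 volume ^ 2 ≤ lpNorm u 2 volume * lpNorm (deriv (deriv u)) 2 volume := by
  have h1 : MemLp (deriv u) 2 volume := h.2.2.1.1
  have h2 : Sob 1 M (fun x => (starRingEnd ℂ) (u x)) := (h.le one_le_two).conj
  have e := h2.integral_mul_deriv h.2.2
  have e2 : ∫ x, deriv (fun x => (starRingEnd ℂ) (u x)) x * deriv u x
      = ((∫ x, ‖deriv u x‖ ^ 2 : ℝ) : ℂ) := by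
    rw [← integral_complex_ofReal]
    refine integral_congr_ae ((deriv_conj_comp h.2.1).deriv_ae.mono fun x hx => ?_)
    simp only [hx]
    rw [mul_comm, Complex.mul_conj, Complex.normSq_eq_norm_sq]
  rw [lpNorm_two_sq h1]
  have h3 : ‖∫ x, (starRingEnd ℂ) (u x) * deriv (deriv u) x‖
      ≤ lpNorm u 2 volume * lpNorm (deriv (deriv u)) 2 volume := by
    refine L2Bound.norm_integral_mul_le ⟨h2.l2.1, ?_⟩ ⟨h.2.2.2.2.1, le_rfl⟩
    exact (lpNorm_conj u 2 volume).le
  rw [e, e2, norm_neg, Complex.norm_real, Real.norm_eq_abs] at h3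
  exact (le_abs_self _).trans h3

end Products

/-! ### Iterated derivatives and interpolation between Sobolev norms. -/

section IteratedDeriv

variable {E : Type*} [NormedAddCommGroup E] [NormedSpace ℝ E] [CompleteSpace E]

theorem Sob.iterated {m k : ℕ} {M : ℝ} {u : ℝ → E} (h : Sob (k + m) M u) :
    Sob m M (iteratedDeriv k u) := by
  induction k generalizing u with
  | zero => simpa using h
  | succ k ih =>
    rw [iteratedDeriv_succ']
    rw [show k + 1 + m = (k + m) + 1 by ring] at h
    exact ih h.2.2

theorem Sob.locallyIntegrable {m : ℕ} {M : ℝ} {u : ℝ → E} (h : Sob m M u) :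
    LocallyIntegrable u := h.l2.1.locallyIntegrable (by norm_num)

theorem Sob.hasWeakDeriv {m : ℕ} {M : ℝ} {u : ℝ → E} (h : Sob m M u) :
    HasWeakDeriv m u (iteratedDeriv m u) := by
  induction m generalizing u with
  | zero => simpa using HasWeakDeriv.zero h.locallyIntegrable
  | succ m ih =>
    rw [iteratedDeriv_succ', add_comm]
    exact h.2.1.hasWeakDeriv.comp (ih h.2.2)

theorem Sob.of_lpNorm {m : ℕ} {M N : ℝ} {u : ℝ → E} (h : Sob m M u)
    (hN : ∀ k ≤ m, lpNorm (iteratedDeriv k u) 2 volume ≤ N) : Sob m N u := by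
  induction m generalizing u with
  | zero => exact ⟨h.1, by simpa using hN 0 le_rfl⟩
  | succ m ih =>
    refine ⟨⟨h.1.1, by simpa using hN 0 (Nat.zero_le _)⟩, h.2.1, ih h.2.2 fun k hk => ?_⟩
    rw [← iteratedDeriv_succ']
    exact hN _ (by omega)

/-- A log-convex finite sequence is bounded by its end values. -/
theorem le_of_sq_le_mul {m : ℕ} {x : ℕ → ℝ} {N : ℝ} (h0 : ∀ k, 0 ≤ x k)
    (h : ∀ k, k + 2 ≤ m → x (k + 1) ^ 2 ≤ x k * x (k + 2)) (hl : x 0 ≤ N) (hr : x m ≤ N) :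
    ∀ k ≤ m, x k ≤ N := by
  obtain ⟨j, hj, hmax⟩ := Finset.exists_max_image (Finset.range (m + 1)) x ⟨0, by simp⟩
  by_contra! hcon
  obtain ⟨k, hk, hkN⟩ := hcon
  -- Take the first index at which the maximum is attained. If the maximum exceeds `N`, this index
  -- is interior, its left neighbour is strictly smaller, and log-convexity fails there.
  have hP : ∃ i, i ≤ m ∧ x j ≤ x i := ⟨j, by simpa [Nat.lt_succ_iff] using hj, le_rfl⟩
  classical
  have hfind := Nat.find_spec hP
  set i := Nat.find hP
  have hxi : N < x i := hkN.trans_le ((hmax k (by simp; omega)).trans hfind.2)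
  have hi0 : i ≠ 0 := fun h => by rw [h] at hxi; linarith
  have him : i ≠ m := fun h => by rw [h] at hxi; linarith
  obtain ⟨l, hl'⟩ := Nat.exists_eq_succ_of_ne_zero hi0
  have hlt : x l < x j := by
    by_contra hc
    exact Nat.find_min hP (m := l) (by omega) ⟨by omega, not_lt.1 hc⟩
  have h1 := h l (by omega)
  have h2 : x (l + 2) ≤ x j := hmax _ (by simp; omega)
  have h3 : x (l + 1) = x i := by rw [hl']
  rw [h3] at h1
  have hxj : 0 < x j := (h0 l).trans_lt hlt
  nlinarith [h0 l, h0 (l + 2), hfind.2]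

/-- Interpolation: intermediate derivatives are controlled by the extreme ones. -/
theorem Sob.interpolate {m : ℕ} {M N : ℝ} {u : ℝ → ℂ} (h : Sob m M u)
    (hl : lpNorm u 2 volume ≤ N) (hr : lpNorm (iteratedDeriv m u) 2 volume ≤ N) :
    Sob m N u := by
  refine h.of_lpNorm (le_of_sq_le_mul (fun k => lpNorm_nonneg) (fun k hk => ?_)
    (by simpa using hl) hr)
  obtain ⟨l, rfl⟩ := Nat.exists_eq_add_of_le hk
  have h2 : Sob 2 M (iteratedDeriv k u) :=
    (Sob.iterated (m := 2 + l) (by rwa [← add_assoc])).le (by omega)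
  have := h2.lpNorm_deriv_sq_le
  rwa [← iteratedDeriv_succ, ← iteratedDeriv_succ] at this

end IteratedDeriv

/-! ### Smooth functions of a density bounded away from vacuum. -/

section Composition

theorem contDiffOn_deriv_Ioi {f : ℝ → ℝ} (hf : ContDiffOn ℝ ∞ f (Ioi 0)) :
    ContDiffOn ℝ ∞ (deriv f) (Ioi 0) :=
  ((contDiffOn_infty_iff_deriv_of_isOpen isOpen_Ioi).1 hf).2

theorem exists_bound_Icc {f : ℝ → ℝ} (hf : ContDiffOn ℝ ∞ f (Ioi 0)) {L : ℝ} (hL : 0 < L) :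
    ∃ C, 0 ≤ C ∧ ∀ s ∈ Icc L⁻¹ L, ‖f s‖ ≤ C := by
  have hsub : Icc L⁻¹ L ⊆ Ioi 0 := fun s hs => lt_of_lt_of_le (inv_pos.2 hL) hs.1
  obtain ⟨C, hC⟩ := isCompact_Icc.exists_bound_of_continuousOn (hf.continuousOn.mono hsub)
  exact ⟨max C 0, le_max_right _ _, fun s hs => (hC s hs).trans (le_max_left _ _)⟩

theorem exists_lipschitz_Icc {f : ℝ → ℝ} (hf : ContDiffOn ℝ ∞ f (Ioi 0)) {L : ℝ} (hL : 0 < L) :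
    ∃ C, 0 ≤ C ∧ ∀ s ∈ Icc L⁻¹ L, ∀ r ∈ Icc L⁻¹ L, ‖f s - f r‖ ≤ C * ‖s - r‖ := by
  have hsub : Icc L⁻¹ L ⊆ Ioi 0 := fun s hs => lt_of_lt_of_le (inv_pos.2 hL) hs.1
  obtain ⟨C, h0, hC⟩ := exists_bound_Icc (contDiffOn_deriv_Ioi hf) hL
  refine ⟨C, h0, fun s hs r hr => ?_⟩
  exact (convex_Icc L⁻¹ L).norm_image_sub_le_of_norm_hasDerivWithin_le
    (fun s hs => ((hf.differentiableOn (by simp)).differentiableAt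
      (Ioi_mem_nhds (hsub hs))).hasDerivAt.hasDerivWithinAt) hC hr hs

/-- The derivative is f'(ρ)ρ', so the induction on the order runs over all smooth `f` at once. At
least one derivative of ρ is required, since ρ must be continuous. -/
theorem exists_coef_comp {f : ℝ → ℝ} (hf : ContDiffOn ℝ ∞ f (Ioi 0)) (m : ℕ) {L : ℝ} (hL : 0 < L) :
    ∃ C, ∀ ρ : ℝ → ℝ, Coef (m + 1) L ρ → (∀ x, ρ x ∈ Icc L⁻¹ L) →
      Coef (m + 1) C (fun x => f (ρ x)) := by
  have hsub : Icc L⁻¹ L ⊆ Ioi 0 := fun s hs => lt_of_lt_of_le (inv_pos.2 hL) hs.1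
  induction m generalizing f with
  | zero =>
    obtain ⟨C, h0, hC⟩ := exists_bound_Icc hf hL
    obtain ⟨D, hD0, hD⟩ := exists_bound_Icc (contDiffOn_deriv_Ioi hf) hL
    refine ⟨max C (D * L), fun ρ hρ hb => ?_⟩
    have hp := hρ.2.1.comp (hf.of_le (by simp)) fun x => hsub (hb x)
    refine Coef.of_isPrim (fun x => (hC _ (hb x)).trans (le_max_left _ _)) hp ?_
    have hcont : Continuous fun x => deriv f (ρ x) :=
      (contDiffOn_deriv_Ioi hf).continuousOn.comp_continuous hρ.2.1.continuous fun x => hsub (hb x)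
    have := hρ.2.2.mul_zero_of_bound hcont.aestronglyMeasurable hD0
      (Eventually.of_forall fun x => hD _ (hb x))
    refine Coef.mono ?_ (le_max_right C (D * L))
    simpa only [mul_comm] using this
  | succ m ih =>
    obtain ⟨C, h0, hC⟩ := exists_bound_Icc hf hL
    obtain ⟨D, hD⟩ := ih (contDiffOn_deriv_Ioi hf)
    refine ⟨max C (2 ^ (m + 1) * (L * D)), fun ρ hρ hb => ?_⟩
    have hp := hρ.2.1.comp (hf.of_le (by simp)) fun x => hsub (hb x)
    refine Coef.of_isPrim (fun x => (hC _ (hb x)).trans (le_max_left _ _)) hp ?_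
    exact ((hD ρ hρ.pred hb).mul hρ.2.2 le_rfl le_rfl (Or.inl (by omega))).mono (le_max_right _ _)

/-- The derivative of f(ρ) - f(σ) is (f'(ρ) - f'(σ))ρ' + f'(σ)(ρ' - σ'). Both terms are linear in
the difference, and the induction applies with f' in place of f. -/
theorem exists_sob_comp_sub {f : ℝ → ℝ} (hf : ContDiffOn ℝ ∞ f (Ioi 0)) (m : ℕ) {L : ℝ}
    (hL : 0 < L) :
    ∃ C, 0 ≤ C ∧ ∀ (ρ σ : ℝ → ℝ) (η : ℝ), Coef m L ρ → Coef m L σ → Continuous ρ → Continuous σ →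
      (∀ x, ρ x ∈ Icc L⁻¹ L) → (∀ x, σ x ∈ Icc L⁻¹ L) → Sob m η (fun x => ρ x - σ x) →
      Sob m (C * η) (fun x => f (ρ x) - f (σ x)) := by
  have hsub : Icc L⁻¹ L ⊆ Ioi 0 := fun s hs => lt_of_lt_of_le (inv_pos.2 hL) hs.1
  induction m generalizing f with
  | zero =>
    obtain ⟨C, h0, hC⟩ := exists_lipschitz_Icc hf hL
    refine ⟨C, h0, fun ρ σ η _ _ hρ hσ hρb hσb hd => ?_⟩
    have c1 := hf.continuousOn.comp_continuous hρ fun x => hsub (hρb x)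
    have c2 := hf.continuousOn.comp_continuous hσ fun x => hsub (hσb x)
    exact hd.l2.of_le h0 (c1.sub c2).aestronglyMeasurable
      (Eventually.of_forall fun x => hC _ (hρb x) _ (hσb x))
  | succ m ih =>
    have hf' := contDiffOn_deriv_Ioi hf
    obtain ⟨C, h0, hC⟩ := exists_lipschitz_Icc hf hL
    obtain ⟨C', h0', hC'⟩ := exists_lipschitz_Icc hf' hL
    obtain ⟨D, hD0, hD⟩ := ih hf'
    obtain ⟨A, hA⟩ := exists_coef_comp hf' m hL
    refine ⟨max C (max (3 * 2 ^ m * (L * D)) (C' * (3 * L)) + max (3 * 2 ^ m * A) 0),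
      le_max_of_le_left h0, fun ρ σ η hρ hσ hρc hσc hρb hσb hd => ?_⟩
    have hη := hd.nonneg
    have c1 := hf.continuousOn.comp_continuous hρc fun x => hsub (hρb x)
    have c2 := hf.continuousOn.comp_continuous hσc fun x => hsub (hσb x)
    have hp := (hρ.2.1.comp (hf.of_le (by simp)) fun x => hsub (hρb x)).sub
      (hσ.2.1.comp (hf.of_le (by simp)) fun x => hsub (hσb x))
    have hdp : Sob m η (fun x => deriv ρ x - deriv σ x) := by
      cases m with
      | zero => exact Sob.congr_zero hd.2.2 (hρ.2.1.sub hσ.2.1).deriv_ae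
      | succ m =>
        rw [show (fun x => deriv ρ x - deriv σ x) = deriv (fun x => ρ x - σ x) from
          funext fun x => ((hρ.2.1.sub hσ.2.1).hasDerivAt
            (hρ.2.2.2.1.continuous.sub hσ.2.2.2.1.continuous) x).deriv.symm]
        exact hd.2.2
    -- For m = 0 the factor ρ' is only in L² + L^∞. The product is then compared pointwise with (ρ -
    -- σ)ρ', where ρ - σ is bounded because it lies in H¹.
    have t1 : Sob m (max (3 * 2 ^ m * (L * D)) (C' * (3 * L)) * η)
        (fun x => (deriv f (ρ x) - deriv f (σ x)) * deriv ρ x) := by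
      cases m with
      | zero =>
        have e := hd.l2.mul_coef_zero hd.l2.1.1 hd.norm_le hρ.2.2
        have c3 := hf'.continuousOn.comp_continuous hρc fun x => hsub (hρb x)
        have c4 := hf'.continuousOn.comp_continuous hσc fun x => hsub (hσb x)
        refine (e.of_le h0' ((c3.sub c4).aestronglyMeasurable.mul
          hρ.2.1.1.aestronglyMeasurable)
          (Eventually.of_forall fun x => ?_)).mono ?_
        · rw [Pi.mul_apply, norm_mul, norm_mul, ← mul_assoc]
          exact mul_le_mul_of_nonneg_right (hC' _ (hρb x) _ (hσb x)) (norm_nonneg _)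
        · calc C' * (3 * (L * η)) = C' * (3 * L) * η := by ring
            _ ≤ _ := mul_le_mul_of_nonneg_right (le_max_right _ _) hη
      | succ m =>
        refine ((hD ρ σ η hρ.pred hσ.pred hρc hσc hρb hσb hd.pred).mul_coef hρ.2.2 le_rfl le_rfl
          (Or.inl (by omega))).mono ?_
        calc 3 * 2 ^ (m + 1) * (L * (D * η)) = 3 * 2 ^ (m + 1) * (L * D) * η := by ring
          _ ≤ _ := mul_le_mul_of_nonneg_right (le_max_left _ _) hη
    have t2 : Sob m (max (3 * 2 ^ m * A) 0 * η)
        (fun x => deriv f (σ x) * (deriv ρ x - deriv σ x)) := by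
      have e := hdp.mul_coef (hA σ hσ hσb) le_rfl (Nat.le_succ m) (Or.inr (by omega))
      refine (e.congr fun x => mul_comm _ _).mono ?_
      calc 3 * 2 ^ m * (A * η) = 3 * 2 ^ m * A * η := by ring
        _ ≤ _ := mul_le_mul_of_nonneg_right (le_max_left _ _) hη
    refine Sob.of_isPrim ?_ hp ?_
    · refine (hd.l2.of_le h0 (c1.sub c2).aestronglyMeasurable
        (Eventually.of_forall fun x => hC _ (hρb x) _ (hσb x))).mono ?_
      exact mul_le_mul_of_nonneg_right (le_max_left _ _) hη
    · have e := t1.add t2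
      rw [← add_mul] at e
      exact (e.congr fun x => by ring).mono (mul_le_mul_of_nonneg_right (le_max_right C _) hη)

end Composition

/-! ### Comparison with the Sobolev spaces defined by weak derivatives -/

section Bridge

variable {E : Type*} [NormedAddCommGroup E] [NormedSpace ℝ E] [CompleteSpace E]

/-- The first weak derivative has a regular representative by induction, and u agrees almost
everywhere with a primitive of it. -/
theorem exists_sob_of_memH {m : ℕ} {M : ℝ} {u : ℝ → E} (h : MemH m u)
    (hM : ∀ k ≤ m, lpNorm (weakDeriv k u) 2 volume ≤ M) : ∃ v, v =ᵐ[volume] u ∧ Sob m M v := by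
  induction m generalizing u with
  | zero =>
    obtain ⟨w, hw, hw2⟩ := h 0 le_rfl
    have h0 : w =ᵐ[volume] u := hw.unique (HasWeakDeriv.zero hw.1)
    refine ⟨w, h0, hw2, ?_⟩
    rw [← lpNorm_congr_ae' (weakDeriv_ae hw)]
    exact hM 0 le_rfl
  | succ m ih =>
    obtain ⟨w, hw, hw2⟩ := h 1 (by omega)
    have hstep : ∀ {k z}, HasWeakDeriv (k + 1) u z → HasWeakDeriv k w z := fun hz =>
      hw.of_comp (by rwa [add_comm])
    obtain ⟨v', hv', hs⟩ := ih (u := w) (fun k hk => by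
      obtain ⟨z, hz, hz2⟩ := h (k + 1) (by omega)
      exact ⟨z, hstep hz, hz2⟩) (fun k hk => by
      obtain ⟨z, hz, hz2⟩ := h (k + 1) (by omega)
      rw [lpNorm_congr_ae' ((weakDeriv_ae (hstep hz)).trans (weakDeriv_ae hz).symm)]
      exact hM _ (by omega))
    obtain ⟨v, hv, hp⟩ := hw.exists_isPrim
    obtain ⟨w0, hw0, hw02⟩ := h 0 (by omega)
    have h0 : w0 =ᵐ[volume] u := hw0.unique (HasWeakDeriv.zero hw0.1)
    refine ⟨v, hv, Sob.of_isPrim ⟨(memLp_congr_ae (hv.trans h0.symm)).2 hw02, ?_⟩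
      (hp.congr hv'.symm) hs⟩
    rw [lpNorm_congr_ae' (hv.trans (h0.symm.trans (weakDeriv_ae hw0).symm))]
    exact hM 0 (by omega)

theorem lpNorm_weakDeriv_le_normH {m k : ℕ} (hk : k ≤ m) (u : ℝ → E) :
    lpNorm (weakDeriv k u) 2 volume ≤ normH m u := by
  refine Real.le_sqrt_of_sq_le ?_
  exact Finset.single_le_sum (f := fun k => lpNorm (weakDeriv k u) 2 volume ^ 2)
    (fun i _ => sq_nonneg _) (by simp; omega)

theorem MemH.exists_sob {m : ℕ} {u : ℝ → E} (h : MemH m u) :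
    ∃ v, v =ᵐ[volume] u ∧ Sob m (normH m u) v :=
  exists_sob_of_memH h fun _ hk => lpNorm_weakDeriv_le_normH hk u

theorem Sob.hasWeakDeriv_ae {m k : ℕ} {M : ℝ} {u v : ℝ → E} (h : Sob m M v) (hk : k ≤ m)
    (hv : v =ᵐ[volume] u) : HasWeakDeriv k u (iteratedDeriv k v) :=
  (h.le hk).hasWeakDeriv.congr hv Filter.EventuallyEq.rfl

theorem Sob.weakDeriv_ae {m k : ℕ} {M : ℝ} {u v : ℝ → E} (h : Sob m M v) (hk : k ≤ m)
    (hv : v =ᵐ[volume] u) : weakDeriv k u =ᵐ[volume] iteratedDeriv k v :=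
  EulerKorteweg.weakDeriv_ae (h.hasWeakDeriv_ae hk hv)

theorem Sob.l2_iteratedDeriv {m k : ℕ} {M : ℝ} {u : ℝ → E} (h : Sob m M u) (hk : k ≤ m) :
    L2Bound M (iteratedDeriv k u) := by
  obtain ⟨l, rfl⟩ := Nat.exists_eq_add_of_le hk
  exact h.iterated.l2

theorem Sob.memH {m : ℕ} {M : ℝ} {u v : ℝ → E} (h : Sob m M v) (hv : v =ᵐ[volume] u) :
    MemH m u := fun _ hk => ⟨_, h.hasWeakDeriv_ae hk hv, (h.l2_iteratedDeriv hk).1⟩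

theorem HasWeakDeriv.add {k : ℕ} {u w u₂ w₂ : ℝ → E} (h : HasWeakDeriv k u w)
    (h' : HasWeakDeriv k u₂ w₂) :
    HasWeakDeriv k (fun x => u x + u₂ x) (fun x => w x + w₂ x) := by
  refine ⟨h.1.add h'.1, h.2.1.add h'.2.1, fun φ h1 h2 => ?_⟩
  simp only [smul_add]
  rw [integral_add (h.1.integrable_test (h1.iteratedDeriv_infty k) (h2.iteratedDeriv k))
    (h'.1.integrable_test (h1.iteratedDeriv_infty k) (h2.iteratedDeriv k)),
    integral_add (h.2.1.integrable_test h1 h2) (h'.2.1.integrable_test h1 h2),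
    h.2.2 φ h1 h2, h'.2.2 φ h1 h2, smul_add]

theorem HasWeakDeriv.const_mul {k : ℕ} {u w : ℝ → ℂ} (h : HasWeakDeriv k u w) (c : ℂ) :
    HasWeakDeriv k (fun x => c * u x) (fun x => c * w x) :=
  h.clm (ContinuousLinearMap.mul ℝ ℂ c)

theorem Sob.const_mul {m : ℕ} {M : ℝ} {u : ℝ → ℂ} (h : Sob m M u) (c : ℂ) :
    Sob m (‖c‖ * M) (fun x => c * u x) :=
  h.clm (ContinuousLinearMap.mul ℝ ℂ c) (norm_nonneg _) (fun x => by simp)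

theorem Coef.const_mul {m : ℕ} {M : ℝ} {u : ℝ → ℂ} (h : Coef m M u) (c : ℂ) :
    Coef m (‖c‖ * M) (fun x => c * u x) :=
  h.clm (ContinuousLinearMap.mul ℝ ℂ c) (norm_nonneg _) (fun x => by simp)

theorem IsPrim.const_mul {u u' : ℝ → ℂ} (h : IsPrim u u') (c : ℂ) :
    IsPrim (fun x => c * u x) (fun x => c * u' x) :=
  h.clm (ContinuousLinearMap.mul ℝ ℂ c)

theorem Sob.ofReal {m : ℕ} {M : ℝ} {u : ℝ → ℝ} (h : Sob m M u) :
    Sob m M (fun x => (u x : ℂ)) := by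
  simpa using h.clm Complex.ofRealCLM zero_le_one (by simp)

theorem Coef.ofReal {m : ℕ} {M : ℝ} {u : ℝ → ℝ} (h : Coef m M u) :
    Coef m M (fun x => (u x : ℂ)) := by
  simpa using h.clm Complex.ofRealCLM zero_le_one (by simp)

theorem IsPrim.ofReal {u u' : ℝ → ℝ} (h : IsPrim u u') :
    IsPrim (fun x => (u x : ℂ)) (fun x => (u' x : ℂ)) := by
  simpa using h.clm Complex.ofRealCLM

theorem Sob.re {m : ℕ} {M : ℝ} {u : ℝ → ℂ} (h : Sob m M u) : Sob m M (fun x => (u x).re) := by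
  simpa using h.clm Complex.reCLM zero_le_one (fun x => by simpa using Complex.abs_re_le_norm x)

theorem Sob.im {m : ℕ} {M : ℝ} {u : ℝ → ℂ} (h : Sob m M u) : Sob m M (fun x => (u x).im) := by
  simpa using h.clm Complex.imCLM zero_le_one (fun x => by simpa using Complex.abs_im_le_norm x)

end Bridge

/-! ### Commutators with derivatives -/

section Leibniz

theorem Sob.isPrim_iteratedDeriv {m : ℕ} {M : ℝ} {u : ℝ → ℂ} (h : Sob (m + 1) M u) :
    IsPrim (iteratedDeriv m u) (iteratedDeriv (m + 1) u) := by
  rw [iteratedDeriv_succ]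
  exact (Sob.iterated (k := m) (m := 1) h).2.1

/-- In ∂ᵐ(aZ'') only the two leading Leibniz terms are too singular to be treated as errors. The
remainder keeps two derivatives, because the energy estimate integrates it by parts twice. The
number `q` counts spare derivatives and is raised by one when the induction descends. -/
theorem exists_commutator_second (m : ℕ) : ∀ q : ℕ, ∃ C, ∀ (a Z : ℝ → ℂ) (M η : ℝ),
    Coef (m + q + 3) M a → Sob (m + q + 2) η Z →
    ∃ e : ℝ → ℂ, Sob (q + 2) (C * (M * η)) e ∧
      HasWeakDeriv m (fun x => a x * iteratedDeriv 2 Z x)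
        (fun x => a x * iteratedDeriv (m + 2) Z x + m * (deriv a x * iteratedDeriv (m + 1) Z x)
          + e x) := by
  induction m with
  | zero =>
    refine fun q => ⟨0, fun a Z M η ha hZ => ⟨fun _ => 0, ?_, ?_⟩⟩
    · have := hZ.clm (0 : ℂ →L[ℝ] ℂ) le_rfl (by simp)
      simpa using this.le (by omega)
    · simp only [CharP.cast_eq_zero, zero_mul, add_zero, zero_add]
      refine HasWeakDeriv.zero ?_
      have h2 : Sob q η (iteratedDeriv 2 Z) :=
        Sob.iterated (hZ.le (by omega))
      have ha1 := ha.le (k := 1) (by omega)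
      exact (h2.mul_coef ha1 (Nat.zero_le _) (by omega) (Or.inr le_rfl)).locallyIntegrable.congr
        (Eventually.of_forall fun x => mul_comm _ _)
  | succ m ih =>
    intro q
    obtain ⟨C, hC⟩ := ih (q + 1)
    refine ⟨m * (3 * 2 ^ (q + 2)) + C, fun a Z M η ha hZ => ?_⟩
    obtain ⟨e, he, hw⟩ := hC a Z M η (ha.le (by omega)) (hZ.le (by omega))
    have hZ1 : Sob (q + 2) η (iteratedDeriv (m + 1) Z) := Sob.iterated (hZ.le (by omega))
    have p1 : IsPrim (iteratedDeriv (m + 1) Z) (iteratedDeriv (m + 2) Z) :=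
      (hZ.le (by omega)).isPrim_iteratedDeriv
    have p2 : IsPrim (iteratedDeriv (m + 2) Z) (iteratedDeriv (m + 3) Z) :=
      (hZ.le (by omega)).isPrim_iteratedDeriv
    have ha1 := ha.le (k := (m + q + 2) + 2) (by omega)
    have pa := ha1.2.1
    have pa1 := ha1.2.2.2.1
    -- One more derivative turns m a' Z⁽ᵐ⁺¹⁾ into m a' Z⁽ᵐ⁺²⁾, to which a Z⁽ᵐ⁺²⁾ adds one further
    -- copy, and leaves m a'' Z⁽ᵐ⁺¹⁾ for the remainder.
    refine ⟨fun x => m * (iteratedDeriv (m + 1) Z x * deriv (deriv a) x) + deriv e x, ?_, ?_⟩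
    · have e1 := (hZ1.mul_coef ha1.2.2.2.2 le_rfl (by omega) (Or.inl (by omega))).const_mul (m : ℂ)
      refine (e1.add he.2.2).mono (le_of_eq ?_)
      simp; ring
    · have hp := ((pa.mul p2).add ((pa1.mul p1).const_mul (m : ℂ))).add he.2.1
      have := hw.comp hp.hasWeakDeriv
      refine this.congr Filter.EventuallyEq.rfl (Eventually.of_forall fun x => ?_)
      push_cast
      ring

/-- For a first order term already the second Leibniz term has two derivatives to spare, so only the
leading one is kept. -/
theorem exists_commutator_first (m : ℕ) : ∀ q : ℕ, ∃ C, ∀ (b Z : ℝ → ℂ) (M η : ℝ),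
    Coef (m + q + 2) M b → Sob (m + q + 2) η Z →
    ∃ e : ℝ → ℂ, Sob (q + 2) (C * (M * η)) e ∧
      HasWeakDeriv m (fun x => b x * deriv Z x)
        (fun x => b x * iteratedDeriv (m + 1) Z x + e x) := by
  induction m with
  | zero =>
    refine fun q => ⟨0, fun a Z M η ha hZ => ⟨fun _ => 0, ?_, ?_⟩⟩
    · have := hZ.clm (0 : ℂ →L[ℝ] ℂ) le_rfl (by simp)
      simpa using this.le (by omega)
    · simp only [add_zero, zero_add, iteratedDeriv_one]
      refine HasWeakDeriv.zero ?_
      have h2 : Sob (q + 1) η (deriv Z) := (hZ.le (k := q + 2) (by omega)).2.2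
      have ha1 := ha.le (k := 1) (by omega)
      exact (h2.mul_coef ha1 (Nat.zero_le _) (by omega) (Or.inr le_rfl)).locallyIntegrable.congr
        (Eventually.of_forall fun x => mul_comm _ _)
  | succ m ih =>
    intro q
    obtain ⟨C, hC⟩ := ih (q + 1)
    refine ⟨(3 * 2 ^ (q + 2)) + C, fun b Z M η hb hZ => ?_⟩
    obtain ⟨e, he, hw⟩ := hC b Z M η (hb.le (by omega)) (hZ.le (by omega))
    have hZ1 : Sob (q + 2) η (iteratedDeriv (m + 1) Z) := Sob.iterated (hZ.le (by omega))
    have p1 : IsPrim (iteratedDeriv (m + 1) Z) (iteratedDeriv (m + 2) Z) :=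
      (hZ.le (by omega)).isPrim_iteratedDeriv
    have hb1 := hb.le (k := (m + q + 2) + 1) (by omega)
    refine ⟨fun x => iteratedDeriv (m + 1) Z x * deriv b x + deriv e x, ?_, ?_⟩
    · have e1 := hZ1.mul_coef hb1.2.2 le_rfl (by omega) (Or.inl (by omega))
      exact (e1.add he.2.2).mono (le_of_eq (by ring))
    · have hp := (hb1.2.1.mul p1).add he.2.1
      have := hw.comp hp.hasWeakDeriv
      refine this.congr Filter.EventuallyEq.rfl (Eventually.of_forall fun x => ?_)
      ring

end Leibniz

/-! ### The resolvent of a divergence form operator -/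

section Resolvent

theorem inner_toLp_eq {f : ℝ → ℂ} (hf : MemLp f 2 volume) (g : Lp ℂ 2 (volume : Measure ℝ)) :
    inner ℂ (hf.toLp f) g = ∫ x, (starRingEnd ℂ) (f x) * g x := by
  rw [L2.inner_def]
  refine integral_congr_ae (hf.coeFn_toLp.mono fun x hx => ?_)
  simp only [hx, RCLike.inner_apply]
  ring

theorem inner_toLp_prod_eq {f₁ f₂ : ℝ → ℂ} (h₁ : MemLp f₁ 2 volume) (h₂ : MemLp f₂ 2 volume)
    (g : WithLp 2 (Lp ℂ 2 (volume : Measure ℝ) × Lp ℂ 2 (volume : Measure ℝ))) :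
    inner ℂ (WithLp.toLp 2 (h₁.toLp f₁, h₂.toLp f₂)) g
      = (∫ x, (starRingEnd ℂ) (f₁ x) * g.fst x) + ∫ x, (starRingEnd ℂ) (f₂ x) * g.snd x := by
  rw [WithLp.prod_inner_apply, ← inner_toLp_eq h₁, ← inner_toLp_eq h₂]
  rfl

theorem memLp_test {φ : ℝ → ℝ} (hφ : ContDiff ℝ ∞ φ) (hc : HasCompactSupport φ) (p : ENNReal) :
    MemLp φ p volume := hφ.continuous.memLp_of_hasCompactSupport hc

theorem memLp_test_mul {φ β : ℝ → ℝ} (hφ : ContDiff ℝ ∞ φ) (hc : HasCompactSupport φ)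
    (hβ : Continuous β) : MemLp (fun x => ((φ x * β x : ℝ) : ℂ)) 2 volume := by
  have h1 : MemLp (fun x => φ x * β x) 2 volume :=
    (hφ.continuous.mul hβ).memLp_of_hasCompactSupport hc.mul_right
  exact h1.ofReal

theorem locallyIntegrable_mul_Lp {β : ℝ → ℝ} (hβ : Continuous β) {g : ℝ → ℂ}
    (hg : MemLp g 2 volume) : LocallyIntegrable (fun x => (β x : ℂ) * g x) := by
  have := (hg.locallyIntegrable (by norm_num)).continuous_smul (Complex.continuous_ofReal.comp hβ)
  simpa only [smul_eq_mul, Function.comp_apply] using this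

/-- Solvability of `μ h - (α h')' = μ Y` in the weak sense. -/
theorem exists_resolvent {μ α : ℝ → ℝ} (hμ : Continuous μ) (hα : Continuous α)
    (hμ0 : ∀ x, 0 < μ x) (hα0 : ∀ x, 0 < α x) {d D : ℝ} (hd : 0 < d) (hμd : ∀ x, d ≤ μ x)
    (hαd : ∀ x, d ≤ α x) (hμD : ∀ x, μ x ≤ D) {Y : ℝ → ℂ} (hY : MemLp Y 2 volume) :
    ∃ h h' : ℝ → ℂ, MemLp h 2 volume ∧ MemLp h' 2 volume ∧ HasWeakDeriv 1 h h' ∧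
      HasWeakDeriv 1 (fun x => (α x : ℂ) * h' x) (fun x => (μ x : ℂ) * (h x - Y x)) := by
  set sμ : ℝ → ℝ := fun x => √(μ x) with hsμ
  set sα : ℝ → ℝ := fun x => √(α x) with hsα
  have csμ : Continuous sμ := hμ.sqrt
  have csα : Continuous sα := hα.sqrt
  have psμ : ∀ x, 0 < sμ x := fun x => Real.sqrt_pos.2 (hμ0 x)
  have psα : ∀ x, 0 < sα x := fun x => Real.sqrt_pos.2 (hα0 x)
  have csμi : Continuous fun x => (sμ x)⁻¹ := csμ.inv₀ fun x => (psμ x).ne'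
  have csαi : Continuous fun x => (sα x)⁻¹ := csα.inv₀ fun x => (psα x).ne'
  have sqμ : ∀ x, sμ x * sμ x = μ x := fun x => Real.mul_self_sqrt (hμ0 x).le
  have sqα : ∀ x, sα x * sα x = α x := fun x => Real.mul_self_sqrt (hα0 x).le
  -- The equation is solved by an orthogonal projection in L² × L². The orthogonal complement of the
  -- span `W` of the pairs (φ'/√μ, φ/√α) consists of the pairs (√μ h, √α h') with h' the weak
  -- derivative of h. Projecting (√μ Y, 0) onto it minimizes ∫ μ|h - Y|² + α|h'|².
  let L := Lp ℂ 2 (volume : Measure ℝ)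
  let H := WithLp 2 (L × L)
  have m1 : ∀ φ : {φ : ℝ → ℝ // ContDiff ℝ ∞ φ ∧ HasCompactSupport φ},
      MemLp (fun x => ((deriv φ.1 x * (sμ x)⁻¹ : ℝ) : ℂ)) 2 volume := fun φ =>
    memLp_test_mul (contDiff_infty_iff_deriv.1 φ.2.1).2 φ.2.2.deriv csμi
  have m2 : ∀ φ : {φ : ℝ → ℝ // ContDiff ℝ ∞ φ ∧ HasCompactSupport φ},
      MemLp (fun x => ((φ.1 x * (sα x)⁻¹ : ℝ) : ℂ)) 2 volume := fun φ =>
    memLp_test_mul φ.2.1 φ.2.2 csαi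
  let e : {φ : ℝ → ℝ // ContDiff ℝ ∞ φ ∧ HasCompactSupport φ} → H := fun φ =>
    WithLp.toLp 2 ((m1 φ).toLp _, (m2 φ).toLp _)
  let W : Submodule ℂ H := Submodule.span ℂ (range e)
  have mY : MemLp (fun x => (sμ x : ℂ) * Y x) 2 volume := by
    refine hY.of_le_mul (c := √D) ?_ (Eventually.of_forall fun x => ?_)
    · exact (Complex.continuous_ofReal.comp csμ).aestronglyMeasurable.mul hY.1
    · rw [norm_mul, Complex.norm_real, Real.norm_of_nonneg (psμ x).le]
      exact mul_le_mul_of_nonneg_right (Real.sqrt_le_sqrt (hμD x)) (norm_nonneg _)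
  let X : H := WithLp.toLp 2 (mY.toLp _, 0)
  obtain ⟨g, hg, hgX⟩ : ∃ g ∈ Wᗮ, X - g ∈ Wᗮᗮ :=
    ⟨_, Wᗮ.starProjection_apply_mem X, Submodule.sub_starProjection_mem_orthogonal X⟩
  have hgW : ∀ φ : {φ : ℝ → ℝ // ContDiff ℝ ∞ φ ∧ HasCompactSupport φ},
      (∫ x, ((deriv φ.1 x * (sμ x)⁻¹ : ℝ) : ℂ) * g.fst x)
        + ∫ x, ((φ.1 x * (sα x)⁻¹ : ℝ) : ℂ) * g.snd x = 0 := by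
    intro φ
    have h1 := (Submodule.mem_orthogonal W g).1 hg (e φ) (Submodule.subset_span ⟨φ, rfl⟩)
    rw [inner_toLp_prod_eq (m1 φ) (m2 φ)] at h1
    simpa only [Complex.conj_ofReal] using h1
  have li1 : LocallyIntegrable fun x => ((sμ x)⁻¹ : ℝ) * g.fst x :=
    locallyIntegrable_mul_Lp csμi (Lp.memLp g.fst)
  have li2 : LocallyIntegrable fun x => ((sα x)⁻¹ : ℝ) * g.snd x :=
    locallyIntegrable_mul_Lp csαi (Lp.memLp g.snd)
  have hmem : ∀ {s : ℝ → ℝ} {r : ℝ → ℝ}, Continuous s → (∀ x, 0 < s x) → (∀ x, s x * s x = r x) →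
      (∀ x, d ≤ r x) → ∀ f : L, MemLp (fun x => (((s x)⁻¹ : ℝ) : ℂ) * f x) 2 volume := by
    intro s r hs hs0 hsr hr f
    refine (Lp.memLp f).of_le_mul (c := (√d)⁻¹) ?_ (Eventually.of_forall fun x => ?_)
    · exact (Complex.continuous_ofReal.comp
        (hs.inv₀ fun x => (hs0 x).ne')).aestronglyMeasurable.mul (Lp.memLp f).1
    · rw [norm_mul, Complex.norm_real, Real.norm_of_nonneg (inv_pos.2 (hs0 x)).le]
      refine mul_le_mul_of_nonneg_right (inv_anti₀ (Real.sqrt_pos.2 hd) ?_) (norm_nonneg _)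
      rw [Real.sqrt_le_left (hs0 x).le, sq, hsr]
      exact hr x
  have hwd : HasWeakDeriv 1 (fun x => (((sμ x)⁻¹ : ℝ) : ℂ) * g.fst x)
      (fun x => (((sα x)⁻¹ : ℝ) : ℂ) * g.snd x) := by
    refine ⟨li1, li2, fun φ h1 h2 => ?_⟩
    have := hgW ⟨φ, h1, h2⟩
    rw [iteratedDeriv_one, pow_one, neg_smul, one_smul, eq_neg_iff_add_eq_zero, ← this]
    congr 1 <;> refine integral_congr_ae (Eventually.of_forall fun x => ?_) <;>
      simp only [Complex.real_smul, Complex.ofReal_mul, mul_assoc]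
  refine ⟨_, _, hmem csμ psμ sqμ hμd g.fst, hmem csα psα sqα hαd g.snd, hwd, ?_, ?_, ?_⟩
  · exact (li2.continuous_smul (Complex.continuous_ofReal.comp hα)).congr
      (Eventually.of_forall fun x => by simp)
  · exact ((li1.sub (hY.locallyIntegrable (by norm_num))).continuous_smul
      (Complex.continuous_ofReal.comp hμ)).congr (Eventually.of_forall fun x => by simp)
  intro φ h1 h2
  have k1 : MemLp (fun x => ((φ x * sμ x : ℝ) : ℂ)) 2 volume := memLp_test_mul h1 h2 csμ
  have k2 : MemLp (fun x => ((deriv φ x * sα x : ℝ) : ℂ)) 2 volume :=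
    memLp_test_mul (contDiff_infty_iff_deriv.1 h1).2 h2.deriv csα
  let k : H := WithLp.toLp 2 (k1.toLp _, k2.toLp _)
  -- The pair built from a test function φ belongs to the space projected onto, since ∫ (ψ'φ + ψφ')
  -- = 0. Orthogonality of the residual to it is the Euler-Lagrange equation, that is, the claim.
  have hk : k ∈ Wᗮ := by
    rw [Submodule.mem_orthogonal]
    intro w hw
    induction hw using Submodule.span_induction with
    | mem w hw =>
      obtain ⟨ψ, rfl⟩ := hw
      rw [inner_toLp_prod_eq (m1 ψ) (m2 ψ)]
      have e1 : ∫ x, (starRingEnd ℂ) ((deriv ψ.1 x * (sμ x)⁻¹ : ℝ) : ℂ) * k1.toLp _ x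
          = ∫ x, ((deriv ψ.1 x * φ x : ℝ) : ℂ) := by
        refine integral_congr_ae (k1.coeFn_toLp.mono fun x hx => ?_)
        simp only [hx, Complex.conj_ofReal]
        rw [← Complex.ofReal_mul]
        congr 1
        have := (psμ x).ne'
        field_simp
      have e2 : ∫ x, (starRingEnd ℂ) ((ψ.1 x * (sα x)⁻¹ : ℝ) : ℂ) * k2.toLp _ x
          = ∫ x, ((ψ.1 x * deriv φ x : ℝ) : ℂ) := by
        refine integral_congr_ae (k2.coeFn_toLp.mono fun x hx => ?_)
        simp only [hx, Complex.conj_ofReal]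
        rw [← Complex.ofReal_mul]
        congr 1
        have := (psα x).ne'
        field_simp
      have e4 : k.fst = k1.toLp _ := rfl
      have e5 : k.snd = k2.toLp _ := rfl
      rw [e4, e5, e1, e2, integral_complex_ofReal, integral_complex_ofReal, ← Complex.ofReal_add]
      have e3 := (isPrim_of_contDiff h1).hasWeakDeriv.2.2 ψ.1 ψ.2.1 ψ.2.2
      rw [iteratedDeriv_one] at e3
      simp only [smul_eq_mul] at e3
      rw [e3]; simp
    | zero => simp
    | add x y _ _ hx hy => rw [inner_add_left, hx, hy, add_zero]
    | smul a x _ hx => rw [inner_smul_left, hx, mul_zero]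
  have h3 := (Submodule.mem_orthogonal _ _).1 hgX k hk
  rw [inner_toLp_prod_eq k1 k2] at h3
  have ix : ∀ {f : ℝ → ℂ}, LocallyIntegrable f → ∀ {χ : ℝ → ℝ}, ContDiff ℝ ∞ χ →
      HasCompactSupport χ → Integrable fun x => χ x • f x := fun hf _ hχ hc =>
    hf.integrable_test hχ hc
  have e1 : ∫ x, (starRingEnd ℂ) ((φ x * sμ x : ℝ) : ℂ) * (X - g).fst x
      = -∫ x, φ x • ((μ x : ℂ) * ((((sμ x)⁻¹ : ℝ) : ℂ) * g.fst x - Y x)) := by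
    rw [← integral_neg]
    refine integral_congr_ae ?_
    have hs : (X - g).fst =ᵐ[volume] fun x => (sμ x : ℂ) * Y x - g.fst x := by
      filter_upwards [Lp.coeFn_sub (mY.toLp _) g.fst, mY.coeFn_toLp] with x h4 h5
      have : (X - g).fst = mY.toLp _ - g.fst := rfl
      rw [this, h4, Pi.sub_apply, h5]
    filter_upwards [hs] with x hx
    simp only [hx, Complex.conj_ofReal, Complex.real_smul, ← sqμ x]
    have : (sμ x : ℂ) ≠ 0 := Complex.ofReal_ne_zero.2 (psμ x).ne'
    push_cast
    field_simp
    ring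
  have e2 : ∫ x, (starRingEnd ℂ) ((deriv φ x * sα x : ℝ) : ℂ) * (X - g).snd x
      = -∫ x, deriv φ x • ((α x : ℂ) * ((((sα x)⁻¹ : ℝ) : ℂ) * g.snd x)) := by
    rw [← integral_neg]
    refine integral_congr_ae ?_
    have hs : (X - g).snd =ᵐ[volume] fun x => - g.snd x := by
      filter_upwards [Lp.coeFn_neg g.snd] with x h4
      have : (X - g).snd = - g.snd := zero_sub _
      rw [this, h4, Pi.neg_apply]
    filter_upwards [hs] with x hx
    simp only [hx, Complex.conj_ofReal, Complex.real_smul, ← sqα x]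
    have : (sα x : ℂ) ≠ 0 := Complex.ofReal_ne_zero.2 (psα x).ne'
    push_cast
    field_simp
  rw [e1, e2] at h3
  rw [iteratedDeriv_one, pow_one, neg_smul, one_smul]
  linear_combination -h3

end Resolvent

/-! ### Regularity of the resolvent and bounds with explicit dependence on ε. -/

section ResolventBounds

theorem integrable_normSq {u : ℝ → ℂ} {M : ℝ} (h : L2Bound M u) : Integrable fun x => ‖u x‖ ^ 2 :=
  (memLp_two_iff_integrable_sq_norm h.1.1).1 h.1

theorem integral_normSq_le {u : ℝ → ℂ} {M : ℝ} (h : L2Bound M u) : ∫ x, ‖u x‖ ^ 2 ≤ M ^ 2 := by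
  rw [← lpNorm_two_sq h.1]
  exact pow_le_pow_left₀ lpNorm_nonneg h.2 2

theorem L2Bound.of_integral_le {u : ℝ → ℂ} {N : ℝ} (h : MemLp u 2 volume) (hN : 0 ≤ N)
    (hle : ∫ x, ‖u x‖ ^ 2 ≤ N ^ 2) : L2Bound N u :=
  ⟨h, by rw [← lpNorm_two_sq h] at hle; exact le_of_sq_le_sq hle hN⟩

theorem L2Bound.ofReal_mul {u : ℝ → ℂ} {M N : ℝ} {β : ℝ → ℝ} (h : L2Bound M u)
    (hβ : AEStronglyMeasurable β volume) (hN : 0 ≤ N) (hb : ∀ x, |β x| ≤ N) :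
    L2Bound (N * M) (fun x => (β x : ℂ) * u x) :=
  h.of_le hN ((Complex.continuous_ofReal.comp_aestronglyMeasurable hβ).mul h.1.1)
    (Eventually.of_forall fun x => by
      rw [norm_mul, Complex.norm_real]
      exact mul_le_mul_of_nonneg_right (hb x) (norm_nonneg _))

theorem conj_mul_self_ofReal (z : ℂ) (β : ℝ) :
    (β : ℂ) * z * (starRingEnd ℂ) z = ((β * ‖z‖ ^ 2 : ℝ) : ℂ) := by
  rw [mul_assoc, Complex.mul_conj, Complex.normSq_eq_norm_sq]; push_cast; ring

/-- The real part of `∫ β P' P̄` loses no derivative. -/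
theorem abs_re_integral_deriv_conj_le {N A : ℝ} {β : ℝ → ℝ} {P P' : ℝ → ℂ} (hβ : Coef 2 N β)
    (hP : L2Bound A P) (hp : IsPrim P P') (hP' : MemLp P' 2 volume) :
    |(∫ x, (β x : ℂ) * P' x * (starRingEnd ℂ) (P x)).re| ≤ N * A ^ 2 := by
  have hN := hβ.nonneg
  have cβ : AEStronglyMeasurable β volume := hβ.2.1.continuous.aestronglyMeasurable
  have cβ' : AEStronglyMeasurable (deriv β) volume := hβ.2.2.2.1.continuous.aestronglyMeasurable
  have l1 : L2Bound (N * A) fun x => (β x : ℂ) * P x := hP.ofReal_mul cβ hN hβ.1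
  have l2 : L2Bound (N * A) fun x => ((deriv β x : ℝ) : ℂ) * P x := hP.ofReal_mul cβ' hN hβ.2.2.1
  have lP' : L2Bound (lpNorm P' 2 volume) P' := ⟨hP', le_rfl⟩
  have l3 : L2Bound (N * _) fun x => (β x : ℂ) * P' x := lP'.ofReal_mul cβ hN hβ.1
  have lc : L2Bound A fun x => (starRingEnd ℂ) (P x) := Sob.conj (m := 0) hP
  have lc' : L2Bound _ fun x => (starRingEnd ℂ) (P' x) := Sob.conj (m := 0) lP'
  -- The derivative of β|P|² has integral zero, and βP'P̄ and βPP̄' are conjugate. Twice the real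
  -- part is therefore -∫ β'|P|².
  have hF := (hβ.2.1.ofReal.mul hp).mul (deriv_conj_comp hp)
  have i1 : Integrable fun x => ((deriv β x : ℝ) : ℂ) * P x * (starRingEnd ℂ) (P x) :=
    l2.integrable_mul lc
  have i2 : Integrable fun x => (β x : ℂ) * P' x * (starRingEnd ℂ) (P x) := l3.integrable_mul lc
  have i3 : Integrable fun x => (β x : ℂ) * P x * (starRingEnd ℂ) (P' x) := l1.integrable_mul lc'
  have e := hF.integral_eq_zero (l1.integrable_mul lc)
    (((i1.add i2).add i3).congr (Eventually.of_forall fun x => by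
      simp only [Pi.add_apply]; ring))
  have e1 : ∫ x, (((deriv β x : ℝ) : ℂ) * P x + (β x : ℂ) * P' x) * (starRingEnd ℂ) (P x)
      + (β x : ℂ) * P x * (starRingEnd ℂ) (P' x)
      = (∫ x, ((deriv β x : ℝ) : ℂ) * P x * (starRingEnd ℂ) (P x))
        + (∫ x, (β x : ℂ) * P' x * (starRingEnd ℂ) (P x))
        + ∫ x, (β x : ℂ) * P x * (starRingEnd ℂ) (P' x) := by
    have i12 : Integrable fun x => ((deriv β x : ℝ) : ℂ) * P x * (starRingEnd ℂ) (P x)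
        + (β x : ℂ) * P' x * (starRingEnd ℂ) (P x) := i1.add i2
    rw [← integral_add i1 i2, ← integral_add i12 i3]
    exact integral_congr_ae (Eventually.of_forall fun x => by simp only [add_mul])
  have e2 : ∫ x, (β x : ℂ) * P x * (starRingEnd ℂ) (P' x)
      = (starRingEnd ℂ) (∫ x, (β x : ℂ) * P' x * (starRingEnd ℂ) (P x)) := by
    rw [← integral_conj]
    refine integral_congr_ae (Eventually.of_forall fun x => ?_)
    simp only [map_mul, Complex.conj_ofReal, Complex.conj_conj]; ring
  have e3 := l2.norm_integral_mul_le lc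
  rw [e1, e2] at e
  have e4 := congrArg Complex.re e
  simp only [Complex.add_re, Complex.conj_re, Complex.zero_re] at e4
  have e5 := (Complex.abs_re_le_norm (∫ x, ((deriv β x : ℝ) : ℂ) * P x * (starRingEnd ℂ) (P x))).trans e3
  rw [abs_le] at e5 ⊢
  constructor <;> nlinarith [mul_nonneg hN (sq_nonneg A)]

/-- Regular solutions of the resolvent equation `μ h - ε (a μ h')' = μ Y`. -/
def IsResolvent (ε : ℝ) (a μ : ℝ → ℝ) (Y h : ℝ → ℂ) : Prop :=
  (∃ A, Sob 2 A h) ∧ IsPrim (fun x => ((ε * (a x * μ x) : ℝ) : ℂ) * deriv h x)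
    (fun x => (μ x : ℂ) * (h x - Y x))

/-- The flux P = εaμh' has the square integrable derivative μ(h - Y), so it lies in H¹.
Multiplication by ν/ε, with ν the inverse of aμ, transfers this to h'. -/
theorem exists_isResolvent {M ε : ℝ} {a μ ν : ℝ → ℝ} {Y : ℝ → ℂ} (hε : 0 < ε) (hM : 1 ≤ M)
    (ha : Coef 2 M a) (hμ : Coef 2 M μ) (ha0 : ∀ x, M⁻¹ ≤ a x) (hμ0 : ∀ x, M⁻¹ ≤ μ x)
    (hν : Coef 2 M ν) (hνe : ∀ x, ν x * (a x * μ x) = 1) (hY : MemLp Y 2 volume) :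
    ∃ h, IsResolvent ε a μ Y h := by
  have hM0 : 0 < M := by linarith
  have ca := ha.2.1.continuous
  have cμ := hμ.2.1.continuous
  have pa : ∀ x, 0 < a x := fun x => (inv_pos.2 hM0).trans_le (ha0 x)
  have pμ : ∀ x, 0 < μ x := fun x => (inv_pos.2 hM0).trans_le (hμ0 x)
  have hlow : ∀ x, M⁻¹ * M⁻¹ ≤ a x * μ x := fun x =>
    mul_le_mul (ha0 x) (hμ0 x) (inv_pos.2 hM0).le (pa x).le
  obtain ⟨h, h', mh, mh', w1, w2⟩ := exists_resolvent (α := fun x => ε * (a x * μ x)) cμ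
    (continuous_const.mul (ca.mul cμ)) pμ (fun x => mul_pos hε (mul_pos (pa x) (pμ x)))
    (d := min M⁻¹ (ε * (M⁻¹ * M⁻¹))) (D := M) (by positivity)
    (fun x => (min_le_left _ _).trans (hμ0 x))
    (fun x => (min_le_right _ _).trans (mul_le_mul_of_nonneg_left (hlow x) hε.le))
    (fun x => (le_abs_self _).trans (hμ.1 x)) hY
  obtain ⟨k, hk, pk⟩ := w1.exists_isPrim
  obtain ⟨P, hP, pP⟩ := w2.exists_isPrim
  have mdiff : MemLp (fun x => (μ x : ℂ) * (h x - Y x)) 2 volume :=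
    (L2Bound.ofReal_mul (M := lpNorm (h - Y) 2 volume) ⟨mh.sub hY, le_rfl⟩
      cμ.aestronglyMeasurable hM0.le hμ.1).1
  have hba : ∀ x, |ε * (a x * μ x)| ≤ ε * (M * M) := fun x => by
    rw [abs_mul, abs_of_pos hε, abs_mul]
    exact mul_le_mul_of_nonneg_left (mul_le_mul (ha.1 x) (hμ.1 x) (abs_nonneg _) hM0.le) hε.le
  have mP : MemLp P 2 volume := (memLp_congr_ae hP).2
    (L2Bound.ofReal_mul (M := lpNorm h' 2 volume) ⟨mh', le_rfl⟩
      (continuous_const.mul (ca.mul cμ)).aestronglyMeasurable (by positivity) hba).1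
  set A := max (lpNorm P 2 volume) (lpNorm (fun x => (μ x : ℂ) * (h x - Y x)) 2 volume) with hA
  have sP : Sob 1 A P := Sob.of_isPrim ⟨mP, le_max_left _ _⟩ pP ⟨mdiff, le_max_right _ _⟩
  have s1 := (sP.mul_coef (k := 1) hν.ofReal le_rfl (by norm_num) (Or.inl le_rfl)).const_mul
    ((ε⁻¹ : ℝ) : ℂ)
  have ek : ∀ x, ((ε⁻¹ : ℝ) : ℂ) * (((ε * (a x * μ x) : ℝ) : ℂ) * h' x * (ν x : ℂ)) = h' x := by
    intro x
    have h1 : (ν x : ℂ) * (a x * μ x) = 1 := by exact_mod_cast hνe x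
    have h2 : ((ε : ℝ) : ℂ) ≠ 0 := Complex.ofReal_ne_zero.2 hε.ne'
    push_cast
    field_simp
    linear_combination (h' x) * h1
  have e1 : h' =ᵐ[volume] fun x => ((ε⁻¹ : ℝ) : ℂ) * (P x * (ν x : ℂ)) := by
    filter_upwards [hP] with x hx
    rw [hx, ek]
  have pk2 := pk.congr e1
  set A₂ := max (lpNorm k 2 volume)
    (‖((ε⁻¹ : ℝ) : ℂ)‖ * (3 * 2 ^ 1 * (M * A))) with hA₂
  have sk : Sob 2 A₂ k := Sob.of_isPrim ⟨(memLp_congr_ae hk).2 mh, le_max_left _ _⟩ pk2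
    (s1.mono (le_max_right _ _))
  have ed : deriv k = fun x => ((ε⁻¹ : ℝ) : ℂ) * (P x * (ν x : ℂ)) :=
    funext fun x => (pk2.hasDerivAt s1.2.1.continuous x).deriv
  refine ⟨k, ⟨A₂, sk⟩, ?_⟩
  have e2 : (fun x => ((ε * (a x * μ x) : ℝ) : ℂ) * deriv k x) = P := by
    funext x
    have h1 : (ν x : ℂ) * (a x * μ x) = 1 := by exact_mod_cast hνe x
    have h2 : ((ε : ℝ) : ℂ) ≠ 0 := Complex.ofReal_ne_zero.2 hε.ne'
    rw [ed]
    push_cast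
    field_simp
    linear_combination (P x) * h1
  rw [e2]
  refine pP.congr (hk.mono fun x hx => ?_)
  simp only [hx]

section

variable {M ε : ℝ} {a μ γ : ℝ → ℝ} {Y h : ℝ → ℂ}

/-- The quadratic identity for the resolvent. -/
theorem IsResolvent.integral_eq (hr : IsResolvent ε a μ Y h) (hM : 0 ≤ M) (hε : 0 ≤ ε)
    (ha : Coef 2 M a) (hμ : Coef 2 M μ) (hY : MemLp Y 2 volume) :
    ∫ x, (μ x : ℂ) * Y x * (starRingEnd ℂ) (h x)
      = (((∫ x, μ x * ‖h x‖ ^ 2) + ∫ x, ε * (a x * μ x) * ‖deriv h x‖ ^ 2 : ℝ) : ℂ) := by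
  obtain ⟨⟨A, hh⟩, hp⟩ := hr
  have ca := ha.2.1.continuous
  have cμ := hμ.2.1.continuous
  have lY : L2Bound _ Y := ⟨hY, le_rfl⟩
  have lμY := lY.ofReal_mul cμ.aestronglyMeasurable hM hμ.1
  have lμh := hh.l2.ofReal_mul cμ.aestronglyMeasurable hM hμ.1
  have lc : L2Bound A fun x => (starRingEnd ℂ) (h x) := hh.conj.l2
  have ldc : L2Bound A fun x => (starRingEnd ℂ) (deriv h x) := (hh.2.2.conj (m := 1)).l2
  have hba : ∀ x, |ε * (a x * μ x)| ≤ ε * (M * M) := fun x => by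
    rw [abs_mul, abs_of_nonneg hε, abs_mul]
    exact mul_le_mul_of_nonneg_left (mul_le_mul (ha.1 x) (hμ.1 x) (abs_nonneg _) hM) hε
  have lP : L2Bound _ fun x => ((ε * (a x * μ x) : ℝ) : ℂ) * deriv h x :=
    hh.2.2.l2.ofReal_mul (continuous_const.mul (ca.mul cμ)).aestronglyMeasurable (by positivity) hba
  have i1 : Integrable fun x => (μ x : ℂ) * Y x * (starRingEnd ℂ) (h x) := lμY.integrable_mul lc
  have i2 : Integrable fun x => (μ x : ℂ) * h x * (starRingEnd ℂ) (h x) := lμh.integrable_mul lc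
  have i3 : Integrable fun x => ((ε * (a x * μ x) : ℝ) : ℂ) * deriv h x *
      (starRingEnd ℂ) (deriv h x) := lP.integrable_mul ldc
  have hF := hp.mul (deriv_conj_comp hh.2.1)
  have e := hF.integral_eq_zero (lP.integrable_mul lc) (((i2.sub i1).add i3).congr
    (Eventually.of_forall fun x => by simp only [Pi.add_apply, Pi.sub_apply]; ring))
  have e1 : ∫ x, (μ x : ℂ) * (h x - Y x) * (starRingEnd ℂ) (h x)
      + ((ε * (a x * μ x) : ℝ) : ℂ) * deriv h x * (starRingEnd ℂ) (deriv h x)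
      = (∫ x, (μ x : ℂ) * h x * (starRingEnd ℂ) (h x))
        - (∫ x, (μ x : ℂ) * Y x * (starRingEnd ℂ) (h x))
        + ∫ x, ((ε * (a x * μ x) : ℝ) : ℂ) * deriv h x * (starRingEnd ℂ) (deriv h x) := by
    have i21 : Integrable fun x => (μ x : ℂ) * h x * (starRingEnd ℂ) (h x)
        - (μ x : ℂ) * Y x * (starRingEnd ℂ) (h x) := i2.sub i1
    rw [← integral_sub i2 i1, ← integral_add i21 i3]
    exact integral_congr_ae (Eventually.of_forall fun x => by simp only [mul_sub, sub_mul])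
  rw [e1] at e
  simp only [conj_mul_self_ofReal, integral_complex_ofReal] at e
  push_cast at e ⊢
  linear_combination -e

/-- Writing μ = γ² and applying Cauchy-Schwarz to the quadratic identity gives X₀ + X₁ ≤ p√X₀, hence
X₀ + X₁ ≤ p². The bound for h' degenerates like ε^{-1/2}; the factor ε in the flux compensates for
this later. -/
theorem IsResolvent.bounds {p : ℝ} (hr : IsResolvent ε a μ Y h) (hM : 1 ≤ M) (hε : 0 < ε)
    (ha : Coef 2 M a) (hμ : Coef 2 M μ) (ha0 : ∀ x, M⁻¹ ≤ a x) (hμ0 : ∀ x, M⁻¹ ≤ μ x)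
    (hγ : ∀ x, μ x = γ x ^ 2) (hγc : Continuous γ) (hY : MemLp Y 2 volume)
    (hp : L2Bound p (fun x => (γ x : ℂ) * Y x)) :
    (∫ x, μ x * ‖h x‖ ^ 2) + (∫ x, ε * (a x * μ x) * ‖deriv h x‖ ^ 2) ≤ p ^ 2 ∧
      L2Bound (M * p) h ∧ L2Bound (M / √ε * p) (deriv h) := by
  have hM0 : 0 < M := by linarith
  have e := hr.integral_eq hM0.le hε.le ha hμ hY
  obtain ⟨⟨A, hh⟩, -⟩ := hr
  have hp0 := hp.nonneg
  have pa : ∀ x, 0 < a x := fun x => (inv_pos.2 hM0).trans_le (ha0 x)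
  have pμ : ∀ x, 0 < μ x := fun x => (inv_pos.2 hM0).trans_le (hμ0 x)
  set X₀ := ∫ x, μ x * ‖h x‖ ^ 2 with hX₀
  set X₁ := ∫ x, ε * (a x * μ x) * ‖deriv h x‖ ^ 2 with hX₁
  have n0 : 0 ≤ X₀ := integral_nonneg fun x => mul_nonneg (pμ x).le (sq_nonneg _)
  have n1 : 0 ≤ X₁ := integral_nonneg fun x =>
    mul_nonneg (mul_pos hε (mul_pos (pa x) (pμ x))).le (sq_nonneg _)
  have γb : ∀ x, |γ x| ≤ M := fun x => by
    have h1 := (le_abs_self _).trans (hμ.1 x)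
    rw [hγ] at h1
    have h2 : |γ x| ^ 2 ≤ M ^ 2 := by rw [sq_abs]; nlinarith
    exact le_of_sq_le_sq h2 hM0.le
  have lγh : L2Bound √X₀ (fun x => (γ x : ℂ) * h x) := by
    refine L2Bound.of_integral_le (hh.l2.ofReal_mul hγc.aestronglyMeasurable hM0.le γb).1
      (Real.sqrt_nonneg _) ?_
    rw [Real.sq_sqrt n0, hX₀]
    refine le_of_eq (integral_congr_ae (Eventually.of_forall fun x => ?_))
    simp only [norm_mul, Complex.norm_real, Real.norm_eq_abs, mul_pow, sq_abs, hγ]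
  have lc : L2Bound √X₀ (fun x => (starRingEnd ℂ) ((γ x : ℂ) * h x)) := Sob.conj (m := 0) lγh
  have cs := hp.norm_integral_mul_le lc
  have e1 : ∫ x, (γ x : ℂ) * Y x * (starRingEnd ℂ) ((γ x : ℂ) * h x) = ((X₀ + X₁ : ℝ) : ℂ) := by
    rw [← e]
    refine integral_congr_ae (Eventually.of_forall fun x => ?_)
    simp only [map_mul, Complex.conj_ofReal, hγ x]
    push_cast; ring
  rw [e1, Complex.norm_real, Real.norm_of_nonneg (add_nonneg n0 n1)] at cs
  have h3 := Real.sq_sqrt n0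
  have h4 := Real.sqrt_nonneg X₀
  have h5 : √X₀ ≤ p := by
    rcases h4.eq_or_lt with h6 | h6
    · rw [← h6]; exact hp0
    · by_contra! hc
      nlinarith
  have h6 : X₀ + X₁ ≤ p ^ 2 := by nlinarith
  have inth : Integrable fun x => μ x * ‖h x‖ ^ 2 := by
    refine (integrable_normSq lγh).congr (Eventually.of_forall fun x => ?_)
    simp only [norm_mul, Complex.norm_real, Real.norm_eq_abs, mul_pow, sq_abs, hγ]
  have inth' : Integrable fun x => ε * (a x * μ x) * ‖deriv h x‖ ^ 2 := by
    refine (integrable_normSq hh.2.2.l2).bdd_mul (c := ε * (M * M)) ?_ ?_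
    · exact (continuous_const.mul
        (ha.2.1.continuous.mul hμ.2.1.continuous)).aestronglyMeasurable
    · refine Eventually.of_forall fun x => ?_
      rw [Real.norm_eq_abs, abs_mul, abs_of_pos hε, abs_mul]
      exact mul_le_mul_of_nonneg_left (mul_le_mul (ha.1 x) (hμ.1 x) (abs_nonneg _) hM0.le) hε.le
  refine ⟨h6, L2Bound.of_integral_le hh.l2.1 (by positivity) ?_,
    L2Bound.of_integral_le hh.2.2.l2.1 (by positivity) ?_⟩
  · have : M⁻¹ * ∫ x, ‖h x‖ ^ 2 ≤ X₀ := by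
      rw [← integral_const_mul]
      exact integral_mono ((integrable_normSq hh.l2).const_mul _) inth
        fun x => mul_le_mul_of_nonneg_right (hμ0 x) (sq_nonneg _)
    rw [inv_mul_le_iff₀ hM0] at this
    have h7 : M * X₀ ≤ M * p ^ 2 := mul_le_mul_of_nonneg_left (by linarith) hM0.le
    nlinarith [sq_nonneg p]
  · have : ε * (M⁻¹ * M⁻¹) * ∫ x, ‖deriv h x‖ ^ 2 ≤ X₁ := by
      rw [← integral_const_mul]
      refine integral_mono ((integrable_normSq hh.2.2.l2).const_mul _) inth' fun x => ?_
      refine mul_le_mul_of_nonneg_right (mul_le_mul_of_nonneg_left ?_ hε.le) (sq_nonneg _)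
      exact mul_le_mul (ha0 x) (hμ0 x) (inv_pos.2 hM0).le (pa x).le
    rw [mul_pow, div_pow, Real.sq_sqrt hε.le]
    have h7 : ε * (M⁻¹ * M⁻¹) * ∫ x, ‖deriv h x‖ ^ 2 ≤ p ^ 2 := by linarith
    have h8 : ∫ x, ‖deriv h x‖ ^ 2
        = M ^ 2 / ε * (ε * (M⁻¹ * M⁻¹) * ∫ x, ‖deriv h x‖ ^ 2) := by
      field_simp
    rw [h8]
    exact mul_le_mul_of_nonneg_left h7 (by positivity)

end

end ResolventBounds

/-! ### The energy production of the Schrödinger equation tested against the resolvent. -/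

section Energy

theorem Sob.deriv_conj {m : ℕ} {A : ℝ} {h : ℝ → ℂ} (hh : Sob (m + 2) A h) (x : ℝ) :
    deriv (fun x => (starRingEnd ℂ) (h x)) x = (starRingEnd ℂ) (deriv h x) :=
  ((deriv_conj_comp hh.2.1).hasDerivAt
    (Complex.continuous_conj.comp hh.2.2.2.1.continuous) x).deriv

variable {M ε p η κ : ℝ} {a μ γ v β : ℝ → ℝ} {c Q q h : ℝ → ℂ}

/-- The transport term tested against the resolvent loses no derivative. -/
theorem IsResolvent.abs_re_transport_le {Y : ℝ → ℂ} (hr : IsResolvent ε a μ Y h) (hM : 1 ≤ M)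
    (hε : 0 < ε) (ha : Coef 2 M a) (hμ : Coef 2 M μ) (ha0 : ∀ x, M⁻¹ ≤ a x) (hμ0 : ∀ x, M⁻¹ ≤ μ x)
    (hγ : ∀ x, μ x = γ x ^ 2) (hγc : Continuous γ) (hY : MemLp Y 2 volume)
    (hp : L2Bound p (fun x => (γ x : ℂ) * Y x)) (hvμ : Coef 2 M (fun x => v x * μ x))
    (hβ : Coef 2 M β) (hβv : ∀ x, v x = β x * (a x * μ x)) :
    |(∫ x, ((v x * μ x : ℝ) : ℂ) * Y x * (starRingEnd ℂ) (deriv h x)).re| ≤ 2 * M ^ 7 * p ^ 2 := by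
  have hM0 : 0 < M := by linarith
  obtain ⟨-, bh, bh'⟩ := hr.bounds hM hε ha hμ ha0 hμ0 hγ hγc hY hp
  obtain ⟨⟨A, hh⟩, hP⟩ := hr
  have ca := ha.2.1.continuous
  have cμ := hμ.2.1.continuous
  have hba : ∀ x, |ε * (a x * μ x)| ≤ ε * (M * M) := fun x => by
    rw [abs_mul, abs_of_pos hε, abs_mul]
    exact mul_le_mul_of_nonneg_left (mul_le_mul (ha.1 x) (hμ.1 x) (abs_nonneg _) hM0.le) hε.le
  have lP : L2Bound _ fun x => ((ε * (a x * μ x) : ℝ) : ℂ) * deriv h x :=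
    bh'.ofReal_mul (continuous_const.mul (ca.mul cμ)).aestronglyMeasurable (by positivity) hba
  have lY : L2Bound _ Y := ⟨hY, le_rfl⟩
  have lhY : L2Bound _ fun x => h x - Y x := Sob.sub (m := 0) (M := M * p) bh lY
  have lP' : L2Bound _ fun x => (μ x : ℂ) * (h x - Y x) :=
    lhY.ofReal_mul cμ.aestronglyMeasurable hM0.le hμ.1
  have t1 := abs_re_integral_deriv_conj_le hvμ bh hh.2.1 hh.2.2.l2.1
  have t2 := abs_re_integral_deriv_conj_le hβ lP hP lP'.1
  have ldc : L2Bound _ fun x => (starRingEnd ℂ) (deriv h x) := Sob.conj (m := 0) bh'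
  have lc : L2Bound _ fun x => (starRingEnd ℂ) (h x) := Sob.conj (m := 0) bh
  have lPc : L2Bound _ fun x => (starRingEnd ℂ) (((ε * (a x * μ x) : ℝ) : ℂ) * deriv h x) :=
    Sob.conj (m := 0) lP
  have i1 : Integrable fun x => ((v x * μ x : ℝ) : ℂ) * h x * (starRingEnd ℂ) (deriv h x) :=
    (bh.ofReal_mul hvμ.2.1.continuous.aestronglyMeasurable hM0.le hvμ.1).integrable_mul ldc
  have i2 : Integrable fun x => (β x : ℂ) * ((μ x : ℂ) * (h x - Y x)) *
      (starRingEnd ℂ) (((ε * (a x * μ x) : ℝ) : ℂ) * deriv h x) :=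
    (lP'.ofReal_mul hβ.2.1.continuous.aestronglyMeasurable hM0.le hβ.1).integrable_mul lPc
  -- With P = εaμh' the resolvent equation reads μY = μh - P', and v = βaμ turns v P' h̄' into ε⁻¹ β
  -- P' P̄. Both resulting integrals have the form whose real part loses no derivative.
  have e1 : ∫ x, ((v x * μ x : ℝ) : ℂ) * Y x * (starRingEnd ℂ) (deriv h x)
      = (∫ x, ((v x * μ x : ℝ) : ℂ) * h x * (starRingEnd ℂ) (deriv h x))
        - ((ε⁻¹ : ℝ) : ℂ) * ∫ x, (β x : ℂ) * ((μ x : ℂ) * (h x - Y x)) *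
      (starRingEnd ℂ) (((ε * (a x * μ x) : ℝ) : ℂ) * deriv h x) := by
    rw [← integral_const_mul, ← integral_sub i1 (i2.const_mul _)]
    refine integral_congr_ae (Eventually.of_forall fun x => ?_)
    have h2 : (ε : ℂ) ≠ 0 := Complex.ofReal_ne_zero.2 hε.ne'
    have h3 : (v x : ℂ) = β x * (a x * μ x) := by exact_mod_cast hβv x
    simp only [map_mul, Complex.conj_ofReal]
    push_cast
    rw [h3]
    field_simp
    ring
  have e2 : (∫ x, ((v x * μ x : ℝ) : ℂ) * h x * (starRingEnd ℂ) (deriv h x)).re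
      = (∫ x, ((v x * μ x : ℝ) : ℂ) * deriv h x * (starRingEnd ℂ) (h x)).re := by
    rw [← Complex.conj_re, ← integral_conj]
    refine congrArg Complex.re (integral_congr_ae (Eventually.of_forall fun x => ?_))
    simp only [map_mul, Complex.conj_ofReal, Complex.conj_conj]
    ring
  rw [e1, Complex.sub_re, Complex.re_ofReal_mul, e2]
  -- In L² the flux has size ε · ε^{-1/2}, so ε⁻¹‖P‖² is bounded uniformly in ε.
  have e3 : ε⁻¹ * (M * (ε * (M * M) * (M / √ε * p)) ^ 2) = M ^ 7 * p ^ 2 := by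
    have := Real.sq_sqrt hε.le
    have h5 : √ε ≠ 0 := (Real.sqrt_pos.2 hε).ne'
    field_simp
    rw [this]
  have t3 := mul_le_mul_of_nonneg_left t2 (inv_pos.2 hε).le
  rw [e3, ← abs_of_pos (inv_pos.2 hε), ← abs_mul] at t3
  have h6 : M * (M * p) ^ 2 ≤ M ^ 7 * p ^ 2 := by
    have : M ^ 3 ≤ M ^ 7 := pow_le_pow_right₀ hM (by norm_num)
    nlinarith [sq_nonneg p]
  rw [abs_le] at t1 t3 ⊢
  constructor <;> linarith

/-- The energy estimate, tested against the resolvent. -/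
theorem IsResolvent.abs_re_energy_le (hr : IsResolvent ε a μ (deriv (deriv Q)) h) (hM : 1 ≤ M)
    (hε : 0 < ε) (ha : Coef 2 M a) (hμ : Coef 3 M μ) (ha0 : ∀ x, M⁻¹ ≤ a x)
    (hμ0 : ∀ x, M⁻¹ ≤ μ x) (hγ : ∀ x, μ x = γ x ^ 2) (hγc : Continuous γ)
    (hp : L2Bound p (fun x => (γ x : ℂ) * deriv (deriv Q) x)) (hpη : p ≤ M * η)
    (hvμ : Coef 2 M (fun x => v x * μ x)) (hβ : Coef 2 M β) (hβv : ∀ x, v x = β x * (a x * μ x))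
    (hc : Coef 2 M c) (hQ : Sob 2 η Q) (hq : Sob 2 κ q)
    (hrel : ∀ x, c x * μ x = -(v x * μ x : ℂ)
      - Complex.I * ((a x * deriv μ x - deriv a x * μ x : ℝ) : ℂ)) :
    |(∫ x, (-Complex.I * (a x * deriv (deriv Q) x) + c x * deriv Q x + q x) *
        deriv (deriv (fun x => (μ x : ℂ) * (starRingEnd ℂ) (h x))) x).re|
      ≤ 20 * M ^ 8 * (η + κ) * p := by
  have hM0 : 0 < M := by linarith
  have hη := hQ.nonneg
  have hκ := hq.nonneg
  have hp0 := hp.nonneg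
  set Y := deriv (deriv Q) with hYdef
  have lY : L2Bound η Y := hQ.2.2.2.2
  have hμ2 := hμ.le (k := 2) (by norm_num)
  have T1 := hr.abs_re_transport_le hM hε ha hμ2 ha0 hμ0 hγ hγc lY.1 hp hvμ hβ hβv
  have T2 := hr.integral_eq hM0.le hε.le ha hμ2 lY.1
  obtain ⟨-, bh, bh'⟩ := hr.bounds hM hε ha hμ2 ha0 hμ0 hγ hγc lY.1 hp
  obtain ⟨⟨A, hh⟩, hP⟩ := hr
  have cμ := hμ.2.1.continuous
  have cμ' := hμ.2.2.2.1.continuous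
  have cμ'' := hμ.2.2.2.2.2.1.continuous
  have ca := ha.2.1.continuous
  have ca' := ha.2.2.2.1.continuous
  have cc := hc.2.1.continuous
  set k : ℝ → ℂ := fun x => (starRingEnd ℂ) (h x) with hk
  have sk : Sob 2 A k := hh.conj
  have lk : L2Bound (M * p) k := Sob.conj (m := 0) bh
  have dk : deriv k = fun x => (starRingEnd ℂ) (deriv h x) := funext hh.deriv_conj
  have ddk : ∀ᵐ x, deriv (deriv k) x = (starRingEnd ℂ) (deriv (deriv h) x) := by
    rw [dk]; exact (deriv_conj_comp hh.2.2.2.1).deriv_ae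
  set θ : ℝ → ℂ := fun x => (μ x : ℂ) * k x with hθ
  have sθ : Sob 2 _ θ :=
    (sk.mul_coef hμ.ofReal le_rfl (by norm_num) (Or.inl (by norm_num))).congr fun x => mul_comm _ _
  have lθ : L2Bound (M * (M * p)) θ := lk.ofReal_mul cμ.aestronglyMeasurable hM0.le hμ.1
  have pθ : IsPrim θ fun x => ((deriv μ x : ℝ) : ℂ) * k x + (μ x : ℂ) * deriv k x :=
    hμ.2.1.ofReal.mul sk.2.1
  have dθ : deriv θ = fun x => ((deriv μ x : ℝ) : ℂ) * k x + (μ x : ℂ) * deriv k x :=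
    funext fun x => (pθ.hasDerivAt (((Complex.continuous_ofReal.comp cμ').mul
      sk.2.1.continuous).add ((Complex.continuous_ofReal.comp cμ).mul
      sk.2.2.2.1.continuous)) x).deriv
  have ddθ : ∀ᵐ x, deriv (deriv θ) x = ((deriv (deriv μ) x : ℝ) : ℂ) * k x
      + 2 * (((deriv μ x : ℝ) : ℂ) * deriv k x) + (μ x : ℂ) * deriv (deriv k) x := by
    rw [dθ]
    filter_upwards [((hμ.2.2.2.1.ofReal.mul sk.2.1).add
      (hμ.2.1.ofReal.mul sk.2.2.2.1)).deriv_ae] with x hx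
    rw [hx]; ring
  -- The conjugated resolvent equation in expanded form; it eliminates the second derivative of `k`.
  have hres : ∀ᵐ x, (ε : ℂ) * (((deriv a x * μ x + a x * deriv μ x : ℝ) : ℂ) * deriv k x
      + ((a x * μ x : ℝ) : ℂ) * deriv (deriv k) x) = μ x * (k x - (starRingEnd ℂ) (Y x)) := by
    have h1 := (((ha.2.1.mul hμ.2.1).ofReal.mul hh.2.2.2.1).const_mul (ε : ℂ)).deriv_ae
    have h2 := hP.deriv_ae
    filter_upwards [h1, h2, ddk] with x h1 h2 h3
    have h4 : (fun x => ((ε * (a x * μ x) : ℝ) : ℂ) * deriv h x)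
        = fun x => (ε : ℂ) * (((a x * μ x : ℝ) : ℂ) * deriv h x) := by
      funext x; push_cast; ring
    rw [h4, h1] at h2
    have h5 := congrArg (starRingEnd ℂ) h2
    simp only [map_mul, map_add, map_sub, Complex.conj_ofReal] at h5
    rw [h3, dk]
    linear_combination h5
  -- the coefficient of the zero order term
  set R : ℝ → ℂ := fun x => -Complex.I * ((a x * deriv (deriv μ) x : ℝ) : ℂ)
    - c x * ((deriv μ x : ℝ) : ℂ) with hR
  have cR : Continuous R := ((continuous_const.mul (Complex.continuous_ofReal.comp (ca.mul cμ''))).sub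
    (cc.mul (Complex.continuous_ofReal.comp cμ')))
  have bR : ∀ x, ‖R x‖ ≤ 2 * M ^ 2 := fun x => by
    refine (norm_sub_le _ _).trans ?_
    have h1 : ‖-Complex.I * ((a x * deriv (deriv μ) x : ℝ) : ℂ)‖ ≤ M * M := by
      rw [norm_mul, norm_neg, Complex.norm_I, one_mul, Complex.norm_real, norm_mul]
      exact mul_le_mul (ha.1 x) (hμ.2.2.2.2.1 x) (norm_nonneg _) hM0.le
    have h2 : ‖c x * ((deriv μ x : ℝ) : ℂ)‖ ≤ M * M := by
      rw [norm_mul, Complex.norm_real]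
      exact mul_le_mul (hc.1 x) (hμ.2.2.1 x) (norm_nonneg _) hM0.le
    linarith
  have lYR : L2Bound (2 * M ^ 2 * η) fun x => Y x * R x :=
    lY.mul_of_bound cR.aestronglyMeasurable (by positivity) (Eventually.of_forall bR)
  have ldk : L2Bound A (deriv k) := sk.2.2.l2
  have lYc : L2Bound η fun x => (starRingEnd ℂ) (Y x) := Sob.conj (m := 0) lY
  have lμY : L2Bound (M * η) fun x => (μ x : ℂ) * Y x :=
    lY.ofReal_mul cμ.aestronglyMeasurable hM0.le hμ.1
  -- the lower order terms
  have scQ : Sob 1 (3 * 2 ^ 1 * (M * η)) fun x => deriv Q x * c x :=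
    hQ.2.2.mul_coef hc le_rfl (by norm_num) (Or.inl le_rfl)
  have sc'Q : Sob 1 (3 * 2 ^ 1 * (M * η)) fun x => deriv Q x * deriv c x :=
    hQ.2.2.mul_coef hc.2.2 le_rfl le_rfl (Or.inl le_rfl)
  have sθ1 : Sob 1 _ θ := sθ.pred
  have I1 : ∫ x, q x * deriv (deriv θ) x = ∫ x, deriv (deriv q) x * θ x := by
    rw [hq.pred.integral_mul_deriv sθ.2.2, hq.2.2.integral_mul_deriv sθ1, neg_neg]
  have I2 : ∫ x, deriv Q x * c x * deriv (deriv θ) x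
      = -(∫ x, Y x * c x * deriv θ x) + ∫ x, deriv (fun x => deriv Q x * deriv c x) x * θ x := by
    rw [scQ.integral_mul_deriv sθ.2.2]
    have h1 : ∫ x, deriv (fun x => deriv Q x * c x) x * deriv θ x
        = (∫ x, Y x * c x * deriv θ x) + ∫ x, deriv Q x * deriv c x * deriv θ x := by
      rw [← integral_add]
      · refine integral_congr_ae ((hQ.2.2.2.1.mul hc.2.1).deriv_ae.mono fun x hx => ?_)
        simp only [hx]; ring
      · exact (lY.mul_of_bound cc.aestronglyMeasurable hM0.le
          (Eventually.of_forall hc.1)).integrable_mul sθ.2.2.l2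
      · exact sc'Q.l2.integrable_mul sθ.2.2.l2
    rw [h1, sc'Q.integral_mul_deriv sθ1]; ring
  -- the leading terms
  have iYθ'' : Integrable fun x => -Complex.I * (a x * Y x) * deriv (deriv θ) x := by
    have h1 := (lY.ofReal_mul ca.aestronglyMeasurable hM0.le ha.1).integrable_mul sθ.2.2.2.2
    exact (h1.const_mul (-Complex.I)).congr (Eventually.of_forall fun x => by
      simp only []; ring)
  have icQ : Integrable fun x => deriv Q x * c x * deriv (deriv θ) x :=
    scQ.l2.integrable_mul sθ.2.2.2.2
  have iq : Integrable fun x => q x * deriv (deriv θ) x := hq.l2.integrable_mul sθ.2.2.2.2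
  have iYcθ : Integrable fun x => Y x * c x * deriv θ x :=
    (lY.mul_of_bound cc.aestronglyMeasurable hM0.le
      (Eventually.of_forall hc.1)).integrable_mul sθ.2.2.l2
  have j1 : Integrable fun x => (μ x : ℂ) * Y x * k x := lμY.integrable_mul lk
  have j2 : Integrable fun x => (μ x : ℂ) * Y x * (starRingEnd ℂ) (Y x) := lμY.integrable_mul lYc
  have j3 : Integrable fun x => ((v x * μ x : ℝ) : ℂ) * Y x * deriv k x :=
    (lY.ofReal_mul hvμ.2.1.continuous.aestronglyMeasurable hM0.le hvμ.1).integrable_mul ldk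
  have j4 : Integrable fun x => Y x * R x * k x := lYR.integrable_mul lk
  -- After the elimination of k'' the factor of Y k' is -i(aμ' - a'μ) - cμ. By `hrel` this is the
  -- real function vμ, and here the choice of the weight enters.
  have I3 : (∫ x, -Complex.I * (a x * Y x) * deriv (deriv θ) x) - ∫ x, Y x * c x * deriv θ x
      = -Complex.I * ((ε⁻¹ : ℝ) : ℂ) * ((∫ x, (μ x : ℂ) * Y x * k x)
          - ∫ x, (μ x : ℂ) * Y x * (starRingEnd ℂ) (Y x))
        + (∫ x, ((v x * μ x : ℝ) : ℂ) * Y x * deriv k x) + ∫ x, Y x * R x * k x := by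
    have j12 : Integrable fun x => -Complex.I * ((ε⁻¹ : ℝ) : ℂ) * ((μ x : ℂ) * Y x * k x
        - (μ x : ℂ) * Y x * (starRingEnd ℂ) (Y x)) := (j1.sub j2).const_mul _
    have j123 : Integrable fun x => -Complex.I * ((ε⁻¹ : ℝ) : ℂ) * ((μ x : ℂ) * Y x * k x
        - (μ x : ℂ) * Y x * (starRingEnd ℂ) (Y x)) + ((v x * μ x : ℝ) : ℂ) * Y x * deriv k x :=
      j12.add j3
    rw [← integral_sub j1 j2, ← integral_const_mul, ← integral_add j12 j3,
      ← integral_add j123 j4, ← integral_sub iYθ'' iYcθ]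
    refine integral_congr_ae ?_
    filter_upwards [ddθ, hres] with x h1 h2
    have h3 := hrel x
    have h4 : (ε : ℂ) ≠ 0 := Complex.ofReal_ne_zero.2 hε.ne'
    have h5 : ((deriv a x * μ x + a x * deriv μ x : ℝ) : ℂ) * deriv k x
      + ((a x * μ x : ℝ) : ℂ) * deriv (deriv k) x
        = (ε : ℂ)⁻¹ * (μ x * (k x - (starRingEnd ℂ) (Y x))) := by
      rw [← h2]; field_simp
    simp only [hR]
    rw [h1, dθ]
    push_cast at h3 h5 ⊢
    linear_combination (-Complex.I * Y x) * h5 - (Y x * deriv k x) * h3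
  have hsplit : ∫ x, (-Complex.I * (a x * Y x) + c x * deriv Q x + q x) * deriv (deriv θ) x
      = ((∫ x, -Complex.I * (a x * Y x) * deriv (deriv θ) x) - ∫ x, Y x * c x * deriv θ x)
        + (∫ x, deriv (fun x => deriv Q x * deriv c x) x * θ x)
        + ∫ x, deriv (deriv q) x * θ x := by
    have i12 : Integrable fun x => -Complex.I * (a x * Y x) * deriv (deriv θ) x
      + deriv Q x * c x * deriv (deriv θ) x := iYθ''.add icQ
    rw [← I1]
    have : (∫ x, -Complex.I * (a x * Y x) * deriv (deriv θ) x) - (∫ x, Y x * c x * deriv θ x)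
        + (∫ x, deriv (fun x => deriv Q x * deriv c x) x * θ x)
        = (∫ x, -Complex.I * (a x * Y x) * deriv (deriv θ) x)
          + ∫ x, deriv Q x * c x * deriv (deriv θ) x := by rw [I2]; ring
    rw [this, ← integral_add iYθ'' icQ, ← integral_add i12 iq]
    exact integral_congr_ae (Eventually.of_forall fun x => by simp only []; ring)
  -- The term singular in ε is harmless: ∫ μYh̄ and ∫ μ|Y|² are real, so it is purely imaginary.
  have T3 : (-Complex.I * ((ε⁻¹ : ℝ) : ℂ) * ((∫ x, (μ x : ℂ) * Y x * k x)
          - ∫ x, (μ x : ℂ) * Y x * (starRingEnd ℂ) (Y x))).re = 0 := by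
    rw [T2]
    simp only [conj_mul_self_ofReal, integral_complex_ofReal]
    rw [← Complex.ofReal_sub, mul_assoc, ← Complex.ofReal_mul]
    simp
  have B1 := lYR.norm_integral_mul_le lk
  have B2 : ‖∫ x, deriv (deriv q) x * θ x‖ ≤ κ * (M * (M * p)) :=
    L2Bound.norm_integral_mul_le hq.2.2.2.2 lθ
  have B3 : ‖∫ x, deriv (fun x => deriv Q x * deriv c x) x * θ x‖
      ≤ 3 * 2 ^ 1 * (M * η) * (M * (M * p)) := L2Bound.norm_integral_mul_le sc'Q.2.2 lθ
  rw [hsplit, I3]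
  simp only [Complex.add_re, T3, zero_add]
  simp only [dk] at T1 ⊢
  have B1' := (Complex.abs_re_le_norm _).trans B1
  have B2' := (Complex.abs_re_le_norm _).trans B2
  have B3' := (Complex.abs_re_le_norm _).trans B3
  have hp2 : p ^ 2 ≤ M * (η * p) := by nlinarith
  have m3 : M ^ 3 ≤ M ^ 8 := pow_le_pow_right₀ hM (by norm_num)
  have m2 : M ^ 2 ≤ M ^ 8 := pow_le_pow_right₀ hM (by norm_num)
  have hηp : 0 ≤ η * p := by positivity
  have hκp : 0 ≤ κ * p := by positivity
  have k1 : 2 * M ^ 7 * p ^ 2 ≤ 2 * M ^ 8 * (η * p) := by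
    calc 2 * M ^ 7 * p ^ 2 ≤ 2 * M ^ 7 * (M * (η * p)) :=
          mul_le_mul_of_nonneg_left hp2 (by positivity)
      _ = _ := by ring
  have k2 : 2 * M ^ 2 * η * (M * p) ≤ 2 * M ^ 8 * (η * p) := by
    calc 2 * M ^ 2 * η * (M * p) = 2 * (M ^ 3 * (η * p)) := by ring
      _ ≤ 2 * (M ^ 8 * (η * p)) := by gcongr
      _ = _ := by ring
  have k3 : κ * (M * (M * p)) ≤ M ^ 8 * (κ * p) := by
    calc κ * (M * (M * p)) = M ^ 2 * (κ * p) := by ring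
      _ ≤ _ := by gcongr
  have k4 : 3 * 2 ^ 1 * (M * η) * (M * (M * p)) ≤ 6 * M ^ 8 * (η * p) := by
    calc 3 * 2 ^ 1 * (M * η) * (M * (M * p)) = 6 * (M ^ 3 * (η * p)) := by ring
      _ ≤ 6 * (M ^ 8 * (η * p)) := by gcongr
      _ = _ := by ring
  have k5 : 0 ≤ M ^ 8 * (κ * p) := by positivity
  have k6 : 0 ≤ M ^ 8 * (η * p) := by positivity
  rw [abs_le] at T1 B1' B2' B3' ⊢
  constructor <;> nlinarith

end Energy

/-! ### Weak derivatives in time -/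

section Time

variable {E : Type*} [NormedAddCommGroup E] [NormedSpace ℝ E]
variable {G : Type*} [NormedAddCommGroup G] [NormedSpace ℝ G]

/-- `∂ₜ u = w` at time `s`, in the sense of distributions in space. -/
def HasWeakTimeDeriv (I : Set ℝ) (s : ℝ) (u : ℝ → ℝ → E) (w : ℝ → E) : Prop :=
  ∀ φ : ℝ → ℝ, ContDiff ℝ ∞ φ → HasCompactSupport φ →
    HasDerivWithinAt (fun t => ∫ x, φ x • u t x) (∫ x, φ x • w x) I s

theorem HasWeakTimeDeriv.congr {I : Set ℝ} {s : ℝ} {u u₂ : ℝ → ℝ → E} {w w₂ : ℝ → E}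
    (h : HasWeakTimeDeriv I s u w) (hs : s ∈ I) (hu : ∀ t ∈ I, u t =ᵐ[volume] u₂ t)
    (hw : w =ᵐ[volume] w₂) : HasWeakTimeDeriv I s u₂ w₂ := by
  intro φ h1 h2
  have e : ∀ t ∈ I, ∫ x, φ x • u₂ t x = ∫ x, φ x • u t x := fun t ht =>
    integral_congr_ae ((hu t ht).mono fun x hx => by simp only [hx])
  rw [← integral_congr_ae (hw.mono fun x hx => congrArg (φ x • ·) hx)]
  exact (h φ h1 h2).congr e (e s hs)

theorem HasWeakTimeDeriv.clm [CompleteSpace E] [CompleteSpace G] {I : Set ℝ} {s : ℝ}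
    {u : ℝ → ℝ → E} {w : ℝ → E} (h : HasWeakTimeDeriv I s u w) (hs : s ∈ I) (L : E →L[ℝ] G)
    (hu : ∀ t ∈ I, LocallyIntegrable (u t)) (hw : LocallyIntegrable w) :
    HasWeakTimeDeriv I s (fun t x => L (u t x)) (fun x => L (w x)) := by
  intro φ h1 h2
  have e : ∀ {v : ℝ → E}, LocallyIntegrable v → ∫ x, φ x • L (v x) = L (∫ x, φ x • v x) := by
    intro v hv
    rw [← L.integral_comp_comm (hv.integrable_test h1 h2)]
    simp only [map_smul]
  rw [e hw]
  exact (L.hasFDerivAt.comp_hasDerivWithinAt s (h φ h1 h2)).congr (fun t ht => e (hu t ht))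
    (e (hu s hs))

theorem HasWeakTimeDeriv.add {I : Set ℝ} {s : ℝ} {u u₂ : ℝ → ℝ → E} {w w₂ : ℝ → E}
    (h : HasWeakTimeDeriv I s u w) (h' : HasWeakTimeDeriv I s u₂ w₂) (hs : s ∈ I)
    (hu : ∀ t ∈ I, LocallyIntegrable (u t)) (hw : LocallyIntegrable w)
    (hu₂ : ∀ t ∈ I, LocallyIntegrable (u₂ t)) (hw₂ : LocallyIntegrable w₂) :
    HasWeakTimeDeriv I s (fun t x => u t x + u₂ t x) (fun x => w x + w₂ x) := by
  intro φ h1 h2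
  have e : ∀ {v v₂ : ℝ → E}, LocallyIntegrable v → LocallyIntegrable v₂ →
      ∫ x, φ x • (v x + v₂ x) = (∫ x, φ x • v x) + ∫ x, φ x • v₂ x := by
    intro v v₂ hv hv₂
    simp only [smul_add]
    exact integral_add (hv.integrable_test h1 h2) (hv₂.integrable_test h1 h2)
  rw [e hw hw₂]
  exact ((h φ h1 h2).add (h' φ h1 h2)).congr (fun t ht => e (hu t ht) (hu₂ t ht))
    (e (hu s hs) (hu₂ s hs))

theorem HasWeakTimeDeriv.neg {I : Set ℝ} {s : ℝ} {u : ℝ → ℝ → E} {w : ℝ → E}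
    (h : HasWeakTimeDeriv I s u w) : HasWeakTimeDeriv I s (fun t x => -u t x) (fun x => -w x) := by
  intro φ h1 h2
  simp only [smul_neg, integral_neg]
  exact (h φ h1 h2).neg

theorem HasWeakTimeDeriv.sub {I : Set ℝ} {s : ℝ} {u u₂ : ℝ → ℝ → E} {w w₂ : ℝ → E}
    (h : HasWeakTimeDeriv I s u w) (h' : HasWeakTimeDeriv I s u₂ w₂) (hs : s ∈ I)
    (hu : ∀ t ∈ I, LocallyIntegrable (u t)) (hw : LocallyIntegrable w)
    (hu₂ : ∀ t ∈ I, LocallyIntegrable (u₂ t)) (hw₂ : LocallyIntegrable w₂) :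
    HasWeakTimeDeriv I s (fun t x => u t x - u₂ t x) (fun x => w x - w₂ x) := by
  simpa only [sub_eq_add_neg] using h.add h'.neg hs hu hw (fun t ht => (hu₂ t ht).neg) hw₂.neg

/-- Space derivatives commute with the weak time derivative. -/
theorem HasWeakTimeDeriv.weakDeriv {I : Set ℝ} {s : ℝ} {k : ℕ} {u u₂ : ℝ → ℝ → E} {w w₂ : ℝ → E}
    (h : HasWeakTimeDeriv I s u w) (hs : s ∈ I) (hu : ∀ t ∈ I, HasWeakDeriv k (u t) (u₂ t))
    (hw : HasWeakDeriv k w w₂) : HasWeakTimeDeriv I s u₂ w₂ := by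
  intro φ h1 h2
  have e : ∀ {v v₂ : ℝ → E}, HasWeakDeriv k v v₂ →
      ∫ x, φ x • v₂ x = (-1 : ℝ) ^ k • ∫ x, iteratedDeriv k φ x • v x := by
    intro v v₂ hv
    rw [hv.2.2 φ h1 h2, smul_smul, ← mul_pow]
    simp
  rw [e hw]
  exact ((h _ (h1.iteratedDeriv_infty k) (h2.iteratedDeriv k)).const_smul _).congr
    (fun t ht => e (hu t ht)) (e (hu s hs))

theorem HasWeakTimeDeriv.norm_integral_sub_le {I : Set ℝ} (hI : I.OrdConnected) {u w : ℝ → ℝ → E} {B : ℝ}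
    (h : ∀ s ∈ I, HasWeakTimeDeriv I s u (w s)) {φ : ℝ → ℝ} (h1 : ContDiff ℝ ∞ φ)
    (h2 : HasCompactSupport φ) (hu : ∀ t ∈ I, LocallyIntegrable (u t))
    (hB : ∀ s ∈ I, ‖∫ x, φ x • w s x‖ ≤ B) {s t : ℝ} (hs : s ∈ I) (ht : t ∈ I) :
    ‖∫ x, φ x • (u t x - u s x)‖ ≤ B * |t - s| := by
  have := hI.convex.norm_image_sub_le_of_norm_hasDerivWithin_le (fun r hr => h r hr φ h1 h2) hB hs ht
  simp only [smul_sub]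
  rwa [integral_sub ((hu t ht).integrable_test h1 h2) ((hu s hs).integrable_test h1 h2)]

/-- Test with normalized bumps concentrating at the point. -/
theorem abs_le_of_forall_test {d : ℝ → ℝ} (hd : Continuous d) {B : ℝ}
    (h : ∀ φ : ℝ → ℝ, ContDiff ℝ ∞ φ → HasCompactSupport φ → (∀ x, 0 ≤ φ x) → ∫ x, φ x = 1 →
      |∫ x, φ x • d x| ≤ B) (x : ℝ) : |d x| ≤ B := by
  refine le_of_forall_pos_le_add fun ε hε => ?_
  obtain ⟨δ, hδ, hball⟩ := Metric.continuous_iff.1 hd x ε hε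
  let b : ContDiffBump x := ⟨δ / 2, δ, by positivity, by linarith⟩
  have hb := b.integral_normed (μ := (volume : Measure ℝ))
  have h1 := h _ b.contDiff_normed b.hasCompactSupport_normed b.nonneg_normed hb
  have hint : Integrable (b.normed volume) := b.integrable_normed
  have i1 : Integrable fun y => b.normed volume y • d y :=
    hd.locallyIntegrable.integrable_test b.contDiff_normed b.hasCompactSupport_normed
  have e : d x - ∫ y, b.normed volume y • d y = ∫ y, b.normed volume y • (d x - d y) := by
    simp only [smul_sub]
    rw [integral_sub (hint.smul_const _) i1, integral_smul_const, hb, one_smul]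
  have h3 : |∫ y, b.normed volume y • (d x - d y)| ≤ ε := by
    rw [← Real.norm_eq_abs]
    refine (norm_integral_le_of_norm_le (g := fun y => b.normed volume y * ε) (hint.mul_const _)
      (Eventually.of_forall fun y => ?_)).trans ?_
    · rw [norm_smul, Real.norm_of_nonneg (b.nonneg_normed y)]
      by_cases hy : y ∈ Metric.ball x δ
      · refine mul_le_mul_of_nonneg_left ?_ (b.nonneg_normed y)
        rw [norm_sub_rev, ← dist_eq_norm]
        exact (hball y hy).le
      · have : b.normed volume y = 0 := by
          by_contra hne
          exact hy (by simpa [b.support_normed_eq] using (Function.mem_support.2 hne))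
        simp [this]
    · rw [integral_mul_const, hb, one_mul]
  calc |d x| = |(∫ y, b.normed volume y • d y) + (d x - ∫ y, b.normed volume y • d y)| := by
        congr 1; ring
    _ ≤ _ := (abs_add_le _ _).trans (add_le_add h1 (by rw [e]; exact h3))

/-- A bounded weak time derivative gives a Lipschitz bound in `L^∞`. -/
theorem abs_sub_le_of_hasWeakTimeDeriv {I : Set ℝ} (hI : I.OrdConnected) {u w : ℝ → ℝ → ℝ} {B : ℝ}
    (h : ∀ s ∈ I, HasWeakTimeDeriv I s u (w s)) (hu : ∀ t ∈ I, Continuous (u t))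
    (hB : ∀ s ∈ I, ∀ x, |w s x| ≤ B) {s t : ℝ} (hs : s ∈ I) (ht : t ∈ I) (x : ℝ) :
    |u t x - u s x| ≤ B * |t - s| := by
  refine abs_le_of_forall_test ((hu t ht).sub (hu s hs)) (fun φ h1 h2 h0 h3 => ?_) x
  refine HasWeakTimeDeriv.norm_integral_sub_le hI h h1 h2 (fun t ht => (hu t ht).locallyIntegrable)
    (fun r hr => ?_) hs ht
  have hi : Integrable φ := h1.continuous.integrable_of_hasCompactSupport h2
  refine (norm_integral_le_of_norm_le (g := fun y => φ y * B) (hi.mul_const _)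
      (Eventually.of_forall fun y => ?_)).trans ?_
  · rw [norm_smul, Real.norm_of_nonneg (h0 y)]
    exact mul_le_mul_of_nonneg_left (hB r hr y) (h0 y)
  · rw [integral_mul_const, h3, one_mul]

/-- Duality, with d itself approximated by a test function: D² ≤ εD + B(D + ε) for every ε > 0, so D
≤ B. Square integrability is assumed here and only the norm is estimated. -/
theorem L2Bound.of_forall_test {d : ℝ → ℝ} (hd : MemLp d 2 volume) {B : ℝ} (hB : 0 ≤ B)
    (h : ∀ φ : ℝ → ℝ, ContDiff ℝ ∞ φ → HasCompactSupport φ →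
      |∫ x, φ x • d x| ≤ B * lpNorm φ 2 volume) : L2Bound B d := by
  refine ⟨hd, ?_⟩
  set D := lpNorm d 2 volume with hD
  have hD0 : 0 ≤ D := lpNorm_nonneg
  have key : ∀ ε > 0, D ^ 2 ≤ ε * D + B * (D + ε) := by
    intro ε hε
    obtain ⟨φ, hc, hs, hle⟩ := hd.exist_eLpNorm_sub_le (by norm_num) (by norm_num) hε
    have hφ : MemLp φ 2 volume := hs.continuous.memLp_of_hasCompactSupport hc
    have l1 : L2Bound ε (fun x => d x - φ x) := by
      refine ⟨hd.sub hφ, ?_⟩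
      show lpNorm (d - φ) 2 volume ≤ ε
      rw [← toReal_eLpNorm (hd.sub hφ).1]
      exact ENNReal.toReal_le_of_le_ofReal hε.le hle
    have l2 : L2Bound D d := ⟨hd, le_rfl⟩
    have l3 : lpNorm φ 2 volume ≤ D + ε := by
      have := (Sob.sub (m := 0) (M := D) (M' := ε) l2 l1).l2.2
      simpa using this
    have e1 : D ^ 2 = (∫ x, (d x - φ x) * d x) + ∫ x, φ x • d x := by
      rw [hD, lpNorm_two_sq hd, ← integral_add (l1.integrable_mul l2)
        (hd.locallyIntegrable (by norm_num) |>.integrable_test hs hc)]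
      refine integral_congr_ae (Eventually.of_forall fun x => ?_)
      simp only [Real.norm_eq_abs, sq_abs, smul_eq_mul]; ring
    have h1 := l1.norm_integral_mul_le l2
    have h2 := h φ hs hc
    rw [e1]
    have h3 := (le_abs_self _).trans h1
    have h4 := (le_abs_self _).trans h2
    have h5 := mul_le_mul_of_nonneg_left l3 hB
    linarith
  have h2 : D ^ 2 ≤ B * D := by
    refine le_of_forall_pos_le_add fun ε hε => ?_
    have h3 : 0 < D + B + 1 := by linarith
    have := key (ε / (D + B + 1)) (by positivity)
    have h4 : ε / (D + B + 1) * D + B * (ε / (D + B + 1)) ≤ ε := by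
      have : ε / (D + B + 1) * D + B * (ε / (D + B + 1)) = ε * ((D + B) / (D + B + 1)) := by
        field_simp
      rw [this]
      refine mul_le_of_le_one_right hε.le ?_
      rw [div_le_one h3]; linarith
    linarith
  rcases hD0.eq_or_lt with h0 | h0
  · rw [← h0]; exact hB
  · nlinarith

/-- A square integrable weak time derivative gives a Lipschitz bound in `L²`. -/
theorem l2_sub_of_hasWeakTimeDeriv_real {I : Set ℝ} (hI : I.OrdConnected) {u w : ℝ → ℝ → ℝ}
    {B : ℝ} (h : ∀ s ∈ I, HasWeakTimeDeriv I s u (w s)) (hu : ∀ t ∈ I, LocallyIntegrable (u t))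
    (hB : ∀ s ∈ I, L2Bound B (w s)) {s t : ℝ} (hs : s ∈ I) (ht : t ∈ I)
    (hd : MemLp (fun x => u t x - u s x) 2 volume) :
    L2Bound (B * |t - s|) (fun x => u t x - u s x) := by
  have hB0 := (hB s hs).nonneg
  refine L2Bound.of_forall_test hd (by positivity) fun φ h1 h2 => ?_
  have := HasWeakTimeDeriv.norm_integral_sub_le hI h h1 h2 hu (B := B * lpNorm φ 2 volume)
    (fun r hr => ?_) hs ht
  · rw [Real.norm_eq_abs] at this; linarith
  · have l1 : L2Bound (lpNorm φ 2 volume) φ := ⟨memLp_test h1 h2 2, le_rfl⟩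
    have := l1.norm_integral_mul_le (hB r hr)
    rw [mul_comm]; exact this

/-- Real and imaginary parts are treated separately, whence the factor 2. -/
theorem l2_sub_of_hasWeakTimeDeriv {I : Set ℝ} (hI : I.OrdConnected) {u w : ℝ → ℝ → ℂ}
    {B : ℝ} (h : ∀ s ∈ I, HasWeakTimeDeriv I s u (w s)) (hu : ∀ t ∈ I, LocallyIntegrable (u t))
    (hB : ∀ s ∈ I, L2Bound B (w s)) {s t : ℝ} (hs : s ∈ I) (ht : t ∈ I)
    (hd : MemLp (fun x => u t x - u s x) 2 volume) :
    L2Bound (2 * B * |t - s|) (fun x => u t x - u s x) := by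
  have hw : ∀ r ∈ I, LocallyIntegrable (w r) := fun r hr =>
    (hB r hr).1.locallyIntegrable (by norm_num)
  have cl : ∀ (L : ℂ →L[ℝ] ℝ) {v : ℝ → ℂ}, LocallyIntegrable v →
      LocallyIntegrable fun x => L (v x) := fun L v hv x => by
    obtain ⟨S, hS, hi⟩ := hv x
    exact ⟨S, hS, L.integrable_comp hi⟩
  have hL : ∀ L : ℂ →L[ℝ] ℝ, (∀ z, ‖L z‖ ≤ 1 * ‖z‖) →
      L2Bound (B * |t - s|) (fun x => L (u t x - u s x)) := by
    intro L hL
    have := l2_sub_of_hasWeakTimeDeriv_real hI (u := fun t x => L (u t x))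
      (w := fun t x => L (w t x)) (B := B) (fun r hr => (h r hr).clm hr L hu (hw r hr))
      (fun r hr => cl L (hu r hr)) (fun r hr => by simpa using (hB r hr).clm L zero_le_one hL)
      hs ht (by
        have := (L2Bound.clm (M := _) ⟨hd, le_rfl⟩ L zero_le_one hL).1
        simpa only [map_sub] using this)
    simpa only [map_sub] using this
  have r1 := hL Complex.reCLM fun z => by simpa using Complex.abs_re_le_norm z
  have r2 := hL Complex.imCLM fun z => by simpa using Complex.abs_im_le_norm z
  refine ⟨hd, ?_⟩
  have c1 : L2Bound (1 * (B * |t - s|)) fun x => (((u t x - u s x).re : ℝ) : ℂ) :=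
    r1.clm Complex.ofRealCLM zero_le_one (by simp)
  have c2 : L2Bound (1 * (B * |t - s|)) fun x => (((u t x - u s x).im : ℝ) : ℂ) * Complex.I := by
    refine r2.of_le zero_le_one ?_ (Eventually.of_forall fun x => by
      rw [norm_mul, Complex.norm_I, mul_one, one_mul, Complex.norm_real]; exact le_rfl)
    exact (Complex.continuous_ofReal.comp_aestronglyMeasurable r2.1.1).mul
      aestronglyMeasurable_const
  have := (c1.add c2).2
  simp only [Complex.re_add_im] at this
  linarith

/-- A weak time derivative may be tested against any function in the dual Lebesgue space of the
space in which the function is Lipschitz in time. -/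
theorem HasWeakTimeDeriv.hasDerivWithinAt_of_approx {I : Set ℝ} {s : ℝ} {u : ℝ → ℝ → ℂ}
    {w : ℝ → ℂ} (h : HasWeakTimeDeriv I s u w) (hs : s ∈ I)
    (hu : ∀ t ∈ I, LocallyIntegrable (u t)) (hw : LocallyIntegrable w) {p : ENNReal} (hp : p ≠ ⊤)
    (hp1 : 1 ≤ p) {B : ℝ} (hB : 0 ≤ B)
    (hd : ∀ t ∈ I, ∀ ψ : ℝ → ℂ, MemLp ψ p volume →
      Integrable (fun x => ψ x * (u t x - u s x)) ∧
      ‖∫ x, ψ x * (u t x - u s x)‖ ≤ lpNorm ψ p volume * (B * |t - s|))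
    (hwB : ∀ ψ : ℝ → ℂ, MemLp ψ p volume →
      Integrable (fun x => ψ x * w x) ∧ ‖∫ x, ψ x * w x‖ ≤ lpNorm ψ p volume * B)
    {ψ : ℝ → ℂ} (hψ : MemLp ψ p volume) :
    HasDerivWithinAt (fun t => ∫ x, ψ x * (u t x - u s x)) (∫ x, ψ x * w x) I s := by
  -- complex test functions
  have htest : ∀ φ : ℝ → ℂ, ContDiff ℝ ∞ φ → HasCompactSupport φ →
      HasDerivWithinAt (fun t => ∫ x, φ x * (u t x - u s x)) (∫ x, φ x * w x) I s := by
    intro φ h1 h2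
    have h1r : ContDiff ℝ ∞ fun x => (φ x).re := Complex.reCLM.contDiff.comp h1
    have h1i : ContDiff ℝ ∞ fun x => (φ x).im := Complex.imCLM.contDiff.comp h1
    have h2r : HasCompactSupport fun x => (φ x).re := h2.comp_left (g := Complex.re) rfl
    have h2i : HasCompactSupport fun x => (φ x).im := h2.comp_left (g := Complex.im) rfl
    have e : ∀ {v : ℝ → ℂ}, LocallyIntegrable v → ∫ x, φ x * v x
        = (∫ x, (φ x).re • v x) + Complex.I * ∫ x, (φ x).im • v x := by
      intro v hv
      rw [← integral_const_mul, ← integral_add (hv.integrable_test h1r h2r)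
        ((hv.integrable_test h1i h2i).const_mul _)]
      refine integral_congr_ae (Eventually.of_forall fun x => ?_)
      simp only [Complex.real_smul]
      linear_combination (-(v x)) * Complex.re_add_im (φ x)
    have e2 : ∀ t ∈ I, ∫ x, φ x * (u t x - u s x)
        = ((∫ x, (φ x).re • u t x) + Complex.I * ∫ x, (φ x).im • u t x)
          - ((∫ x, (φ x).re • u s x) + Complex.I * ∫ x, (φ x).im • u s x) := by
      intro t ht
      have hi : ∀ {v : ℝ → ℂ}, LocallyIntegrable v → Integrable fun x => φ x * v x := by
        intro v hv
        simpa only [smul_eq_mul] using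
          hv.integrable_smul_left_of_hasCompactSupport h1.continuous h2
      rw [← e (hu t ht), ← e (hu s hs), ← integral_sub (hi (hu t ht)) (hi (hu s hs))]
      simp only [mul_sub]
    rw [e hw]
    exact (((h _ h1r h2r).add ((h _ h1i h2i).const_mul Complex.I)).sub_const _).congr e2 (e2 s hs)
  rw [hasDerivWithinAt_iff_isLittleO, Asymptotics.isLittleO_iff]
  intro ε hε
  -- Replacing ψ by a test function at distance δ changes the two pairings together by at most 2δB|t
  -- - s| ≤ (ε/2)|t - s|.
  set δ := ε / (4 * B + 4) with hδ
  have hδ0 : 0 < δ := by positivity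
  obtain ⟨φ, hc, hsm, hle⟩ := hψ.exist_eLpNorm_sub_le hp hp1 hδ0
  have hφ : MemLp φ p volume := hsm.continuous.memLp_of_hasCompactSupport hc
  have hψφ := hψ.sub hφ
  have hn : lpNorm (ψ - φ) p volume ≤ δ := by
    rw [← toReal_eLpNorm hψφ.1]
    exact ENNReal.toReal_le_of_le_ofReal hδ0.le hle
  have ht := htest φ hsm hc
  rw [hasDerivWithinAt_iff_isLittleO, Asymptotics.isLittleO_iff] at ht
  filter_upwards [ht (half_pos hε), self_mem_nhdsWithin] with t ht htI
  have z : ∀ χ : ℝ → ℂ, ∫ x, χ x * (u s x - u s x) = 0 := fun χ => by simp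
  rw [z, sub_zero] at ht ⊢
  obtain ⟨i1, b1⟩ := hd t htI _ hψφ
  obtain ⟨i2, b2⟩ := hwB _ hψφ
  obtain ⟨i3, -⟩ := hd t htI _ hφ
  obtain ⟨i4, -⟩ := hwB _ hφ
  have e1 : ∫ x, ψ x * (u t x - u s x)
      = (∫ x, (ψ - φ) x * (u t x - u s x)) + ∫ x, φ x * (u t x - u s x) := by
    rw [← integral_add i1 i3]
    exact integral_congr_ae (Eventually.of_forall fun x => by simp only [Pi.sub_apply]; ring)
  have e2 : ∫ x, ψ x * w x = (∫ x, (ψ - φ) x * w x) + ∫ x, φ x * w x := by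
    rw [← integral_add i2 i4]
    exact integral_congr_ae (Eventually.of_forall fun x => by simp only [Pi.sub_apply]; ring)
  rw [e1, e2]
  have e3 : (∫ x, (ψ - φ) x * (u t x - u s x)) + (∫ x, φ x * (u t x - u s x))
      - (t - s) • ((∫ x, (ψ - φ) x * w x) + ∫ x, φ x * w x)
      = (∫ x, (ψ - φ) x * (u t x - u s x)) - (t - s) • (∫ x, (ψ - φ) x * w x)
        + ((∫ x, φ x * (u t x - u s x)) - (t - s) • ∫ x, φ x * w x) := by
    rw [smul_add]; ring
  rw [e3]
  have b1' : ‖∫ x, (ψ - φ) x * (u t x - u s x)‖ ≤ δ * (B * |t - s|) :=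
    b1.trans (mul_le_mul_of_nonneg_right hn (by positivity))
  have b2' : ‖(t - s) • ∫ x, (ψ - φ) x * w x‖ ≤ |t - s| * (δ * B) := by
    rw [norm_smul, Real.norm_eq_abs]
    exact mul_le_mul_of_nonneg_left (b2.trans (mul_le_mul_of_nonneg_right hn hB)) (abs_nonneg _)
  have b3 : δ * (4 * B + 4) = ε := by rw [hδ]; field_simp
  refine (norm_add_le _ _).trans ((add_le_add (norm_sub_le _ _) ht).trans ?_)
  rw [Real.norm_eq_abs]
  have b4 : (2 * (δ * B)) * |t - s| ≤ ε / 2 * |t - s| :=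
    mul_le_mul_of_nonneg_right (by nlinarith) (abs_nonneg _)
  linarith

end Time

/-! ### The hydrodynamic state at a fixed time -/

section State

/-- `√(K(s)/s)`. -/
noncomputable def gradWeight (K : ℝ → ℝ) (s : ℝ) : ℝ := √(K s / s)

/-- `√(s K(s))`. -/
noncomputable def soundWeight (K : ℝ → ℝ) (s : ℝ) : ℝ := √(s * K s)

/-- A primitive of `√(K(s)/s)`. -/
noncomputable def gradPotential (K : ℝ → ℝ) (s : ℝ) : ℝ := ∫ r in (1 : ℝ)..s, gradWeight K r

variable {K g : ℝ → ℝ}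

theorem contDiffOn_gradWeight (hK : ContDiffOn ℝ ∞ K (Ioi 0)) (hKpos : ∀ s > 0, 0 < K s) :
    ContDiffOn ℝ ∞ (gradWeight K) (Ioi 0) :=
  (hK.div contDiffOn_id fun _ hs => (ne_of_gt hs)).sqrt fun s hs =>
    (div_pos (hKpos s hs) hs).ne'

theorem contDiffOn_soundWeight (hK : ContDiffOn ℝ ∞ K (Ioi 0)) (hKpos : ∀ s > 0, 0 < K s) :
    ContDiffOn ℝ ∞ (soundWeight K) (Ioi 0) :=
  (contDiffOn_id.mul hK).sqrt fun s hs => (mul_pos hs (hKpos s hs)).ne'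

theorem gradWeight_pos (hKpos : ∀ s > 0, 0 < K s) {s : ℝ} (hs : 0 < s) : 0 < gradWeight K s :=
  Real.sqrt_pos.2 (div_pos (hKpos s hs) hs)

theorem soundWeight_pos (hKpos : ∀ s > 0, 0 < K s) {s : ℝ} (hs : 0 < s) : 0 < soundWeight K s :=
  Real.sqrt_pos.2 (mul_pos hs (hKpos s hs))

theorem gradWeight_sq (hKpos : ∀ s > 0, 0 < K s) {s : ℝ} (hs : 0 < s) :
    gradWeight K s ^ 2 = K s / s := Real.sq_sqrt (div_pos (hKpos s hs) hs).le

theorem soundWeight_eq {s : ℝ} (hs : 0 < s) :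
    soundWeight K s = s * gradWeight K s := by
  rw [soundWeight, gradWeight, show s * K s = s ^ 2 * (K s / s) by field_simp,
    Real.sqrt_mul (by positivity), Real.sqrt_sq hs.le]

theorem hasDerivAt_of_contDiffOn {f : ℝ → ℝ} (hf : ContDiffOn ℝ ∞ f (Ioi 0)) {s : ℝ} (hs : 0 < s) :
    HasDerivAt f (deriv f s) s :=
  ((hf.differentiableOn (by simp)).differentiableAt (Ioi_mem_nhds hs)).hasDerivAt

theorem hasDerivAt_gradPotential (hK : ContDiffOn ℝ ∞ K (Ioi 0)) (hKpos : ∀ s > 0, 0 < K s)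
    {s : ℝ} (hs : 0 < s) : HasDerivAt (gradPotential K) (gradWeight K s) s := by
  have hc := (contDiffOn_gradWeight hK hKpos).continuousOn
  have hsub : uIcc 1 s ⊆ Ioi (0 : ℝ) := fun x hx => by
    rcases mem_uIcc.1 hx with h | h
    · exact lt_of_lt_of_le one_pos h.1
    · exact lt_of_lt_of_le hs h.1
  exact intervalIntegral.integral_hasDerivAt_right ((hc.mono hsub).intervalIntegrable)
    (hc.stronglyMeasurableAtFilter isOpen_Ioi s hs) (hc.continuousAt (Ioi_mem_nhds hs))

theorem contDiffOn_gradPotential (hK : ContDiffOn ℝ ∞ K (Ioi 0)) (hKpos : ∀ s > 0, 0 < K s) :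
    ContDiffOn ℝ ∞ (gradPotential K) (Ioi 0) := by
  rw [contDiffOn_infty_iff_deriv_of_isOpen isOpen_Ioi]
  exact ⟨fun s hs => (hasDerivAt_gradPotential hK hKpos hs).differentiableAt.differentiableWithinAt,
    (contDiffOn_gradWeight hK hKpos).congr fun s hs => (hasDerivAt_gradPotential hK hKpos hs).deriv⟩

/-- Differentiate (√(K/s))² = K/s and use a = s√(K/s). In terms of w this yields a ∂ₓw + w²/2 = K
∂ₓ²ρ + ½K'(∂ₓρ)², so the capillary terms become first order in w. -/
theorem soundWeight_mul_deriv_gradWeight (hK : ContDiffOn ℝ ∞ K (Ioi 0))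
    (hKpos : ∀ s > 0, 0 < K s) {s : ℝ} (hs : 0 < s) :
    soundWeight K s * deriv (gradWeight K) s + 1 / 2 * gradWeight K s ^ 2 = 1 / 2 * deriv K s := by
  have h1 := (hasDerivAt_of_contDiffOn (contDiffOn_gradWeight hK hKpos) hs).pow 2
  have h2 : HasDerivAt (fun r => K r / r) ((deriv K s * s - K s * 1) / s ^ 2) s :=
    (hasDerivAt_of_contDiffOn hK hs).div (hasDerivAt_id s) hs.ne'
  have h3 := h1.unique (h2.congr_of_eventuallyEq
    (Filter.mem_of_superset (Ioi_mem_nhds hs) fun r hr => gradWeight_sq hKpos hr))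
  rw [gradWeight_sq hKpos hs, soundWeight_eq hs]
  simp only [Nat.cast_ofNat, Nat.add_one_sub_one, pow_one] at h3
  rw [eq_div_iff (by positivity)] at h3
  have h4 : s * gradWeight K s * deriv (gradWeight K) s = 1 / 2 * (deriv K s - K s / s) := by
    field_simp
    have : s * (2 * (gradWeight K s * s * deriv (gradWeight K) s)) = s * (s * deriv K s - K s) / s * 1 := by
      field_simp; linarith
    field_simp at this
    linarith
  rw [h4]; ring

/-- A density bounded away from vacuum and a velocity, with `k` controlled derivatives. -/
structure RegState (k : ℕ) (L : ℝ) (ρ v : ℝ → ℝ) : Prop where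
  density : Coef (k + 1) L ρ
  velocity : Coef k L v
  mem : ∀ x, ρ x ∈ Icc L⁻¹ L

theorem RegState.le {k j : ℕ} {L : ℝ} {ρ v : ℝ → ℝ} (h : RegState k L ρ v) (hj : j ≤ k) :
    RegState j L ρ v := ⟨h.density.le (by omega), h.velocity.le hj, h.mem⟩

/-- `w = √(K(ρ)/ρ) ∂ₓρ`. -/
noncomputable def wRep (K : ℝ → ℝ) (ρ : ℝ → ℝ) (x : ℝ) : ℝ := gradWeight K (ρ x) * deriv ρ x

/-- `z = v + i w`. -/
noncomputable def zRep (K : ℝ → ℝ) (ρ v : ℝ → ℝ) (x : ℝ) : ℂ := (v x : ℂ) + Complex.I * (wRep K ρ x : ℂ)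

theorem exists_coef_zRep (hK : ContDiffOn ℝ ∞ K (Ioi 0)) (hKpos : ∀ s > 0, 0 < K s) (k : ℕ)
    {L : ℝ} (hL : 0 < L) : ∃ C, ∀ ρ v : ℝ → ℝ, RegState k L ρ v →
      Coef k C (wRep K ρ) ∧ Coef k C (zRep K ρ v) := by
  obtain ⟨C₁, h₁⟩ := exists_coef_comp (contDiffOn_gradWeight hK hKpos) k hL
  have key : ∃ C, ∀ ρ v : ℝ → ℝ, RegState k L ρ v → Coef k C (wRep K ρ) :=
    ⟨_, fun ρ v h => (h₁ ρ h.density h.mem).mul h.density.2.2 (Nat.le_succ k) le_rfl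
      (Or.inl (Nat.succ_le_succ (Nat.zero_le k)))⟩
  obtain ⟨C, hC⟩ := key
  refine ⟨max C (L + ‖Complex.I‖ * C), fun ρ v h => ⟨(hC ρ v h).mono (le_max_left _ _), ?_⟩⟩
  exact (h.velocity.ofReal.add ((hC ρ v h).ofReal.const_mul Complex.I)).mono (le_max_right _ _)

/-- The flux of the `z` equation, `-i a(ρ) ∂ₓz - z² / 2 - g(ρ)`. -/
noncomputable def zFlux (K g : ℝ → ℝ) (ρ v : ℝ → ℝ) (x : ℝ) : ℂ :=
  -Complex.I * ((soundWeight K (ρ x) : ℂ) * deriv (zRep K ρ v) x) - zRep K ρ v x ^ 2 / 2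
    - (g (ρ x) : ℂ)

/-- The flux of the velocity equation. -/
noncomputable def vFlux (K g : ℝ → ℝ) (ρ v : ℝ → ℝ) (x : ℝ) : ℝ :=
  soundWeight K (ρ x) * deriv (wRep K ρ) x + wRep K ρ x ^ 2 / 2 - g (ρ x) - v x ^ 2 / 2

theorem exists_coef_vFlux (hK : ContDiffOn ℝ ∞ K (Ioi 0)) (hKpos : ∀ s > 0, 0 < K s)
    (hg : ContDiffOn ℝ ∞ g (Ioi 0)) (k : ℕ)
    {L : ℝ} (hL : 0 < L) : ∃ C, ∀ ρ v : ℝ → ℝ, RegState (k + 1) L ρ v →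
      Coef k C (vFlux K g ρ v) := by
  obtain ⟨C₁, h₁⟩ := exists_coef_comp (contDiffOn_soundWeight hK hKpos) (k + 1) hL
  obtain ⟨C₂, h₂⟩ := exists_coef_comp hg (k + 1) hL
  obtain ⟨C₃, h₃⟩ := exists_coef_zRep hK hKpos (k + 1) hL
  refine ⟨_, fun ρ v h => Coef.congr (((((h₁ ρ h.density h.mem).mul (h₃ ρ v h).1.2.2
    (k := k) (by omega) le_rfl (Or.inl (by omega))).add
    ((((h₃ ρ v h).1.mul (h₃ ρ v h).1 (k := k) (by omega) (by omega) (Or.inl (by omega)))).clm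
      ((1 / 2 : ℝ) • ContinuousLinearMap.id ℝ ℝ) (c := 1 / 2) (by norm_num)
      (fun x => by simp))).sub ((h₂ ρ h.density h.mem).le (by omega))).sub
    ((h.velocity.mul h.velocity (k := k) (by omega) (by omega) (Or.inl (by omega))).clm
      ((1 / 2 : ℝ) • ContinuousLinearMap.id ℝ ℝ) (c := 1 / 2) (by norm_num)
      (fun x => by simp))) fun x => ?_⟩
  simp only [vFlux, _root_.smul_apply, ContinuousLinearMap.id_apply, smul_eq_mul]
  ring

theorem vFlux_ae_eq (hK : ContDiffOn ℝ ∞ K (Ioi 0)) (hKpos : ∀ s > 0, 0 < K s)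
    {k : ℕ} {L : ℝ} (hL : 0 < L) {ρ v : ℝ → ℝ} (h : RegState (k + 1) L ρ v)
    {V : ℝ → ℝ × ℝ} (h1 : (fun y => (V y).1) =ᵐ[volume] ρ) (h2 : (fun y => (V y).2) =ᵐ[volume] v) :
    (fun x => J (deltaH K g V x)) =ᵐ[volume] fun x => (-(ρ x * v x), vFlux K g ρ v x) := by
  have hpos : ∀ x, 0 < ρ x := fun x => lt_of_lt_of_le (inv_pos.2 hL) (h.mem x).1
  have p1 := h.density.2.1
  have p2 := h.density.2.2.2.1
  have w1 := weakDeriv_ae (p1.hasWeakDeriv.congr h1.symm (ae_eq_refl _))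
  have w2 := weakDeriv_ae ((p1.hasWeakDeriv.comp p2.hasWeakDeriv).congr h1.symm (ae_eq_refl _))
  have pw : IsPrim (wRep K ρ) _ :=
    (p1.comp ((contDiffOn_gradWeight hK hKpos).of_le (by simp)) hpos).mul p2
  filter_upwards [h1, h2, w1, w2, pw.deriv_ae] with x e1 e2 e3 e4 e5
  have e6 := soundWeight_mul_deriv_gradWeight hK hKpos (hpos x)
  have e7 : soundWeight K (ρ x) * gradWeight K (ρ x) = K (ρ x) := by
    rw [soundWeight_eq (hpos x), mul_assoc, ← pow_two, gradWeight_sq hKpos (hpos x)]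
    field_simp [(hpos x).ne']
  simp only [J, deltaH, vFlux, e1, e2, e3, e4, e5, wRep, Prod.mk.injEq]
  refine ⟨trivial, ?_⟩
  linear_combination (-deriv ρ x ^ 2) * e6 - deriv (deriv ρ) x * e7

/-- The real and imaginary parts of the complex flux are the fluxes of v and w; this allows the two
equations to be treated as a single one. -/
theorem zFlux_eq {ρ v : ℝ → ℝ} {x : ℝ} (hw : DifferentiableAt ℝ (wRep K ρ) x)
    (hv : DifferentiableAt ℝ v x) : zFlux K g ρ v x = (vFlux K g ρ v x : ℂ)
      - Complex.I * ((wRep K ρ x * v x + soundWeight K (ρ x) * deriv v x : ℝ) : ℂ) := by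
  have hd : deriv (zRep K ρ v) x = ((deriv v x : ℝ) : ℂ)
      + Complex.I * ((deriv (wRep K ρ) x : ℝ) : ℂ) :=
    (hv.hasDerivAt.ofReal_comp.add (hw.hasDerivAt.ofReal_comp.const_mul Complex.I)).deriv
  simp only [zFlux, vFlux, hd, zRep]
  push_cast
  linear_combination (-(soundWeight K (ρ x) : ℂ) * ((deriv (wRep K ρ) x : ℝ) : ℂ) - (wRep K ρ x : ℂ) ^ 2 / 2) *
    Complex.I_sq

end State

/-! ### The equations as weak time derivatives -/

section Flow

variable {K g : ℝ → ℝ}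

theorem exists_taylor_Icc {f : ℝ → ℝ} (hf : ContDiffOn ℝ ∞ f (Ioi 0)) {L : ℝ} (hL : 0 < L) :
    ∃ C, 0 ≤ C ∧ ∀ s ∈ Icc L⁻¹ L, ∀ r ∈ Icc L⁻¹ L,
      |f r - f s - deriv f s * (r - s)| ≤ C * |r - s| ^ 2 := by
  obtain ⟨C, hC, h⟩ := exists_lipschitz_Icc (contDiffOn_deriv_Ioi hf) hL
  refine ⟨C, hC, fun s hs r hr => ?_⟩
  have hsub : uIcc s r ⊆ Icc L⁻¹ L := uIcc_subset_Icc hs hr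
  have hd : ∀ y ∈ uIcc s r, HasDerivWithinAt (fun y => f y - deriv f s * y)
      (deriv f y - deriv f s * 1) (uIcc s r) y := fun y hy =>
    ((hasDerivAt_of_contDiffOn hf (lt_of_lt_of_le (inv_pos.2 hL) (hsub hy).1)).sub
      ((hasDerivAt_id y).const_mul _)).hasDerivWithinAt
  have := (convex_uIcc s r).norm_image_sub_le_of_norm_hasDerivWithin_le (C := C * |r - s|) hd
    (fun y hy => by
      rw [mul_one]
      refine (h y (hsub hy) s hs).trans (mul_le_mul_of_nonneg_left ?_ hC)
      exact abs_sub_left_of_mem_uIcc hy) left_mem_uIcc right_mem_uIcc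
  rw [Real.norm_eq_abs, Real.norm_eq_abs] at this
  calc _ = |f r - deriv f s * r - (f s - deriv f s * s)| := by congr 1; ring
    _ ≤ _ := this.trans (by rw [pow_two, mul_assoc])

/-- The chain rule for weak time derivatives. -/
theorem HasWeakTimeDeriv.comp {I : Set ℝ} (hI : I.OrdConnected) {ρ r : ℝ → ℝ → ℝ} {B L : ℝ}
    (hL : 0 < L) (h : ∀ s ∈ I, HasWeakTimeDeriv I s ρ (r s)) (hρ : ∀ t ∈ I, Continuous (ρ t))
    (hr : ∀ t ∈ I, LocallyIntegrable (r t)) (hB : ∀ s ∈ I, ∀ x, |r s x| ≤ B)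
    (hmem : ∀ t ∈ I, ∀ x, ρ t x ∈ Icc L⁻¹ L) {f : ℝ → ℝ} (hf : ContDiffOn ℝ ∞ f (Ioi 0))
    {s : ℝ} (hs : s ∈ I) :
    HasWeakTimeDeriv I s (fun t x => f (ρ t x)) (fun x => deriv f (ρ s x) * r s x) := by
  intro φ h1 h2
  have hB0 : 0 ≤ B := (abs_nonneg _).trans (hB s hs 0)
  have hpos : ∀ t ∈ I, ∀ x, 0 < ρ t x := fun t ht x =>
    lt_of_lt_of_le (inv_pos.2 hL) (hmem t ht x).1
  have hlip : ∀ t ∈ I, ∀ x, |ρ t x - ρ s x| ≤ B * |t - s| := fun t ht x =>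
    abs_sub_le_of_hasWeakTimeDeriv hI h hρ hB hs ht x
  have cf : ∀ {f : ℝ → ℝ}, ContDiffOn ℝ ∞ f (Ioi 0) → ∀ t ∈ I, Continuous fun x => f (ρ t x) :=
    fun hf t ht => hf.continuousOn.comp_continuous (hρ t ht) (hpos t ht)
  have cf' := cf (contDiffOn_deriv_Ioi hf) s hs
  have cψ : Continuous fun x => φ x * deriv f (ρ s x) := h1.continuous.mul cf'
  have sψ : HasCompactSupport fun x => φ x * deriv f (ρ s x) := h2.mul_right
  have hψ : MemLp (fun x => ((φ x * deriv f (ρ s x) : ℝ) : ℂ)) 1 volume :=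
    (Complex.continuous_ofReal.comp cψ).memLp_of_hasCompactSupport
      (sψ.comp_left (g := fun x : ℝ => (x : ℂ)) (by simp))
  -- The linear part of the expansion. The weight φ f'(ρ(s)) need not be smooth, but ρ is Lipschitz
  -- in time with values in L^∞ and may be tested against any integrable function.
  have lin := HasWeakTimeDeriv.hasDerivWithinAt_of_approx (p := 1) (I := I) (s := s)
    (u := fun t x => (ρ t x : ℂ)) (w := fun x => (r s x : ℂ)) (B := B)
    ((h s hs).clm hs Complex.ofRealCLM (fun t ht => (hρ t ht).locallyIntegrable) (hr s hs)) hs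
    (fun t ht => (Complex.continuous_ofReal.comp (hρ t ht)).locallyIntegrable)
    (fun x => by
      obtain ⟨S, hS, hi⟩ := hr s hs x
      exact ⟨S, hS, hi.ofReal⟩) (by simp) le_rfl hB0
    (fun t ht ψ hψ => by
      have hb : ∀ᵐ x, ‖(ρ t x : ℂ) - (ρ s x : ℂ)‖ ≤ B * |t - s| := Eventually.of_forall fun x => by
        rw [← Complex.ofReal_sub, Complex.norm_real]; exact hlip t ht x
      have hi := memLp_one_iff_integrable.1 hψ
      refine ⟨hi.mul_bdd (c := B * |t - s|) (by
        exact ((Complex.continuous_ofReal.comp (hρ t ht)).sub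
          (Complex.continuous_ofReal.comp (hρ s hs))).aestronglyMeasurable) hb, ?_⟩
      rw [lpNorm_one_eq_integral_norm hψ.1, ← integral_mul_const]
      refine norm_integral_le_of_norm_le (hi.norm.mul_const _) (hb.mono fun x hx => ?_)
      rw [norm_mul]; exact mul_le_mul_of_nonneg_left hx (norm_nonneg _))
    (fun ψ hψ => by
      have hb : ∀ᵐ x, ‖(r s x : ℂ)‖ ≤ B := Eventually.of_forall fun x => by
        rw [Complex.norm_real]; exact hB s hs x
      have hi := memLp_one_iff_integrable.1 hψ
      refine ⟨hi.mul_bdd (c := B) (Complex.continuous_ofReal.comp_aestronglyMeasurable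
        (hr s hs).aestronglyMeasurable) hb, ?_⟩
      rw [lpNorm_one_eq_integral_norm hψ.1, ← integral_mul_const]
      refine norm_integral_le_of_norm_le (hi.norm.mul_const _) (hb.mono fun x hx => ?_)
      rw [norm_mul]; exact mul_le_mul_of_nonneg_left hx (norm_nonneg _)) hψ
  have lin2 : HasDerivWithinAt (fun t => ∫ x, (φ x * deriv f (ρ s x)) * (ρ t x - ρ s x))
      (∫ x, φ x • (deriv f (ρ s x) * r s x)) I s := by
    have := Complex.reCLM.hasFDerivAt.comp_hasDerivWithinAt s lin
    have e : (∫ x, φ x • (deriv f (ρ s x) * r s x))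
        = Complex.reCLM (∫ x, ((φ x * deriv f (ρ s x) : ℝ) : ℂ) * (r s x : ℂ)) := by
      simp only [← Complex.ofReal_mul, integral_complex_ofReal, Complex.reCLM_apply,
        Complex.ofReal_re, smul_eq_mul, mul_assoc]
    rw [e]
    have e2 : ∀ t, ∫ x, (φ x * deriv f (ρ s x)) * (ρ t x - ρ s x) = Complex.reCLM
        (∫ x, ((φ x * deriv f (ρ s x) : ℝ) : ℂ) * ((ρ t x : ℂ) - (ρ s x : ℂ))) := fun t => by
      simp only [← Complex.ofReal_mul, ← Complex.ofReal_sub, integral_complex_ofReal,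
        Complex.reCLM_apply, Complex.ofReal_re]
    exact this.congr (fun t _ => e2 t) (e2 s)
  obtain ⟨C, hC, htay⟩ := exists_taylor_Icc hf hL
  have hφi : Integrable φ := h1.continuous.integrable_of_hasCompactSupport h2
  -- The Taylor remainder is quadratic in ρ(t) - ρ(s), hence of order |t - s|².
  have rem : HasDerivWithinAt
      (fun t => ∫ x, φ x * (f (ρ t x) - f (ρ s x) - deriv f (ρ s x) * (ρ t x - ρ s x))) 0 I s := by
    rw [hasDerivWithinAt_iff_isLittleO]
    have z : ∫ x, φ x * (f (ρ s x) - f (ρ s x) - deriv f (ρ s x) * (ρ s x - ρ s x)) = 0 := by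
      simp
    simp only [z, sub_zero, smul_zero]
    have hO : (fun t => ∫ x, φ x * (f (ρ t x) - f (ρ s x) - deriv f (ρ s x) * (ρ t x - ρ s x)))
        =O[𝓝[I] s] fun t => |t - s| ^ 2 := by
      refine Asymptotics.IsBigO.of_bound ((∫ x, |φ x|) * (C * B ^ 2)) ?_
      filter_upwards [self_mem_nhdsWithin] with t ht
      rw [norm_pow, Real.norm_eq_abs |t - s|, abs_abs]
      calc _ ≤ ∫ x, |φ x| * (C * (B * |t - s|) ^ 2) := by
            refine norm_integral_le_of_norm_le (hφi.abs.mul_const _)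
              (Eventually.of_forall fun x => ?_)
            rw [norm_mul]
            refine mul_le_mul_of_nonneg_left ?_ (abs_nonneg _)
            exact (htay _ (hmem s hs x) _ (hmem t ht x)).trans (mul_le_mul_of_nonneg_left
              (pow_le_pow_left₀ (abs_nonneg _) (hlip t ht x) 2) hC)
        _ = _ := by rw [integral_mul_const]; ring
    refine hO.trans_isLittleO ?_
    have : (fun t => |t - s| ^ 2) =o[𝓝 s] fun t => t - s := by
      have := (Asymptotics.isLittleO_pow_sub_sub s (one_lt_two (α := ℕ)))
      simpa using this
    exact this.mono nhdsWithin_le_nhds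
  have tot := (lin2.add rem).add_const (∫ x, φ x • f (ρ s x))
  rw [add_zero] at tot
  have e : ∀ t ∈ I, ∫ x, φ x • f (ρ t x) = (∫ x, (φ x * deriv f (ρ s x)) * (ρ t x - ρ s x))
      + (∫ x, φ x * (f (ρ t x) - f (ρ s x) - deriv f (ρ s x) * (ρ t x - ρ s x)))
      + ∫ x, φ x • f (ρ s x) := by
    intro t ht
    have i1 : Integrable fun x => (φ x * deriv f (ρ s x)) * (ρ t x - ρ s x) :=
      (cψ.mul ((hρ t ht).sub (hρ s hs))).integrable_of_hasCompactSupport sψ.mul_right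
    have i2 : Integrable fun x =>
        φ x * (f (ρ t x) - f (ρ s x) - deriv f (ρ s x) * (ρ t x - ρ s x)) :=
      (h1.continuous.mul (((cf hf t ht).sub (cf hf s hs)).sub
        (cf'.mul ((hρ t ht).sub (hρ s hs))))).integrable_of_hasCompactSupport h2.mul_right
    have i3 : Integrable fun x => φ x • f (ρ s x) :=
      (cf hf s hs).locallyIntegrable.integrable_test h1 h2
    have i12 : Integrable fun x => (φ x * deriv f (ρ s x)) * (ρ t x - ρ s x)
        + φ x * (f (ρ t x) - f (ρ s x) - deriv f (ρ s x) * (ρ t x - ρ s x)) := i1.add i2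
    rw [← integral_add i1 i2, ← integral_add i12 i3]
    refine integral_congr_ae (Eventually.of_forall fun x => ?_)
    simp only [smul_eq_mul]; ring
  exact tot.congr e (e s hs)

/-- The regularity of the states makes both fluxes primitives of locally integrable functions. The
space derivative can then be taken off the test function and the system splits into components. -/
theorem IsSolution.hasWeakTimeDeriv (hK : ContDiffOn ℝ ∞ K (Ioi 0)) (hKpos : ∀ s > 0, 0 < K s)
    (hg : ContDiffOn ℝ ∞ g (Ioi 0)) {k : ℕ} {L : ℝ} (hL : 0 < L) {I : Set ℝ}
    {V f : ℝ → ℝ → ℝ × ℝ} (h : IsSolution K g f I V) {ρ v : ℝ → ℝ → ℝ} {f₁ f₂ : ℝ → ℝ}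
    (h1 : ∀ t ∈ I, (fun y => (V t y).1) =ᵐ[volume] ρ t)
    (h2 : ∀ t ∈ I, (fun y => (V t y).2) =ᵐ[volume] v t) (hreg : ∀ t ∈ I, RegState (k + 2) L (ρ t) (v t))
    {t : ℝ} (ht : t ∈ I) (h3 : (fun y => (f t y).1) =ᵐ[volume] f₁)
    (h4 : (fun y => (f t y).2) =ᵐ[volume] f₂) (h5 : LocallyIntegrable f₁)
    (h6 : LocallyIntegrable f₂) :
    HasWeakTimeDeriv I t ρ (fun x => -deriv (fun y => ρ t y * v t y) x + f₁ x) ∧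
      HasWeakTimeDeriv I t v (fun x => deriv (vFlux K g (ρ t) (v t)) x + f₂ x) := by
  obtain ⟨C, hC⟩ := exists_coef_vFlux hK hKpos hg (k + 1) hL
  have p1 : IsPrim (fun y => ρ t y * v t y) (deriv fun y => ρ t y * v t y) :=
    ((hreg t ht).density.2.1.mul (hreg t ht).velocity.2.1).deriv
  have p2 : IsPrim (vFlux K g (ρ t) (v t)) (deriv (vFlux K g (ρ t) (v t))) :=
    (hC _ _ (hreg t ht)).2.1
  have pair : ∀ {φ : ℝ → ℝ} {W : ℝ → ℝ × ℝ} {p q : ℝ → ℝ}, ContDiff ℝ ∞ φ → HasCompactSupport φ →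
      (fun y => (W y).1) =ᵐ[volume] p → (fun y => (W y).2) =ᵐ[volume] q → LocallyIntegrable p →
      LocallyIntegrable q → ∫ x, φ x • W x = (∫ x, φ x • p x, ∫ x, φ x • q x) := by
    intro φ W p q a b e1 e2 i1 i2
    have hi : Integrable fun x => φ x • (p x, q x) :=
      (i1.integrable_test a b).prodMk (i2.integrable_test a b)
    rw [show ∫ x, φ x • W x = ∫ x, φ x • (p x, q x) from integral_congr_ae (by
      filter_upwards [e1, e2] with x y1 y2
      rw [← y1, ← y2])]
    exact Prod.ext (fst_integral hi) (snd_integral hi)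
  have main : ∀ φ : ℝ → ℝ, ContDiff ℝ ∞ φ → HasCompactSupport φ →
      HasDerivWithinAt (fun s => ((∫ x, φ x • ρ s x, ∫ x, φ x • v s x) : ℝ × ℝ))
        (∫ x, φ x • (-deriv (fun y => ρ t y * v t y) x + f₁ x),
          ∫ x, φ x • (deriv (vFlux K g (ρ t) (v t)) x + f₂ x)) I t := by
    intro φ a b
    have hd := h φ a b t ht
    have eV : ∀ s ∈ I, (∫ x, φ x • ρ s x, ∫ x, φ x • v s x) = ∫ x, φ x • V s x := fun s hs =>
      (pair a b (h1 s hs) (h2 s hs) (hreg s hs).density.2.1.locallyIntegrable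
        (hreg s hs).velocity.2.1.locallyIntegrable).symm
    have hJ := vFlux_ae_eq (g := g) hK hKpos hL (k := k + 1) (hreg t ht) (h1 t ht) (h2 t ht)
    have a' : ContDiff ℝ ∞ (deriv φ) := by simpa using a.iteratedDeriv_infty 1
    have eJ := pair a' b.deriv (hJ.mono fun x hx => congrArg Prod.fst hx)
      (hJ.mono fun x hx => congrArg Prod.snd hx) p1.neg.locallyIntegrable p2.locallyIntegrable
    have ef := pair a b h3 h4 h5 h6
    rw [eJ, ef] at hd
    have q1 := p1.neg.hasWeakDeriv.2.2 φ a b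
    have q2 := p2.hasWeakDeriv.2.2 φ a b
    simp only [iteratedDeriv_one, pow_one, neg_smul, one_smul] at q1 q2
    have i1 := p1.neg.hasWeakDeriv.2.1.integrable_test a b
    have i2 := p2.hasWeakDeriv.2.1.integrable_test a b
    have e3 : ((∫ x, φ x • (-deriv (fun y => ρ t y * v t y) x + f₁ x),
        ∫ x, φ x • (deriv (vFlux K g (ρ t) (v t)) x + f₂ x)) : ℝ × ℝ)
        = -((∫ x, deriv φ x • -(ρ t x * v t x), ∫ x, deriv φ x • vFlux K g (ρ t) (v t) x) : ℝ × ℝ)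
          + (∫ x, φ x • f₁ x, ∫ x, φ x • f₂ x) := by
      rw [q1, q2]
      simp only [smul_add, Prod.neg_mk, neg_neg, Prod.mk_add_mk]
      rw [integral_add i1 (h5.integrable_test a b), integral_add i2 (h6.integrable_test a b)]
    rw [e3]
    exact hd.congr eV (eV t ht)
  exact ⟨fun φ a b => (main φ a b).fst, fun φ a b => (main φ a b).snd⟩

/-- A family of states with a source, which solves the equations in the sense of weak time
derivatives. -/
structure IsFlow (K g : ℝ → ℝ) (k j : ℕ) (L φ : ℝ) (I : Set ℝ) (ρ v f₁ f₂ : ℝ → ℝ → ℝ) :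
    Prop where
  reg : ∀ t ∈ I, RegState k L (ρ t) (v t)
  src₁ : ∀ t ∈ I, Sob (j + 1) φ (f₁ t)
  src₂ : ∀ t ∈ I, Sob j φ (f₂ t)
  mass : ∀ t ∈ I, HasWeakTimeDeriv I t ρ (fun x => -deriv (fun y => ρ t y * v t y) x + f₁ t x)
  momentum : ∀ t ∈ I, HasWeakTimeDeriv I t v (fun x => deriv (vFlux K g (ρ t) (v t)) x + f₂ t x)

/-- The source of the `z` equation. -/
noncomputable def zSource (K : ℝ → ℝ) (ρ f₁ f₂ : ℝ → ℝ) (x : ℝ) : ℂ :=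
  (f₂ x : ℂ) + Complex.I * ((deriv (fun y => gradWeight K (ρ y) * f₁ y) x : ℝ) : ℂ)

theorem exists_flux_density_bound (k : ℕ) (L : ℝ) : ∃ C, ∀ ρ v : ℝ → ℝ, RegState (k + 2) L ρ v →
    Coef (k + 1) C (deriv fun y => ρ y * v y) :=
  ⟨_, fun ρ v h => (h.density.mul h.velocity (k := k + 2) (by omega) le_rfl
    (Or.inl (by omega))).2.2⟩

theorem IsFlow.abs_density_sub_le {k j : ℕ} {L φ : ℝ} {I : Set ℝ} {ρ v f₁ f₂ : ℝ → ℝ → ℝ}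
    (h : IsFlow K g (k + 2) j L φ I ρ v f₁ f₂) (hI : I.OrdConnected) {C : ℝ}
    (hC : ∀ ρ v : ℝ → ℝ, RegState (k + 2) L ρ v → Coef (k + 1) C (deriv fun y => ρ y * v y))
    {s t : ℝ} (hs : s ∈ I) (ht : t ∈ I) (x : ℝ) :
    |ρ t x - ρ s x| ≤ (C + 2 * φ) * |t - s| := by
  refine abs_sub_le_of_hasWeakTimeDeriv hI h.mass (fun r hr => (h.reg r hr).density.2.1.continuous)
    (fun r hr y => ?_) hs ht x
  refine (abs_add_le _ _).trans (add_le_add ?_ ((h.src₁ r hr).norm_le y))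
  rw [abs_neg]; exact (hC _ _ (h.reg r hr)).1 y

/-- Since w = ∂ₓR(ρ) with R a primitive of √(K/ρ), the equation for w is the space derivative of the
equation for R(ρ). The chain rule in time is thus needed for the density only, never for ∂ₓρ. -/
theorem IsFlow.hasWeakTimeDeriv_zRep (hK : ContDiffOn ℝ ∞ K (Ioi 0)) (hKpos : ∀ s > 0, 0 < K s)
    (hg : ContDiffOn ℝ ∞ g (Ioi 0)) {k j : ℕ} {L φ : ℝ} (hL : 0 < L) {I : Set ℝ}
    (hI : I.OrdConnected) {ρ v f₁ f₂ : ℝ → ℝ → ℝ} (h : IsFlow K g (k + 2) j L φ I ρ v f₁ f₂)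
    {t : ℝ} (ht : t ∈ I) :
    HasWeakTimeDeriv I t (fun s => zRep K (ρ s) (v s))
      (fun x => deriv (zFlux K g (ρ t) (v t)) x + zSource K (ρ t) (f₁ t) (f₂ t) x) := by
  obtain ⟨C, hC⟩ := exists_flux_density_bound k L
  obtain ⟨Cv, hCv⟩ := exists_coef_vFlux hK hKpos hg (k + 1) hL
  obtain ⟨Cz, hCz⟩ := exists_coef_zRep hK hKpos (k + 2) hL
  have hpos : ∀ s ∈ I, ∀ x, 0 < ρ s x := fun s hs x =>
    lt_of_lt_of_le (inv_pos.2 hL) ((h.reg s hs).mem x).1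
  have cR := contDiffOn_gradPotential hK hKpos
  have lr : ∀ s ∈ I, LocallyIntegrable fun x => -deriv (fun y => ρ s y * v s y) x + f₁ s x :=
    fun s hs => ((hC _ _ (h.reg s hs)).2.1.locallyIntegrable.neg).add (h.src₁ s hs).locallyIntegrable
  have hR := HasWeakTimeDeriv.comp hI hL (B := C + 2 * φ) h.mass
    (fun s hs => (h.reg s hs).density.2.1.continuous) lr (fun s hs y =>
      (abs_add_le _ _).trans (add_le_add (by rw [abs_neg]; exact (hC _ _ (h.reg s hs)).1 y)
        ((h.src₁ s hs).norm_le y))) (fun s hs => (h.reg s hs).mem) cR ht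
  have eR : ∀ s ∈ I, ∀ x, deriv (gradPotential K) (ρ s x) = gradWeight K (ρ s x) := fun s hs x =>
    (hasDerivAt_gradPotential hK hKpos (hpos s hs x)).deriv
  have pw : ∀ s ∈ I, IsPrim (fun x => gradPotential K (ρ s x)) (wRep K (ρ s)) := fun s hs => by
    have := (h.reg s hs).density.2.1.comp (cR.of_le (by simp)) (hpos s hs)
    simp only [eR s hs] at this
    exact this
  have hreg := h.reg t ht
  have pρ := hreg.density.2.1
  have pρ' := hreg.density.2.2.2.1
  have pv := hreg.velocity.2.1
  have pv' := hreg.velocity.2.2.2.1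
  have cρ' : Continuous (deriv (ρ t)) := pρ'.continuous
  have cv' : Continuous (deriv (v t)) := pv'.continuous
  have ps : IsPrim (fun x => soundWeight K (ρ t x)) _ :=
    pρ.comp ((contDiffOn_soundWeight hK hKpos).of_le (by simp)) (hpos t ht)
  have pgw : IsPrim (fun x => gradWeight K (ρ t x)) _ :=
    pρ.comp ((contDiffOn_gradWeight hK hKpos).of_le (by simp)) (hpos t ht)
  have pwr : IsPrim (wRep K (ρ t)) (deriv (wRep K (ρ t))) := (hCz _ _ hreg).1.2.1
  have pA : IsPrim (fun x => wRep K (ρ t) x * v t x + soundWeight K (ρ t x) * deriv (v t) x)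
      (deriv fun x => wRep K (ρ t) x * v t x + soundWeight K (ρ t x) * deriv (v t) x) :=
    ((pwr.mul pv).add (ps.mul pv')).deriv
  have pf : IsPrim (fun x => gradWeight K (ρ t x) * f₁ t x)
      (deriv fun x => gradWeight K (ρ t x) * f₁ t x) := (pgw.mul (h.src₁ t ht).2.1).deriv
  -- Here a = ρ√(K/ρ) identifies the flux of w as wv + a ∂ₓv.
  have erhs : ∀ x, deriv (gradPotential K) (ρ t x) *
        (-deriv (fun y => ρ t y * v t y) x + f₁ t x)
      = -(wRep K (ρ t) x * v t x + soundWeight K (ρ t x) * deriv (v t) x)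
        + gradWeight K (ρ t x) * f₁ t x := by
    intro x
    have d1 := ((pρ.hasDerivAt cρ' x).mul (pv.hasDerivAt cv' x)).deriv
    rw [eR t ht, show deriv (fun y => ρ t y * v t y) x = _ from d1,
      soundWeight_eq (hpos t ht x), wRep]
    ring
  have hw : HasWeakTimeDeriv I t (fun s => wRep K (ρ s))
      (fun x => -deriv (fun x => wRep K (ρ t) x * v t x + soundWeight K (ρ t x) * deriv (v t) x) x
        + deriv (fun x => gradWeight K (ρ t x) * f₁ t x) x) := by
    refine hR.weakDeriv ht (fun s hs => (pw s hs).hasWeakDeriv) ?_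
    rw [show (fun x => deriv (gradPotential K) (ρ t x) *
        (-deriv (fun y => ρ t y * v t y) x + f₁ t x)) = _ from funext erhs]
    exact (pA.neg.add pf).hasWeakDeriv
  have pF : IsPrim (vFlux K g (ρ t) (v t)) (deriv (vFlux K g (ρ t) (v t))) := (hCv _ _ hreg).2.1
  have l1 : LocallyIntegrable fun x => deriv (vFlux K g (ρ t) (v t)) x + f₂ t x :=
    pF.1.add (h.src₂ t ht).locallyIntegrable
  have l2 : LocallyIntegrable fun x =>
      -deriv (fun x => wRep K (ρ t) x * v t x + soundWeight K (ρ t x) * deriv (v t) x) x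
        + deriv (fun x => gradWeight K (ρ t x) * f₁ t x) x := pA.1.neg.add pf.1
  have lv : ∀ s ∈ I, LocallyIntegrable (v s) := fun s hs =>
    (h.reg s hs).velocity.2.1.locallyIntegrable
  have lw : ∀ s ∈ I, LocallyIntegrable (wRep K (ρ s)) := fun s hs =>
    (hCz _ _ (h.reg s hs)).1.2.1.locallyIntegrable
  have cl : ∀ {u : ℝ → ℝ} (T : ℝ →L[ℝ] ℂ), LocallyIntegrable u →
      LocallyIntegrable fun x => T (u x) := fun T hv x => by
    obtain ⟨S, hS, hi⟩ := hv x
    exact ⟨S, hS, T.integrable_comp hi⟩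
  let T : ℝ →L[ℝ] ℂ := Complex.I • Complex.ofRealCLM
  have tot := ((h.momentum t ht).clm ht Complex.ofRealCLM lv l1).add (hw.clm ht T lw l2) ht
    (fun s hs => cl Complex.ofRealCLM (lv s hs)) (cl Complex.ofRealCLM l1)
    (fun s hs => cl T (lw s hs)) (cl T l2)
  refine tot.congr ht (fun s hs => Eventually.of_forall fun x => ?_) ?_
  · simp [T, zRep]
  · have pz : IsPrim (zFlux K g (ρ t) (v t)) fun x =>
        ((deriv (vFlux K g (ρ t) (v t)) x : ℝ) : ℂ) - Complex.I * ((deriv (fun x =>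
          wRep K (ρ t) x * v t x + soundWeight K (ρ t x) * deriv (v t) x) x : ℝ) : ℂ) := by
      have hz : ∀ x, zFlux K g (ρ t) (v t) x = _ := fun x => zFlux_eq (g := g)
        ((pwr.hasDerivAt (hCz _ _ hreg).1.2.2.2.1.continuous x).differentiableAt)
        ((pv.hasDerivAt cv' x).differentiableAt)
      rw [show zFlux K g (ρ t) (v t) = _ from funext hz]
      exact pF.ofReal.sub (pA.ofReal.const_mul Complex.I)
    filter_upwards [pz.deriv_ae] with x hx
    rw [hx]
    simp only [T, zSource, Complex.ofRealCLM_apply, _root_.smul_apply, smul_eq_mul]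
    push_cast
    ring

end Flow

/-! ### Two states at a fixed time -/

section Pair

variable {K g : ℝ → ℝ}

/-- The difference of the `z` variables. -/
noncomputable def dz (K : ℝ → ℝ) (ρ v ρa va : ℝ → ℝ) (x : ℝ) : ℂ := zRep K ρ v x - zRep K ρa va x

/-- A bound in terms of the full Sobolev size of the difference of the states. It supplies
membership of Δz in H²ⁿ, which the sharper control by N presupposes. -/
theorem exists_sob_dz (hK : ContDiffOn ℝ ∞ K (Ioi 0)) (hKpos : ∀ s > 0, 0 < K s) (m : ℕ) {L : ℝ}
    (hL : 0 < L) : ∃ C, 0 ≤ C ∧ ∀ (A : ℝ) (ρ v ρa va : ℝ → ℝ), RegState (m + 2) L ρ v →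
      RegState (m + 4) L ρa va → Sob (m + 3) A (fun x => ρ x - ρa x) →
      Sob (m + 2) A (fun x => v x - va x) → Sob (m + 2) (C * A) (dz K ρ v ρa va) := by
  obtain ⟨C₁, h₁⟩ := exists_coef_comp (contDiffOn_gradWeight hK hKpos) (m + 2) hL
  obtain ⟨C₂, h0, h₂⟩ := exists_sob_comp_sub (contDiffOn_gradWeight hK hKpos) (m + 3) hL
  refine ⟨max 0 (1 + 1 * (3 * 2 ^ (m + 2) * (L * C₂) + 3 * 2 ^ (m + 2) * C₁)), le_max_left _ _,
    fun A ρ v ρa va h ha hρ hv => ?_⟩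
  have i1 := h₂ ρ ρa A h.density (ha.density.le (by omega)) h.density.2.1.continuous
    ha.density.2.1.continuous h.mem ha.mem hρ
  have i2 := i1.mul_coef ha.density.2.2 (k := m + 2) (by omega) (by omega) (Or.inl (by omega))
  have i3 := hρ.2.2.mul_coef (h₁ ρ h.density h.mem) (k := m + 2) le_rfl (by omega)
    (Or.inl (by omega))
  have i4 := hv.ofReal.add (((i2.add i3).ofReal).const_mul Complex.I)
  have hA := hρ.nonneg
  refine (i4.mono (le_trans (le_of_eq ?_) (mul_le_mul_of_nonneg_right (le_max_right _ _) hA))).congr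
    fun x => ?_
  · rw [Complex.norm_I]; ring
  · have d : deriv (fun x => ρ x - ρa x) x = deriv ρ x - deriv ρa x :=
      ((h.density.2.1.hasDerivAt h.density.2.2.2.1.continuous x).sub
        (ha.density.2.1.hasDerivAt ha.density.2.2.2.1.continuous x)).deriv
    simp only [dz, zRep, wRep, d]
    push_cast
    ring

/-- From Im Δz = √(K/ρ) ∂ₓΔρ + Δ(√(K/ρ)) ∂ₓρᵃ one solves for ∂ₓΔρ. The last term involves Δρ without
further derivatives, so each induction step gains one. -/
theorem exists_sob_density (hK : ContDiffOn ℝ ∞ K (Ioi 0)) (hKpos : ∀ s > 0, 0 < K s) (m : ℕ)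
    {L : ℝ} (hL : 0 < L) : ∀ k ≤ m + 3, ∃ C, 0 ≤ C ∧ ∀ (η : ℝ) (ρ v ρa va : ℝ → ℝ),
      RegState (m + 2) L ρ v → RegState (m + 4) L ρa va → L2Bound η (fun x => ρ x - ρa x) →
      Sob (m + 2) η (dz K ρ v ρa va) → Sob k (C * η) (fun x => ρ x - ρa x) := by
  intro k
  induction k with
  | zero => exact fun _ => ⟨1, zero_le_one, fun η ρ v ρa va _ _ h _ => by rw [one_mul]; exact h⟩
  | succ k ih =>
    intro hk
    obtain ⟨C, hC, ih⟩ := ih (by omega)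
    have cinv : ContDiffOn ℝ ∞ (fun s => (gradWeight K s)⁻¹) (Ioi 0) :=
      (contDiffOn_gradWeight hK hKpos).inv fun s hs => (gradWeight_pos hKpos hs).ne'
    obtain ⟨C₁, h₁⟩ := exists_coef_comp cinv (m + 2) hL
    obtain ⟨C₂, h0, h₂⟩ := exists_sob_comp_sub (contDiffOn_gradWeight hK hKpos) k hL
    refine ⟨max 1 (3 * 2 ^ k * (C₁ * (1 + 3 * 2 ^ k * (L * (C₂ * C))))),
      zero_le_one.trans (le_max_left _ _), fun η ρ v ρa va h ha hρ hz => ?_⟩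
    have hη := hρ.nonneg
    have i0 := ih η ρ v ρa va h ha hρ hz
    have i1 := h₂ ρ ρa _ (h.density.le (by omega)) (ha.density.le (by omega))
      h.density.2.1.continuous ha.density.2.1.continuous h.mem ha.mem i0
    have i2 := i1.mul_coef ha.density.2.2 (k := k) le_rfl (by omega) (Or.inr (by omega))
    have i3 := (hz.im.le (k := k) (by omega)).sub i2
    have i4 := i3.mul_coef (h₁ ρ h.density h.mem) (k := k) le_rfl (by omega) (Or.inr (by omega))
    refine Sob.of_isPrim (hρ.mono (le_mul_of_one_le_left hη (le_max_left _ _)))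
      (h.density.2.1.sub ha.density.2.1)
      ((i4.mono ((le_of_eq ?_).trans (mul_le_mul_of_nonneg_right (le_max_right _ _) hη))).congr
        fun x => ?_)
    · ring
    · have := (gradWeight_pos hKpos (lt_of_lt_of_le (inv_pos.2 hL) (h.mem x).1)).ne'
      have e : (dz K ρ v ρa va x).im = wRep K ρ x - wRep K ρa x := by simp [dz, zRep]
      simp only [e, wRep]
      field_simp
      ring

/-- The Sobolev norms of two close states. -/
structure RegPair (K : ℝ → ℝ) (m : ℕ) (L η : ℝ) (ρ v ρa va : ℝ → ℝ) : Prop where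
  fst : RegState (m + 2) L ρ v
  snd : RegState (m + 4) L ρa va
  density : Sob (m + 3) η (fun x => ρ x - ρa x)
  z : Sob (m + 2) η (dz K ρ v ρa va)

/-- The right-hand side of the equation for the difference of the `z` variables. -/
noncomputable def dzRhs (K g : ℝ → ℝ) (ρ v ρa va f₁ f₂ : ℝ → ℝ) (x : ℝ) : ℂ :=
  deriv (zFlux K g ρ v) x - (deriv (zFlux K g ρa va) x + zSource K ρa f₁ f₂ x)

/-- The complexified sound speed. -/
noncomputable def cSound (K : ℝ → ℝ) (ρ : ℝ → ℝ) (x : ℝ) : ℂ := (soundWeight K (ρ x) : ℂ)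

theorem exists_coef_cSound (hK : ContDiffOn ℝ ∞ K (Ioi 0)) (hKpos : ∀ s > 0, 0 < K s) (k : ℕ)
    {L : ℝ} (hL : 0 < L) : ∃ C, ∀ ρ v : ℝ → ℝ, RegState k L ρ v → Coef (k + 1) C (cSound K ρ) := by
  obtain ⟨C₁, h₁⟩ := exists_coef_comp (contDiffOn_soundWeight hK hKpos) k hL
  exact ⟨C₁, fun ρ v h => (h₁ ρ h.density h.mem).ofReal⟩

/-- The principal coefficients are those of the exact solution, and everything else is bounded
linearly. The worst error is ∂ₓ(Δa ∂ₓzᵃ), whose control in H²ⁿ uses 2n + 2 derivatives of zᵃ. -/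
theorem exists_dzRhs (hK : ContDiffOn ℝ ∞ K (Ioi 0)) (hKpos : ∀ s > 0, 0 < K s)
    (hg : ContDiffOn ℝ ∞ g (Ioi 0)) (m : ℕ) {L : ℝ} (hL : 0 < L) :
    ∃ C, 0 ≤ C ∧ ∀ (η φ : ℝ) (ρ v ρa va f₁ f₂ : ℝ → ℝ), RegPair K m L η ρ v ρa va →
      Sob (m + 3) φ f₁ → Sob (m + 2) φ f₂ → ∃ q : ℝ → ℂ, Sob (m + 2) (C * (η + φ)) q ∧
      dzRhs K g ρ v ρa va f₁ f₂ =ᵐ[volume] fun x =>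
        -Complex.I * (cSound K ρ x * iteratedDeriv 2 (dz K ρ v ρa va) x)
        - (zRep K ρ v x + Complex.I * deriv (cSound K ρ) x) * deriv (dz K ρ v ρa va) x + q x := by
  obtain ⟨C₁, h₁⟩ := exists_coef_comp (contDiffOn_gradWeight hK hKpos) (m + 2) hL
  obtain ⟨C₂, h02, h₂⟩ := exists_sob_comp_sub (contDiffOn_soundWeight hK hKpos) (m + 3) hL
  obtain ⟨C₃, h03, h₃⟩ := exists_sob_comp_sub hg (m + 3) hL
  obtain ⟨C₄, h₄⟩ := exists_coef_zRep hK hKpos (m + 4) hL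
  obtain ⟨C₅, h₅⟩ := exists_coef_zRep hK hKpos (m + 2) hL
  obtain ⟨C₆, h₆⟩ := exists_coef_cSound hK hKpos (m + 2) hL
  obtain ⟨C₇, h₇⟩ := exists_coef_cSound hK hKpos (m + 4) hL
  set T : ℝ := 3 * 2 ^ (m + 2) * C₄ + (3 * 2 ^ (m + 3) * (C₄ * C₂) + C₃) with hT
  set S : ℝ := 1 + 3 * 2 ^ (m + 3) * C₁ with hS
  refine ⟨max 0 (max T S), le_max_left _ _, fun η φ ρ v ρa va f₁ f₂ h hf1 hf2 => ?_⟩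
  have hη := h.z.nonneg
  have hφ := hf1.nonneg
  have cz := (h₅ ρ v h.fst).2
  have cza := (h₄ ρa va h.snd).2
  have ca := h₆ ρ v h.fst
  have caa := h₇ ρa va h.snd
  have hZ := h.z
  have sub : ∀ {f : ℝ → ℝ} {C : ℝ}, (∀ (ρ σ : ℝ → ℝ) (η : ℝ), Coef (m + 3) L ρ → Coef (m + 3) L σ →
      Continuous ρ → Continuous σ → (∀ x, ρ x ∈ Icc L⁻¹ L) → (∀ x, σ x ∈ Icc L⁻¹ L) →
      Sob (m + 3) η (fun x => ρ x - σ x) → Sob (m + 3) (C * η) (fun x => f (ρ x) - f (σ x))) →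
      Sob (m + 3) (C * η) (fun x => f (ρ x) - f (ρa x)) := fun hh =>
    hh ρ ρa η h.fst.density (h.snd.density.le (by omega)) h.fst.density.2.1.continuous
      h.snd.density.2.1.continuous h.fst.mem h.snd.mem h.density
  have da : Sob (m + 3) (C₂ * η) (fun x => cSound K ρ x - cSound K ρa x) :=
    (sub h₂).ofReal.congr fun x => by simp [cSound]
  have dg := (sub h₃).ofReal
  have t1 := hZ.mul_coef cza.2.2 (k := m + 2) le_rfl (by omega) (Or.inl (by omega))
  have t2 := (da.mul_coef cza.2.2 (k := m + 3) le_rfl (by omega) (Or.inl (by omega))).const_mul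
    Complex.I
  have t3 := (t2.add dg)
  have t4 : Sob (m + 3) (3 * 2 ^ (m + 3) * (C₁ * φ))
      (fun y => gradWeight K (ρa y) * f₁ y) :=
    (hf1.mul_coef (h₁ ρa (h.snd.density.le (by omega)) h.snd.mem) (k := m + 3) le_rfl le_rfl
      (Or.inl (by omega))).congr fun x => mul_comm _ _
  have t5 : Sob (m + 2) (φ + ‖Complex.I‖ * (3 * 2 ^ (m + 3) * (C₁ * φ))) (zSource K ρa f₁ f₂) :=
    hf2.ofReal.add (t4.2.2.ofReal.const_mul Complex.I)
  have t6 := (t1.add (t3.2.2)).add t5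
  refine ⟨_, t6.neg.mono ?_, ?_⟩
  · rw [Complex.norm_I]
    calc _ = T * η + S * φ := by rw [hT, hS]; ring
      _ ≤ max 0 (max T S) * η + max 0 (max T S) * φ := add_le_add
          (mul_le_mul_of_nonneg_right ((le_max_left _ _).trans (le_max_right _ _)) hη)
          (mul_le_mul_of_nonneg_right ((le_max_right _ _).trans (le_max_right _ _)) hφ)
      _ = _ := by ring
  · have dZ : ∀ x, deriv (zRep K ρ v) x = deriv (dz K ρ v ρa va) x + deriv (zRep K ρa va) x :=
      fun x => by
        have := ((cz.2.1.hasDerivAt cz.2.2.2.1.continuous x).sub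
          (cza.2.1.hasDerivAt cza.2.2.2.1.continuous x)).deriv
        rw [show deriv (dz K ρ v ρa va) x = _ from this]; ring
    -- Expanding the square around z rather than zᵃ gives -zΔz + ½(Δz)². Its derivative is -z ∂ₓΔz -
    -- Δz ∂ₓzᵃ, so no derivative falls on z.
    have e1 : ∀ x, zFlux K g ρ v x = zFlux K g ρa va x
        + (-Complex.I * (cSound K ρ x * deriv (dz K ρ v ρa va) x)
          - zRep K ρ v x * dz K ρ v ρa va x
          + 1 / 2 * (dz K ρ v ρa va x * dz K ρ v ρa va x)
          - (Complex.I * ((cSound K ρ x - cSound K ρa x) * deriv (zRep K ρa va) x)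
            + ((g (ρ x) - g (ρa x) : ℝ) : ℂ))) := by
      intro x
      have e2 : zRep K ρ v x = dz K ρ v ρa va x + zRep K ρa va x := by simp [dz]
      simp only [zFlux, dZ, e2, cSound]
      push_cast
      ring
    have posa : ∀ x, 0 < ρa x := fun x => lt_of_lt_of_le (inv_pos.2 hL) (h.snd.mem x).1
    have pga : IsPrim (fun x => g (ρa x)) (deriv fun x => g (ρa x)) :=
      (h.snd.density.2.1.comp (hg.of_le (by simp)) posa).deriv
    have pza := cza.2.1
    have pza' := cza.2.2.2.1
    have p1 : IsPrim (zFlux K g ρa va) (deriv (zFlux K g ρa va)) := by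
      have := (((caa.2.1.mul pza').const_mul (-Complex.I)).sub
        ((pza.mul pza).const_mul (1 / 2))).sub pga.ofReal
      rw [show (fun x => -Complex.I * (cSound K ρa x * deriv (zRep K ρa va) x)
        - 1 / 2 * (zRep K ρa va x * zRep K ρa va x) - (g (ρa x) : ℂ)) = zFlux K g ρa va from by
          funext x; simp only [zFlux, cSound]; ring] at this
      exact this.deriv
    have p2 := p1.add (((((ca.2.1.mul hZ.2.2.2.1).const_mul (-Complex.I)).sub
      (cz.2.1.mul hZ.2.1)).add ((hZ.2.1.mul hZ.2.1).const_mul (1 / 2))).sub t3.2.1)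
    rw [← funext e1] at p2
    filter_upwards [p2.deriv_ae] with x hx
    rw [dzRhs, hx, iteratedDeriv_succ, iteratedDeriv_one, dZ]
    ring

end Pair

/-! ### The energy estimate for the top order derivative at a fixed time -/

section TopOrder

variable {K g : ℝ → ℝ}

/-- The square of the gauge. -/
noncomputable def gaugeSq (K : ℝ → ℝ) (n : ℕ) (s : ℝ) : ℝ := gauge K n s ^ 2

theorem contDiffOn_gauge (hK : ContDiffOn ℝ ∞ K (Ioi 0)) (hKpos : ∀ s > 0, 0 < K s) (n : ℕ) :
    ContDiffOn ℝ ∞ (gauge K n) (Ioi 0) :=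
  ((contDiffOn_soundWeight hK hKpos).pow n).mul (contDiffOn_id.sqrt fun _ hs => (ne_of_gt hs))

theorem gauge_pos (hKpos : ∀ s > 0, 0 < K s) (n : ℕ) {s : ℝ} (hs : 0 < s) : 0 < gauge K n s :=
  mul_pos (pow_pos (soundWeight_pos hKpos hs) n) (Real.sqrt_pos.2 hs)

theorem contDiffOn_gaugeSq (hK : ContDiffOn ℝ ∞ K (Ioi 0)) (hKpos : ∀ s > 0, 0 < K s) (n : ℕ) :
    ContDiffOn ℝ ∞ (gaugeSq K n) (Ioi 0) := (contDiffOn_gauge hK hKpos n).pow 2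

theorem gaugeSq_pos (hKpos : ∀ s > 0, 0 < K s) (n : ℕ) {s : ℝ} (hs : 0 < s) : 0 < gaugeSq K n s :=
  pow_pos (gauge_pos hKpos n hs) 2

theorem gaugeSq_eq (n : ℕ) {s : ℝ} (hs : 0 < s) :
    gaugeSq K n s = soundWeight K s ^ (2 * n) * s := by
  rw [gaugeSq, gauge, mul_pow, Real.sq_sqrt hs.le, ← pow_mul, mul_comm n, soundWeight]

/-- The identity which selects the gauge. -/
theorem gaugeSq_identity (hK : ContDiffOn ℝ ∞ K (Ioi 0)) (hKpos : ∀ s > 0, 0 < K s) (n : ℕ) {s : ℝ}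
    (hs : 0 < s) : soundWeight K s * deriv (gaugeSq K n) s
      = gradWeight K s * gaugeSq K n s + 2 * n * deriv (soundWeight K) s * gaugeSq K n s := by
  have h1 : HasDerivAt (fun r => soundWeight K r ^ (2 * n) * r) _ s :=
    ((hasDerivAt_of_contDiffOn (contDiffOn_soundWeight hK hKpos) hs).pow (2 * n)).mul
      (hasDerivAt_id s)
  have h2 := (h1.congr_of_eventuallyEq (Filter.mem_of_superset (Ioi_mem_nhds hs) fun r hr =>
    gaugeSq_eq (K := K) n hr)).deriv
  rw [h2, gaugeSq_eq n hs]
  -- The power rule produces the exponent `2 * n - 1`, a truncated subtraction when `n` is zero.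
  rcases n with _ | n
  · simp [soundWeight_eq hs, mul_comm]
  · rw [show 2 * (n + 1) - 1 = 2 * n + 1 by omega, show 2 * (n + 1) = 2 * n + 1 + 1 by ring]
    have e := soundWeight_eq (K := K) hs
    simp only [pow_succ (soundWeight K s) (2 * n + 1), Pi.pow_apply]
    push_cast
    linear_combination (soundWeight K s) ^ (2 * n + 1) * soundWeight K s * e

/-- The coefficient of the transport term after `m` derivatives. -/
noncomputable def transportCoef (K : ℝ → ℝ) (m : ℕ) (ρ v : ℝ → ℝ) (x : ℝ) : ℂ :=
  -(zRep K ρ v x + Complex.I * ((m + 1) * deriv (cSound K ρ) x))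

/-- For 2n = m + 2 the gauge identity gives a ∂ₓμ - μ ∂ₓa = (w + (m+1) ∂ₓa)μ, which matches the
imaginary part of the transport coefficient. This is the relation `hrel` of the energy estimate. -/
theorem transportCoef_mul_gaugeSq (hK : ContDiffOn ℝ ∞ K (Ioi 0)) (hKpos : ∀ s > 0, 0 < K s)
    {n m k : ℕ} (hnm : m + 2 = 2 * n) {L : ℝ} {ρ v : ℝ → ℝ} (hρ : Coef (k + 2) L ρ)
    (hpos : ∀ x, 0 < ρ x) (x : ℝ) :
    transportCoef K m ρ v x * (gaugeSq K n (ρ x) : ℂ) = -(v x * gaugeSq K n (ρ x) : ℂ)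
      - Complex.I * ((soundWeight K (ρ x) * deriv (fun x => gaugeSq K n (ρ x)) x
        - deriv (fun x => soundWeight K (ρ x)) x * gaugeSq K n (ρ x) : ℝ) : ℂ) := by
  have d1 := hρ.2.1.hasDerivAt hρ.2.2.2.1.continuous x
  have d2 : deriv (fun x => gaugeSq K n (ρ x)) x = deriv (gaugeSq K n) (ρ x) * deriv ρ x :=
    ((hasDerivAt_of_contDiffOn (contDiffOn_gaugeSq hK hKpos n) (hpos x)).comp x d1).deriv
  have d3 := ((hasDerivAt_of_contDiffOn (contDiffOn_soundWeight hK hKpos) (hpos x)).comp x d1)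
  have d4 : deriv (fun x => soundWeight K (ρ x)) x = deriv (soundWeight K) (ρ x) * deriv ρ x :=
    d3.deriv
  have d5 : deriv (cSound K ρ) x = ((deriv (soundWeight K) (ρ x) * deriv ρ x : ℝ) : ℂ) :=
    d3.ofReal_comp.deriv
  have id1 := gaugeSq_identity hK hKpos n (hpos x)
  have id2 : soundWeight K (ρ x) * (deriv (gaugeSq K n) (ρ x) * deriv ρ x)
      - deriv (soundWeight K) (ρ x) * deriv ρ x * gaugeSq K n (ρ x)
      = wRep K ρ x * gaugeSq K n (ρ x) + (m + 1) * (deriv (soundWeight K) (ρ x) * deriv ρ x)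
        * gaugeSq K n (ρ x) := by
    have hn : (2 * n : ℝ) = m + 2 := by exact_mod_cast hnm.symm
    rw [hn] at id1
    rw [wRep]
    linear_combination deriv ρ x * id1
  rw [transportCoef, d2, d4, d5, id2, zRep]
  push_cast
  ring

/-- The divergence form of the equation contributes one ∂ₓa, and commuting m derivatives with the
second order term contributes m more. Together they form the m + 1 in `transportCoef`. -/
theorem exists_weakDeriv_dzRhs (hK : ContDiffOn ℝ ∞ K (Ioi 0)) (hKpos : ∀ s > 0, 0 < K s)
    (hg : ContDiffOn ℝ ∞ g (Ioi 0)) (m : ℕ) {L : ℝ} (hL : 0 < L) :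
    ∃ C, 0 ≤ C ∧ ∀ (η φ : ℝ) (ρ v ρa va f₁ f₂ : ℝ → ℝ), RegPair K m L η ρ v ρa va →
      Sob (m + 3) φ f₁ → Sob (m + 2) φ f₂ → ∃ q : ℝ → ℂ, Sob 2 (C * (η + φ)) q ∧
      HasWeakDeriv m (dzRhs K g ρ v ρa va f₁ f₂) fun x =>
        -Complex.I * (cSound K ρ x * deriv (deriv (iteratedDeriv m (dz K ρ v ρa va))) x)
        + transportCoef K m ρ v x * deriv (iteratedDeriv m (dz K ρ v ρa va)) x + q x := by
  obtain ⟨C₀, h0, hR⟩ := exists_dzRhs hK hKpos hg m hL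
  obtain ⟨C₅, h₅⟩ := exists_coef_zRep hK hKpos (m + 2) hL
  obtain ⟨C₆, h₆⟩ := exists_coef_cSound hK hKpos (m + 2) hL
  obtain ⟨D₁, hD₁⟩ := exists_commutator_first m 0
  obtain ⟨D₂, hD₂⟩ := exists_commutator_second m 0
  refine ⟨max 0 (D₂ * C₆ + D₁ * (C₅ + C₆)) + C₀, by positivity,
    fun η φ ρ v ρa va f₁ f₂ h hf1 hf2 => ?_⟩
  obtain ⟨q, hq, hG⟩ := hR η φ ρ v ρa va f₁ f₂ h hf1 hf2
  have cz := (h₅ ρ v h.fst).2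
  have ca := h₆ ρ v h.fst
  have cb : Coef (m + 2) (C₅ + C₆) fun x => zRep K ρ v x + Complex.I * deriv (cSound K ρ) x := by
    have := cz.add (ca.2.2.const_mul Complex.I)
    rwa [Complex.norm_I, one_mul] at this
  obtain ⟨e₁, he₁, w₁⟩ := hD₁ _ (dz K ρ v ρa va) _ η cb h.z
  obtain ⟨e₂, he₂, w₂⟩ := hD₂ _ (dz K ρ v ρa va) _ η ca h.z
  have hη := h.z.nonneg
  have hφ := hf1.nonneg
  refine ⟨fun x => -Complex.I * e₂ x + -e₁ x + iteratedDeriv m q x,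
    (((he₂.const_mul (-Complex.I)).add he₁.neg).add (hq.iterated (k := m))).mono ?_, ?_⟩
  · rw [norm_neg, Complex.norm_I]
    calc _ = (D₂ * C₆ + D₁ * (C₅ + C₆)) * η + C₀ * (η + φ) := by ring
      _ ≤ max 0 (D₂ * C₆ + D₁ * (C₅ + C₆)) * (η + φ) + C₀ * (η + φ) := by
          refine add_le_add ((mul_le_mul_of_nonneg_right (le_max_right 0 _) hη).trans
            (mul_le_mul_of_nonneg_left (by linarith) (le_max_left _ _))) le_rfl
      _ = _ := by ring
  · have w₃ := (hq.le (k := m) (by omega)).hasWeakDeriv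
    have w := ((w₂.const_mul (-Complex.I)).add (w₁.const_mul (-1))).add w₃
    refine w.congr ?_ (Eventually.of_forall fun x => ?_)
    · filter_upwards [hG] with x hx
      rw [hx]; ring
    · simp only [transportCoef, ← iteratedDeriv_succ]
      ring

theorem lpNorm_mul_bound {M : ℝ} {c u : ℝ → ℂ} (hu : L2Bound M u) (hc : Continuous c) {B : ℝ}
    (hB : ∀ x, ‖c x‖ ≤ B) : L2Bound (B * M) (fun x => c x * u x) :=
  (hu.mul_of_bound hc.aestronglyMeasurable ((norm_nonneg _).trans (hB 0))
    (Eventually.of_forall hB)).congr (Eventually.of_forall fun _ => mul_comm _ _)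

theorem exists_dzRhs_l2 (hK : ContDiffOn ℝ ∞ K (Ioi 0)) (hKpos : ∀ s > 0, 0 < K s)
    (hg : ContDiffOn ℝ ∞ g (Ioi 0)) (m : ℕ) {L : ℝ} (hL : 0 < L) :
    ∃ C, 0 ≤ C ∧ ∀ (η φ : ℝ) (ρ v ρa va f₁ f₂ : ℝ → ℝ), RegPair K m L η ρ v ρa va →
      Sob (m + 3) φ f₁ → Sob (m + 2) φ f₂ →
      L2Bound (C * (η + φ)) (dzRhs K g ρ v ρa va f₁ f₂) := by
  obtain ⟨C₀, h0, hR⟩ := exists_dzRhs hK hKpos hg m hL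
  obtain ⟨C₅, h₅⟩ := exists_coef_zRep hK hKpos (m + 2) hL
  obtain ⟨C₆, h₆⟩ := exists_coef_cSound hK hKpos (m + 2) hL
  refine ⟨max 0 (C₆ + (C₅ + C₆)) + C₀, by positivity, fun η φ ρ v ρa va f₁ f₂ h hf1 hf2 => ?_⟩
  obtain ⟨q, hq, hG⟩ := hR η φ ρ v ρa va f₁ f₂ h hf1 hf2
  have cz := (h₅ ρ v h.fst).2
  have ca := h₆ ρ v h.fst
  have hη := h.z.nonneg
  have hφ := hf1.nonneg
  have cb : Coef (m + 2) (C₅ + C₆) fun x => zRep K ρ v x + Complex.I * deriv (cSound K ρ) x := by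
    have := cz.add (ca.2.2.const_mul Complex.I)
    rwa [Complex.norm_I, one_mul] at this
  have l2 : L2Bound η (iteratedDeriv 2 (dz K ρ v ρa va)) := h.z.l2_iteratedDeriv (by omega)
  have l1 : L2Bound η (deriv (dz K ρ v ρa va)) := h.z.2.2.l2
  have b1 := lpNorm_mul_bound l2 ca.2.1.continuous ca.1
  have b2 := lpNorm_mul_bound l1 cb.2.1.continuous cb.1
  have tot := (((Sob.const_mul (m := 0) b1 (-Complex.I)).add (Sob.neg (m := 0) b2)).add
    (hq.le (k := 0) (by omega))).l2
  refine (tot.mono ?_).congr ?_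
  · rw [norm_neg, Complex.norm_I]
    calc _ = (C₆ + (C₅ + C₆)) * η + C₀ * (η + φ) := by ring
      _ ≤ max 0 (C₆ + (C₅ + C₆)) * (η + φ) + C₀ * (η + φ) := by
          refine add_le_add ((mul_le_mul_of_nonneg_right (le_max_right 0 _) hη).trans
            (mul_le_mul_of_nonneg_left (by linarith) (le_max_left _ _))) le_rfl
      _ = _ := by ring
  · filter_upwards [hG] with x hx
    rw [hx]; ring

/-- Uniform bounds for the coefficients of the top order energy. -/
structure EnergyCoef (K : ℝ → ℝ) (n : ℕ) (M : ℝ) (ρ v : ℝ → ℝ) : Prop where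
  one_le : 1 ≤ M
  pos : ∀ x, 0 < ρ x
  continuous : Continuous ρ
  sound : Coef 2 M (fun x => soundWeight K (ρ x))
  gauge : Coef 3 M (fun x => gaugeSq K n (ρ x))
  sound_ge : ∀ x, M⁻¹ ≤ soundWeight K (ρ x)
  gauge_ge : ∀ x, M⁻¹ ≤ gaugeSq K n (ρ x)
  inv : Coef 2 M (fun x => (soundWeight K (ρ x) * gaugeSq K n (ρ x))⁻¹)
  vel : Coef 2 M (fun x => v x * gaugeSq K n (ρ x))
  vel_inv : Coef 2 M (fun x => v x * (soundWeight K (ρ x) * gaugeSq K n (ρ x))⁻¹)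

theorem exists_energyCoef (hK : ContDiffOn ℝ ∞ K (Ioi 0)) (hKpos : ∀ s > 0, 0 < K s) (n m : ℕ)
    {L : ℝ} (hL : 0 < L) : ∃ M, ∀ ρ v : ℝ → ℝ, RegState (m + 2) L ρ v → EnergyCoef K n M ρ v := by
  have c1 := contDiffOn_soundWeight hK hKpos
  have c2 := contDiffOn_gaugeSq hK hKpos n
  have c3 : ContDiffOn ℝ ∞ (fun s => (soundWeight K s * gaugeSq K n s)⁻¹) (Ioi 0) :=
    (c1.mul c2).inv fun s hs => (mul_pos (soundWeight_pos hKpos hs) (gaugeSq_pos hKpos n hs)).ne'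
  obtain ⟨A₁, hA₁⟩ := exists_coef_comp c1 (m + 2) hL
  obtain ⟨A₂, hA₂⟩ := exists_coef_comp c2 (m + 2) hL
  obtain ⟨A₃, hA₃⟩ := exists_coef_comp c3 (m + 2) hL
  obtain ⟨B₁, hB1, hB₁⟩ := exists_bound_Icc (c1.inv fun s hs => (soundWeight_pos hKpos hs).ne') hL
  obtain ⟨B₂, hB2, hB₂⟩ := exists_bound_Icc (c2.inv fun s hs => (gaugeSq_pos hKpos n hs).ne') hL
  set A₄ := (2 : ℝ) ^ 2 * (A₂ * L)
  set A₅ := (2 : ℝ) ^ 2 * (A₃ * L)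
  refine ⟨1 + |A₁| + |A₂| + |A₃| + |B₁| + |B₂| + |A₄| + |A₅|, fun ρ v h => ?_⟩
  set M := 1 + |A₁| + |A₂| + |A₃| + |B₁| + |B₂| + |A₄| + |A₅| with hM
  have n1 := abs_nonneg A₁; have n2 := abs_nonneg A₂; have n3 := abs_nonneg A₃
  have n4 := abs_nonneg A₄; have n5 := abs_nonneg A₅; have n6 := abs_nonneg B₁
  have n7 := abs_nonneg B₂
  have hpos : ∀ x, 0 < ρ x := fun x => lt_of_lt_of_le (inv_pos.2 hL) (h.mem x).1
  have hM0 : 0 < M := by linarith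
  refine ⟨by linarith, hpos, h.density.2.1.continuous,
    ((hA₁ ρ h.density h.mem).le (by omega)).mono (by linarith [le_abs_self A₁]),
    ((hA₂ ρ h.density h.mem).le (by omega)).mono (by linarith [le_abs_self A₂]),
    fun x => ?_, fun x => ?_,
    ((hA₃ ρ h.density h.mem).le (by omega)).mono (by linarith [le_abs_self A₃]),
    (h.velocity.mul (hA₂ ρ h.density h.mem) (k := 2) (by omega) (by omega) (Or.inl (by omega))).mono
      (by linarith [le_abs_self A₄]),
    (h.velocity.mul (hA₃ ρ h.density h.mem) (k := 2) (by omega) (by omega) (Or.inl (by omega))).mono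
      (by linarith [le_abs_self A₅])⟩
  · rw [inv_le_comm₀ hM0 (soundWeight_pos hKpos (hpos x))]
    exact ((le_abs_self _).trans (hB₁ _ (h.mem x))).trans (by linarith [le_abs_self B₁])
  · rw [inv_le_comm₀ hM0 (gaugeSq_pos hKpos n (hpos x))]
    exact ((le_abs_self _).trans (hB₂ _ (h.mem x))).trans (by linarith [le_abs_self B₂])

/-- The energy estimate at a fixed time, for `m = 2 n - 2`. -/
theorem exists_energy_bound (hK : ContDiffOn ℝ ∞ K (Ioi 0)) (hKpos : ∀ s > 0, 0 < K s)
    (hg : ContDiffOn ℝ ∞ g (Ioi 0)) (n m : ℕ) (hnm : m + 2 = 2 * n) {L : ℝ} (hL : 0 < L) :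
    ∃ C, 0 ≤ C ∧ ∀ (η φ : ℝ) (ρ v ρa va f₁ f₂ : ℝ → ℝ), RegPair K m L η ρ v ρa va →
      Sob (m + 3) φ f₁ → Sob (m + 2) φ f₂ → ∃ Γ : ℝ → ℂ,
      HasWeakDeriv m (dzRhs K g ρ v ρa va f₁ f₂) Γ ∧ L2Bound (C * (η + φ)) Γ ∧
      ∀ (ε p : ℝ) (h : ℝ → ℂ), 0 < ε → p ≤ η →
        L2Bound p (fun x => (gauge K n (ρ x) : ℂ) * iteratedDeriv (m + 2) (dz K ρ v ρa va) x) →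
        IsResolvent ε (fun x => soundWeight K (ρ x)) (fun x => gaugeSq K n (ρ x))
          (iteratedDeriv (m + 2) (dz K ρ v ρa va)) h →
        |(∫ x, Γ x * deriv (deriv (fun x => (gaugeSq K n (ρ x) : ℂ) * (starRingEnd ℂ) (h x))) x).re|
          ≤ C * (η + φ) * p := by
  obtain ⟨C₀, h0, hR⟩ := exists_weakDeriv_dzRhs hK hKpos hg m hL
  obtain ⟨M₀, hM₀⟩ := exists_energyCoef hK hKpos n m hL
  obtain ⟨C₅, h₅⟩ := exists_coef_zRep hK hKpos (m + 2) hL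
  obtain ⟨C₆, h₆⟩ := exists_coef_cSound hK hKpos (m + 2) hL
  set c₀ : ℝ := C₅ + (m + 1) * C₆ with hc₀
  set M := |M₀| + |c₀| + |C₆| + 1 with hM
  have hM1 : 1 ≤ M := by linarith [abs_nonneg M₀, abs_nonneg c₀, abs_nonneg C₆]
  have hMM : M₀ ≤ M := by linarith [le_abs_self M₀, abs_nonneg c₀, abs_nonneg C₆]
  have hcM : c₀ ≤ M := by linarith [le_abs_self c₀, abs_nonneg M₀, abs_nonneg C₆]
  have hCM : C₆ ≤ M := by linarith [le_abs_self C₆, abs_nonneg M₀, abs_nonneg c₀]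
  clear_value M c₀
  refine ⟨20 * M ^ 8 * (1 + C₀) + (M + M + C₀), by positivity,
    fun η φ ρ v ρa va f₁ f₂ h hf1 hf2 => ?_⟩
  obtain ⟨q, hq, hw⟩ := hR η φ ρ v ρa va f₁ f₂ h hf1 hf2
  have hη := h.z.nonneg
  have hφ := hf1.nonneg
  have cz := (h₅ ρ v h.fst).2
  have ca := h₆ ρ v h.fst
  have cc : Coef (m + 2) c₀ (transportCoef K m ρ v) := by
    have := (cz.add ((ca.2.2.const_mul ((m : ℂ) + 1)).const_mul Complex.I)).neg
    refine this.mono (le_of_eq ?_)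
    rw [Complex.norm_I, one_mul, hc₀, show ((m : ℂ) + 1) = ((m + 1 : ℕ) : ℂ) by push_cast; ring,
      Complex.norm_natCast]
    push_cast; ring
  have hQ : Sob 2 η (iteratedDeriv m (dz K ρ v ρa va)) := h.z.iterated
  have eQ : deriv (deriv (iteratedDeriv m (dz K ρ v ρa va)))
      = iteratedDeriv (m + 2) (dz K ρ v ρa va) := by
    rw [← iteratedDeriv_succ, ← iteratedDeriv_succ]
  refine ⟨_, hw, ?_, ?_⟩
  · have b1 := lpNorm_mul_bound hQ.2.2.2.2 ca.2.1.continuous ca.1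
    have b2 := lpNorm_mul_bound hQ.2.2.l2 cc.2.1.continuous cc.1
    have tot := (((Sob.const_mul (m := 0) b1 (-Complex.I)).add (show Sob 0 _ _ from b2)).add
      (hq.le (k := 0) (by omega))).l2
    refine tot.mono ?_
    rw [norm_neg, Complex.norm_I]
    have t1 : C₆ * η ≤ M * (η + φ) := by gcongr; linarith
    have t2 : c₀ * η ≤ M * (η + φ) := by gcongr; linarith
    have t3 : 0 ≤ 20 * M ^ 8 * (1 + C₀) * (η + φ) := by positivity
    linarith
  · intro ε p k hε hpη hp hr
    have E := hM₀ ρ v h.fst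
    have mono : ∀ {j : ℕ} {u : ℝ → ℝ}, Coef j M₀ u → Coef j M u := fun hu => hu.mono hMM
    have inv_le : M⁻¹ ≤ M₀⁻¹ := inv_anti₀ (by linarith [E.one_le]) hMM
    have key := IsResolvent.abs_re_energy_le (M := M) (ε := ε) (p := p) (η := η)
      (κ := C₀ * (η + φ)) (γ := fun x => gauge K n (ρ x)) (v := v) (c := transportCoef K m ρ v)
      (q := q) (Q := iteratedDeriv m (dz K ρ v ρa va)) (h := k)
      (by rw [eQ]; exact hr) hM1 hε (mono E.sound) (mono E.gauge)
      (fun x => inv_le.trans (E.sound_ge x)) (fun x => inv_le.trans (E.gauge_ge x)) (fun x => rfl)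
      ((contDiffOn_gauge hK hKpos n).continuousOn.comp_continuous E.continuous E.pos)
      (by rw [eQ]; exact hp) (hpη.trans (le_mul_of_one_le_left hη hM1)) (mono E.vel)
      (mono E.vel_inv) (fun x => by
        have := (mul_pos (soundWeight_pos hKpos (E.pos x)) (gaugeSq_pos hKpos n (E.pos x))).ne'
        rw [mul_assoc, inv_mul_cancel₀ this, mul_one])
      ((cc.le (by omega)).mono hcM) hQ hq (transportCoef_mul_gaugeSq hK hKpos hnm h.fst.density E.pos)
    rw [eQ] at key
    rw [eQ]
    refine key.trans ?_
    have hp0 := hp.nonneg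
    refine mul_le_mul_of_nonneg_right ?_ hp0
    have t0 : η + C₀ * (η + φ) ≤ (1 + C₀) * (η + φ) := by linarith
    have t1 := mul_le_mul_of_nonneg_left t0 (show 0 ≤ 20 * M ^ 8 by positivity)
    have t2 : 0 ≤ (M + M + C₀) * (η + φ) := by positivity
    linarith

end TopOrder

/-! ### The regularized top order energy in time -/

section RegularizedEnergy

/-- The right slopes of -f are eventually at most B + δ for every δ > 0, so -f is compared with an
affine function of slope B. -/
theorem sub_le_of_eventually {I : Set ℝ} (hI : I.OrdConnected) {f : ℝ → ℝ} (hf : ContinuousOn f I)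
    {B : ℝ} (h : ∀ s ∈ I, ∀ δ > 0, ∀ᶠ t in 𝓝[I] s, f s - f t ≤ (B + δ) * |t - s|) {a b : ℝ}
    (ha : a ∈ I) (hb : b ∈ I) (hab : a ≤ b) : f a - f b ≤ B * (b - a) := by
  have hsub : Icc a b ⊆ I := hI.out ha hb
  have key := image_le_of_liminf_slope_right_le_deriv_boundary (f := fun x => -f x) (a := a) (b := b)
    (hf.mono hsub).neg (B := fun x => -f a + B * (x - a)) (B' := fun _ => B) (by simp)
    (by fun_prop) (fun x _ => by
      have := (((hasDerivAt_id x).sub_const a).const_mul B).const_add (-f a)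
      simpa using this.hasDerivWithinAt) (fun x hx r hr => by
      have hmono : 𝓝[Ioc x b] x ≤ 𝓝[I] x := nhdsWithin_mono _ fun y hy =>
        hsub ⟨hx.1.trans hy.1.le, hy.2⟩
      have e := (h x (hsub ⟨hx.1, hx.2.le⟩) ((r - B) / 2) (by linarith)).filter_mono hmono
      rw [nhdsWithin_Ioc_eq_nhdsGT hx.2] at e
      refine Eventually.frequently ?_
      filter_upwards [e, self_mem_nhdsWithin] with y hy hxy
      have hpos : 0 < y - x := sub_pos.2 hxy
      rw [abs_of_pos hpos] at hy
      rw [slope_def_field, div_lt_iff₀ hpos]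
      nlinarith) (right_mem_Icc.2 hab)
  linarith

/-- A continuous function which decreases at speed at most `B` in both directions is
Lipschitz. -/
theorem abs_sub_le_of_eventually {I : Set ℝ} (hI : I.OrdConnected) {f : ℝ → ℝ}
    (hf : ContinuousOn f I) {B : ℝ}
    (h : ∀ s ∈ I, ∀ δ > 0, ∀ᶠ t in 𝓝[I] s, f s - f t ≤ (B + δ) * |t - s|) {a b : ℝ}
    (ha : a ∈ I) (hb : b ∈ I) : |f b - f a| ≤ B * |b - a| := by
  have main : ∀ {a b : ℝ}, a ∈ I → b ∈ I → a ≤ b → |f b - f a| ≤ B * |b - a| := by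
    intro a b ha hb hab
    have h1 := sub_le_of_eventually hI hf h ha hb hab
    have hI' : (Neg.neg ⁻¹' I).OrdConnected := ⟨fun x hx y hy z hz =>
      hI.out hy hx ⟨neg_le_neg hz.2, neg_le_neg hz.1⟩⟩
    -- The hypothesis concerns times on both sides of s, so it is preserved by time reversal, and
    -- this gives the opposite inequality.
    have h2 := sub_le_of_eventually (f := fun x => f (-x)) hI'
      (hf.comp continuous_neg.continuousOn fun x hx => hx) (B := B) (fun s hs δ hδ => by
        have ht : Tendsto Neg.neg (𝓝[Neg.neg ⁻¹' I] s) (𝓝[I] (-s)) :=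
          tendsto_nhdsWithin_iff.2 ⟨(continuous_neg.tendsto s).mono_left nhdsWithin_le_nhds,
            self_mem_nhdsWithin⟩
        filter_upwards [ht.eventually (h (-s) hs δ hδ)] with t ht
        rwa [show -t - -s = -(t - s) by ring, abs_neg] at ht)
      (a := -b) (b := -a) (by simpa using hb) (by simpa using ha) (by linarith)
    simp only [neg_neg] at h2
    rw [abs_of_nonneg (sub_nonneg.2 hab), abs_le]
    constructor <;> linarith
  rcases le_total a b with hab | hab
  · exact main ha hb hab
  · rw [abs_sub_comm (f b), abs_sub_comm b]
    exact main hb ha hab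

/-- Weights of the top order energy. -/
structure IsWeight (M : ℝ) (a μ γ : ℝ → ℝ) : Prop where
  one_le : 1 ≤ M
  coef_a : Coef 2 M a
  coef_μ : Coef 2 M μ
  a_ge : ∀ x, M⁻¹ ≤ a x
  μ_ge : ∀ x, M⁻¹ ≤ μ x
  coef_inv : Coef 2 M (fun x => (a x * μ x)⁻¹)
  μ_eq : ∀ x, μ x = γ x ^ 2
  continuous_γ : Continuous γ

variable {M ε : ℝ} {a μ γ : ℝ → ℝ} {Y h k : ℝ → ℂ}

theorem IsWeight.pos (hw : IsWeight M a μ γ) : 0 < M := by linarith [hw.one_le]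

theorem IsWeight.a_pos (hw : IsWeight M a μ γ) (x : ℝ) : 0 < a x :=
  (inv_pos.2 hw.pos).trans_le (hw.a_ge x)

theorem IsWeight.μ_pos (hw : IsWeight M a μ γ) (x : ℝ) : 0 < μ x :=
  (inv_pos.2 hw.pos).trans_le (hw.μ_ge x)

theorem IsWeight.abs_mul_le (hw : IsWeight M a μ γ) (x : ℝ) : |a x * μ x| ≤ M * M := by
  rw [abs_mul]
  exact mul_le_mul (hw.coef_a.1 x) (hw.coef_μ.1 x) (abs_nonneg _) hw.pos.le

theorem IsWeight.continuous_mul (hw : IsWeight M a μ γ) : Continuous fun x => a x * μ x :=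
  hw.coef_a.2.1.continuous.mul hw.coef_μ.2.1.continuous

theorem IsWeight.exists_isResolvent (hw : IsWeight M a μ γ) (hε : 0 < ε) (hY : MemLp Y 2 volume) :
    ∃ h, IsResolvent ε a μ Y h :=
  EulerKorteweg.exists_isResolvent hε hw.one_le hw.coef_a hw.coef_μ hw.a_ge hw.μ_ge hw.coef_inv
    (fun x => inv_mul_cancel₀ (mul_pos (hw.a_pos x) (hw.μ_pos x)).ne') hY

theorem IsWeight.l2_of_mul {p : ℝ} (hw : IsWeight M a μ γ) (hY : AEStronglyMeasurable Y volume)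
    (hp : L2Bound p (fun x => (γ x : ℂ) * Y x)) : L2Bound (M * p) Y := by
  refine hp.of_le hw.pos.le hY (Eventually.of_forall fun x => ?_)
  rw [norm_mul, Complex.norm_real, Real.norm_eq_abs, ← mul_assoc]
  refine le_mul_of_one_le_left (norm_nonneg _) ?_
  have h1 : M⁻¹ ≤ γ x ^ 2 := (hw.μ_ge x).trans_eq (hw.μ_eq x)
  have h2 : 1 ≤ M * γ x ^ 2 := by
    have := mul_le_mul_of_nonneg_left h1 hw.pos.le
    rwa [mul_inv_cancel₀ hw.pos.ne'] at this
  have h3 : (1 : ℝ) ^ 2 ≤ (M * |γ x|) ^ 2 := by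
    rw [mul_pow, sq_abs]
    have := mul_le_mul hw.one_le h2 zero_le_one hw.pos.le
    nlinarith
  exact le_of_sq_le_sq h3 (mul_nonneg hw.pos.le (abs_nonneg _))

theorem IsWeight.l2_mul {A : ℝ} (hw : IsWeight M a μ γ) (hY : L2Bound A Y) :
    MemLp (fun x => (γ x : ℂ) * Y x) 2 volume := by
  refine (hY.ofReal_mul hw.continuous_γ.aestronglyMeasurable hw.pos.le fun x => ?_).1
  have h1 := (le_abs_self _).trans (hw.coef_μ.1 x)
  rw [hw.μ_eq] at h1
  have h2 : |γ x| ^ 2 ≤ M ^ 2 := by rw [sq_abs]; nlinarith [hw.one_le]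
  exact le_of_sq_le_sq h2 hw.pos.le

/-- The regularized energy density. -/
noncomputable def energyDensity (ε : ℝ) (a μ : ℝ → ℝ) (Y k : ℝ → ℂ) (x : ℝ) : ℝ :=
  2 * ((μ x : ℂ) * Y x * (starRingEnd ℂ) (k x)).re - μ x * ‖k x‖ ^ 2
    - ε * (a x * μ x) * ‖deriv k x‖ ^ 2

theorem IsWeight.integrable_μ {A : ℝ} (hw : IsWeight M a μ γ) (hk : L2Bound A k) :
    Integrable fun x => μ x * ‖k x‖ ^ 2 :=
  (integrable_normSq hk).bdd_mul (c := M) hw.coef_μ.2.1.continuous.aestronglyMeasurable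
    (Eventually.of_forall hw.coef_μ.1)

theorem IsWeight.integrable_a {A : ℝ} (hw : IsWeight M a μ γ) (hε : 0 ≤ ε) (hk : L2Bound A k) :
    Integrable fun x => ε * (a x * μ x) * ‖k x‖ ^ 2 :=
  (integrable_normSq hk).bdd_mul (c := ε * (M * M))
    (continuous_const.mul hw.continuous_mul).aestronglyMeasurable (Eventually.of_forall fun x => by
      rw [norm_mul, Real.norm_of_nonneg hε]
      exact mul_le_mul_of_nonneg_left (hw.abs_mul_le x) hε)

theorem IsWeight.integrable_pair {A B : ℝ} (hw : IsWeight M a μ γ) (hY : L2Bound B Y)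
    (hk : L2Bound A k) : Integrable fun x => (μ x : ℂ) * Y x * (starRingEnd ℂ) (k x) :=
  (hY.ofReal_mul hw.coef_μ.2.1.continuous.aestronglyMeasurable hw.pos.le
    hw.coef_μ.1).integrable_mul (show L2Bound A _ from Sob.conj (m := 0) hk)

theorem IsWeight.integrable_energyDensity {A B : ℝ} (hw : IsWeight M a μ γ) (hε : 0 ≤ ε)
    (hY : L2Bound B Y) (hk : Sob 1 A k) : Integrable (energyDensity ε a μ Y k) :=
  (((hw.integrable_pair hY hk.l2).re.const_mul 2).sub (hw.integrable_μ hk.l2)).sub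
    (hw.integrable_a hε hk.2.2)

/-- The resolvent maximizes the regularized energy. -/
theorem IsResolvent.integral_energyDensity_le {A B : ℝ} (hr : IsResolvent ε a μ Y h)
    (hw : IsWeight M a μ γ) (hε : 0 ≤ ε) (hY : L2Bound B Y) (hk : Sob 1 A k) :
    ∫ x, energyDensity ε a μ Y k x ≤ ∫ x, energyDensity ε a μ Y h x := by
  obtain ⟨⟨A', hh⟩, hp⟩ := hr
  have hd := (hh.le (k := 1) (by omega)).sub hk
  have pd := hh.2.1.sub hk.2.1
  have lc : L2Bound _ fun x => (starRingEnd ℂ) (h x - k x) := hd.conj.l2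
  have ldc : L2Bound _ fun x => (starRingEnd ℂ) (deriv h x - deriv k x) :=
    Sob.conj (m := 0) (Sob.sub (m := 0) hh.2.2.l2 hk.2.2)
  have lP : L2Bound _ fun x => ((ε * (a x * μ x) : ℝ) : ℂ) * deriv h x :=
    hh.2.2.l2.ofReal_mul (N := ε * (M * M))
      (continuous_const.mul hw.continuous_mul).aestronglyMeasurable
      (by have := hw.pos; positivity) fun x => by
        rw [abs_mul, abs_of_nonneg hε]
        exact mul_le_mul_of_nonneg_left (hw.abs_mul_le x) hε
  have lhY : L2Bound _ fun x => (μ x : ℂ) * (h x - Y x) :=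
    (Sob.sub (m := 0) hh.l2 hY).l2.ofReal_mul hw.coef_μ.2.1.continuous.aestronglyMeasurable
      hw.pos.le hw.coef_μ.1
  have i1 := lhY.integrable_mul lc
  have i2 := lP.integrable_mul ldc
  have iF : Integrable fun x => (μ x : ℂ) * (h x - Y x) * (starRingEnd ℂ) (h x - k x)
      + ((ε * (a x * μ x) : ℝ) : ℂ) * deriv h x * (starRingEnd ℂ) (deriv h x - deriv k x) :=
    i1.add i2
  have e := (hp.mul (deriv_conj_comp pd)).integral_eq_zero (lP.integrable_mul lc) iF
  have j1 := hw.integrable_energyDensity hε hY (hh.le (k := 1) (by omega))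
  have j2 := hw.integrable_energyDensity hε hY hk
  have iR : Integrable fun x => 2 * ((μ x : ℂ) * (h x - Y x) * (starRingEnd ℂ) (h x - k x)
      + ((ε * (a x * μ x) : ℝ) : ℂ) * deriv h x * (starRingEnd ℂ) (deriv h x - deriv k x)).re :=
    iF.re.const_mul 2
  have i0 : ∫ x, 2 * ((μ x : ℂ) * (h x - Y x) * (starRingEnd ℂ) (h x - k x)
      + ((ε * (a x * μ x) : ℝ) : ℂ) * deriv h x * (starRingEnd ℂ) (deriv h x - deriv k x)).re
      = 0 := by
    rw [integral_const_mul]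
    have := integral_re (𝕜 := ℂ) iF
    simp only [RCLike.re_eq_complex_re] at this
    rw [this, e]; simp
  -- Completing the square: the energy of h minus that of k, plus the Euler-Lagrange pairing, is the
  -- integral of μ|h - k|² + εaμ|h' - k'|². The pairing integrates to zero.
  have nn : 0 ≤ ∫ x, (energyDensity ε a μ Y h x - energyDensity ε a μ Y k x)
      + 2 * ((μ x : ℂ) * (h x - Y x) * (starRingEnd ℂ) (h x - k x)
      + ((ε * (a x * μ x) : ℝ) : ℂ) * deriv h x * (starRingEnd ℂ) (deriv h x - deriv k x)).re := by
    refine integral_nonneg fun x => ?_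
    have : (energyDensity ε a μ Y h x - energyDensity ε a μ Y k x)
        + 2 * ((μ x : ℂ) * (h x - Y x) * (starRingEnd ℂ) (h x - k x)
        + ((ε * (a x * μ x) : ℝ) : ℂ) * deriv h x * (starRingEnd ℂ) (deriv h x - deriv k x)).re
        = μ x * ‖h x - k x‖ ^ 2 + ε * (a x * μ x) * ‖deriv h x - deriv k x‖ ^ 2 := by
      simp only [energyDensity, ← Complex.normSq_eq_norm_sq, Complex.normSq_apply, Complex.add_re,
        Complex.mul_re, Complex.mul_im, Complex.sub_re, Complex.sub_im, Complex.conj_re,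
        Complex.conj_im, Complex.ofReal_re, Complex.ofReal_im]
      ring
    show 0 ≤ _
    rw [this]
    have := hw.μ_pos x
    have := hw.a_pos x
    positivity
  have j12 : Integrable fun x => energyDensity ε a μ Y h x - energyDensity ε a μ Y k x := j1.sub j2
  rw [integral_add j12 iR, integral_sub j1 j2, i0] at nn
  linarith

/-- At the maximizer the linear term is twice the quadratic one, so the energy equals ∫ μ|h|² +
εaμ|h'|². -/
theorem IsResolvent.integral_energyDensity_le_sq {p : ℝ} (hr : IsResolvent ε a μ Y h)
    (hw : IsWeight M a μ γ) (hε : 0 < ε) (hY : MemLp Y 2 volume)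
    (hp : L2Bound p (fun x => (γ x : ℂ) * Y x)) :
    ∫ x, energyDensity ε a μ Y h x ≤ p ^ 2 := by
  have e := hr.integral_eq hw.pos.le hε.le hw.coef_a hw.coef_μ hY
  have b := (hr.bounds hw.one_le hε hw.coef_a hw.coef_μ hw.a_ge hw.μ_ge hw.μ_eq hw.continuous_γ hY
    hp).1
  obtain ⟨⟨A', hh⟩, -⟩ := hr
  have ip := hw.integrable_pair (show L2Bound _ Y from ⟨hY, le_rfl⟩) hh.l2
  have i0 := integral_re (𝕜 := ℂ) ip
  simp only [RCLike.re_eq_complex_re] at i0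
  have ip2 : Integrable fun x => 2 * ((μ x : ℂ) * Y x * (starRingEnd ℂ) (h x)).re :=
    ip.re.const_mul 2
  have i1 := hw.integrable_μ hh.l2
  have i2 := hw.integrable_a hε.le hh.2.2.l2
  have i3 : Integrable fun x => 2 * ((μ x : ℂ) * Y x * (starRingEnd ℂ) (h x)).re
      - μ x * ‖h x‖ ^ 2 := ip2.sub i1
  simp only [energyDensity]
  rw [integral_sub i3 i2, integral_sub ip2 i1, integral_const_mul, i0, e, Complex.ofReal_re]
  linarith

/-- The constant degenerates as ε → 0, which does no harm: it only makes the second derivatives of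
μh̄ bounded uniformly in time for fixed ε. -/
theorem exists_resolvent_bound (M P : ℝ) {ε : ℝ} (hε : 0 < ε) : ∃ C, ∀ (a μ γ : ℝ → ℝ)
    (Y h : ℝ → ℂ), IsWeight M a μ γ → MemLp Y 2 volume → L2Bound P (fun x => (γ x : ℂ) * Y x) →
    IsResolvent ε a μ Y h →
    Sob 2 C (fun x => (μ x : ℂ) * (starRingEnd ℂ) (h x)) := by
  set A₁ := ε * (M * M) * (M / √ε * P) with hA₁
  set A₂ := M * (M * P + M * P) with hA₂
  set A₃ := ‖((ε⁻¹ : ℝ) : ℂ)‖ * (3 * 2 ^ 1 * (M * max A₁ A₂)) with hA₃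
  refine ⟨3 * 2 ^ 2 * (M * max (M * P) A₃), fun a μ γ Y h hw hY hp hr => ?_⟩
  obtain ⟨-, b1, b2⟩ := hr.bounds hw.one_le hε hw.coef_a hw.coef_μ hw.a_ge hw.μ_ge hw.μ_eq
    hw.continuous_γ hY hp
  have bY := hw.l2_of_mul hY.1 hp
  obtain ⟨⟨A, hh⟩, hP⟩ := hr
  have lP : L2Bound A₁ fun x => ((ε * (a x * μ x) : ℝ) : ℂ) * deriv h x :=
    b2.ofReal_mul (continuous_const.mul hw.continuous_mul).aestronglyMeasurable
      (by have := hw.pos; positivity) fun x => by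
        rw [abs_mul, abs_of_pos hε]
        exact mul_le_mul_of_nonneg_left (hw.abs_mul_le x) hε.le
  have lP' : L2Bound A₂ fun x => (μ x : ℂ) * (h x - Y x) :=
    (Sob.sub (m := 0) b1 bY).l2.ofReal_mul hw.coef_μ.2.1.continuous.aestronglyMeasurable
      hw.pos.le hw.coef_μ.1
  have sP : Sob 1 (max A₁ A₂) fun x => ((ε * (a x * μ x) : ℝ) : ℂ) * deriv h x :=
    Sob.of_isPrim (lP.mono (le_max_left _ _)) hP (show Sob 0 _ _ from lP'.mono (le_max_right _ _))
  have s1 := ((sP.mul_coef hw.coef_inv.ofReal (k := 1) le_rfl (by omega)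
    (Or.inl le_rfl)).const_mul ((ε⁻¹ : ℝ) : ℂ))
  have s2 : Sob 1 A₃ (deriv h) := s1.congr fun x => by
    have h1 : (a x : ℂ) ≠ 0 := Complex.ofReal_ne_zero.2 (hw.a_pos x).ne'
    have h2 : (μ x : ℂ) ≠ 0 := Complex.ofReal_ne_zero.2 (hw.μ_pos x).ne'
    have h3 : (ε : ℂ) ≠ 0 := Complex.ofReal_ne_zero.2 hε.ne'
    push_cast
    field_simp
  have s3 : Sob 2 (max (M * P) A₃) h :=
    Sob.of_isPrim (b1.mono (le_max_left _ _)) hh.2.1 (s2.mono (le_max_right _ _))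
  exact (s3.conj.mul_coef hw.coef_μ.ofReal (k := 2) le_rfl le_rfl (Or.inl (by omega))).congr
    fun x => mul_comm _ _

/-- Comparison of the regularized energies at two times. -/
theorem energyDensity_sub_ge {A A₁ D P : ℝ} {a₂ μ₂ γ₂ : ℝ → ℝ} {Q Q₂ : ℝ → ℂ} (hε : 0 < ε)
    (hw : IsWeight M a μ γ) (hw₂ : IsWeight M a₂ μ₂ γ₂) (hQ : Sob 2 A Q) (hQ₂ : Sob 2 A₁ Q₂)
    (hp : L2Bound P (fun x => (γ x : ℂ) * deriv (deriv Q) x))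
    (hp₂ : L2Bound P (fun x => (γ₂ x : ℂ) * deriv (deriv Q₂) x))
    (hr : IsResolvent ε a μ (deriv (deriv Q)) h) (hr₂ : IsResolvent ε a₂ μ₂ (deriv (deriv Q₂)) k)
    (hμ : ∀ x, |μ₂ x - μ x| ≤ D) (ha : ∀ x, |a₂ x * μ₂ x - a x * μ x| ≤ D) :
    (∫ x, energyDensity ε a μ (deriv (deriv Q)) h x)
      - ∫ x, energyDensity ε a₂ μ₂ (deriv (deriv Q₂)) k x
      ≤ 4 * M ^ 2 * P ^ 2 * D - 2 * (∫ x, deriv (deriv (fun x => (μ x : ℂ) * (starRingEnd ℂ) (h x))) x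
        * (Q₂ x - Q x)).re := by
  have hD : 0 ≤ D := (abs_nonneg _).trans (hμ 0)
  have lY : L2Bound A (deriv (deriv Q)) := hQ.2.2.2.2
  have lY₂ : L2Bound A₁ (deriv (deriv Q₂)) := hQ₂.2.2.2.2
  have bY₂ := hw₂.l2_of_mul lY₂.1.1 hp₂
  obtain ⟨-, b1, b2⟩ := hr.bounds hw.one_le hε hw.coef_a hw.coef_μ hw.a_ge hw.μ_ge hw.μ_eq
    hw.continuous_γ lY.1 hp
  obtain ⟨A', hh⟩ := hr.1
  -- At the second time the maximizer is replaced by that of the first time. By maximality this can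
  -- only lower the energy, and both densities then carry the same `h`.
  have le := hr₂.integral_energyDensity_le hw₂ hε.le lY₂ (hh.le (k := 1) (by omega))
  have j1 := hw.integrable_energyDensity hε.le lY (hh.le (k := 1) (by omega))
  have j2 := hw₂.integrable_energyDensity hε.le lY₂ (hh.le (k := 1) (by omega))
  -- integration by parts
  have hθ : Sob 2 _ (fun x => (μ x : ℂ) * (starRingEnd ℂ) (h x)) :=
    (hh.conj.mul_coef hw.coef_μ.ofReal (k := 2) le_rfl le_rfl (Or.inl (by omega))).congr
      fun x => mul_comm _ _
  set θ : ℝ → ℂ := fun x => (μ x : ℂ) * (starRingEnd ℂ) (h x) with hθe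
  have hd := hQ₂.sub hQ
  have dd : deriv (fun x => Q₂ x - Q x) = fun x => deriv Q₂ x - deriv Q x := funext fun x =>
    ((hQ₂.2.1.hasDerivAt hQ₂.2.2.2.1.continuous x).sub
      (hQ.2.1.hasDerivAt hQ.2.2.2.1.continuous x)).deriv
  have ddd : deriv (deriv fun x => Q₂ x - Q x) =ᵐ[volume]
      fun x => deriv (deriv Q₂) x - deriv (deriv Q) x := by
    rw [dd]; exact (hQ₂.2.2.2.1.sub hQ.2.2.2.1).deriv_ae
  have ibp : ∫ x, deriv (deriv θ) x * (Q₂ x - Q x)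
      = ∫ x, θ x * (deriv (deriv Q₂) x - deriv (deriv Q) x) := by
    have e1 := (hd.le (k := 1) (by omega)).integral_mul_deriv hθ.2.2
    have e2 := (hθ.le (k := 1) (by omega)).integral_mul_deriv hd.2.2
    calc _ = ∫ x, (Q₂ x - Q x) * deriv (deriv θ) x :=
          integral_congr_ae (Eventually.of_forall fun x => mul_comm _ _)
      _ = -∫ x, deriv (fun x => Q₂ x - Q x) x * deriv θ x := e1
      _ = -∫ x, deriv θ x * deriv (fun x => Q₂ x - Q x) x := by simp only [mul_comm]
      _ = ∫ x, θ x * deriv (deriv fun x => Q₂ x - Q x) x := e2.symm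
      _ = _ := integral_congr_ae (ddd.mono fun x hx => by simp only [hx])
  rw [ibp]
  have iθ : Integrable fun x => θ x * (deriv (deriv Q₂) x - deriv (deriv Q) x) :=
    hθ.l2.integrable_mul (Sob.sub (m := 0) lY₂ lY).l2
  have ir := integral_re (𝕜 := ℂ) iθ
  simp only [RCLike.re_eq_complex_re] at ir
  rw [← ir]
  have iθr : Integrable fun x => 2 * (θ x * (deriv (deriv Q₂) x - deriv (deriv Q) x)).re :=
    iθ.re.const_mul 2
  have n1 := integrable_normSq bY₂
  have n2 := integrable_normSq b1
  have n3 := integrable_normSq b2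
  have n12 : Integrable fun x => ‖deriv (deriv Q₂) x‖ ^ 2 + 2 * ‖h x‖ ^ 2 := n1.add (n2.const_mul 2)
  have n123 : Integrable fun x => ‖deriv (deriv Q₂) x‖ ^ 2 + 2 * ‖h x‖ ^ 2
      + ε * ‖deriv h x‖ ^ 2 := n12.add (n3.const_mul ε)
  have pw : ∀ x, energyDensity ε a μ (deriv (deriv Q)) h x
      - energyDensity ε a₂ μ₂ (deriv (deriv Q₂)) h x
      ≤ D * (‖deriv (deriv Q₂) x‖ ^ 2 + 2 * ‖h x‖ ^ 2 + ε * ‖deriv h x‖ ^ 2)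
        - 2 * (θ x * (deriv (deriv Q₂) x - deriv (deriv Q) x)).re := by
    intro x
    have e : energyDensity ε a μ (deriv (deriv Q)) h x
        - energyDensity ε a₂ μ₂ (deriv (deriv Q₂)) h x
        = -(μ₂ x - μ x) * (2 * (deriv (deriv Q₂) x * (starRingEnd ℂ) (h x)).re)
          + (μ₂ x - μ x) * ‖h x‖ ^ 2 + (a₂ x * μ₂ x - a x * μ x) * (ε * ‖deriv h x‖ ^ 2)
          - 2 * (θ x * (deriv (deriv Q₂) x - deriv (deriv Q) x)).re := by
      simp only [energyDensity, hθe, Complex.mul_re, Complex.mul_im, Complex.sub_re,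
        Complex.sub_im, Complex.conj_re, Complex.conj_im, Complex.ofReal_re, Complex.ofReal_im]
      ring
    rw [e]
    have t1 : |2 * (deriv (deriv Q₂) x * (starRingEnd ℂ) (h x)).re|
        ≤ ‖deriv (deriv Q₂) x‖ ^ 2 + ‖h x‖ ^ 2 := by
      rw [abs_mul, abs_two]
      have := Complex.abs_re_le_norm (deriv (deriv Q₂) x * (starRingEnd ℂ) (h x))
      rw [norm_mul, RCLike.norm_conj] at this
      nlinarith [sq_nonneg (‖deriv (deriv Q₂) x‖ - ‖h x‖)]
    have t2 : -(μ₂ x - μ x) * (2 * (deriv (deriv Q₂) x * (starRingEnd ℂ) (h x)).re)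
        ≤ D * (‖deriv (deriv Q₂) x‖ ^ 2 + ‖h x‖ ^ 2) := by
      refine (le_abs_self _).trans ?_
      rw [abs_mul, abs_neg]
      exact mul_le_mul (hμ x) t1 (abs_nonneg _) hD
    have t3 : (μ₂ x - μ x) * ‖h x‖ ^ 2 ≤ D * ‖h x‖ ^ 2 :=
      mul_le_mul_of_nonneg_right ((le_abs_self _).trans (hμ x)) (sq_nonneg _)
    have t4 : (a₂ x * μ₂ x - a x * μ x) * (ε * ‖deriv h x‖ ^ 2) ≤ D * (ε * ‖deriv h x‖ ^ 2) :=
      mul_le_mul_of_nonneg_right ((le_abs_self _).trans (ha x)) (by positivity)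
    linarith
  have m1 := integral_mono (j1.sub j2) ((n123.const_mul D).sub iθr) pw
  simp only [Pi.sub_apply] at m1
  rw [integral_sub j1 j2, integral_sub (n123.const_mul D) iθr, integral_const_mul,
    integral_const_mul, integral_add n12 (n3.const_mul ε), integral_add n1 (n2.const_mul 2),
    integral_const_mul, integral_const_mul] at m1
  have q1 := integral_normSq_le bY₂
  have q2 := integral_normSq_le b1
  have q3 := mul_le_mul_of_nonneg_left (integral_normSq_le b2) hε.le
  have q4 : ε * (M / √ε * P) ^ 2 = M ^ 2 * P ^ 2 := by
    rw [mul_pow, div_pow, Real.sq_sqrt hε.le]; field_simp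
  rw [q4] at q3
  have q5 := mul_le_mul_of_nonneg_left (show (∫ x, ‖deriv (deriv Q₂) x‖ ^ 2) + 2 * (∫ x, ‖h x‖ ^ 2)
    + ε * (∫ x, ‖deriv h x‖ ^ 2) ≤ 4 * (M ^ 2 * P ^ 2) by rw [mul_pow] at q1 q2; linarith) hD
  linarith

end RegularizedEnergy

/-! ### The top order energy in time -/

section EnergyInTime

variable {M ε : ℝ}

/-- Insert a test function k close to Y into the maximized functional: it takes the value ∫ μ|Y|² -
μ|Y - k|² - εaμ|k'|². First k is fixed, then ε is taken small. -/
theorem IsWeight.exists_energyDensity_ge {a μ γ : ℝ → ℝ} {Y : ℝ → ℂ} (hw : IsWeight M a μ γ)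
    (hY : MemLp Y 2 volume) {δ : ℝ} (hδ : 0 < δ) : ∃ ε₀ > 0, ∀ ε > 0, ε ≤ ε₀ → ∀ h,
      IsResolvent ε a μ Y h → (∫ x, μ x * ‖Y x‖ ^ 2) - δ ≤ ∫ x, energyDensity ε a μ Y h x := by
  have hM := hw.pos
  set τ := √(δ / (2 * M)) with hτ
  have hτ0 : 0 < τ := Real.sqrt_pos.2 (by positivity)
  obtain ⟨k, hc, hs, hle⟩ := hY.exist_eLpNorm_sub_le (by norm_num) (by norm_num) hτ0
  have hk : MemLp k 2 volume := hs.continuous.memLp_of_hasCompactSupport hc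
  have hk' : MemLp (deriv k) 2 volume :=
    (hs.continuous_deriv (by simp)).memLp_of_hasCompactSupport hc.deriv
  have lYk : L2Bound τ (fun x => Y x - k x) := by
    refine ⟨hY.sub hk, ?_⟩
    show lpNorm (Y - k) 2 volume ≤ τ
    rw [← toReal_eLpNorm (hY.sub hk).1]
    exact ENNReal.toReal_le_of_le_ofReal hτ0.le hle
  set A := max (lpNorm k 2 volume) (lpNorm (deriv k) 2 volume) with hA
  have sk : Sob 1 A k := ⟨⟨hk, le_max_left _ _⟩, isPrim_of_contDiff hs, ⟨hk', le_max_right _ _⟩⟩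
  refine ⟨δ / (2 * (M * M * A ^ 2 + 1)), by positivity, fun ε hε hε0 h hr => ?_⟩
  have lY : L2Bound _ Y := ⟨hY, le_rfl⟩
  refine le_trans ?_ (hr.integral_energyDensity_le hw hε.le lY sk)
  have e : ∀ x, energyDensity ε a μ Y k x
      = μ x * ‖Y x‖ ^ 2 - μ x * ‖Y x - k x‖ ^ 2 - ε * (a x * μ x) * ‖deriv k x‖ ^ 2 := fun x => by
    simp only [energyDensity, ← Complex.normSq_eq_norm_sq, Complex.normSq_apply, Complex.mul_re,
      Complex.mul_im, Complex.sub_re, Complex.sub_im, Complex.conj_re, Complex.conj_im,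
      Complex.ofReal_re, Complex.ofReal_im]
    ring
  have i1 := hw.integrable_μ lY
  have i2 := hw.integrable_μ lYk
  have i3 := hw.integrable_a hε.le sk.2.2
  have i12 : Integrable fun x => μ x * ‖Y x‖ ^ 2 - μ x * ‖Y x - k x‖ ^ 2 := i1.sub i2
  simp only [e]
  rw [integral_sub i12 i3, integral_sub i1 i2]
  have b2 : ∫ x, μ x * ‖Y x - k x‖ ^ 2 ≤ M * τ ^ 2 := by
    refine le_trans ?_ (mul_le_mul_of_nonneg_left (integral_normSq_le lYk) hM.le)
    rw [← integral_const_mul]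
    exact integral_mono i2 ((integrable_normSq lYk).const_mul M) fun x =>
      mul_le_mul_of_nonneg_right ((le_abs_self _).trans (hw.coef_μ.1 x)) (sq_nonneg _)
  have b3 : ∫ x, ε * (a x * μ x) * ‖deriv k x‖ ^ 2 ≤ ε * (M * M) * A ^ 2 := by
    refine le_trans ?_ (mul_le_mul_of_nonneg_left (integral_normSq_le sk.2.2.l2)
      (show 0 ≤ ε * (M * M) by positivity))
    rw [← integral_const_mul]
    exact integral_mono i3 ((integrable_normSq sk.2.2.l2).const_mul _) fun x =>
      mul_le_mul_of_nonneg_right (mul_le_mul_of_nonneg_left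
        ((le_abs_self _).trans (hw.abs_mul_le x)) hε.le) (sq_nonneg _)
  have c2 : M * τ ^ 2 = δ / 2 := by
    rw [hτ, Real.sq_sqrt (by positivity)]; field_simp
  have c3 : ε * (M * M) * A ^ 2 ≤ δ / 2 := by
    rw [le_div_iff₀ (by positivity)] at hε0
    nlinarith
  linarith

/-- A family with a weak time derivative and a bounded energy production. -/
structure EnergyFlow (M D B P W : ℝ) (I : Set ℝ) (a μ γ : ℝ → ℝ → ℝ) (Q Γ : ℝ → ℝ → ℂ) : Prop where
  ordConnected : I.OrdConnected
  weight : ∀ t ∈ I, IsWeight M (a t) (μ t) (γ t)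
  lip_μ : ∀ s ∈ I, ∀ t ∈ I, ∀ x, |μ t x - μ s x| ≤ D * |t - s|
  lip_a : ∀ s ∈ I, ∀ t ∈ I, ∀ x, |a t x * μ t x - a s x * μ s x| ≤ D * |t - s|
  sob : ∀ t ∈ I, ∃ A, Sob 2 A (Q t)
  time_deriv : ∀ t ∈ I, HasWeakTimeDeriv I t Q (Γ t)
  time_deriv_l2 : ∀ t ∈ I, L2Bound B (Γ t)
  energy_le : ∀ t ∈ I, L2Bound P (fun x => (γ t x : ℂ) * deriv (deriv (Q t)) x)
  production : ∀ t ∈ I, ∀ ε > 0, ∀ h, IsResolvent ε (a t) (μ t) (deriv (deriv (Q t))) h →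
    |(∫ x, Γ t x * deriv (deriv (fun x => (μ t x : ℂ) * (starRingEnd ℂ) (h x))) x).re| ≤ W

variable {D B P W : ℝ} {I : Set ℝ} {a μ γ : ℝ → ℝ → ℝ} {Q Γ : ℝ → ℝ → ℂ}

/-- The envelope inequality is used twice. With the L² Lipschitz bound for Q it gives continuity,
with a constant that depends on ε; with the differentiability of the tested Q it gives slopes
controlled by the production W, independently of ε. -/
theorem EnergyFlow.regularized (hf : EnergyFlow M D B P W I a μ γ Q Γ) {ε : ℝ} (hε : 0 < ε)
    {h : ℝ → ℝ → ℂ} (hh : ∀ t ∈ I, IsResolvent ε (a t) (μ t) (deriv (deriv (Q t))) (h t)) {s t : ℝ}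
    (hs : s ∈ I) (ht : t ∈ I) :
    |(∫ x, energyDensity ε (a t) (μ t) (deriv (deriv (Q t))) (h t) x)
      - ∫ x, energyDensity ε (a s) (μ s) (deriv (deriv (Q s))) (h s) x|
      ≤ (4 * M ^ 2 * P ^ 2 * D + 2 * W) * |t - s| := by
  set f : ℝ → ℝ := fun t => ∫ x, energyDensity ε (a t) (μ t) (deriv (deriv (Q t))) (h t) x with hfe
  set θ : ℝ → ℝ → ℂ := fun s => deriv (deriv (fun x => (μ s x : ℂ) * (starRingEnd ℂ) (h s x)))
    with hθ
  obtain ⟨C, hC⟩ := exists_resolvent_bound M P hε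
  have lY : ∀ t ∈ I, MemLp (deriv (deriv (Q t))) 2 volume := fun t ht => by
    obtain ⟨A, hA⟩ := hf.sob t ht
    exact hA.2.2.2.2.1
  have lθ : ∀ s ∈ I, L2Bound C (θ s) := fun s hs =>
    (hC _ _ _ _ _ (hf.weight s hs) (lY s hs) (hf.energy_le s hs) (hh s hs)).2.2.2.2
  have key : ∀ s ∈ I, ∀ t ∈ I, f s - f t ≤ 4 * M ^ 2 * P ^ 2 * (D * |t - s|)
      - 2 * (∫ x, θ s x * (Q t x - Q s x)).re := fun s hs t ht => by
    obtain ⟨A, hA⟩ := hf.sob s hs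
    obtain ⟨A', hA'⟩ := hf.sob t ht
    exact energyDensity_sub_ge hε (hf.weight s hs) (hf.weight t ht) hA hA' (hf.energy_le s hs)
      (hf.energy_le t ht) (hh s hs) (hh t ht) (hf.lip_μ s hs t ht) (hf.lip_a s hs t ht)
  have hB0 : 0 ≤ B := (hf.time_deriv_l2 s hs).nonneg
  have lQ : ∀ t ∈ I, LocallyIntegrable (Q t) := fun t ht => by
    obtain ⟨A, hA⟩ := hf.sob t ht
    exact hA.locallyIntegrable
  have dQ : ∀ s ∈ I, ∀ t ∈ I, L2Bound (2 * B * |t - s|) (fun x => Q t x - Q s x) :=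
    fun s hs t ht => by
      obtain ⟨A, hA⟩ := hf.sob s hs
      obtain ⟨A', hA'⟩ := hf.sob t ht
      exact l2_sub_of_hasWeakTimeDeriv hf.ordConnected hf.time_deriv lQ hf.time_deriv_l2 hs ht
        (hA'.sub hA).l2.1
  have cont : ContinuousOn f I := by
    set L := |4 * M ^ 2 * P ^ 2 * D| + 2 * (C * (2 * B)) with hL
    have hC0 : 0 ≤ C := (lθ s hs).nonneg
    have one : ∀ s ∈ I, ∀ t ∈ I, f s - f t ≤ L * |t - s| := fun s hs t ht => by
      have h1 := (lθ s hs).norm_integral_mul_le (dQ s hs t ht)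
      have h2 := (Complex.abs_re_le_norm _).trans h1
      have h3 := (abs_le.1 h2).1
      have h4 := key s hs t ht
      have h5 := mul_le_mul_of_nonneg_right (le_abs_self (4 * M ^ 2 * P ^ 2 * D))
        (abs_nonneg (t - s))
      rw [hL]
      linarith
    have hL0 : 0 ≤ L := by positivity
    refine LipschitzOnWith.continuousOn (K := L.toNNReal) (LipschitzOnWith.of_dist_le_mul
      fun s hs t ht => ?_)
    rw [Real.coe_toNNReal _ hL0, Real.dist_eq, Real.dist_eq, abs_le]
    have h1 := one s hs t ht
    have h2 := one t ht s hs
    rw [abs_sub_comm] at h1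
    constructor <;> linarith
  refine abs_sub_le_of_eventually hf.ordConnected cont (fun s hs δ hδ => ?_) hs ht
  -- The second derivative of μh̄ is only square integrable, and Q is Lipschitz in time in L², so
  -- the pairing is with p = 2.
  have hd := HasWeakTimeDeriv.hasDerivWithinAt_of_approx (p := 2) (hf.time_deriv s hs) hs lQ
    ((hf.time_deriv_l2 s hs).1.locallyIntegrable (by norm_num)) (by norm_num) (by norm_num)
    (show 0 ≤ 2 * B by positivity)
    (fun t ht ψ hψ => by
      have l : L2Bound _ ψ := ⟨hψ, le_rfl⟩
      exact ⟨l.integrable_mul (dQ s hs t ht), l.norm_integral_mul_le (dQ s hs t ht)⟩)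
    (fun ψ hψ => by
      have l : L2Bound _ ψ := ⟨hψ, le_rfl⟩
      exact ⟨l.integrable_mul (hf.time_deriv_l2 s hs), (l.norm_integral_mul_le (hf.time_deriv_l2 s hs)).trans
        (mul_le_mul_of_nonneg_left (by linarith) lpNorm_nonneg)⟩) (lθ s hs).1
  have hprod := hf.production s hs ε hε (h s) (hh s hs)
  have hcomm : ∫ x, Γ s x * deriv (deriv (fun x => (μ s x : ℂ) * (starRingEnd ℂ) (h s x))) x
      = ∫ x, θ s x * Γ s x := integral_congr_ae (Eventually.of_forall fun x => mul_comm _ _)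
  rw [hcomm] at hprod
  rw [hasDerivWithinAt_iff_isLittleO, Asymptotics.isLittleO_iff] at hd
  filter_upwards [hd (half_pos hδ), self_mem_nhdsWithin] with t ht htI
  simp only [sub_self, mul_zero, integral_zero, sub_zero] at ht
  have h1 := (Complex.abs_re_le_norm _).trans ht
  rw [Complex.sub_re, Complex.real_smul, Complex.re_ofReal_mul, Real.norm_eq_abs] at h1
  have h2 := (abs_le.1 h1).1
  have h3 : |(t - s) * (∫ x, θ s x * Γ s x).re| ≤ |t - s| * W := by
    rw [abs_mul]; exact mul_le_mul_of_nonneg_left hprod (abs_nonneg _)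
  have h4 := (abs_le.1 h3).1
  have h5 := key s hs t htI
  linarith

/-- The top order energy is Lipschitz in time. -/
theorem EnergyFlow.abs_sub_le (hf : EnergyFlow M D B P W I a μ γ Q Γ) {s t : ℝ} (hs : s ∈ I)
    (ht : t ∈ I) :
    |lpNorm (fun x => (γ t x : ℂ) * deriv (deriv (Q t)) x) 2 volume ^ 2
      - lpNorm (fun x => (γ s x : ℂ) * deriv (deriv (Q s)) x) 2 volume ^ 2|
      ≤ (4 * M ^ 2 * P ^ 2 * D + 2 * W) * |t - s| := by
  have lY : ∀ t ∈ I, MemLp (deriv (deriv (Q t))) 2 volume := fun t ht => by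
    obtain ⟨A, hA⟩ := hf.sob t ht
    exact hA.2.2.2.2.1
  have sq : ∀ t ∈ I, lpNorm (fun x => (γ t x : ℂ) * deriv (deriv (Q t)) x) 2 volume ^ 2
      = ∫ x, μ t x * ‖deriv (deriv (Q t)) x‖ ^ 2 := fun t ht => by
    rw [lpNorm_two_sq (hf.energy_le t ht).1]
    refine integral_congr_ae (Eventually.of_forall fun x => ?_)
    simp only [norm_mul, Complex.norm_real, Real.norm_eq_abs, mul_pow, sq_abs,
      (hf.weight t ht).μ_eq]
  have one : ∀ s ∈ I, ∀ t ∈ I, lpNorm (fun x => (γ t x : ℂ) * deriv (deriv (Q t)) x) 2 volume ^ 2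
      - lpNorm (fun x => (γ s x : ℂ) * deriv (deriv (Q s)) x) 2 volume ^ 2
      ≤ (4 * M ^ 2 * P ^ 2 * D + 2 * W) * |t - s| := by
    intro s hs t ht
    refine le_of_forall_pos_le_add fun δ hδ => ?_
    -- Since the regularized energy never exceeds the true one, ε need be adapted only to the time
    -- at which the true energy is bounded from above, here t.
    obtain ⟨ε, hε, hge⟩ := (hf.weight t ht).exists_energyDensity_ge (lY t ht) hδ
    have ex : ∀ r, ∃ h, r ∈ I → IsResolvent ε (a r) (μ r) (deriv (deriv (Q r))) h := fun r => by
      by_cases hr : r ∈ I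
      · obtain ⟨h, hh⟩ := (hf.weight r hr).exists_isResolvent hε (lY r hr)
        exact ⟨h, fun _ => hh⟩
      · exact ⟨0, fun h => absurd h hr⟩
    choose h hh using ex
    have h1 := hge ε hε le_rfl _ (hh t ht)
    have h2 := (abs_le.1 (hf.regularized hε hh hs ht)).2
    have h3 := (hh s hs).integral_energyDensity_le_sq (hf.weight s hs) hε (lY s hs)
      (p := lpNorm (fun x => (γ s x : ℂ) * deriv (deriv (Q s)) x) 2 volume)
      ⟨(hf.energy_le s hs).1, le_rfl⟩
    rw [sq t ht]
    linarith
  rw [abs_le]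
  have h1 := one s hs t ht
  have h2 := one t ht s hs
  rw [abs_sub_comm] at h2
  constructor <;> linarith

end EnergyInTime

/-! ### The estimate in time for two flows -/

section PairFlow

variable {K g : ℝ → ℝ}

theorem HasWeakTimeDeriv.mono {E : Type*} [NormedAddCommGroup E] [NormedSpace ℝ E] {I I' : Set ℝ}
    {s : ℝ} {u : ℝ → ℝ → E} {w : ℝ → E} (h : HasWeakTimeDeriv I s u w) (hI : I' ⊆ I) :
    HasWeakTimeDeriv I' s u w := fun φ h1 h2 => (h φ h1 h2).mono hI

theorem IsFlow.mono {k j : ℕ} {L φ : ℝ} {I I' : Set ℝ} {ρ v f₁ f₂ : ℝ → ℝ → ℝ}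
    (h : IsFlow K g k j L φ I ρ v f₁ f₂) (hI : I' ⊆ I) : IsFlow K g k j L φ I' ρ v f₁ f₂ :=
  ⟨fun t ht => h.reg t (hI ht), fun t ht => h.src₁ t (hI ht), fun t ht => h.src₂ t (hI ht),
    fun t ht => (h.mass t (hI ht)).mono hI, fun t ht => (h.momentum t (hI ht)).mono hI⟩

/-- A flow without source, a flow with source, and uniform bounds for their difference. -/
structure PairFlow (K g : ℝ → ℝ) (m : ℕ) (L η φ : ℝ) (I : Set ℝ) (ρ v ρa va f₁ f₂ : ℝ → ℝ → ℝ) :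
    Prop where
  ordConnected : I.OrdConnected
  fst : IsFlow K g (m + 2) 0 L 0 I ρ v (fun _ _ => 0) (fun _ _ => 0)
  snd : IsFlow K g (m + 4) (m + 2) L φ I ρa va f₁ f₂
  pair : ∀ t ∈ I, RegPair K m L η (ρ t) (v t) (ρa t) (va t)

variable {m : ℕ} {L η φ : ℝ} {I : Set ℝ} {ρ v ρa va f₁ f₂ : ℝ → ℝ → ℝ}

theorem PairFlow.mono {I' : Set ℝ} (h : PairFlow K g m L η φ I ρ v ρa va f₁ f₂) (hI : I' ⊆ I)
    (ho : I'.OrdConnected) : PairFlow K g m L η φ I' ρ v ρa va f₁ f₂ :=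
  ⟨ho, h.fst.mono hI, h.snd.mono hI, fun t ht => h.pair t (hI ht)⟩

theorem abs_lpNorm_sub_le {E : Type*} [NormedAddCommGroup E] {u w : ℝ → E} {M : ℝ}
    (hu : MemLp u 2 volume) (hw : MemLp w 2 volume)
    (h : lpNorm (fun x => u x - w x) 2 volume ≤ M) :
    |lpNorm u 2 volume - lpNorm w 2 volume| ≤ M := by
  have h1 : lpNorm u 2 volume ≤ lpNorm (fun x => u x - w x) 2 volume + lpNorm w 2 volume := by
    have := lpNorm_add_le (hu.sub hw) (g := w) (by norm_num)
    rwa [sub_add_cancel] at this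
  have h2 : lpNorm w 2 volume ≤ lpNorm (fun x => u x - w x) 2 volume + lpNorm u 2 volume := by
    have := lpNorm_add_le (hw.sub hu) (g := u) (by norm_num)
    rwa [lpNorm_sub_comm, sub_add_cancel] at this
  rw [abs_le]
  constructor <;> linarith

/-- Up to the source, ∂ₜΔρ = -∂ₓ(vΔρ + ρᵃΔv), which is in L² with a bound linear in the difference.
Duality does the rest. -/
theorem exists_density_lipschitz (K g : ℝ → ℝ) (m : ℕ) (L : ℝ) : ∃ C, 0 ≤ C ∧
    ∀ (η φ : ℝ) (I : Set ℝ) (ρ v ρa va f₁ f₂ : ℝ → ℝ → ℝ),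
      PairFlow K g m L η φ I ρ v ρa va f₁ f₂ → ∀ s ∈ I, ∀ t ∈ I,
      L2Bound (C * (η + φ) * |t - s|) (fun x => (ρ t x - ρa t x) - (ρ s x - ρa s x)) := by
  set c : ℝ := 3 * 2 ^ 2 * L + 3 * 2 ^ 2 * L with hc
  refine ⟨max c 1, by positivity, fun η φ I ρ v ρa va f₁ f₂ h s hs t ht => ?_⟩
  have p1 : ∀ t ∈ I, IsPrim (fun y => ρ t y * v t y) (deriv fun y => ρ t y * v t y) := fun t ht =>
    ((h.fst.reg t ht).density.2.1.mul (h.fst.reg t ht).velocity.2.1).deriv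
  have p2 : ∀ t ∈ I, IsPrim (fun y => ρa t y * va t y) (deriv fun y => ρa t y * va t y) :=
    fun t ht => ((h.snd.reg t ht).density.2.1.mul (h.snd.reg t ht).velocity.2.1).deriv
  have heq : ∀ r ∈ I, HasWeakTimeDeriv I r (fun t x => ρ t x - ρa t x)
      (fun x => (-deriv (fun y => ρ r y * v r y) x + 0)
        - (-deriv (fun y => ρa r y * va r y) x + f₁ r x)) := fun r hr =>
    (h.fst.mass r hr).sub (h.snd.mass r hr) hr
      (fun t ht => (h.fst.reg t ht).density.2.1.locallyIntegrable)
      ((p1 r hr).1.neg.add (show LocallyIntegrable (fun _ : ℝ => (0 : ℝ)) from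
        continuous_const.locallyIntegrable))
      (fun t ht => (h.snd.reg t ht).density.2.1.locallyIntegrable)
      ((p2 r hr).1.neg.add (h.snd.src₁ r hr).locallyIntegrable)
  refine l2_sub_of_hasWeakTimeDeriv_real h.ordConnected heq
    (fun t ht => (h.pair t ht).density.locallyIntegrable) (fun r hr => ?_) hs ht
    ((h.pair t ht).density.sub (h.pair s hs).density).l2.1
  have hp := h.pair r hr
  have hη := hp.z.nonneg
  have hφ := (h.snd.src₁ r hr).nonneg
  have dv : Sob (m + 2) η (fun x => v r x - va r x) := hp.z.re.congr fun x => by simp [dz, zRep]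
  have t1 := hp.density.mul_coef hp.fst.velocity (k := 2) (by omega) (by omega) (Or.inl (by omega))
  have t2 := dv.mul_coef hp.snd.density (k := 2) (by omega) (by omega) (Or.inl (by omega))
  have t3 := t1.add t2
  have e : ∀ x, (ρ r x - ρa r x) * v r x + (v r x - va r x) * ρa r x
      = ρ r x * v r x - ρa r x * va r x := fun x => by ring
  have t4 := (t3.congr e).2.2.l2
  have t5 : L2Bound _ _ := Sob.neg (m := 0) (Sob.add (m := 0) t4 (h.snd.src₁ r hr).l2)
  refine (t5.mono ?_).congr ?_
  · calc _ = c * η + 1 * φ := by rw [hc]; ring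
      _ ≤ max c 1 * η + max c 1 * φ := add_le_add
          (mul_le_mul_of_nonneg_right (le_max_left _ _) hη)
          (mul_le_mul_of_nonneg_right (le_max_right _ _) hφ)
      _ = _ := by ring
  · filter_upwards [((p1 r hr).sub (p2 r hr)).deriv_ae] with x hx
    rw [hx]; ring

theorem PairFlow.hasWeakTimeDeriv_dz (hK : ContDiffOn ℝ ∞ K (Ioi 0)) (hKpos : ∀ s > 0, 0 < K s)
    (hg : ContDiffOn ℝ ∞ g (Ioi 0)) (hL : 0 < L) (h : PairFlow K g m L η φ I ρ v ρa va f₁ f₂)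
    {t : ℝ} (ht : t ∈ I) :
    HasWeakTimeDeriv I t (fun s => dz K (ρ s) (v s) (ρa s) (va s))
      (dzRhs K g (ρ t) (v t) (ρa t) (va t) (f₁ t) (f₂ t)) := by
  have e1 := h.fst.hasWeakTimeDeriv_zRep hK hKpos hg hL h.ordConnected ht
  have e2 := h.snd.hasWeakTimeDeriv_zRep (k := m + 2) hK hKpos hg hL h.ordConnected ht
  obtain ⟨C, hC⟩ := exists_coef_zRep hK hKpos (m + 2) hL
  obtain ⟨C', hC'⟩ := exists_coef_zRep hK hKpos (m + 4) hL
  obtain ⟨D, -, hD⟩ := exists_dzRhs_l2 hK hKpos hg m hL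
  have e0 : ∀ x, zSource K (ρ t) (fun _ => 0) (fun _ => 0) x = 0 := fun x => by simp [zSource]
  have lsrc : ∀ {k : ℕ} {ρ v f₁ f₂ : ℝ → ℝ} {φ : ℝ}, RegState (k + 2) L ρ v → Sob 1 φ f₁ →
      LocallyIntegrable f₂ →
      LocallyIntegrable fun x => deriv (zFlux K g ρ v) x + zSource K ρ f₁ f₂ x := by
    intro k ρ v f₁ f₂ φ hreg hf1 hf2
    obtain ⟨A, hA⟩ := exists_coef_zRep hK hKpos (k + 2) hL
    have hpos : ∀ x, 0 < ρ x := fun x => lt_of_lt_of_le (inv_pos.2 hL) (hreg.mem x).1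
    have cz := (hA _ _ hreg).2
    have pρ := hreg.density.2.1
    have ps := pρ.comp ((contDiffOn_soundWeight hK hKpos).of_le (by simp)) hpos
    have pgw := pρ.comp ((contDiffOn_gradWeight hK hKpos).of_le (by simp)) hpos
    have pg := pρ.comp (hg.of_le (by simp)) hpos
    have pz : IsPrim (zFlux K g ρ v) (deriv (zFlux K g ρ v)) := by
      have := (((ps.ofReal.mul cz.2.2.2.1).const_mul (-Complex.I)).sub
        ((cz.2.1.mul cz.2.1).const_mul (1 / 2))).sub pg.ofReal
      rw [show (fun x => -Complex.I * ((soundWeight K (ρ x) : ℂ) * deriv (zRep K ρ v) x)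
        - 1 / 2 * (zRep K ρ v x * zRep K ρ v x) - (g (ρ x) : ℂ)) = zFlux K g ρ v from by
          funext x; simp only [zFlux]; ring] at this
      exact this.deriv
    have cl : ∀ {u : ℝ → ℝ}, LocallyIntegrable u → LocallyIntegrable fun x => (u x : ℂ) :=
      fun hv x => by
        obtain ⟨S, hS, hi⟩ := hv x
        exact ⟨S, hS, hi.ofReal⟩
    exact pz.1.add ((cl hf2).add (((pgw.mul hf1.2.1).deriv.ofReal.const_mul Complex.I).1))
  have z0 : Sob 1 (0 : ℝ) (fun _ : ℝ => (0 : ℝ)) := (h.fst.src₁ t ht)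
  have := e1.sub e2 ht (fun s hs => (hC _ _ (h.fst.reg s hs)).2.2.1.locallyIntegrable)
    (lsrc (h.fst.reg t ht) z0 z0.locallyIntegrable)
    (fun s hs => (hC' _ _ (h.snd.reg s hs)).2.2.1.locallyIntegrable)
    (lsrc (h.snd.reg t ht) ((h.snd.src₁ t ht).le (by omega)) (h.snd.src₂ t ht).locallyIntegrable)
  refine this.congr ht (fun s _ => ae_eq_refl _) (Eventually.of_forall fun x => ?_)
  simp only [dzRhs, e0, add_zero]

theorem exists_dz_lipschitz (hK : ContDiffOn ℝ ∞ K (Ioi 0)) (hKpos : ∀ s > 0, 0 < K s)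
    (hg : ContDiffOn ℝ ∞ g (Ioi 0)) (m : ℕ) {L : ℝ} (hL : 0 < L) : ∃ C, 0 ≤ C ∧
    ∀ (η φ : ℝ) (I : Set ℝ) (ρ v ρa va f₁ f₂ : ℝ → ℝ → ℝ),
      PairFlow K g m L η φ I ρ v ρa va f₁ f₂ → ∀ s ∈ I, ∀ t ∈ I,
      L2Bound (C * (η + φ) * |t - s|) (fun x => dz K (ρ t) (v t) (ρa t) (va t) x
        - dz K (ρ s) (v s) (ρa s) (va s) x) := by
  obtain ⟨D, hD0, hD⟩ := exists_dzRhs_l2 hK hKpos hg m hL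
  refine ⟨2 * D, by positivity, fun η φ I ρ v ρa va f₁ f₂ h s hs t ht => ?_⟩
  have := l2_sub_of_hasWeakTimeDeriv h.ordConnected
    (fun r hr => h.hasWeakTimeDeriv_dz hK hKpos hg hL hr)
    (fun r hr => (h.pair r hr).z.locallyIntegrable) (fun r hr => hD η φ _ _ _ _ _ _ (h.pair r hr)
      (h.snd.src₁ r hr) (h.snd.src₂ r hr)) hs ht ((h.pair t ht).z.sub (h.pair s hs).z).l2.1
  refine this.mono (le_of_eq ?_)
  ring

/-- The variation of Δz is controlled in L², and that of the weight √ρ uniformly, because ρ is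
Lipschitz in time in L^∞. -/
theorem exists_weighted_lipschitz (hK : ContDiffOn ℝ ∞ K (Ioi 0)) (hKpos : ∀ s > 0, 0 < K s)
    (hg : ContDiffOn ℝ ∞ g (Ioi 0)) (m : ℕ) {L : ℝ} (hL : 0 < L) : ∃ C, 0 ≤ C ∧
    ∀ (η φ : ℝ) (I : Set ℝ) (ρ v ρa va f₁ f₂ : ℝ → ℝ → ℝ),
      PairFlow K g m L η φ I ρ v ρa va f₁ f₂ → ∀ s ∈ I, ∀ t ∈ I,
      |lpNorm (fun x => √(ρ t x) • dz K (ρ t) (v t) (ρa t) (va t) x) 2 volume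
        - lpNorm (fun x => √(ρ s x) • dz K (ρ s) (v s) (ρa s) (va s) x) 2 volume|
      ≤ C * (η + φ) * |t - s| := by
  obtain ⟨C, hC0, hC⟩ := exists_dz_lipschitz hK hKpos hg m hL
  obtain ⟨F, hF⟩ := exists_flux_density_bound m L
  have csq : ContDiffOn ℝ ∞ (fun s : ℝ => √s) (Ioi 0) :=
    contDiffOn_id.sqrt fun s hs => (ne_of_gt hs)
  obtain ⟨A, hA0, hA⟩ := exists_bound_Icc csq hL
  obtain ⟨B, hB0, hB⟩ := exists_lipschitz_Icc csq hL
  refine ⟨A * C + B * |F|, by positivity, fun η φ I ρ v ρa va f₁ f₂ h s hs t ht => ?_⟩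
  have hpt := h.pair t ht
  have hps := h.pair s hs
  have hη := hpt.z.nonneg
  have hφ := (h.snd.src₁ s hs).nonneg
  have cont : ∀ r ∈ I, Continuous fun x => √(ρ r x) := fun r hr =>
    Real.continuous_sqrt.comp (h.fst.reg r hr).density.2.1.continuous
  have mem : ∀ r ∈ I, MemLp (fun x => √(ρ r x) • dz K (ρ r) (v r) (ρa r) (va r) x) 2 volume :=
    fun r hr => ((h.pair r hr).z.l2.ofReal_mul (cont r hr).aestronglyMeasurable hA0
      fun x => hA _ ((h.fst.reg r hr).mem x)).1
  refine abs_lpNorm_sub_le (mem t ht) (mem s hs) ?_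
  have l1 : L2Bound (A * (C * (η + φ) * |t - s|)) fun x => ((√(ρ s x) : ℝ) : ℂ) *
      (dz K (ρ t) (v t) (ρa t) (va t) x - dz K (ρ s) (v s) (ρa s) (va s) x) :=
    (hC η φ I _ _ _ _ _ _ h s hs t ht).ofReal_mul (cont s hs).aestronglyMeasurable hA0
      fun x => hA _ ((h.fst.reg s hs).mem x)
  have l2 : L2Bound (B * (|F| * |t - s|) * η) fun x => ((√(ρ t x) - √(ρ s x) : ℝ) : ℂ) *
      dz K (ρ t) (v t) (ρa t) (va t) x := by
    refine hpt.z.l2.ofReal_mul ((cont t ht).sub (cont s hs)).aestronglyMeasurable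
      (by positivity) fun x => ?_
    refine (hB _ ((h.fst.reg t ht).mem x) _ ((h.fst.reg s hs).mem x)).trans
      (mul_le_mul_of_nonneg_left ?_ hB0)
    have := h.fst.abs_density_sub_le h.ordConnected hF hs ht x
    rw [mul_zero, add_zero] at this
    exact this.trans (mul_le_mul_of_nonneg_right (le_abs_self _) (abs_nonneg _))
  have l3 := l1.add l2
  have e : (fun x => √(ρ t x) • dz K (ρ t) (v t) (ρa t) (va t) x
      - √(ρ s x) • dz K (ρ s) (v s) (ρa s) (va s) x) = fun x => ((√(ρ s x) : ℝ) : ℂ) *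
      (dz K (ρ t) (v t) (ρa t) (va t) x - dz K (ρ s) (v s) (ρa s) (va s) x)
      + ((√(ρ t x) - √(ρ s x) : ℝ) : ℂ) * dz K (ρ t) (v t) (ρa t) (va t) x := by
    funext x
    simp only [Complex.real_smul]
    push_cast; ring
  rw [e]
  refine l3.2.trans ?_
  have : B * (|F| * |t - s|) * η ≤ B * |F| * (η + φ) * |t - s| := by
    have : 0 ≤ B * |F| * φ * |t - s| := by positivity
    linarith
  linarith

/-- The weighted norm of the top order derivative. -/
noncomputable def topNorm (K : ℝ → ℝ) (n : ℕ) (ρ v ρa va : ℝ → ℝ) : ℝ :=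
  lpNorm (fun x => (gauge K n (ρ x) : ℂ) * iteratedDeriv (2 * n) (dz K ρ v ρa va) x) 2 volume

/-- The bound `P` for the top order norm on the interval is kept apart from η: one power of it is
divided out when passing from the square to the norm. -/
theorem exists_topNorm_sq_lipschitz (hK : ContDiffOn ℝ ∞ K (Ioi 0)) (hKpos : ∀ s > 0, 0 < K s)
    (hg : ContDiffOn ℝ ∞ g (Ioi 0)) (n m : ℕ) (hnm : m + 2 = 2 * n) {L : ℝ} (hL : 0 < L) :
    ∃ C, 0 ≤ C ∧ ∀ (η φ P : ℝ) (I : Set ℝ) (ρ v ρa va f₁ f₂ : ℝ → ℝ → ℝ),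
      PairFlow K g m L η φ I ρ v ρa va f₁ f₂ → P ≤ η →
      (∀ t ∈ I, topNorm K n (ρ t) (v t) (ρa t) (va t) ≤ P) → ∀ s ∈ I, ∀ t ∈ I,
      |topNorm K n (ρ t) (v t) (ρa t) (va t) ^ 2 - topNorm K n (ρ s) (v s) (ρa s) (va s) ^ 2|
        ≤ C * (η + φ) * P * |t - s| := by
  obtain ⟨C, hC0, hC⟩ := exists_energy_bound hK hKpos hg n m hnm hL
  obtain ⟨M, hM⟩ := exists_energyCoef hK hKpos n m hL
  obtain ⟨F, hF⟩ := exists_flux_density_bound m L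
  obtain ⟨B₁, hB1, hB₁⟩ := exists_lipschitz_Icc (contDiffOn_gaugeSq hK hKpos n) hL
  obtain ⟨B₂, hB2, hB₂⟩ := exists_lipschitz_Icc
    ((contDiffOn_soundWeight hK hKpos).mul (contDiffOn_gaugeSq hK hKpos n)) hL
  set D := (B₁ + B₂) * |F| with hD
  have hD0 : 0 ≤ D := by positivity
  refine ⟨4 * M ^ 2 * D + 2 * C, by positivity,
    fun η φ P I ρ v ρa va f₁ f₂ h hPη hP s hs t ht => ?_⟩
  have hη := (h.pair s hs).z.nonneg
  have hφ := (h.snd.src₁ s hs).nonneg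
  have hP0 : 0 ≤ P := lpNorm_nonneg.trans (hP s hs)
  have ex : ∀ r, ∃ Γ : ℝ → ℂ, r ∈ I →
      HasWeakDeriv m (dzRhs K g (ρ r) (v r) (ρa r) (va r) (f₁ r) (f₂ r)) Γ ∧
      L2Bound (C * (η + φ)) Γ ∧ ∀ (ε p : ℝ) (h : ℝ → ℂ), 0 < ε → p ≤ η →
        L2Bound p (fun x => (gauge K n (ρ r x) : ℂ) *
          iteratedDeriv (m + 2) (dz K (ρ r) (v r) (ρa r) (va r)) x) →
        IsResolvent ε (fun x => soundWeight K (ρ r x)) (fun x => gaugeSq K n (ρ r x))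
          (iteratedDeriv (m + 2) (dz K (ρ r) (v r) (ρa r) (va r))) h →
        |(∫ x, Γ x * deriv (deriv (fun x => (gaugeSq K n (ρ r x) : ℂ) *
          (starRingEnd ℂ) (h x))) x).re| ≤ C * (η + φ) * p := fun r => by
    by_cases hr : r ∈ I
    · obtain ⟨Γ, hΓ⟩ := hC η φ _ _ _ _ _ _ (h.pair r hr) (h.snd.src₁ r hr) (h.snd.src₂ r hr)
      exact ⟨Γ, fun _ => hΓ⟩
    · exact ⟨0, fun h => absurd h hr⟩
  choose Γ hΓ using ex
  have eQ : ∀ r, deriv (deriv (iteratedDeriv m (dz K (ρ r) (v r) (ρa r) (va r))))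
      = iteratedDeriv (m + 2) (dz K (ρ r) (v r) (ρa r) (va r)) := fun r => by
    rw [← iteratedDeriv_succ, ← iteratedDeriv_succ]
  have hw : ∀ r ∈ I, IsWeight M (fun x => soundWeight K (ρ r x)) (fun x => gaugeSq K n (ρ r x))
      (fun x => gauge K n (ρ r x)) := fun r hr => by
    have E := hM _ _ (h.fst.reg r hr)
    exact ⟨E.one_le, E.sound, E.gauge.le (by omega), E.sound_ge, E.gauge_ge, E.inv, fun x => rfl,
      (contDiffOn_gauge hK hKpos n).continuousOn.comp_continuous E.continuous E.pos⟩
  have hρ : ∀ s ∈ I, ∀ t ∈ I, ∀ x, |ρ t x - ρ s x| ≤ |F| * |t - s| := fun s hs t ht x => by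
    have := h.fst.abs_density_sub_le h.ordConnected hF hs ht x
    rw [mul_zero, add_zero] at this
    exact this.trans (mul_le_mul_of_nonneg_right (le_abs_self _) (abs_nonneg _))
  have hE : ∀ r ∈ I, L2Bound P (fun x => (gauge K n (ρ r x) : ℂ) *
      iteratedDeriv (m + 2) (dz K (ρ r) (v r) (ρa r) (va r)) x) := fun r hr => by
    refine ⟨(hw r hr).l2_mul ((h.pair r hr).z.l2_iteratedDeriv le_rfl), ?_⟩
    have := hP r hr
    rwa [topNorm, ← hnm] at this
  have flow : EnergyFlow M D (C * (η + φ)) P (C * (η + φ) * P) I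
      (fun r x => soundWeight K (ρ r x)) (fun r x => gaugeSq K n (ρ r x))
      (fun r x => gauge K n (ρ r x)) (fun r => iteratedDeriv m (dz K (ρ r) (v r) (ρa r) (va r)))
      Γ := by
    refine ⟨h.ordConnected, hw, fun s hs t ht x => ?_, fun s hs t ht x => ?_,
      fun r hr => ⟨η, (h.pair r hr).z.iterated⟩, fun r hr => ?_, fun r hr => (hΓ r hr).2.1,
      fun r hr => ?_, fun r hr ε hε k hk => ?_⟩
    · refine (hB₁ _ ((h.fst.reg t ht).mem x) _ ((h.fst.reg s hs).mem x)).trans ?_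
      refine (mul_le_mul_of_nonneg_left (hρ s hs t ht x) hB1).trans ?_
      have : 0 ≤ B₂ * |F| * |t - s| := by positivity
      rw [hD]; linarith
    · refine (hB₂ _ ((h.fst.reg t ht).mem x) _ ((h.fst.reg s hs).mem x)).trans ?_
      refine (mul_le_mul_of_nonneg_left (hρ s hs t ht x) hB2).trans ?_
      have : 0 ≤ B₁ * |F| * |t - s| := by positivity
      rw [hD]; linarith
    · exact (h.hasWeakTimeDeriv_dz hK hKpos hg hL hr).weakDeriv hr
        (fun q hq => ((h.pair q hq).z.le (k := m) (by omega)).hasWeakDeriv) (hΓ r hr).1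
    · simp only [eQ]; exact hE r hr
    · simp only [eQ] at hk
      exact (hΓ r hr).2.2 ε P k hε hPη (hE r hr) hk
  have key := flow.abs_sub_le hs ht
  simp only [eQ, hnm] at key
  refine key.trans (mul_le_mul_of_nonneg_right ?_ (abs_nonneg _))
  have : 4 * M ^ 2 * D * P * P ≤ 4 * M ^ 2 * D * P * (η + φ) := by
    gcongr; linarith
  linarith

end PairFlow

/-! ### The gauged norm in time -/

section GaugedNorm

variable {K g : ℝ → ℝ}

/-- On a compact interval let x be a maximum point of p. Then (p(x) - p(y)) p(x) ≤ p(x)² - p(y)² ≤ c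
p(x)|x - y|, and p(x) cancels. Zeros of p, where the square root is not differentiable, cause no
trouble. -/
theorem abs_sub_le_of_sq_lipschitz {I : Set ℝ} (hI : I.OrdConnected) {p : ℝ → ℝ} {c η : ℝ}
    (hc : 0 ≤ c) (h0 : ∀ t, 0 ≤ p t) (hη : ∀ t ∈ I, p t ≤ η)
    (h : ∀ s ∈ I, ∀ t ∈ I, ∀ P ≤ η, (∀ r ∈ Icc s t, p r ≤ P) → ∀ x ∈ Icc s t, ∀ y ∈ Icc s t,
      |p y ^ 2 - p x ^ 2| ≤ c * P * |y - x|) {s t : ℝ} (hs : s ∈ I) (ht : t ∈ I) :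
    |p t - p s| ≤ c * |t - s| := by
  have main : ∀ s ∈ I, ∀ t ∈ I, s ≤ t → |p t - p s| ≤ c * |t - s| := by
    intro s hs t ht hst
    have hsub : Icc s t ⊆ I := hI.out hs ht
    have hη0 : 0 ≤ η := (h0 s).trans (hη s hs)
    have lip : LipschitzOnWith (c * η).toNNReal (fun x => p x ^ 2) (Icc s t) :=
      LipschitzOnWith.of_dist_le_mul fun x hx y hy => by
        rw [Real.coe_toNNReal _ (by positivity), Real.dist_eq, Real.dist_eq]
        exact h s hs t ht η le_rfl (fun r hr => hη r (hsub hr)) y hy x hx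
    have cont : ContinuousOn p (Icc s t) :=
      (lip.continuousOn.sqrt).congr fun x _ => (Real.sqrt_sq (h0 x)).symm
    obtain ⟨x, hx, hmax⟩ := isCompact_Icc.exists_isMaxOn (nonempty_Icc.2 hst) cont
    have one : ∀ y ∈ Icc s t, p x - p y ≤ c * |t - s| := by
      intro y hy
      rcases (h0 x).eq_or_lt with h1 | h1
      · have : 0 ≤ c * |t - s| := by positivity
        linarith [h0 y]
      · have h2 := h s hs t ht (p x) (hη x (hsub hx)) (fun r hr => hmax hr) y hy x hx
        have h3 : |x - y| ≤ |t - s| := by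
          rw [abs_of_nonneg (sub_nonneg.2 hst), abs_le]
          constructor <;> linarith [hx.1, hx.2, hy.1, hy.2]
        have h4 := (le_abs_self _).trans h2
        have h5 := mul_le_mul_of_nonneg_left h3 (mul_nonneg hc h1.le)
        have h6 : (p x - p y) * p x ≤ (c * |t - s|) * p x := by
          have : p y ≤ p x := hmax hy
          nlinarith [h0 y]
        exact le_of_mul_le_mul_right h6 h1
    have h1 := one s (left_mem_Icc.2 hst)
    have h2 := one t (right_mem_Icc.2 hst)
    have h3 : p s ≤ p x := hmax (left_mem_Icc.2 hst)
    have h4 : p t ≤ p x := hmax (right_mem_Icc.2 hst)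
    rw [abs_le]
    constructor <;> linarith
  rcases le_total s t with hst | hst
  · exact main s hs t ht hst
  · rw [abs_sub_comm, abs_sub_comm t]
    exact main t ht s hs hst

theorem exists_topNorm_lipschitz (hK : ContDiffOn ℝ ∞ K (Ioi 0)) (hKpos : ∀ s > 0, 0 < K s)
    (hg : ContDiffOn ℝ ∞ g (Ioi 0)) (n m : ℕ) (hnm : m + 2 = 2 * n) {L : ℝ} (hL : 0 < L) :
    ∃ C, 0 ≤ C ∧ ∀ (η φ : ℝ) (I : Set ℝ) (ρ v ρa va f₁ f₂ : ℝ → ℝ → ℝ),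
      PairFlow K g m L η φ I ρ v ρa va f₁ f₂ →
      (∀ t ∈ I, topNorm K n (ρ t) (v t) (ρa t) (va t) ≤ η) → ∀ s ∈ I, ∀ t ∈ I,
      |topNorm K n (ρ t) (v t) (ρa t) (va t) - topNorm K n (ρ s) (v s) (ρa s) (va s)|
        ≤ C * (η + φ) * |t - s| := by
  obtain ⟨C, hC0, hC⟩ := exists_topNorm_sq_lipschitz hK hKpos hg n m hnm hL
  refine ⟨C, hC0, fun η φ I ρ v ρa va f₁ f₂ h hp s hs t ht => ?_⟩
  have hη := (h.pair s hs).z.nonneg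
  have hφ := (h.snd.src₁ s hs).nonneg
  refine abs_sub_le_of_sq_lipschitz h.ordConnected
    (p := fun t => topNorm K n (ρ t) (v t) (ρa t) (va t)) (by positivity)
    (fun t => lpNorm_nonneg) hp (fun s hs t ht P hP hr x hx y hy => ?_) hs ht
  exact hC η φ P _ _ _ _ _ _ _ (h.mono (h.ordConnected.out hs ht) ordConnected_Icc) hP hr x hx y hy

/-- The gauged modified norm of the difference of two states. -/
noncomputable def gaugedNorm (K : ℝ → ℝ) (n : ℕ) (ρ v ρa va : ℝ → ℝ) : ℝ :=
  lpNorm (fun x => ρ x - ρa x) 2 volume + lpNorm (fun x => √(ρ x) • dz K ρ v ρa va x) 2 volume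
    + topNorm K n ρ v ρa va

/-- The weights are bounded below, so N controls Δz at orders 0 and 2n; interpolation gives the
orders between, and the density follows from Im Δz. The qualitative bound `A` does not enter the
constant. -/
theorem exists_regPair (hK : ContDiffOn ℝ ∞ K (Ioi 0)) (hKpos : ∀ s > 0, 0 < K s) (n m : ℕ)
    (hnm : m + 2 = 2 * n) {L : ℝ} (hL : 0 < L) :
    ∃ C, 1 ≤ C ∧ ∀ (A η : ℝ) (ρ v ρa va : ℝ → ℝ), RegState (m + 2) L ρ v →
      RegState (m + 4) L ρa va → Sob (m + 3) A (fun x => ρ x - ρa x) →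
      Sob (m + 2) A (fun x => v x - va x) → gaugedNorm K n ρ v ρa va ≤ η →
      RegPair K m L (C * η) ρ v ρa va := by
  obtain ⟨C₁, -, h₁⟩ := exists_sob_dz hK hKpos m hL
  obtain ⟨C₂, hC₂, h₂⟩ := exists_sob_density hK hKpos m hL (m + 3) le_rfl
  have csq : ContDiffOn ℝ ∞ (fun s : ℝ => (√s)⁻¹) (Ioi 0) :=
    (contDiffOn_id.sqrt fun s hs => (ne_of_gt hs)).inv fun s hs => (Real.sqrt_pos.2 hs).ne'
  obtain ⟨B₁, hB1, hB₁⟩ := exists_bound_Icc csq hL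
  obtain ⟨B₂, hB2, hB₂⟩ := exists_bound_Icc ((contDiffOn_gauge hK hKpos n).inv
    fun s hs => (gauge_pos hKpos n hs).ne') hL
  set N := 1 + B₁ + B₂ with hN
  have hN1 : 1 ≤ N := by linarith
  refine ⟨N + C₂ * N, by have : 0 ≤ C₂ * N := by positivity
                         linarith, fun A η ρ v ρa va h ha hρ hv hη => ?_⟩
  have hpos : ∀ x, 0 < ρ x := fun x => lt_of_lt_of_le (inv_pos.2 hL) (h.mem x).1
  have qz := h₁ A ρ v ρa va h ha hρ hv
  have n1 : 0 ≤ lpNorm (fun x => ρ x - ρa x) 2 volume := lpNorm_nonneg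
  have n2 : 0 ≤ lpNorm (fun x => √(ρ x) • dz K ρ v ρa va x) 2 volume := lpNorm_nonneg
  have n3 : 0 ≤ topNorm K n ρ v ρa va := lpNorm_nonneg
  rw [gaugedNorm] at hη
  have hη0 : 0 ≤ η := by linarith
  have weight : ∀ {f : ℝ → ℝ} {B : ℝ} {u : ℝ → ℂ}, 0 ≤ B → (∀ s ∈ Icc L⁻¹ L, ‖(f s)⁻¹‖ ≤ B) →
      ContDiffOn ℝ ∞ f (Ioi 0) → (∀ s > 0, 0 < f s) → MemLp u 2 volume →
      lpNorm (fun x => (f (ρ x) : ℂ) * u x) 2 volume ≤ η → lpNorm u 2 volume ≤ B * η := by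
    intro f B u hB0 hB hf hfp hu hle
    obtain ⟨Bf, hBf0, hBf⟩ := exists_bound_Icc hf hL
    have cf : Continuous fun x => f (ρ x) :=
      hf.continuousOn.comp_continuous h.density.2.1.continuous hpos
    have l : L2Bound η (fun x => (f (ρ x) : ℂ) * u x) :=
      ⟨((show L2Bound _ u from ⟨hu, le_rfl⟩).ofReal_mul cf.aestronglyMeasurable hBf0
        fun x => hBf _ (h.mem x)).1, hle⟩
    refine (l.of_le hB0 hu.1 (Eventually.of_forall fun x => ?_)).2
    have h1 := hB _ (h.mem x)
    have h2 := hfp _ (hpos x)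
    rw [norm_inv, Real.norm_of_nonneg h2.le] at h1
    rw [norm_mul, Complex.norm_real, Real.norm_of_nonneg h2.le, ← mul_assoc]
    refine le_mul_of_one_le_left (norm_nonneg _) ?_
    have := mul_le_mul_of_nonneg_right h1 h2.le
    rwa [inv_mul_cancel₀ h2.ne'] at this
  have z0 : lpNorm (dz K ρ v ρa va) 2 volume ≤ N * η := by
    refine (weight (f := fun s => √s) hB1 hB₁ (contDiffOn_id.sqrt fun s hs => (ne_of_gt hs))
      (fun s hs => Real.sqrt_pos.2 hs) qz.l2.1 ?_).trans ?_
    · have : (fun x => √(ρ x) • dz K ρ v ρa va x) = fun x => ((√(ρ x) : ℝ) : ℂ) * dz K ρ v ρa va x :=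
        funext fun x => Complex.real_smul
      rw [this] at hη n2
      linarith
    · exact mul_le_mul_of_nonneg_right (by linarith) hη0
  have ztop : lpNorm (iteratedDeriv (m + 2) (dz K ρ v ρa va)) 2 volume ≤ N * η := by
    refine (weight (f := gauge K n) hB2 hB₂ (contDiffOn_gauge hK hKpos n)
      (fun s hs => gauge_pos hKpos n hs) (qz.l2_iteratedDeriv le_rfl).1 ?_).trans ?_
    · rw [topNorm, ← hnm] at hη n3
      linarith
    · exact mul_le_mul_of_nonneg_right (by linarith) hη0
  have z := qz.interpolate z0 ztop
  have d := h₂ (N * η) ρ v ρa va h ha ⟨hρ.l2.1, by nlinarith⟩ z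
  refine ⟨h, ha, d.mono ?_, z.mono ?_⟩
  · have : 0 ≤ N * η := by positivity
    linarith
  · have : 0 ≤ C₂ * N * η := by positivity
    linarith

/-- An a priori bound for N, needed to start the local Lipschitz estimate, which presupposes some
upper bound η. -/
theorem exists_gaugedNorm_le (hK : ContDiffOn ℝ ∞ K (Ioi 0)) (hKpos : ∀ s > 0, 0 < K s) (n m : ℕ)
    (hnm : m + 2 = 2 * n) {L : ℝ} (hL : 0 < L) :
    ∃ C, 0 ≤ C ∧ ∀ (A : ℝ) (ρ v ρa va : ℝ → ℝ), RegState (m + 2) L ρ v →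
      RegState (m + 4) L ρa va → Sob (m + 3) A (fun x => ρ x - ρa x) →
      Sob (m + 2) A (fun x => v x - va x) → gaugedNorm K n ρ v ρa va ≤ C * A := by
  obtain ⟨C₁, hC1, h₁⟩ := exists_sob_dz hK hKpos m hL
  obtain ⟨B₁, hB1, hB₁⟩ := exists_bound_Icc (f := fun s : ℝ => √s)
    (contDiffOn_id.sqrt fun s hs => (ne_of_gt hs)) hL
  obtain ⟨B₂, hB2, hB₂⟩ := exists_bound_Icc (contDiffOn_gauge hK hKpos n) hL
  refine ⟨1 + B₁ * C₁ + B₂ * C₁, by positivity, fun A ρ v ρa va h ha hρ hv => ?_⟩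
  have qz := h₁ A ρ v ρa va h ha hρ hv
  have hpos : ∀ x, 0 < ρ x := fun x => lt_of_lt_of_le (inv_pos.2 hL) (h.mem x).1
  have cρ := h.density.2.1.continuous
  have b1 : L2Bound (B₁ * (C₁ * A)) fun x => ((√(ρ x) : ℝ) : ℂ) * dz K ρ v ρa va x :=
    qz.l2.ofReal_mul (Real.continuous_sqrt.comp cρ).aestronglyMeasurable hB1
      fun x => hB₁ _ (h.mem x)
  have b2 : L2Bound (B₂ * (C₁ * A)) fun x => (gauge K n (ρ x) : ℂ) *
      iteratedDeriv (2 * n) (dz K ρ v ρa va) x := by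
    rw [← hnm]
    exact (qz.l2_iteratedDeriv le_rfl).ofReal_mul
      ((contDiffOn_gauge hK hKpos n).continuousOn.comp_continuous cρ hpos).aestronglyMeasurable hB2
      fun x => hB₂ _ (h.mem x)
  have e : (fun x => √(ρ x) • dz K ρ v ρa va x) = fun x => ((√(ρ x) : ℝ) : ℂ) * dz K ρ v ρa va x :=
    funext fun x => Complex.real_smul
  have := hρ.l2.2
  have := b1.2
  have := b2.2
  rw [gaugedNorm, topNorm, e]
  linarith

theorem exists_gaugedNorm_lipschitz (hK : ContDiffOn ℝ ∞ K (Ioi 0)) (hKpos : ∀ s > 0, 0 < K s)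
    (hg : ContDiffOn ℝ ∞ g (Ioi 0)) (n m : ℕ) (hnm : m + 2 = 2 * n) {L : ℝ} (hL : 0 < L) :
    ∃ C, 0 ≤ C ∧ ∀ (A η φ : ℝ) (I : Set ℝ) (ρ v ρa va f₁ f₂ : ℝ → ℝ → ℝ), I.OrdConnected →
      IsFlow K g (m + 2) 0 L 0 I ρ v (fun _ _ => 0) (fun _ _ => 0) →
      IsFlow K g (m + 4) (m + 2) L φ I ρa va f₁ f₂ →
      (∀ t ∈ I, Sob (m + 3) A (fun x => ρ t x - ρa t x)) →
      (∀ t ∈ I, Sob (m + 2) A (fun x => v t x - va t x)) →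
      (∀ t ∈ I, gaugedNorm K n (ρ t) (v t) (ρa t) (va t) ≤ η) → ∀ s ∈ I, ∀ t ∈ I,
      |gaugedNorm K n (ρ t) (v t) (ρa t) (va t) - gaugedNorm K n (ρ s) (v s) (ρa s) (va s)|
        ≤ C * (η + φ) * |t - s| := by
  obtain ⟨R, hR1, hR⟩ := exists_regPair hK hKpos n m hnm hL
  obtain ⟨C₁, h01, h₁⟩ := exists_density_lipschitz K g m L
  obtain ⟨C₂, h02, h₂⟩ := exists_weighted_lipschitz hK hKpos hg m hL
  obtain ⟨C₃, h03, h₃⟩ := exists_topNorm_lipschitz hK hKpos hg n m hnm hL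
  refine ⟨(C₁ + C₂ + C₃) * R, by positivity,
    fun A η φ I ρ v ρa va f₁ f₂ hI hf ha hρ hv hN s hs t ht => ?_⟩
  have hP : PairFlow K g m L (R * η) φ I ρ v ρa va f₁ f₂ := ⟨hI, hf, ha, fun t ht =>
    hR A η _ _ _ _ (hf.reg t ht) (ha.reg t ht) (hρ t ht) (hv t ht) (hN t ht)⟩
  have hφ := (ha.src₁ s hs).nonneg
  have n1 : ∀ t, 0 ≤ lpNorm (fun x => ρ t x - ρa t x) 2 volume := fun _ => lpNorm_nonneg
  have n2 : ∀ t, 0 ≤ lpNorm (fun x => √(ρ t x) • dz K (ρ t) (v t) (ρa t) (va t) x) 2 volume :=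
    fun _ => lpNorm_nonneg
  have hη : 0 ≤ η := (add_nonneg (add_nonneg (n1 s) (n2 s)) lpNorm_nonneg).trans (hN s hs)
  have a1 := abs_lpNorm_sub_le (hρ t ht).l2.1 (hρ s hs).l2.1 (h₁ _ φ I _ _ _ _ _ _ hP s hs t ht).2
  have a2 := h₂ _ φ I _ _ _ _ _ _ hP s hs t ht
  have a3 := h₃ _ φ I _ _ _ _ _ _ hP (fun t ht => by
    have h4 := hN t ht
    rw [gaugedNorm] at h4
    have h5 := n1 t
    have h6 := n2 t
    nlinarith) s hs t ht
  have hb : ∀ C, 0 ≤ C → C * (R * η + φ) * |t - s| ≤ C * R * (η + φ) * |t - s| := fun C hC => by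
    have : R * η + φ ≤ R * (η + φ) := by nlinarith
    calc C * (R * η + φ) * |t - s| ≤ C * (R * (η + φ)) * |t - s| := by gcongr
      _ = _ := by ring
  have b1 := abs_le.1 (a1.trans (hb C₁ h01))
  have b2 := abs_le.1 (a2.trans (hb C₂ h02))
  have b3 := abs_le.1 (a3.trans (hb C₃ h03))
  simp only [gaugedNorm]
  rw [abs_le]
  constructor <;> linarith [b1.1, b1.2, b2.1, b2.2, b3.1, b3.2]

end GaugedNorm

/-! ### Representatives and reference states -/

section Representatives

theorem Sob.of_ae {m : ℕ} {M : ℝ} {u v : ℝ → ℝ} (h : Sob m M v) (hv : v =ᵐ[volume] u) :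
    Sob m (normH m u) v :=
  h.of_lpNorm fun k hk => by
    rw [← lpNorm_congr_ae' (h.weakDeriv_ae hk hv)]
    exact lpNorm_weakDeriv_le_normH hk u

theorem normHH_nonneg (k : ℕ) (U : ℝ → ℝ × ℝ) : 0 ≤ normHH k U := Real.sqrt_nonneg _

theorem normH_fst_le_normHH (k : ℕ) (U : ℝ → ℝ × ℝ) :
    normH (k + 1) (fun x => (U x).1) ≤ normHH k U :=
  Real.le_sqrt_of_sq_le (le_add_of_nonneg_right (sq_nonneg _))

theorem normH_snd_le_normHH (k : ℕ) (U : ℝ → ℝ × ℝ) :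
    normH k (fun x => (U x).2) ≤ normHH k U :=
  Real.le_sqrt_of_sq_le (le_add_of_nonneg_left (sq_nonneg _))

/-- Regular representatives of a continuous curve. -/
theorem ContInHH.exists_rep {k : ℕ} {I : Set ℝ} {U : ℝ → ℝ → ℝ × ℝ} (h : ContInHH k I U) :
    ∃ r u : ℝ → ℝ → ℝ, (∀ t ∈ I, r t =ᵐ[volume] (fun x => (U t x).1) ∧
      u t =ᵐ[volume] (fun x => (U t x).2)) ∧
      ∀ t₀ ∈ I, ∀ A > normHH k (U t₀), ∀ ε > 0, ∀ᶠ t in 𝓝[I] t₀,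
        Sob (k + 1) A (r t) ∧ Sob k A (u t) ∧ Sob (k + 1) ε (fun x => r t x - r t₀ x) := by
  have ex : ∀ t, ∃ r u : ℝ → ℝ, t ∈ I → r =ᵐ[volume] (fun x => (U t x).1) ∧
      u =ᵐ[volume] (fun x => (U t x).2) ∧ Sob (k + 1) (normHH k (U t)) r ∧
      Sob k (normHH k (U t)) u := fun t => by
    by_cases ht : t ∈ I
    · obtain ⟨r, hr, sr⟩ := (h.1 t ht).1.exists_sob
      obtain ⟨u, hu, su⟩ := (h.1 t ht).2.exists_sob
      exact ⟨r, u, fun _ => ⟨hr, hu, sr.mono (normH_fst_le_normHH k _),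
        su.mono (normH_snd_le_normHH k _)⟩⟩
    · exact ⟨0, 0, fun h => absurd h ht⟩
  choose r u hru using ex
  refine ⟨r, u, fun t ht => ⟨(hru t ht).1, (hru t ht).2.1⟩, fun t₀ ht₀ A hA ε hε => ?_⟩
  have hA' : 0 < A - normHH k (U t₀) := sub_pos.2 hA
  filter_upwards [(h.2 t₀ ht₀).eventually_lt_const (lt_min hε hA'), self_mem_nhdsWithin] with t h1 ht
  obtain ⟨e1, e2, s1, s2⟩ := hru t ht
  obtain ⟨e3, e4, s3, s4⟩ := hru t₀ ht₀
  have d1 : Sob (k + 1) (normHH k (U t - U t₀)) (fun x => r t x - r t₀ x) :=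
    ((s1.sub s3).of_ae (u := fun x => ((U t - U t₀) x).1) (e1.sub e3)).mono
      (normH_fst_le_normHH k _)
  have d2 : Sob k (normHH k (U t - U t₀)) (fun x => u t x - u t₀ x) :=
    ((s2.sub s4).of_ae (u := fun x => ((U t - U t₀) x).2) (e2.sub e4)).mono
      (normH_snd_le_normHH k _)
  have h2 := (lt_min_iff.1 h1).1
  have h3 := (lt_min_iff.1 h1).2
  exact ⟨((d1.add s3).mono (by linarith)).congr fun x => by ring,
    ((d2.add s4).mono (by linarith)).congr fun x => by ring, d1.mono h2.le⟩

theorem coef_of_contDiff {E : Type*} [NormedAddCommGroup E] [NormedSpace ℝ E] [CompleteSpace E]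
    {M : ℝ} : ∀ {k : ℕ} {u : ℝ → E}, ContDiff ℝ ∞ u →
      (∀ j ≤ k, ∀ x, ‖iteratedDeriv j u x‖ ≤ M) → Coef k M u
  | 0, u, hu, h => Coef.zero_of_bound (Eventually.of_forall fun x => by simpa using h 0 le_rfl x)
      hu.continuous.aestronglyMeasurable ((norm_nonneg _).trans (h 0 le_rfl 0))
  | k + 1, u, hu, h => by
    refine Coef.of_isPrim (fun x => by simpa using h 0 (by omega) x) (isPrim_of_contDiff hu)
      (coef_of_contDiff (by simpa using hu.iteratedDeriv_infty 1) fun j hj x => ?_)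
    rw [← iteratedDeriv_succ']
    exact h (j + 1) (by omega) x

variable {Vref : ℝ → ℝ → ℝ × ℝ}

theorem IsReferenceState.contDiff (h : IsReferenceState Vref) {t : ℝ} (ht : 0 ≤ t) :
    ContDiff ℝ ∞ (Vref t) := by
  rw [← contDiffOn_univ]
  exact h.smooth.comp (contDiff_const.prodMk contDiff_id).contDiffOn fun x _ => ⟨ht, mem_univ x⟩

theorem IsReferenceState.exists_coef (h : IsReferenceState Vref) (k : ℕ) :
    ∃ M, 0 ≤ M ∧ ∀ t ≥ 0, Coef k M (fun x => (Vref t x).1) ∧ Coef k M (fun x => (Vref t x).2) := by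
  choose M hM using fun j => h.bounded j 0
  refine ⟨∑ j ∈ Finset.range (k + 1), |M j|, Finset.sum_nonneg fun j _ => abs_nonneg _,
    fun t ht => ?_⟩
  have hc : Coef k (∑ j ∈ Finset.range (k + 1), |M j|) (Vref t) :=
    coef_of_contDiff (h.contDiff ht) fun j hj x => by
      have h1 := hM j t ht x
      simp only [mixedDeriv, iteratedDerivWithin_zero] at h1
      exact h1.trans ((le_abs_self _).trans (Finset.single_le_sum (f := fun j => |M j|)
        (fun j _ => abs_nonneg _) (Finset.mem_range.2 (by omega))))
  have c1 := hc.clm (ContinuousLinearMap.fst ℝ ℝ ℝ) zero_le_one fun x => by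
    rw [one_mul]; exact norm_fst_le x
  have c2 := hc.clm (ContinuousLinearMap.snd ℝ ℝ ℝ) zero_le_one fun x => by
    rw [one_mul]; exact norm_snd_le x
  rw [one_mul] at c1 c2
  exact ⟨c1, c2⟩

theorem IsReferenceState.exists_lipschitz (h : IsReferenceState Vref) :
    ∃ M, 0 ≤ M ∧ ∀ s ≥ 0, ∀ t ≥ 0, ∀ x, |(Vref t x).1 - (Vref s x).1| ≤ M * |t - s| := by
  obtain ⟨M, hM⟩ := h.bounded 0 1
  refine ⟨|M|, abs_nonneg _, fun s hs t ht x => ?_⟩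
  have hd : DifferentiableOn ℝ (fun s => Vref s x) (Ici 0) := by
    have := h.smooth.comp (contDiff_id.prodMk (contDiff_const (c := x))).contDiffOn
      (s := Ici (0 : ℝ)) fun s hs => ⟨hs, mem_univ x⟩
    exact this.differentiableOn (by simp)
  have := (convex_Ici (0 : ℝ)).norm_image_sub_le_of_norm_derivWithin_le (C := |M|) hd
    (fun r hr => by
      have h1 := hM r hr x
      simp only [mixedDeriv, iteratedDerivWithin_one, iteratedDeriv_zero] at h1
      exact h1.trans (le_abs_self _)) hs ht
  exact (norm_fst_le (Vref t x - Vref s x)).trans this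

/-- A density is bounded below in terms of the supremum norm of `1/ρ + 1/ρᵃ`. -/
theorem one_le_mul_lpNorm {V Va : ℝ → ℝ × ℝ} {ρ ρa : ℝ → ℝ} (hρ : Continuous ρ)
    (hρa : Continuous ρa) (h1 : (fun x => (V x).1) =ᵐ[volume] ρ)
    (h2 : (fun x => (Va x).1) =ᵐ[volume] ρa) (h3 : ∃ m > 0, ∀ᵐ x, m ≤ (V x).1)
    (h4 : ∃ m > 0, ∀ᵐ x, m ≤ (Va x).1) (x : ℝ) :
    1 ≤ ρ x * lpNorm (fun x => 1 / (V x).1 + 1 / (Va x).1) ⊤ volume ∧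
      1 ≤ ρa x * lpNorm (fun x => 1 / (V x).1 + 1 / (Va x).1) ⊤ volume := by
  obtain ⟨m₁, hm1, h3⟩ := h3
  obtain ⟨m₂, hm2, h4⟩ := h4
  set F : ℝ → ℝ := fun x => 1 / (V x).1 + 1 / (Va x).1 with hF
  have hFm : AEStronglyMeasurable F volume := by
    have : Measurable fun x => 1 / ρ x + 1 / ρa x :=
      (hρ.measurable.const_div 1).add (hρa.measurable.const_div 1)
    refine this.aestronglyMeasurable.congr ?_
    filter_upwards [h1, h2] with x e1 e2
    rw [hF, ← e1, ← e2]
  have hFt : MemLp F ⊤ volume := by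
    refine memLp_top_of_bound hFm (1 / m₁ + 1 / m₂) ?_
    filter_upwards [h3, h4] with x e1 e2
    have p1 := hm1.trans_le e1
    have p2 := hm2.trans_le e2
    rw [Real.norm_of_nonneg (by positivity)]
    exact add_le_add (one_div_le_one_div_of_le hm1 e1) (one_div_le_one_div_of_le hm2 e2)
  set Y := lpNorm F ⊤ volume with hY
  have hle : ∀ᵐ x, ‖F x‖ ≤ Y := by
    filter_upwards [ae_le_eLpNormEssSup (f := F) (μ := volume)] with x hx
    rw [hY, ← toReal_eLpNorm hFm, eLpNorm_exponent_top, ← toReal_enorm]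
    refine ENNReal.toReal_mono ?_ hx
    rw [← eLpNorm_exponent_top]
    exact hFt.2.ne
  -- An almost everywhere inequality between continuous functions holds everywhere; it is rephrased
  -- as the equality of a minimum with 1.
  have every : ∀ {σ : ℝ → ℝ}, Continuous σ → (∀ᵐ x, 1 ≤ σ x * Y) → ∀ x, 1 ≤ σ x * Y := by
    intro σ hσ hae x
    have e : (fun x => min (σ x * Y) 1) =ᵐ[volume] fun _ => 1 := hae.mono fun x hx => min_eq_right hx
    have := congrFun ((((hσ.mul continuous_const).min continuous_const).ae_eq_iff_eq volume
      continuous_const).1 e) x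
    exact min_eq_right_iff.1 this
  have key : (∀ᵐ x, 1 ≤ ρ x * Y) ∧ ∀ᵐ x, 1 ≤ ρa x * Y := by
    constructor <;> filter_upwards [h1, h2, h3, h4, hle] with x e1 e2 e3 e4 e5
    all_goals
      have p1 := hm1.trans_le e3
      have p2 := hm2.trans_le e4
      rw [Real.norm_of_nonneg (by rw [hF]; positivity)] at e5
    · rw [← e1]
      have : 1 / (V x).1 ≤ Y := le_trans (le_add_of_nonneg_right (by positivity)) e5
      rwa [div_le_iff₀' p1] at this
    · rw [← e2]
      have : 1 / (Va x).1 ≤ Y := le_trans (le_add_of_nonneg_left (by positivity)) e5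
      rwa [div_le_iff₀' p2] at this
  exact ⟨every hρ key.1 x, every hρa key.2 x⟩

theorem zVar_ae_eq {K : ℝ → ℝ} {k : ℕ} {L : ℝ} {V : ℝ → ℝ × ℝ} {ρ v : ℝ → ℝ}
    (h : RegState k L ρ v) (h1 : (fun x => (V x).1) =ᵐ[volume] ρ)
    (h2 : (fun x => (V x).2) =ᵐ[volume] v) : zVar K V =ᵐ[volume] zRep K ρ v := by
  have w1 := weakDeriv_ae (h.density.2.1.hasWeakDeriv.congr h1.symm (ae_eq_refl _))
  filter_upwards [h1, h2, w1] with x e1 e2 e3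
  simp only [zVar, zRep, wRep, gradWeight, e1, e2, e3]
  apply Complex.ext <;> simp

theorem modNorm_eq_gaugedNorm {K : ℝ → ℝ} {n k : ℕ} {L A : ℝ} {V Va : ℝ → ℝ × ℝ}
    {ρ v ρa va : ℝ → ℝ} (h : RegState k L ρ v) (ha : RegState k L ρa va)
    (h1 : (fun x => (V x).1) =ᵐ[volume] ρ) (h2 : (fun x => (V x).2) =ᵐ[volume] v)
    (h3 : (fun x => (Va x).1) =ᵐ[volume] ρa) (h4 : (fun x => (Va x).2) =ᵐ[volume] va)
    (hz : Sob (2 * n) A (dz K ρ v ρa va)) :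
    MemH (2 * n) (deltaZ K V Va) ∧ modNorm K n V Va = gaugedNorm K n ρ v ρa va := by
  have e : deltaZ K V Va =ᵐ[volume] dz K ρ v ρa va :=
    (zVar_ae_eq h h1 h2).sub (zVar_ae_eq ha h3 h4)
  have ew := hz.weakDeriv_ae le_rfl e.symm
  refine ⟨hz.memH e.symm, ?_⟩
  rw [modNorm, gaugedNorm, topNorm]
  congr 1
  · congr 1
    · refine lpNorm_congr_ae' ?_
      filter_upwards [h1, h3] with x e1 e3
      rw [e1, e3]
    · refine lpNorm_congr_ae' ?_
      filter_upwards [h1, e] with x e1 e2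
      rw [e1, e2]
  · refine lpNorm_congr_ae' ?_
    filter_upwards [h1, ew] with x e1 e2
    rw [e1, e2, Complex.real_smul]

end Representatives

/-! ### Localization in time -/

section Localization

variable {K g : ℝ → ℝ}

theorem IsSolution.mono {f : ℝ → ℝ → ℝ × ℝ} {I J : Set ℝ} {V : ℝ → ℝ → ℝ × ℝ}
    (h : IsSolution K g f I V) (hJ : J ⊆ I) : IsSolution K g f J V :=
  fun φ h1 h2 t ht => (h φ h1 h2 t (hJ ht)).mono hJ

/-- The argument of the constant in the estimate. -/
noncomputable def sizeAt (n : ℕ) (Vref V Va : ℝ → ℝ → ℝ × ℝ) (t : ℝ) : ℝ :=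
  normHH (2 * n) (V t - Vref t) + normHH (2 * n + 2) (Va t - Vref t)
    + lpNorm (fun x => 1 / (V t x).1 + 1 / (Va t x).1) ⊤ volume

theorem sizeAt_nonneg (n : ℕ) (Vref V Va : ℝ → ℝ → ℝ × ℝ) (t : ℝ) : 0 ≤ sizeAt n Vref V Va t :=
  add_nonneg (add_nonneg (normHH_nonneg _ _) (normHH_nonneg _ _)) lpNorm_nonneg

/-- Only the size at t₀ enters L. The summand 1 leaves room for variation in time, the factor 2
comes from the Sobolev embedding, and `M` bounds the reference state. The representatives are fixed
before t₀, so they do not depend on it. -/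
theorem exists_local_flow (hK : ContDiffOn ℝ ∞ K (Ioi 0)) (hKpos : ∀ s > 0, 0 < K s)
    (hg : ContDiffOn ℝ ∞ g (Ioi 0)) (n m : ℕ) (hnm : m + 2 = 2 * n) {Vref : ℝ → ℝ → ℝ × ℝ}
    (hVref : IsReferenceState Vref) :
    ∃ M, 0 ≤ M ∧ ∀ I : Set ℝ, I ⊆ Ici 0 → ∀ V Va fa : ℝ → ℝ → ℝ × ℝ,
      ContInHH (2 * n) I (V - Vref) → ContInHH (2 * n + 2) I (Va - Vref) →
      ContInHH (2 * n) I fa → NoVacuum I V → NoVacuum I Va →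
      IsSolution K g 0 I V → IsSolution K g fa I Va →
      ∃ ρ v ρa va f₁ f₂ : ℝ → ℝ → ℝ, ∀ t₀ ∈ I, ∀ L ≥ 2 * (sizeAt n Vref V Va t₀ + 1) + M,
        ∀ φ > normHH (2 * n) (fa t₀), ∃ δ > 0,
        IsFlow K g (m + 2) 0 L 0 (Metric.ball t₀ δ ∩ I) ρ v (fun _ _ => 0) (fun _ _ => 0) ∧
        IsFlow K g (m + 4) (m + 2) L φ (Metric.ball t₀ δ ∩ I) ρa va f₁ f₂ ∧
        (∀ t ∈ Metric.ball t₀ δ ∩ I, Sob (m + 3) (2 * L) (fun x => ρ t x - ρa t x)) ∧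
        (∀ t ∈ Metric.ball t₀ δ ∩ I, Sob (m + 2) (2 * L) (fun x => v t x - va t x)) ∧
        ∀ t ∈ Metric.ball t₀ δ ∩ I, MemH (2 * n) (deltaZ K (V t) (Va t)) ∧
          modNorm K n (V t) (Va t) = gaugedNorm K n (ρ t) (v t) (ρa t) (va t) := by
  obtain ⟨M₁, hM1, hM₁⟩ := hVref.exists_coef (m + 5)
  obtain ⟨M₂, hM2, hM₂⟩ := hVref.exists_lipschitz
  refine ⟨M₁, hM1, fun I hI V Va fa hV hVa hfa nV nVa sV sVa => ?_⟩
  obtain ⟨r, u, hru, hr⟩ := hV.exists_rep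
  obtain ⟨ra, ua, hrua, hra⟩ := hVa.exists_rep
  obtain ⟨f₁, f₂, hf, hfl⟩ := hfa.exists_rep
  rw [← hnm] at hr hra hfl
  set ρ : ℝ → ℝ → ℝ := fun t x => r t x + (Vref t x).1 with hρ
  set v : ℝ → ℝ → ℝ := fun t x => u t x + (Vref t x).2 with hv
  set ρa : ℝ → ℝ → ℝ := fun t x => ra t x + (Vref t x).1 with hρa
  set va : ℝ → ℝ → ℝ := fun t x => ua t x + (Vref t x).2 with hva
  have e1 : ∀ t ∈ I, (fun x => (V t x).1) =ᵐ[volume] ρ t := fun t ht => by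
    filter_upwards [(hru t ht).1] with x hx
    simp [hρ, hx]
  have e2 : ∀ t ∈ I, (fun x => (V t x).2) =ᵐ[volume] v t := fun t ht => by
    filter_upwards [(hru t ht).2] with x hx
    simp [hv, hx]
  have e3 : ∀ t ∈ I, (fun x => (Va t x).1) =ᵐ[volume] ρa t := fun t ht => by
    filter_upwards [(hrua t ht).1] with x hx
    simp [hρa, hx]
  have e4 : ∀ t ∈ I, (fun x => (Va t x).2) =ᵐ[volume] va t := fun t ht => by
    filter_upwards [(hrua t ht).2] with x hx
    simp [hva, hx]
  refine ⟨ρ, v, ρa, va, f₁, f₂, fun t₀ ht₀ L hL φ hφ => ?_⟩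
  set S := sizeAt n Vref V Va t₀ with hS
  have hS0 : 0 ≤ S := sizeAt_nonneg _ _ _ _ _
  have hL0 : 0 < L := by linarith
  set Y := lpNorm (fun x => 1 / (V t₀ x).1 + 1 / (Va t₀ x).1) ⊤ volume with hY
  have n1 : 0 ≤ normHH (2 * n) (V t₀ - Vref t₀) := normHH_nonneg _ _
  have n2 : 0 ≤ normHH (2 * n + 2) (Va t₀ - Vref t₀) := normHH_nonneg _ _
  have n3 : 0 ≤ Y := lpNorm_nonneg
  have hSe : S = normHH (2 * n) (V t₀ - Vref t₀) + normHH (2 * n + 2) (Va t₀ - Vref t₀) + Y := rfl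
  have hA1 : normHH (m + 2) ((V - Vref) t₀) < S + 1 := by
    rw [hnm]
    show normHH (2 * n) (V t₀ - Vref t₀) < S + 1
    linarith
  have hA2 : normHH (m + 2 + 2) ((Va - Vref) t₀) < S + 1 := by
    rw [hnm]
    show normHH (2 * n + 2) (Va t₀ - Vref t₀) < S + 1
    linarith
  have hφ' : normHH (m + 2) (fa t₀) < φ := by rw [hnm]; exact hφ
  have cref : ∀ t ∈ I, Continuous fun x => (Vref t x).1 := fun t ht =>
    continuous_fst.comp (hVref.contDiff (hI ht)).continuous
  have cont : Continuous (ρ t₀) ∧ Continuous (ρa t₀) := by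
    have h1 := (hr t₀ ht₀ _ hA1 1 one_pos).self_of_nhdsWithin ht₀
    have h2 := (hra t₀ ht₀ _ hA2 1 one_pos).self_of_nhdsWithin ht₀
    exact ⟨h1.1.2.1.continuous.add (cref t₀ ht₀), h2.1.2.1.continuous.add (cref t₀ ht₀)⟩
  have low := one_le_mul_lpNorm cont.1 cont.2 (e1 t₀ ht₀) (e3 t₀ ht₀) (nV t₀ ht₀) (nVa t₀ ht₀)
  have hY0 : 0 < Y := by
    rcases n3.eq_or_lt with h | h
    · have := (low 0).1
      rw [← hY, ← h, mul_zero] at this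
      linarith
    · exact h
  have hYL : L⁻¹ < Y⁻¹ := inv_strictAnti₀ hY0 (by linarith)
  -- The gap between the lower bound 1/Y of the densities at t₀ and the bound 1/L wanted nearby.
  -- Half of it covers the variation of the perturbation (2 · κ/4 by the embedding), half that of
  -- the reference state.
  set κ := Y⁻¹ - L⁻¹ with hκ
  have hκ0 : 0 < κ := sub_pos.2 hYL
  have ev := (hr t₀ ht₀ _ hA1 (κ / 4) (by positivity)).and
    ((hra t₀ ht₀ _ hA2 (κ / 4) (by positivity)).and (hfl t₀ ht₀ φ hφ' 1 one_pos))
  have evt : ∀ᶠ t in 𝓝[I] t₀, |t - t₀| < κ / (2 * (M₂ + 1)) := by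
    refine eventually_nhdsWithin_of_eventually_nhds ?_
    filter_upwards [Metric.ball_mem_nhds t₀ (show 0 < κ / (2 * (M₂ + 1)) by positivity)] with t ht
    rwa [Metric.mem_ball, Real.dist_eq] at ht
  obtain ⟨δ, hδ, hball⟩ := Metric.mem_nhdsWithin_iff.1 (ev.and evt)
  have lower : ∀ {r : ℝ → ℝ → ℝ} {t : ℝ}, t ∈ I → |t - t₀| < κ / (2 * (M₂ + 1)) →
      Sob (m + 1) (κ / 4) (fun x => r t x - r t₀ x) →
      (∀ x, 1 ≤ (r t₀ x + (Vref t₀ x).1) * Y) → ∀ x, L⁻¹ ≤ r t x + (Vref t x).1 := by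
    intro r t ht h1 h2 h3 x
    have a1 := (abs_le.1 (h2.norm_le x)).1
    have a2 := (abs_le.1 (hM₂ t₀ (hI ht₀) t (hI ht) x)).1
    have a3 : Y⁻¹ ≤ r t₀ x + (Vref t₀ x).1 := by
      rw [inv_le_iff_one_le_mul₀ hY0]; exact h3 x
    have a4 : M₂ * |t - t₀| ≤ κ / 2 := by
      rw [lt_div_iff₀ (by positivity)] at h1
      nlinarith [abs_nonneg (t - t₀)]
    linarith
  have regV : ∀ t ∈ Metric.ball t₀ δ ∩ I, RegState (m + 2) L (ρ t) (v t) := fun t ht => by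
    obtain ⟨⟨⟨s1, s2, s3⟩, -⟩, hb⟩ := hball ht
    have cr := hM₁ t (hI ht.2)
    have c1 : Coef (m + 3) (2 * (S + 1) + M₁) (ρ t) := s1.coef.add (cr.1.le (by omega))
    have c2 : Coef (m + 2) (2 * (S + 1) + M₁) (v t) := s2.coef.add (cr.2.le (by omega))
    exact ⟨c1.mono hL, c2.mono hL, fun x => ⟨lower ht.2 hb (s3.le (by omega)) (fun x => (low x).1) x,
      ((le_abs_self _).trans (c1.1 x)).trans hL⟩⟩
  have regVa : ∀ t ∈ Metric.ball t₀ δ ∩ I, RegState (m + 4) L (ρa t) (va t) := fun t ht => by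
    obtain ⟨⟨-, ⟨s1, s2, s3⟩, -⟩, hb⟩ := hball ht
    have cr := hM₁ t (hI ht.2)
    have c1 : Coef (m + 5) (2 * (S + 1) + M₁) (ρa t) := s1.coef.add (cr.1.le (by omega))
    have c2 : Coef (m + 4) (2 * (S + 1) + M₁) (va t) := s2.coef.add (cr.2.le (by omega))
    exact ⟨c1.mono hL, c2.mono hL, fun x => ⟨lower ht.2 hb (s3.le (by omega)) (fun x => (low x).2) x,
      ((le_abs_self _).trans (c1.1 x)).trans hL⟩⟩
  have dρ : ∀ t ∈ Metric.ball t₀ δ ∩ I, Sob (m + 3) (2 * L) (fun x => ρ t x - ρa t x) :=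
    fun t ht => by
      obtain ⟨⟨⟨s1, -, -⟩, ⟨s2, -, -⟩, -⟩, -⟩ := hball ht
      exact ((s1.sub (s2.le (k := m + 3) (by omega))).mono (by linarith)).congr fun x => by
        simp only [hρ, hρa]; ring
  have dv : ∀ t ∈ Metric.ball t₀ δ ∩ I, Sob (m + 2) (2 * L) (fun x => v t x - va t x) :=
    fun t ht => by
      obtain ⟨⟨⟨-, s1, -⟩, ⟨-, s2, -⟩, -⟩, -⟩ := hball ht
      exact ((s1.sub (s2.le (k := m + 2) (by omega))).mono (by linarith)).congr fun x => by
        simp only [hv, hva]; ring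
  have srcs : ∀ t ∈ Metric.ball t₀ δ ∩ I, Sob (m + 3) φ (f₁ t) ∧ Sob (m + 2) φ (f₂ t) :=
    fun t ht => by
      obtain ⟨⟨-, -, s1, s2, -⟩, -⟩ := hball ht
      exact ⟨s1, s2⟩
  have z0 : ∀ k, Sob k (0 : ℝ) (fun _ : ℝ => (0 : ℝ)) := fun k => by
    induction k with
    | zero => exact ⟨MemLp.zero', by simp⟩
    | succ k ih =>
      exact Sob.of_isPrim ih.l2 (u' := fun _ => 0)
        (isPrim_of_hasDerivAt (fun x => hasDerivAt_const x 0) continuous_const) ih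
  refine ⟨δ, hδ, ⟨regV, fun t _ => z0 _, fun t _ => z0 _, fun t ht => ?_, fun t ht => ?_⟩,
    ⟨regVa, fun t ht => (srcs t ht).1, fun t ht => (srcs t ht).2, fun t ht => ?_, fun t ht => ?_⟩,
    dρ, dv, fun t ht => ?_⟩
  · exact ((sV.mono inter_subset_right).hasWeakTimeDeriv hK hKpos hg hL0 (fun s hs => e1 s hs.2)
      (fun s hs => e2 s hs.2) regV ht (f₁ := fun _ => 0) (f₂ := fun _ => 0) (ae_eq_refl _)
      (ae_eq_refl _) (z0 0).locallyIntegrable (z0 0).locallyIntegrable).1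
  · exact ((sV.mono inter_subset_right).hasWeakTimeDeriv hK hKpos hg hL0 (fun s hs => e1 s hs.2)
      (fun s hs => e2 s hs.2) regV ht (f₁ := fun _ => 0) (f₂ := fun _ => 0) (ae_eq_refl _)
      (ae_eq_refl _) (z0 0).locallyIntegrable (z0 0).locallyIntegrable).2
  · exact ((sVa.mono inter_subset_right).hasWeakTimeDeriv hK hKpos hg (k := m + 2) hL0
      (fun s hs => e3 s hs.2) (fun s hs => e4 s hs.2) regVa ht (hf t ht.2).1.symm (hf t ht.2).2.symm
      (srcs t ht).1.locallyIntegrable (srcs t ht).2.locallyIntegrable).1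
  · exact ((sVa.mono inter_subset_right).hasWeakTimeDeriv hK hKpos hg (k := m + 2) hL0
      (fun s hs => e3 s hs.2) (fun s hs => e4 s hs.2) regVa ht (hf t ht.2).1.symm (hf t ht.2).2.symm
      (srcs t ht).1.locallyIntegrable (srcs t ht).2.locallyIntegrable).2
  · obtain ⟨C, -, hC⟩ := exists_sob_dz hK hKpos m hL0
    have hz := hC _ _ _ _ _ (regV t ht) (regVa t ht) (dρ t ht) (dv t ht)
    rw [hnm] at hz
    exact modNorm_eq_gaugedNorm (regV t ht) ((regVa t ht).le (by omega)) (e1 t ht.2) (e2 t ht.2)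
      (e3 t ht.2) (e4 t ht.2) hz

end Localization

/-! ### The Lipschitz bound for the gauged norm and its derivative -/

section Glue

/-- The sums of |c_j| over j ≤ ⌊s⌋ form a nondecreasing step function h, and 1 + ∫₀^{y+1} h is
continuous, nondecreasing and at least the integral of h over [y, y+1], hence at least h(y). -/
theorem exists_continuous_monotone_ge (c : ℕ → ℝ) :
    ∃ C : ℝ → ℝ, ContinuousOn C (Ici 0) ∧ MonotoneOn C (Ici 0) ∧ (∀ y ≥ 0, 0 < C y) ∧
      ∀ y ≥ 0, c ⌊y⌋₊ ≤ C y := by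
  set h : ℝ → ℝ := fun s => ∑ j ∈ Finset.range (⌊s⌋₊ + 1), |c j| with hh
  have hmono : Monotone h := fun a b hab =>
    Finset.sum_le_sum_of_subset_of_nonneg
      (Finset.range_mono (Nat.add_le_add_right (Nat.floor_mono hab) 1)) fun _ _ _ => abs_nonneg _
  have h0 : ∀ s, 0 ≤ h s := fun s => Finset.sum_nonneg fun _ _ => abs_nonneg _
  have hint : ∀ a b, IntervalIntegrable h volume a b := fun a b => hmono.intervalIntegrable
  have hadd : ∀ a b, (∫ s in (0 : ℝ)..b, h s) = (∫ s in (0 : ℝ)..a, h s) + ∫ s in a..b, h s :=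
    fun a b => (intervalIntegral.integral_add_adjacent_intervals (hint 0 a) (hint a b)).symm
  have hpos : ∀ y ≥ (0 : ℝ), 0 ≤ ∫ s in (0 : ℝ)..y, h s := fun y hy =>
    intervalIntegral.integral_nonneg hy fun s _ => h0 s
  refine ⟨fun y => 1 + ∫ s in (0 : ℝ)..(y + 1), h s, ?_, ?_, ?_, ?_⟩
  · exact (continuous_const.add ((intervalIntegral.continuous_primitive hint 0).comp
      (continuous_id.add continuous_const))).continuousOn
  · intro a _ b _ hab
    have := intervalIntegral.integral_nonneg (μ := volume) (by linarith : a + 1 ≤ b + 1)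
      fun s _ => h0 s
    simp only [hadd (a + 1) (b + 1)]
    linarith
  · intro y hy
    have := hpos (y + 1) (by linarith)
    simp only
    linarith
  · intro y hy
    have h1 : (∫ _ in y..(y + 1), h y) ≤ ∫ s in y..(y + 1), h s :=
      intervalIntegral.integral_mono_on (by linarith) intervalIntegrable_const (hint _ _)
        fun s hs => hmono hs.1
    rw [intervalIntegral.integral_const, add_sub_cancel_left, one_smul] at h1
    have h2 : |c ⌊y⌋₊| ≤ h y := Finset.single_le_sum (f := fun j => |c j|)
      (fun _ _ => abs_nonneg _) (Finset.self_mem_range_succ _)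
    have h3 := hpos y hy
    have h4 := le_abs_self (c ⌊y⌋₊)
    simp only [hadd y (y + 1)]
    linarith

theorem abs_derivWithin_le_of_eventually {N : ℝ → ℝ} {I : Set ℝ} {t₀ B : ℝ} (hB : 0 ≤ B)
    (hN : DifferentiableWithinAt ℝ N I t₀)
    (h : ∀ᶠ t in 𝓝[I] t₀, |N t - N t₀| ≤ B * |t - t₀|) : |derivWithin N I t₀| ≤ B := by
  by_cases hacc : AccPt t₀ (𝓟 I)
  · have : (𝓝[I \ {t₀}] t₀).NeBot := by
      rwa [accPt_principal_iff_nhdsWithin] at hacc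
    have ht := (hasDerivWithinAt_iff_tendsto_slope.1 hN.hasDerivWithinAt).abs
    refine le_of_tendsto ht ?_
    filter_upwards [h.filter_mono (nhdsWithin_mono _ sdiff_subset), self_mem_nhdsWithin] with t h1 h2
    have h3 : 0 < |t - t₀| := abs_pos.2 (sub_ne_zero.2 h2.2)
    rw [slope_def_field, abs_div, div_le_iff₀ h3]
    exact h1
  -- At a point that is not an accumulation point the derivative is zero by convention.
  · rw [derivWithin_zero_of_not_accPt hacc, abs_zero]
    exact hB

/-- Rademacher's theorem near each point; a set that is locally null is null. -/
theorem ae_differentiableWithinAt_of_locallyLipschitzOn {N : ℝ → ℝ} {I : Set ℝ}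
    (h : LocallyLipschitzOn I N) : ∀ᵐ t, t ∈ I → DifferentiableWithinAt ℝ N I t := by
  rw [ae_iff]
  refine measure_null_of_locally_null _ fun t₀ ht₀ => ?_
  have hI : t₀ ∈ I := by
    by_contra hc
    exact ht₀ fun h => absurd h hc
  obtain ⟨k, s, hs, hk⟩ := h hI
  obtain ⟨δ, hδ, hball⟩ := Metric.mem_nhdsWithin_iff.1 hs
  have hae := (hk.mono hball).ae_differentiableWithinAt_of_mem_real
  rw [ae_iff] at hae
  refine ⟨_, inter_mem_nhdsWithin _ (Metric.ball_mem_nhds t₀ hδ), measure_mono_null ?_ hae⟩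
  rintro t ⟨h1, h2⟩ h3
  refine h1 fun hI => (differentiableWithinAt_inter' ?_).1 (inter_comm _ I ▸ h3 ⟨h2, hI⟩)
  exact mem_nhdsWithin_of_mem_nhds (Metric.isOpen_ball.mem_nhds h2)

variable {K g : ℝ → ℝ}

/-- The constant of `exists_gaugedNorm_lipschitz`, chosen uniformly for solutions whose size is
controlled by a given number, yields the local estimates for the modified norm. -/
theorem exists_modNorm_estimates (hK : ContDiffOn ℝ ∞ K (Ioi 0)) (hKpos : ∀ s > 0, 0 < K s)
    (hg : ContDiffOn ℝ ∞ g (Ioi 0)) (n : ℕ) (hn : 1 ≤ n) {Vref : ℝ → ℝ → ℝ × ℝ}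
    (hVref : IsReferenceState Vref) :
    ∃ c : ℕ → ℝ, ∀ I : Set ℝ, I ⊆ Ici 0 → I.OrdConnected → ∀ V Va fa : ℝ → ℝ → ℝ × ℝ,
      ContInHH (2 * n) I (V - Vref) → ContInHH (2 * n + 2) I (Va - Vref) →
      ContInHH (2 * n) I fa → NoVacuum I V → NoVacuum I Va →
      IsSolution K g 0 I V → IsSolution K g fa I Va → ∀ t₀ ∈ I,
      MemH (2 * n) (deltaZ K (V t₀) (Va t₀)) ∧
      (∃ k, ∃ s ∈ 𝓝[I] t₀, LipschitzOnWith k (fun t => modNorm K n (V t) (Va t)) s) ∧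
      (DifferentiableWithinAt ℝ (fun t => modNorm K n (V t) (Va t)) I t₀ →
        |derivWithin (fun t => modNorm K n (V t) (Va t)) I t₀| ≤ c ⌊sizeAt n Vref V Va t₀⌋₊ *
          (modNorm K n (V t₀) (Va t₀) + normHH (2 * n) (fa t₀))) := by
  obtain ⟨m, hnm⟩ : ∃ m, m + 2 = 2 * n := ⟨2 * n - 2, by omega⟩
  obtain ⟨M, hM, hflow⟩ := exists_local_flow hK hKpos hg n m hnm hVref
  have hLpos : ∀ j : ℕ, 0 < 2 * ((j : ℝ) + 2) + M := fun j => by positivity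
  choose c hc0 hc using fun j : ℕ => exists_gaugedNorm_lipschitz hK hKpos hg n m hnm (hLpos j)
  refine ⟨c, fun I hI hord V Va fa hV hVa hfa nV nVa sV sVa t₀ ht₀ => ?_⟩
  obtain ⟨ρ, v, ρa, va, f₁, f₂, hloc⟩ := hflow I hI V Va fa hV hVa hfa nV nVa sV sVa
  set N : ℝ → ℝ := fun t => modNorm K n (V t) (Va t) with hN
  set j := ⌊sizeAt n Vref V Va t₀⌋₊ with hj
  -- The size is less than j + 1, so j + 2 exceeds size + 1, while L depends on the integer j alone.
  set L := 2 * ((j : ℝ) + 2) + M with hL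
  set f := normHH (2 * n) (fa t₀) with hf
  have hLge : L ≥ 2 * (sizeAt n Vref V Va t₀ + 1) + M := by
    have := (Nat.lt_floor_add_one (sizeAt n Vref V Va t₀)).le
    rw [← hj] at this
    rw [hL]
    linarith
  have hloc := hloc t₀ ht₀ L hLge
  -- Here η is any bound for N near t₀. The a priori bound yields the Lipschitz property; the bound
  -- N(t₀) + τ, available by continuity at a point of differentiability, yields the derivative
  -- estimate as τ → 0.
  have key : ∀ τ > 0, ∀ η, (∀ᶠ t in 𝓝[I] t₀, N t ≤ η) → ∃ ε > 0,
      ∀ s ∈ Metric.ball t₀ ε ∩ I, ∀ t ∈ Metric.ball t₀ ε ∩ I,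
        |N t - N s| ≤ c j * (η + (f + τ)) * |t - s| := by
    intro τ hτ η hη
    obtain ⟨δ, hδ, h1, h2, h3, h4, h5⟩ := hloc (f + τ) (lt_add_of_pos_right _ hτ)
    obtain ⟨ε, hε, hball⟩ := Metric.mem_nhdsWithin_iff.1 hη
    have hsub : Metric.ball t₀ (min δ ε) ∩ I ⊆ Metric.ball t₀ δ ∩ I :=
      inter_subset_inter_left _ (Metric.ball_subset_ball (min_le_left _ _))
    have hsub' : Metric.ball t₀ (min δ ε) ∩ I ⊆ Metric.ball t₀ ε ∩ I :=
      inter_subset_inter_left _ (Metric.ball_subset_ball (min_le_right _ _))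
    have hoc : (Metric.ball t₀ (min δ ε) ∩ I).OrdConnected := by
      rw [Real.ball_eq_Ioo]
      exact ordConnected_Ioo.inter hord
    refine ⟨min δ ε, lt_min hδ hε, fun s hs t ht => ?_⟩
    simp only [hN]
    rw [(h5 t (hsub ht)).2, (h5 s (hsub hs)).2]
    refine hc j _ η (f + τ) _ ρ v ρa va f₁ f₂ hoc (h1.mono hsub) (h2.mono hsub)
      (fun r hr => h3 r (hsub hr)) (fun r hr => h4 r (hsub hr)) (fun r hr => ?_) s hs t ht
    rw [← (h5 r (hsub hr)).2]
    exact hball (hsub' hr)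
  obtain ⟨δ, hδ, h1, h2, h3, h4, h5⟩ := hloc (f + 1) (lt_add_of_pos_right _ one_pos)
  have ht₀' : t₀ ∈ Metric.ball t₀ δ ∩ I := ⟨Metric.mem_ball_self hδ, ht₀⟩
  obtain ⟨C', -, hC'⟩ := exists_gaugedNorm_le hK hKpos n m hnm (hLpos j)
  have crude : ∀ᶠ t in 𝓝[I] t₀, N t ≤ C' * (2 * L) :=
    Metric.mem_nhdsWithin_iff.2 ⟨δ, hδ, fun t ht => (h5 t ht).2.le.trans
      (hC' _ _ _ _ _ (h1.reg t ht) (h2.reg t ht) (h3 t ht) (h4 t ht))⟩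
  obtain ⟨ε, hε, hlip⟩ := key 1 one_pos _ crude
  have lip : LipschitzOnWith (c j * (C' * (2 * L) + (f + 1))).toNNReal N (Metric.ball t₀ ε ∩ I) :=
    LipschitzOnWith.of_dist_le_mul fun t ht s hs => by
      rw [Real.dist_eq, Real.dist_eq]
      exact (hlip s hs t ht).trans
        (mul_le_mul_of_nonneg_right (Real.le_coe_toNNReal _) (abs_nonneg _))
  have hmem : Metric.ball t₀ ε ∩ I ∈ 𝓝[I] t₀ :=
    Metric.mem_nhdsWithin_iff.2 ⟨ε, hε, subset_rfl⟩
  refine ⟨(h5 t₀ ht₀').1, ⟨_, _, hmem, lip⟩, fun hd => ?_⟩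
  have hN0 : 0 ≤ N t₀ := add_nonneg (add_nonneg lpNorm_nonneg lpNorm_nonneg) lpNorm_nonneg
  have hf0 : 0 ≤ f := normHH_nonneg _ _
  have bound : ∀ τ > 0, |derivWithin N I t₀| ≤ c j * (N t₀ + τ + (f + τ)) := by
    intro τ hτ
    obtain ⟨r, hr, hb⟩ := key τ hτ (N t₀ + τ)
      ((hd.continuousWithinAt.eventually_lt_const (lt_add_of_pos_right _ hτ)).mono fun _ h => h.le)
    refine abs_derivWithin_le_of_eventually (mul_nonneg (hc0 j) (by positivity)) hd ?_
    exact Metric.mem_nhdsWithin_iff.2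
      ⟨r, hr, fun t ht => hb t₀ ⟨Metric.mem_ball_self hr, ht₀⟩ t ht⟩
  have lim : Tendsto (fun τ : ℝ => c j * (N t₀ + τ + (f + τ))) (𝓝[>] 0)
      (𝓝 (c j * (N t₀ + 0 + (f + 0)))) :=
    (Continuous.tendsto (by fun_prop) 0).mono_left nhdsWithin_le_nhds
  rw [add_zero, add_zero] at lim
  exact ge_of_tendsto lim (eventually_nhdsWithin_of_forall fun τ hτ => bound τ hτ)

end Glue

end EulerKorteweg

theorem mainTheorem2 (K g : ℝ → ℝ)
    (hK : ContDiffOn ℝ ∞ K (Set.Ioi 0)) (hKpos : ∀ s > 0, 0 < K s)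
    (hg : ContDiffOn ℝ ∞ g (Set.Ioi 0))
    (n : ℕ) (hn : 1 ≤ n)
    (Vref : ℝ → ℝ → ℝ × ℝ) (hVref : EulerKorteweg.IsReferenceState Vref) :
    ∃ C : ℝ → ℝ, ContinuousOn C (Set.Ici 0) ∧ MonotoneOn C (Set.Ici 0) ∧ (∀ y ≥ 0, 0 < C y) ∧
      ∀ (I : Set ℝ), I ⊆ Set.Ici 0 → I.OrdConnected → I.Nontrivial →
      ∀ (V Va fa : ℝ → ℝ → ℝ × ℝ),
        EulerKorteweg.ContInHH (2 * n) I (V - Vref) →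
        EulerKorteweg.ContInHH (2 * n + 2) I (Va - Vref) →
        EulerKorteweg.ContInHH (2 * n) I fa →
        EulerKorteweg.NoVacuum I V →
        EulerKorteweg.NoVacuum I Va →
        EulerKorteweg.IsSolution K g 0 I V →
        EulerKorteweg.IsSolution K g fa I Va →
        (∀ t ∈ I, EulerKorteweg.MemH (2 * n) (EulerKorteweg.deltaZ K (V t) (Va t))) ∧
        LocallyLipschitzOn I (fun t => EulerKorteweg.modNorm K n (V t) (Va t)) ∧
        (∀ᵐ t, t ∈ I →
          DifferentiableWithinAt ℝ (fun s => EulerKorteweg.modNorm K n (V s) (Va s)) I t) ∧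
        ∀ t ∈ I,
          DifferentiableWithinAt ℝ (fun s => EulerKorteweg.modNorm K n (V s) (Va s)) I t →
          |1 / 2 * derivWithin (fun s => EulerKorteweg.modNorm K n (V s) (Va s)) I t| ≤
            C (EulerKorteweg.normHH (2 * n) (V t - Vref t)
                + EulerKorteweg.normHH (2 * n + 2) (Va t - Vref t)
                + MeasureTheory.lpNorm (fun x => 1 / (V t x).1 + 1 / (Va t x).1) ⊤
                    MeasureTheory.volume)
              * (EulerKorteweg.modNorm K n (V t) (Va t)
                + EulerKorteweg.normHH (2 * n) (fa t)) := by
  obtain ⟨c, hc⟩ := EulerKorteweg.exists_modNorm_estimates hK hKpos hg n hn hVref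
  obtain ⟨C, hcont, hmono, hpos, hge⟩ := EulerKorteweg.exists_continuous_monotone_ge c
  refine ⟨C, hcont, hmono, hpos, fun I hI hord _ V Va fa hV hVa hfa nV nVa sV sVa => ?_⟩
  have est := hc I hI hord V Va fa hV hVa hfa nV nVa sV sVa
  have hlip : LocallyLipschitzOn I (fun t => EulerKorteweg.modNorm K n (V t) (Va t)) :=
    fun t ht => (est t ht).2.1
  refine ⟨fun t ht => (est t ht).1, hlip,
    EulerKorteweg.ae_differentiableWithinAt_of_locallyLipschitzOn hlip, fun t ht hd => ?_⟩
  have h1 := (est t ht).2.2 hd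
  have h2 := hge _ (EulerKorteweg.sizeAt_nonneg n Vref V Va t)
  have h3 : 0 ≤ EulerKorteweg.modNorm K n (V t) (Va t) + EulerKorteweg.normHH (2 * n) (fa t) :=
    add_nonneg (add_nonneg (add_nonneg MeasureTheory.lpNorm_nonneg MeasureTheory.lpNorm_nonneg)
      MeasureTheory.lpNorm_nonneg) (EulerKorteweg.normHH_nonneg _ _)
  have h4 := h1.trans (mul_le_mul_of_nonneg_right h2 h3)
  rw [abs_mul, abs_of_pos (by norm_num : (0 : ℝ) < 1 / 2)]
  have h5 := abs_nonneg (derivWithin (fun s => EulerKorteweg.modNorm K n (V s) (Va s)) I t)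
  exact (by linarith : _ ≤ _).trans h4
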